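/- Let $\Gamma^{4,4}\subset\mathbb R^{4,4}=\Pi_L\oplus\Pi_R$ be the even unimodular lattice of signature $(4,4)$ and let $\mathcal M(T^4)=(SO(4)\times SO(4))\backslash SO^+(4,4)/SO^+(\Gamma^{4,4})$ be the moduli space of sigma models on $T^4$. For a point $\mu$ represented by $h\in SO^+(4,4)$ let $\Gamma_{\text{w-m}}=h\Gamma^{4,4}$ be its winding-momentum (Narain) lattice, with vectors $k=(k_L;k_R)$, and let $G_0=(SU(2)^A_L\times SU(2)^A_R)\cap O(\Gamma_{\text{w-m}})$, where $SU(2)^A$ acts on $\mathbb R^4\cong\mathbb C^2$, $x\mapsto(x_1+ix_3,\,x_2+ix_4)$, in the standard way. Let $\Sigma(T^4;\mu)$ be the (Neveu–Schwarz sector of the) non-chiral theory generated by four left- and four right-moving free bosons, four left- and four right-moving free fermions, and the vertex operators $V_k(z,\bar z)$, $k\in\Gamma_{\text{w-m}}$. The *reflection* of such a theory turns all right-movers into left-movers: it keeps the states, the vacuum and the fermion parity, replaces $\bar z$ by $z$ in every field (so $z^r\bar z^s$ becomes $z^{r+s}$, all $r+s$ being required to be integers), and takes as conformal vector the sum of the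 left- and right-moving stress tensors; here the cocycle operators are readjusted, i.e. the field of a state of charge $k$ may be multiplied by a constant $\kappa(k,l)\in\mathbb C^\times$ on the states of charge $l$. Let $V^f_{E_8}$ be the vertex operator superalgebra (VOSA) of eight chiral free bosons, eight chiral free fermions and the vertex operators of the $E_8$ lattice. **Theorem 6.1.** There is a unique point $\mu^*\in\mathcal M(T^4)$ with $G_0\cong\mathcal T_{24}\times_{C_3}\mathcal T_{24}$, where $\mathcal T_{24}\cong SL_2(\mathbb F_3)$ is the binary tetrahedral group and the fibre product is taken over its abelianization $C_3$. For this point: 1. the lattice $\{(k_L|k_R)\}\subset\mathbb R^8$ obtained from $\Gamma_{\text{w-m}}(\mu^*)$ by changing the form $\|k_L\|^2-\|k_R\|^2$ to $\|k_L\|^2+\|k_R\|^2$ is isometric to the $E_8$ lattice; 2. $\Sigma(T^4;\mu^*)$ has a reflection that is a VOSA of central charge $12$, and every reflection of $\Sigma(T^4;\mu^*)$ that is a VOSA of central charge $12$ is isomorphic, as a VOSA, to $V^f_{E_8}$. -/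

import Mathlib

open Matrix

noncomputable section

/-! ## Vertex operator superalgebras -/

/-- The raw data of a vertex operator superalgebra: a complex vector space with a parity operator
`(-1)^F`, a vacuum, a conformal vector and modes `mode v n = v_n`, where
`Y(v, z) = ∑ v_n z^(-n-1)` (so `n` runs over `ℤ`, as on the Neveu-Schwarz sector). -/
structure VOSAData where
  V : Type
  [instAddCommGroup : AddCommGroup V]
  [instModule : Module ℂ V]
  parity : V →ₗ[ℂ] V
  vac : V
  conf : V
  mode : V →ₗ[ℂ] (ℤ → V →ₗ[ℂ] V)

attribute [instance] VOSAData.instAddCommGroup VOSAData.instModule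

namespace VOSAData

/-- The Virasoro modes `L_n = ω_{n+1}`. -/
def L (W : VOSAData) (n : ℤ) : W.V →ₗ[ℂ] W.V := W.mode W.conf (n + 1)

/-- `v` is homogeneous of parity `p` (`p = 0` even, `p = 1` odd). -/
def HasParity (W : VOSAData) (p : ℕ) (v : W.V) : Prop := W.parity v = (-1 : ℂ) ^ p • v

/-- The axioms of a vertex operator superalgebra of central charge `c` (fields, vacuum, creation,
translation covariance, super-locality, Virasoro relations, and a `½ℤ`-grading by `L_0` that is
bounded below, has finite-dimensional pieces and agrees with the parity). -/
structure IsVOSA (W : VOSAData) (c : ℂ) : Prop where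
  parity_parity : ∀ v, W.parity (W.parity v) = v
  parity_mode : ∀ v n w, W.parity (W.mode v n w) = W.mode (W.parity v) n (W.parity w)
  parity_vac : W.parity W.vac = W.vac
  parity_conf : W.parity W.conf = W.conf
  vac_ne_zero : W.vac ≠ 0
  truncation : ∀ v w, ∃ N : ℤ, ∀ n, N ≤ n → W.mode v n w = 0
  vacuum : ∀ n w, W.mode W.vac n w = if n = -1 then w else 0
  creation : ∀ v, W.mode v (-1) W.vac = v
  creation_regular : ∀ v n, 0 ≤ n → W.mode v n W.vac = 0
  /-- `[L_{-1}, Y(v,z)] = ∂_z Y(v,z)`. -/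
  translation : ∀ v n w,
    W.L (-1) (W.mode v n w) - W.mode v n (W.L (-1) w) = (-n : ℂ) • W.mode v (n - 1) w
  /-- `(z-w)^N (Y(u,z) Y(v,w) - (-1)^{pq} Y(v,w) Y(u,z)) = 0` for some `N`, read off
  coefficient by coefficient. -/
  locality : ∀ (p q : ℕ) (u v : W.V), W.HasParity p u → W.HasParity q v →
    ∃ N : ℕ, ∀ (m k : ℤ) (x : W.V),
      ∑ j ∈ Finset.range (N + 1), ((-1 : ℂ) ^ j * (N.choose j : ℂ)) •
        (W.mode u (m + N - j) (W.mode v (k + j) x)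
          - (-1 : ℂ) ^ (p * q) • W.mode v (k + j) (W.mode u (m + N - j) x)) = 0
  virasoro : ∀ (m n : ℤ) (x : W.V),
    W.L m (W.L n x) - W.L n (W.L m x) = ((m - n : ℤ) : ℂ) • W.L (m + n) x
      + (if m + n = 0 then ((m : ℂ) ^ 3 - m) / 12 * c else 0) • x
  /-- `V` is the sum of the `L_0`-eigenspaces with eigenvalues in `½ℤ`. -/
  grading : ⨆ n : ℤ, Module.End.eigenspace (W.L 0) ((n : ℂ) / 2) = ⊤
  grading_finite : ∀ n : ℤ,
    FiniteDimensional ℂ (Module.End.eigenspace (W.L 0) ((n : ℂ) / 2))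
  grading_bounded : ∃ N : ℤ, ∀ n < N, Module.End.eigenspace (W.L 0) ((n : ℂ) / 2) = ⊥
  grading_parity : ∀ n : ℤ, ∀ v ∈ Module.End.eigenspace (W.L 0) ((n : ℂ) / 2),
    W.parity v = (-1 : ℂ) ^ n • v

/-- Isomorphism of vertex operator superalgebras: a linear bijection that respects the parity, the
vacuum, the conformal vector and all products `v_n w`. -/
def Isomorphic (W W' : VOSAData) : Prop :=
  ∃ f : W.V ≃ₗ[ℂ] W'.V,
    f W.vac = W'.vac ∧ f W.conf = W'.conf ∧ (∀ v, f (W.parity v) = W'.parity (f v)) ∧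
    ∀ v n w, f (W.mode v n w) = W'.mode (f v) n (f w)

end VOSAData

/-! ## Non-chiral field theories and reflection -/

/-- The raw data of a two-dimensional, possibly non-chiral, conformal field theory (on its
Neveu-Schwarz-Neveu-Schwarz sector): a space of states, the fermion parity `(-1)^F`, a vacuum, the
left- and right-moving stress tensors, the decomposition into charge sectors, and the fields
`Y(v; z, z̄) = ∑ field v (r, s) z^r z̄^s`, with real exponents `r`, `s`. -/
structure FieldTheory where
  H : Type
  [instAddCommGroup : AddCommGroup H]
  [instModule : Module ℂ H]
  parity : H →ₗ[ℂ] H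
  vac : H
  stressL : H
  stressR : H
  Charge : Type
  sector : Charge → Submodule ℂ H
  field : H →ₗ[ℂ] (ℝ × ℝ → H →ₗ[ℂ] H)

attribute [instance] FieldTheory.instAddCommGroup FieldTheory.instModule

namespace FieldTheory

/-- The chiral (holomorphic) data carried by a theory all of whose fields are left-moving:
`v_n` is the coefficient of `z^(-n-1) z̄^0`. -/
def chiral (S : FieldTheory) : VOSAData where
  V := S.H
  parity := S.parity
  vac := S.vac
  conf := S.stressL
  mode := LinearMap.pi fun n : ℤ => (LinearMap.proj ((-n - 1 : ℝ), (0 : ℝ))).comp S.field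

/-- `W` is obtained from the non-chiral theory `S` by *reflection*: every right-mover is turned
into a left-mover, that is, `z̄` is replaced by `z` in all the fields, so that `z^r z̄^s` becomes
`z^(r+s)`, and the left- and right-moving stress tensors add up to the conformal vector. All total
exponents `r + s` have to be integers for the result to have meromorphic fields. The states, the
vacuum and the fermion parity are unchanged. As the cocycle operators which make the fields of
charged states mutually local depend on the split into left- and right-movers, they are readjusted:
the reflected field of a state of charge `k` is multiplied by a constant `κ k l`, depending only on
charges, on the states of charge `l`. -/
def IsReflection (S : FieldTheory) (W : VOSAData) : Prop :=
  (∀ (v w : S.H) (r s : ℝ), S.field v (r, s) w ≠ 0 → ∃ n : ℤ, r + s = n) ∧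
  ∃ (Φ : S.H ≃ₗ[ℂ] W.V) (κ : S.Charge → S.Charge → ℂˣ),
    Φ S.vac = W.vac ∧ Φ (S.stressL + S.stressR) = W.conf ∧
    (∀ v, Φ (S.parity v) = W.parity (Φ v)) ∧
    ∀ (k l : S.Charge), ∀ v ∈ S.sector k, ∀ w ∈ S.sector l, ∀ n : ℤ,
      W.mode (Φ v) n (Φ w) =
        (κ k l : ℂ) • Φ (∑ᶠ r : ℝ, S.field v (r, -n - 1 - r) w)

end FieldTheory

/-! ## Free bosons, free fermions and vertex operators based on a lattice

The theory of `N` free bosons and `N` free fermions, some left-moving and some right-moving, with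
vertex operators labelled by the lattice spanned by vectors `e_1, …, e_d` of `ℝ^N`. -/

/-- The input of the construction: `isRight i` says whether the `i`-th boson/fermion pair is
right-moving; `e j` is the `j`-th basis vector of the charge lattice. -/
structure LatticeInput (N d : ℕ) where
  isRight : Fin N → Bool
  e : Fin d → Fin N → ℝ

namespace LatticeInput

/-- Oscillator labels, ordered lexicographically: `(i, n)` labels the creation operators
`a^i_{-n-1}` of the `i`-th boson and `ψ^i_{-n-1/2}` of the `i`-th fermion. -/
abbrev Osc (N : ℕ) : Type := Fin N ×ₗ ℕ

/-- The index of the boson or fermion. -/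
def Osc.idx {N : ℕ} (m : Osc N) : Fin N := (ofLex m).1

/-- The `n` of an oscillator `a^i_{-n-1}` or `ψ^i_{-n-1/2}`. -/
def Osc.lvl {N : ℕ} (m : Osc N) : ℕ := (ofLex m).2

/-- Basis states `∏ (a^i_{-n-1})^{bos (i,n)} · ψ_{m_1} ⋯ ψ_{m_r} |charge⟩`, where
`ferm = {m_1 < ⋯ < m_r}`; the charge is written in the basis `e`. -/
@[ext]
structure State (N d : ℕ) where
  bos : Osc N →₀ ℕ
  ferm : Finset (Osc N)
  charge : Fin d → ℤ

/-- The Fock space. -/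
abbrev Fock (N d : ℕ) : Type := State N d →₀ ℂ

/-- The basis vector of a basis state. -/
def ket {N d : ℕ} (b : State N d) : Fock N d := Finsupp.single b 1

/-- The linear operator with prescribed values on basis states. -/
def onBasis {N d : ℕ} (f : State N d → Fock N d) : Fock N d →ₗ[ℂ] Fock N d :=
  Finsupp.linearCombination ℂ f

variable {N d : ℕ}

/-- The vector `∑ l_j e_j` of `ℝ^N` (all the momenta, left and right). -/
def momentum (I : LatticeInput N d) (l : Fin d → ℤ) : Fin N → ℝ :=
  fun i => ∑ j, (l j : ℝ) * I.e j i

/-- The bilinear form of the lattice: left-movers count positively, right-movers negatively. -/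
def form (I : LatticeInput N d) (x y : Fin N → ℝ) : ℝ :=
  ∑ i, (if I.isRight i then -1 else 1) * (x i * y i)

/-- The standard cocycle `ε(l, m) = (-1)^{∑_{i > j} l_i m_j ⟨e_i, e_j⟩}` defined by
`γ_l γ_m = ε(l, m) γ_{l+m}`, where `γ_l = γ_1^{l_1} ⋯ γ_d^{l_d}`, `γ_i ^ 2 = 1` and
`γ_i γ_j = (-1)^{⟨e_i, e_j⟩} γ_j γ_i`. -/
def cocycle (I : LatticeInput N d) (l m : Fin d → ℤ) : ℂ :=
  Complex.exp (Real.pi * Complex.I *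
    (∑ i, ∑ j, if j < i then (l i : ℝ) * m j * I.form (I.e i) (I.e j) else 0 : ℝ))

/-- The exponent of `z` (left-mover) or of `z̄` (right-mover). -/
def expo (right : Bool) (t : ℝ) : ℝ × ℝ := if right then (0, t) else (t, 0)

/-- The modes `a^i_{-k-1}`, `k ≥ 0`, of the boson `a^i(z) = ∑ a^i_n z^(-n-1)`,
where `[a^i_m, a^j_n] = m δ^{ij} δ_{m+n,0}`. -/
def bosCreate (i : Fin N) (k : ℕ) : Fock N d →ₗ[ℂ] Fock N d :=
  onBasis fun b => ket { b with bos := b.bos + Finsupp.single (toLex (i, k)) 1 }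

/-- The modes `a^i_k`, `k ≥ 0`; the zero mode `a^i_0` measures the momentum. -/
def bosAnnihilate (I : LatticeInput N d) (i : Fin N) : ℕ → Fock N d →ₗ[ℂ] Fock N d
  | 0 => onBasis fun b => (I.momentum b.charge i : ℂ) • ket b
  | k + 1 => onBasis fun b => (((k + 1) * b.bos (toLex (i, k)) : ℕ) : ℂ) •
      ket { b with bos := b.bos - Finsupp.single (toLex (i, k)) 1 }

/-- The sign from moving `ψ_m` past the fermions that precede it. -/
def fermSign (b : State N d) (m : Osc N) : ℂ :=
  (-1) ^ (b.ferm.filter (· < m)).card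

/-- The modes `ψ^i_{-k-1/2}`, `k ≥ 0`, of the fermion `ψ^i(z) = ∑ ψ^i_r z^(-r-1/2)`,
where `{ψ^i_r, ψ^j_s} = δ^{ij} δ_{r+s,0}`. -/
def fermCreate (i : Fin N) (k : ℕ) : Fock N d →ₗ[ℂ] Fock N d :=
  onBasis fun b => if toLex (i, k) ∈ b.ferm then 0 else
    fermSign b (toLex (i, k)) • ket { b with ferm := insert (toLex (i, k)) b.ferm }

/-- The modes `ψ^i_{k+1/2}`, `k ≥ 0`. -/
def fermAnnihilate (i : Fin N) (k : ℕ) : Fock N d →ₗ[ℂ] Fock N d :=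
  onBasis fun b => if toLex (i, k) ∈ b.ferm then
    fermSign b (toLex (i, k)) • ket { b with ferm := b.ferm.erase (toLex (i, k)) } else 0

/-- The normally ordered product `: ∂^n φ(z) / n! · B(z, z̄) :` of a free field
`φ(z) = ∑_{k ≥ 0} c_k z^k + ∑_{k ≥ 0} a_k z^(-k-1)` (a function of `z̄` in place of `z` when
`right` is true), with creation modes `c_k` and annihilation modes `a_k`, and an arbitrary field
`B`, namely `(∂^n φ/n!)_creation B + sgn · B (∂^n φ/n!)_annihilation`; `sgn` is the sign from moving
`φ` past `B`. -/
def normalOrder (right : Bool) (c a : ℕ → Fock N d →ₗ[ℂ] Fock N d) (n : ℕ) (sgn : ℂ)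
    (B : ℝ × ℝ → Fock N d →ₗ[ℂ] Fock N d) : ℝ × ℝ → Fock N d →ₗ[ℂ] Fock N d :=
  fun x => onBasis fun b =>
    (∑ᶠ k : ℕ, (k.choose n : ℂ) • c k (B (x - expo right (k - n)) (ket b))) +
    sgn • ∑ᶠ k : ℕ, ((-1 : ℂ) ^ n * ((k + n).choose n : ℂ)) •
      B (x + expo right (k + 1 + n)) (a k (ket b))

/-- The exponents of the leading factor `∏ z^{p_i q_i}` (`z̄` for right-movers) of the vertex
operator of momentum `p` on a state of momentum `q`. -/
def leadExponent (I : LatticeInput N d) (p q : Fin N → ℝ) : ℝ × ℝ :=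
  ∑ i, expo (I.isRight i) (p i * q i)

/-- The exponents of `∏ z^(n+1)` (`z̄` for right-movers) over the oscillators `(i, n)` in `M`. -/
def oscExponent (I : LatticeInput N d) (M : Osc N →₀ ℕ) : ℝ × ℝ :=
  M.sum fun m r => expo (I.isRight m.idx) (r * (m.lvl + 1))

/-- The vertex operator of the charge `l` with momentum `p`,
`V_l = ε(l, ·) e^l ∏_i z^{p_i a^i_0} exp(∑_{n ≥ 1} p_i a^i_{-n} z^n / n)
  exp(-∑_{n ≥ 1} p_i a^i_n z^{-n} / n)` (with `z̄` in place of `z` for the right-movers). On a basis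
state the annihilation exponential removes oscillators `J` and the creation exponential adds
oscillators `M`. -/
def vertexOp (I : LatticeInput N d) (l : Fin d → ℤ) : ℝ × ℝ → Fock N d →ₗ[ℂ] Fock N d :=
  fun x => onBasis fun b => I.cocycle l b.charge •
    ∑ᶠ (J : Osc N →₀ ℕ) (M : Osc N →₀ ℕ),
      if J ≤ b.bos ∧ x = I.leadExponent (I.momentum l) (I.momentum b.charge)
          + I.oscExponent M - I.oscExponent J then
        ((J.prod fun m r => ((b.bos m).choose r : ℂ) * (-(I.momentum l m.idx : ℂ)) ^ r) *
          (M.prod fun m r => ((I.momentum l m.idx : ℂ) / (m.lvl + 1)) ^ r / (r.factorial : ℂ))) •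
        ket { b with bos := b.bos - J + M, charge := l + b.charge }
      else 0

/-- The fields of the states `ψ_{m_1} ⋯ ψ_{m_r} |l⟩`. -/
def fermField (I : LatticeInput N d) (l : Fin d → ℤ) :
    List (Osc N) → ℝ × ℝ → Fock N d →ₗ[ℂ] Fock N d
  | [] => I.vertexOp l
  | m :: ms => normalOrder (I.isRight m.idx) (fermCreate m.idx) (fermAnnihilate m.idx) m.lvl
      ((-1) ^ ms.length) (I.fermField l ms)

/-- The fields of the states `a_{n_1} ⋯ a_{n_s} ψ_{m_1} ⋯ ψ_{m_r} |l⟩`. -/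
def bosField (I : LatticeInput N d) (B : ℝ × ℝ → Fock N d →ₗ[ℂ] Fock N d) :
    List (Osc N) → ℝ × ℝ → Fock N d →ₗ[ℂ] Fock N d
  | [] => B
  | m :: ms => normalOrder (I.isRight m.idx) (bosCreate m.idx) (I.bosAnnihilate m.idx) m.lvl
      1 (I.bosField B ms)

/-- The field of a basis state. -/
def stateField (I : LatticeInput N d) (b : State N d) : ℝ × ℝ → Fock N d →ₗ[ℂ] Fock N d :=
  I.bosField (I.fermField b.charge (b.ferm.sort (· ≤ ·))) (b.bos.toMultiset.sort (· ≤ ·))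

/-- The vacuum `|0⟩`. -/
def vacuum : Fock N d := ket { bos := 0, ferm := ∅, charge := 0 }

/-- `½ ∑ a^i_{-1} a^i_{-1} |0⟩ + ½ ∑ ψ^i_{-3/2} ψ^i_{-1/2} |0⟩`, over the left-movers or over the
right-movers. -/
def stress (I : LatticeInput N d) (right : Bool) : Fock N d :=
  ∑ i, if I.isRight i = right then
    (1 / 2 : ℂ) • (bosCreate i 0 (bosCreate i 0 vacuum) + fermCreate i 1 (fermCreate i 0 vacuum))
  else 0

/-- The theory of free bosons, free fermions and vertex operators of the given lattice. -/
def theory (I : LatticeInput N d) : FieldTheory where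
  H := Fock N d
  parity := onBasis fun b => (-1 : ℂ) ^ b.ferm.card • ket b
  vac := vacuum
  stressL := I.stress false
  stressR := I.stress true
  Charge := Fin d → ℤ
  sector := fun l => Submodule.span ℂ (ket '' {b | b.charge = l})
  field := Finsupp.linearCombination ℂ I.stateField

end LatticeInput

/-! ## The `E_8` lattice vertex operator superalgebra -/

/-- The simple roots of `E_8`, as the rows of a matrix. -/
def e8Root : Matrix (Fin 8) (Fin 8) ℝ :=
  !![ 1/2, -1/2, -1/2, -1/2, -1/2, -1/2, -1/2, 1/2;
      1, 1, 0, 0, 0, 0, 0, 0;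
      -1, 1, 0, 0, 0, 0, 0, 0;
      0, -1, 1, 0, 0, 0, 0, 0;
      0, 0, -1, 1, 0, 0, 0, 0;
      0, 0, 0, -1, 1, 0, 0, 0;
      0, 0, 0, 0, -1, 1, 0, 0;
      0, 0, 0, 0, 0, -1, 1, 0]

/-- The `E_8` lattice in `ℝ^8`. -/
def e8Lattice : Submodule ℤ (Fin 8 → ℝ) := Submodule.span ℤ (Set.range e8Root)

/-- `V^f_{E_8}`: eight chiral bosons, eight chiral fermions and the vertex operators of the
`E_8` lattice. -/
def VfE8 : VOSAData :=
  (LatticeInput.theory (N := 8) (d := 8) { isRight := fun _ => false, e := e8Root }).chiral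

/-! ## The moduli space of sigma models on `T^4` -/

/-- `ℝ^{4,4} = Π_L ⊕ Π_R`, vectors `(k_L; k_R)`. -/
abbrev R44 : Type := Fin 4 ⊕ Fin 4 → ℝ

/-- The Gram matrix `diag(1, 1, 1, 1, -1, -1, -1, -1)` of `ℝ^{4,4}`. -/
def eta44 : Matrix (Fin 4 ⊕ Fin 4) (Fin 4 ⊕ Fin 4) ℝ :=
  LieAlgebra.Orthogonal.indefiniteDiagonal (Fin 4) (Fin 4) ℝ

theorem eta44_eq : eta44 = Matrix.fromBlocks 1 0 0 (-1) := by
  ext (i | i) (j | j) <;>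
    simp [eta44, LieAlgebra.Orthogonal.indefiniteDiagonal, Matrix.diagonal_apply, Matrix.one_apply]
  split_ifs <;> simp

theorem eta44_mul_self : eta44 * eta44 = 1 := by
  rw [eta44_eq, Matrix.fromBlocks_multiply]; simp

/-- `‖k_L‖² - ‖k_R‖²`. -/
def q44 (x : R44) : ℝ := ∑ i, x (.inl i) ^ 2 - ∑ i, x (.inr i) ^ 2

theorem q44_eq (x : R44) : q44 x = x ⬝ᵥ (eta44 *ᵥ x) := by
  simp [q44, eta44, LieAlgebra.Orthogonal.indefiniteDiagonal, Matrix.mulVec_diagonal, dotProduct,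
    sq, sub_eq_add_neg]

theorem q44_elim (y z : Fin 4 → ℝ) :
    q44 (Sum.elim y z) = ∑ i, y i ^ 2 - ∑ i, z i ^ 2 := by
  simp [q44]

theorem q44_mulVec {g : Matrix (Fin 4 ⊕ Fin 4) (Fin 4 ⊕ Fin 4) ℝ} (hg : gᵀ * eta44 * g = eta44)
    (x : R44) : q44 (g *ᵥ x) = q44 x := by
  rw [q44_eq, q44_eq]
  conv_rhs => rw [← hg]
  rw [← Matrix.mulVec_mulVec, ← Matrix.mulVec_mulVec, Matrix.mulVec_transpose,
    dotProduct_comm x, ← Matrix.dotProduct_mulVec, dotProduct_comm]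

/-- A determinant that does not vanish along a segment keeps its sign. -/
theorem det_pos_of_segment (X Y : Matrix (Fin 4) (Fin 4) ℝ) (h0 : 0 < X.det)
    (h : ∀ t : ℝ, 0 ≤ t → t ≤ 1 → ∀ x, (X + t • Y) *ᵥ x = 0 → x = 0) : 0 < (X + Y).det := by
  have hc : Continuous fun t : ℝ => (X + t • Y).det := by fun_prop
  have hne : ∀ t ∈ Set.Icc (0 : ℝ) 1, (X + t • Y).det ≠ 0 := by
    intro t ht hd
    obtain ⟨v, hv, hv0⟩ := Matrix.exists_mulVec_eq_zero_iff.2 hd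
    exact hv (h t ht.1 ht.2 v hv0)
  by_contra hn
  have h1 : (X + (1 : ℝ) • Y).det ≤ 0 := by simpa using hn
  have h2 : (0 : ℝ) ≤ (X + (0 : ℝ) • Y).det := by simpa using h0.le
  obtain ⟨t, ht, hzero⟩ := intermediate_value_Icc' zero_le_one hc.continuousOn ⟨h1, h2⟩
  exact hne t ht hzero

theorem sum_sq_eq_zero {x : Fin 4 → ℝ} (h : ∑ i, x i ^ 2 ≤ 0) : x = 0 := by
  have h' : ∑ i, x i ^ 2 = 0 := le_antisymm h (Finset.sum_nonneg fun i _ => sq_nonneg _)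
  rw [Finset.sum_eq_zero_iff_of_nonneg fun i _ => sq_nonneg _] at h'
  ext i
  exact pow_eq_zero_iff two_ne_zero |>.1 (h' i (Finset.mem_univ i))

/-- `g` preserves the form of `ℝ^{4,4}` and the orientations of positive- and of negative-definite
four-spaces. -/
def IsSOPlus (g : Matrix (Fin 4 ⊕ Fin 4) (Fin 4 ⊕ Fin 4) ℝ) : Prop :=
  gᵀ * eta44 * g = eta44 ∧ 0 < g.toBlocks₁₁.det ∧ 0 < g.toBlocks₂₂.det

theorem IsSOPlus.mul {g h : Matrix (Fin 4 ⊕ Fin 4) (Fin 4 ⊕ Fin 4) ℝ} (hg : IsSOPlus g)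
    (hh : IsSOPlus h) : IsSOPlus (g * h) := by
  obtain ⟨g1, g2, g3⟩ := hg
  obtain ⟨h1, h2, h3⟩ := hh
  have hq := q44_mulVec g1
  have hq' := q44_mulVec h1
  rw [← Matrix.fromBlocks_toBlocks g] at hq
  rw [← Matrix.fromBlocks_toBlocks h] at hq'
  refine ⟨?_, ?_, ?_⟩
  · calc (g * h)ᵀ * eta44 * (g * h) = hᵀ * (gᵀ * eta44 * g) * h := by
          simp only [Matrix.transpose_mul, Matrix.mul_assoc]
      _ = eta44 := by rw [g1, h1]
  · have key : (g * h).toBlocks₁₁ =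
        g.toBlocks₁₁ * h.toBlocks₁₁ + g.toBlocks₁₂ * h.toBlocks₂₁ := by
      conv_lhs => rw [← Matrix.fromBlocks_toBlocks g, ← Matrix.fromBlocks_toBlocks h,
        Matrix.fromBlocks_multiply]
      rw [Matrix.toBlocks_fromBlocks₁₁]
    rw [key]
    refine det_pos_of_segment _ _ (by rw [Matrix.det_mul]; positivity) fun t ht0 ht1 x hx => ?_
    have e1 := hq' (Sum.elim x 0)
    have e2 := hq (Sum.elim (h.toBlocks₁₁ *ᵥ x) (t • (h.toBlocks₂₁ *ᵥ x)))
    simp only [Matrix.fromBlocks_mulVec, Sum.elim_comp_inl, Sum.elim_comp_inr] at e1 e2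
    have hx' : g.toBlocks₁₁ *ᵥ (h.toBlocks₁₁ *ᵥ x) +
        g.toBlocks₁₂ *ᵥ (t • (h.toBlocks₂₁ *ᵥ x)) = 0 := by
      rw [← hx, Matrix.add_mulVec, Matrix.smul_mulVec, Matrix.mulVec_smul, Matrix.mulVec_mulVec,
        Matrix.mulVec_mulVec]
    rw [hx', q44_elim, q44_elim] at e2
    rw [q44_elim, q44_elim] at e1
    simp only [Matrix.mulVec_zero, add_zero, Pi.zero_apply, Pi.smul_apply, smul_eq_mul, mul_pow,
      ← Finset.mul_sum, ne_eq, OfNat.ofNat_ne_zero, not_false_eq_true, zero_pow,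
      Finset.sum_const_zero, sub_zero, zero_sub] at e1 e2
    apply sum_sq_eq_zero
    have n1 := Finset.sum_nonneg fun i (_ : i ∈ Finset.univ) =>
      sq_nonneg ((h.toBlocks₂₁ *ᵥ x) i)
    have n2 := Finset.sum_nonneg fun i (_ : i ∈ Finset.univ) =>
      sq_nonneg ((g.toBlocks₂₁ *ᵥ (h.toBlocks₁₁ *ᵥ x) +
        g.toBlocks₂₂ *ᵥ (t • (h.toBlocks₂₁ *ᵥ x))) i)
    nlinarith [mul_nonneg (sub_nonneg.2 (show t ^ 2 ≤ 1 by nlinarith)) n1]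
  · have key : (g * h).toBlocks₂₂ =
        g.toBlocks₂₂ * h.toBlocks₂₂ + g.toBlocks₂₁ * h.toBlocks₁₂ := by
      conv_lhs => rw [← Matrix.fromBlocks_toBlocks g, ← Matrix.fromBlocks_toBlocks h,
        Matrix.fromBlocks_multiply]
      rw [Matrix.toBlocks_fromBlocks₂₂, add_comm]
    rw [key]
    refine det_pos_of_segment _ _ (by rw [Matrix.det_mul]; positivity) fun t ht0 ht1 x hx => ?_
    have e1 := hq' (Sum.elim 0 x)
    have e2 := hq (Sum.elim (t • (h.toBlocks₁₂ *ᵥ x)) (h.toBlocks₂₂ *ᵥ x))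
    simp only [Matrix.fromBlocks_mulVec, Sum.elim_comp_inl, Sum.elim_comp_inr] at e1 e2
    have hx' : g.toBlocks₂₁ *ᵥ (t • (h.toBlocks₁₂ *ᵥ x)) +
        g.toBlocks₂₂ *ᵥ (h.toBlocks₂₂ *ᵥ x) = 0 := by
      rw [← hx, Matrix.add_mulVec, Matrix.smul_mulVec, Matrix.mulVec_smul, Matrix.mulVec_mulVec,
        Matrix.mulVec_mulVec, add_comm]
    rw [hx', q44_elim, q44_elim] at e2
    rw [q44_elim, q44_elim] at e1
    simp only [Matrix.mulVec_zero, zero_add, Pi.zero_apply, Pi.smul_apply, smul_eq_mul, mul_pow,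
      ← Finset.mul_sum, ne_eq, OfNat.ofNat_ne_zero, not_false_eq_true, zero_pow,
      Finset.sum_const_zero, sub_zero, zero_sub] at e1 e2
    apply sum_sq_eq_zero
    have n1 := Finset.sum_nonneg fun i (_ : i ∈ Finset.univ) =>
      sq_nonneg ((h.toBlocks₁₂ *ᵥ x) i)
    have n2 := Finset.sum_nonneg fun i (_ : i ∈ Finset.univ) =>
      sq_nonneg ((g.toBlocks₁₁ *ᵥ (t • (h.toBlocks₁₂ *ᵥ x)) +
        g.toBlocks₁₂ *ᵥ (h.toBlocks₂₂ *ᵥ x)) i)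
    nlinarith [mul_nonneg (sub_nonneg.2 (show t ^ 2 ≤ 1 by nlinarith)) n1]

theorem IsSOPlus.one : IsSOPlus 1 := by
  have : (1 : Matrix (Fin 4 ⊕ Fin 4) (Fin 4 ⊕ Fin 4) ℝ) = Matrix.fromBlocks 1 0 0 1 :=
    Matrix.fromBlocks_one.symm
  refine ⟨by simp, ?_, ?_⟩
  · rw [this, Matrix.toBlocks_fromBlocks₁₁]; simp
  · rw [this, Matrix.toBlocks_fromBlocks₂₂]; simp

/-- The inverse of a pseudo-orthogonal matrix. -/
theorem IsSOPlus.inv_eq {g : GL (Fin 4 ⊕ Fin 4) ℝ} (hg : IsSOPlus g.val) :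
    (g⁻¹).val = eta44 * (g.val)ᵀ * eta44 := by
  have h1 : eta44 * (g.val)ᵀ * eta44 * g.val = 1 := by
    rw [Matrix.mul_assoc, Matrix.mul_assoc, ← Matrix.mul_assoc _ eta44, hg.1, eta44_mul_self]
  calc (g⁻¹).val = eta44 * (g.val)ᵀ * eta44 * g.val * (g⁻¹).val := by rw [h1, one_mul]
    _ = _ := by rw [Matrix.mul_assoc, Units.mul_inv, mul_one]

theorem IsSOPlus.inv {g : GL (Fin 4 ⊕ Fin 4) ℝ} (hg : IsSOPlus g.val) :
    IsSOPlus (g⁻¹).val := by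
  have hb : (g⁻¹).val = Matrix.fromBlocks (g.val.toBlocks₁₁)ᵀ (-(g.val.toBlocks₂₁)ᵀ)
      (-(g.val.toBlocks₁₂)ᵀ) (g.val.toBlocks₂₂)ᵀ := by
    rw [hg.inv_eq, eta44_eq]
    conv_lhs => rw [← Matrix.fromBlocks_toBlocks g.val, Matrix.fromBlocks_transpose,
      Matrix.fromBlocks_multiply, Matrix.fromBlocks_multiply]
    simp
  refine ⟨?_, ?_, ?_⟩
  · have h1 : g.val * (g⁻¹).val = 1 := Units.mul_inv g
    calc ((g⁻¹).val)ᵀ * eta44 * (g⁻¹).val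
        = (g.val * (g⁻¹).val)ᵀ * eta44 * (g.val * (g⁻¹).val) := by
          conv_lhs => rw [← hg.1]
          simp only [Matrix.transpose_mul, Matrix.mul_assoc]
      _ = eta44 := by rw [h1]; simp
  · rw [hb, Matrix.toBlocks_fromBlocks₁₁, Matrix.det_transpose]; exact hg.2.1
  · rw [hb, Matrix.toBlocks_fromBlocks₂₂, Matrix.det_transpose]; exact hg.2.2

/-- The group `SO^+(4,4)`, the identity component of `O(4,4)`. -/
def SOPlus44 : Subgroup (GL (Fin 4 ⊕ Fin 4) ℝ) where
  carrier := {g | IsSOPlus g.val}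
  mul_mem' := fun hg hh => by simpa using IsSOPlus.mul hg hh
  one_mem' := by simpa using IsSOPlus.one
  inv_mem' := fun hg => IsSOPlus.inv hg

/-- `SO(4) × SO(4)`, the elements of `SO^+(4,4)` that preserve the decomposition
`Π_L ⊕ Π_R`. -/
def SO4xSO4 : Subgroup SOPlus44 where
  carrier := {g | g.1.val.toBlocks₁₂ = 0 ∧ g.1.val.toBlocks₂₁ = 0}
  mul_mem' := by
    rintro g h ⟨g1, g2⟩ ⟨h1, h2⟩
    have e : (g * h).1.val = g.1.val * h.1.val := rfl
    refine ⟨?_, ?_⟩ <;> rw [e, ← Matrix.fromBlocks_toBlocks g.1.val,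
      ← Matrix.fromBlocks_toBlocks h.1.val, Matrix.fromBlocks_multiply] <;> simp [g1, g2, h1, h2]
  one_mem' := by
    have e : (1 : SOPlus44).1.val = Matrix.fromBlocks 1 0 0 1 := Matrix.fromBlocks_one.symm
    refine ⟨?_, ?_⟩
    · rw [e, Matrix.toBlocks_fromBlocks₁₂]
    · rw [e, Matrix.toBlocks_fromBlocks₂₁]
  inv_mem' := by
    rintro g ⟨g1, g2⟩
    have e : (g⁻¹).1.val = eta44 * (g.1.val)ᵀ * eta44 := IsSOPlus.inv_eq g.2
    refine ⟨?_, ?_⟩ <;> rw [e, eta44_eq, ← Matrix.fromBlocks_toBlocks g.1.val,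
      Matrix.fromBlocks_transpose, Matrix.fromBlocks_multiply, Matrix.fromBlocks_multiply] <;>
      simp [g1, g2]

/-- A basis of the even unimodular lattice `Γ^{4,4}`: the vectors `(δ_i; δ_i)/√2` and
`(δ_i; -δ_i)/√2`, which span four orthogonal hyperbolic planes. -/
def narainBasis : Fin 4 ⊕ Fin 4 → R44
  | .inl i => (Real.sqrt 2)⁻¹ • Sum.elim (Pi.single i 1) (Pi.single i 1)
  | .inr i => (Real.sqrt 2)⁻¹ • Sum.elim (Pi.single i 1) (-Pi.single i 1)

/-- The lattice `Γ^{4,4}`. -/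
def narainLattice : Submodule ℤ R44 := Submodule.span ℤ (Set.range narainBasis)

/-- `SO^+(Γ^{4,4})`: the elements of `SO^+(4,4)` that map the lattice onto itself. -/
def SOPlusNarain : Subgroup SOPlus44 where
  carrier := {g | ∀ x, g.1.val *ᵥ x ∈ narainLattice ↔ x ∈ narainLattice}
  mul_mem' := by
    intro g h hg hh x
    have e : (g * h).1.val = g.1.val * h.1.val := rfl
    rw [e, ← Matrix.mulVec_mulVec, hg, hh]
  one_mem' := by
    intro x
    have e : (1 : SOPlus44).1.val = 1 := rfl
    rw [e, Matrix.one_mulVec]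
  inv_mem' := by
    intro g hg x
    have e : g.1.val * (g⁻¹).1.val = 1 := Units.mul_inv g.1
    rw [← hg, Matrix.mulVec_mulVec, e, Matrix.one_mulVec]

/-- The moduli space `(SO(4) × SO(4)) \ SO^+(4,4) / SO^+(Γ^{4,4})` of sigma models on `T^4`. -/
abbrev ModuliT4 : Type :=
  DoubleCoset.Quotient (SO4xSO4 : Set SOPlus44) (SOPlusNarain : Set SOPlus44)

/-- The point of the moduli space represented by `h`. -/
abbrev moduliPoint (h : SOPlus44) : ModuliT4 := DoubleCoset.mk SO4xSO4 SOPlusNarain h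

/-- The basis of the winding-momentum lattice at the point represented by `h`. -/
def windingBasis (h : SOPlus44) (j : Fin 4 ⊕ Fin 4) : R44 := h.1.val *ᵥ narainBasis j

/-- The winding-momentum (Narain) lattice at the point represented by `h`, inside
`ℝ^{4,4} = Π_L ⊕ Π_R`. -/
def windingLattice (h : SOPlus44) : Submodule ℤ R44 := Submodule.span ℤ (Set.range (windingBasis h))

/-- The sigma model `Σ(T^4; μ)` (Neveu-Schwarz sector) at the point `μ` represented by `h`: four
left- and four right-moving bosons and fermions, and vertex operators based on the
winding-momentum lattice. -/
def sigmaModel (h : SOPlus44) : FieldTheory :=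
  (LatticeInput.theory (N := 4 + 4) (d := 4 + 4)
    { isRight := fun i => (finSumFinEquiv.symm i).isRight
      e := fun j i => windingBasis h (finSumFinEquiv.symm j) (finSumFinEquiv.symm i) })

/-! ## The symmetry group `G_0` -/

/-- The group `SU(2)`. -/
abbrev SU2 : Type := Matrix.specialUnitaryGroup (Fin 2) ℂ

/-- `ℝ^4 ≅ ℂ^2` through the complex combinations `x_1 + i x_3` and `x_2 + i x_4`. -/
def toC2 (x : Fin 4 → ℝ) : Fin 2 → ℂ := ![⟨x 0, x 2⟩, ⟨x 1, x 3⟩]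

/-- The inverse of `toC2`. -/
def ofC2 (z : Fin 2 → ℂ) : Fin 4 → ℝ := ![(z 0).re, (z 1).re, (z 0).im, (z 1).im]

theorem toC2_ofC2 (z : Fin 2 → ℂ) : toC2 (ofC2 z) = z := by
  ext i; fin_cases i <;> simp [toC2, ofC2]

theorem ofC2_toC2 (x : Fin 4 → ℝ) : ofC2 (toC2 x) = x := by
  ext i; fin_cases i <;> simp [toC2, ofC2]

/-- The action of `SU(2)_L^A × SU(2)_R^A` on `Π_L ⊕ Π_R`. -/
def su2Act (g : SU2 × SU2) (x : R44) : R44 :=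
  Sum.elim (ofC2 (g.1.1 *ᵥ toC2 (x ∘ Sum.inl))) (ofC2 (g.2.1 *ᵥ toC2 (x ∘ Sum.inr)))

theorem su2Act_mul (g h : SU2 × SU2) (x : R44) : su2Act (g * h) x = su2Act g (su2Act h x) := by
  simp only [su2Act, Sum.elim_comp_inl, Sum.elim_comp_inr, toC2_ofC2, Matrix.mulVec_mulVec]
  rfl

theorem su2Act_one (x : R44) : su2Act 1 x = x := by
  simp [su2Act, ofC2_toC2]

/-- `G_0 = (SU(2)_L^A × SU(2)_R^A) ∩ O(Γ_{w-m})` at the point represented by `h`. -/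
def G0 (h : SOPlus44) : Subgroup (SU2 × SU2) where
  carrier := {g | ∀ x, su2Act g x ∈ windingLattice h ↔ x ∈ windingLattice h}
  mul_mem' := by
    intro g k hg hk x
    rw [su2Act_mul, hg, hk]
  one_mem' := by
    intro x
    rw [su2Act_one]
  inv_mem' := by
    intro g hg x
    rw [← hg, ← su2Act_mul, mul_inv_cancel, su2Act_one]

/-- The binary tetrahedral group `T_24 ≅ SL_2(𝔽_3)`. -/
abbrev T24 : Type := Matrix.SpecialLinearGroup (Fin 2) (ZMod 3)

/-- `T_24 ×_{C_3} T_24`, the fibre product over the abelianization `T_24 → C_3`. -/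
abbrev T24FibreT24 : Subgroup (T24 × T24) :=
  MonoidHom.eqLocus (Abelianization.of.comp (MonoidHom.fst T24 T24))
    (Abelianization.of.comp (MonoidHom.snd T24 T24))

end

open scoped Quaternion

noncomputable section

open scoped Quaternion
open AddMonoidHom (prodMap)
open Fin (castAdd natAdd sum_univ_four)
open Finset (insert_erase mem_Iic mem_range mem_univ mul_sum range single_le_sum smul_sum
  sum_add_distrib sum_comm sum_congr sum_div sum_eq_single sum_eq_zero sum_neg_distrib sum_nonneg
  sum_range_succ sum_smul sum_sub_distrib univ)
open Finsupp (finsetSum_apply lapply single single_eq_of_ne single_eq_same sum_zero_index)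
open Fintype (sum_sum_type)
open Function (Bijective Injective Surjective support)
open Int (eq_ofNat_of_zero_le negSucc negSucc_eq)
open LinearEquiv (apply_symm_apply funCongrLeft symm_apply_apply symm_apply_eq)
open LinearMap (ker mem_ker prodMap_apply toAddMonoidHom_coe)
open Module.End (eigenspace)
open Multiset (toFinsupp)
open Prod (fst_add fst_sub fst_sum snd_sub snd_sum)
open Quaternion (algebraMap_def normSq normSq_def normSq_def' normSq_nonneg normSq_smul
  self_mul_star)
open QuaternionAlgebra (imI imJ imK)
open Ring (choose_natCast)
open Submodule (mem_iInf smul_mem span span_induction span_mono subset_span)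
open LinearMap renaming comp_apply → lcomp, smul_apply → lsmul, add_apply → ladd,
  sub_apply → lsub, zero_apply → lzero, ext → lext, congr_fun → lcongr,
  sum_apply → lsum, id → lid
open Pi renaming add_apply → padd, smul_apply → psmul, sub_apply → psub, zero_apply → pzero
open Finsupp renaming smul_apply → fsmul, add_apply → fadd, single_apply → fsingle,
  sub_apply → fsub
open Module.End renaming mul_apply → emul
open Submodule renaming zero_mem → szero
open Prod renaming ext → pext
open LatticeInput

/-- Operators on the Fock space. -/
abbrev Op (N d : ℕ) : Type := Fock N d →ₗ[ℂ] Fock N d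

/-- Charges in coordinates. -/
abbrev Charge (d : ℕ) : Type := Fin d → ℤ

/-- Functions of two charges. -/
abbrev Cocycle (d : ℕ) : Type := Charge d → Charge d → ℂ

/-- Sequences of operators, indexed by the modes of a field. -/
abbrev Modes (V : Type*) [AddCommGroup V] [Module ℂ V] := ℤ → V →ₗ[ℂ] V

/-! ## Formal fields -/

lemma finite_of_lt {V : Type*} [AddCommGroup V] {f : ℕ → V} (K : ℕ) (h : ∀ j, K ≤ j → f j = 0) :
    (support f).Finite :=
  (Set.finite_lt_nat K).subset fun j hj => by
    by_contra hc
    exact hj (h j (not_lt.1 hc))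

lemma finsum_eq_range {V : Type*} [AddCommGroup V] {f : ℕ → V} (K : ℕ) (h : ∀ j, K ≤ j → f j = 0) :
    ∑ᶠ j, f j = ∑ j ∈ range K, f j :=
  finsum_eq_sum_of_support_subset _ fun j hj => by
    simp only [Finset.coe_range, Set.mem_Iio]
    by_contra hc
    exact hj (h j (not_lt.1 hc))

section Fields

variable {V : Type*} [AddCommGroup V] [Module ℂ V]

/-- Every vector is annihilated by the coefficients of sufficiently negative powers. -/
def Truncated (A : Modes V) : Prop := ∀ x, ∃ N : ℤ, ∀ n < N, A n x = 0

/-- Multiplication of a two-variable formal distribution by `z - w`. -/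
def zwMul : Module.End ℂ (ℤ → ℤ → V) where
  toFun X := fun a b => X (a - 1) b - X a (b - 1)
  map_add' X Y := by ext a b; simp only [padd]; abel
  map_smul' c X := by ext a b; simp [smul_sub]

/-- Mutual locality of two fields up to the sign `s`. -/
def LocalFields (A C : Modes V) (s : ℂ) : Prop :=
  ∃ N : ℕ, ∀ x, (zwMul ^ N) (fun a b => A a (C b x) - s • C b (A a x)) = 0

/-- `C` is the normally ordered product of `A` and `B` with sign `s`. -/
def IsNop (A B : Modes V) (s : ℂ) (C : Modes V) : Prop :=
  ∀ t x, C t x = (∑ᶠ j : ℕ, A j (B (t - j) x)) + s • ∑ᶠ j : ℕ, B (t + 1 + j) (A (-1 - j) x)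

lemma Truncated.finite_left {A B : Modes V} (hB : Truncated B) (f : ℕ → ℤ) (t : ℤ) (x : V) :
    (support fun j : ℕ => A (f j) (B (t - j) x)).Finite := by
  obtain ⟨N, hN⟩ := hB x
  refine finite_of_lt (t - N + 1).toNat fun j hj => ?_
  rw [hN _ (by omega), map_zero]

lemma Truncated.finite_right {A B : Modes V} (hA : Truncated A) (f : ℕ → ℤ) (t : ℤ) (x : V) :
    (support fun j : ℕ => B (f j) (A (t - j) x)).Finite :=
  Truncated.finite_left hA f t x

lemma IsNop.eq_range {A B C : Modes V} {s : ℂ} (h : IsNop A B s C) (hA : Truncated A)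
    (hB : Truncated B) (t : ℤ) (x : V) : ∃ K₀ : ℕ, ∀ K ≥ K₀, C t x =
      ∑ j ∈ range K, (A j (B (t - j) x) + s • B (t + 1 + j) (A (-1 - j) x)) := by
  obtain ⟨N, hN⟩ := hB x
  obtain ⟨M, hM⟩ := hA x
  refine ⟨max (t - N + 1).toNat (-1 - M + 1).toNat, fun K hK => ?_⟩
  have hK := max_le_iff.1 hK
  rw [h, sum_add_distrib, ← smul_sum, finsum_eq_range K, finsum_eq_range K]
  · intro j hj
    rw [hM _ (by omega), map_zero]
  · intro j hj
    rw [hN _ (by omega), map_zero]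

lemma IsNop.isField {A B C : Modes V} {s : ℂ} (h : IsNop A B s C) (hA : Truncated A)
    (hB : Truncated B) : Truncated C := by
  intro x
  obtain ⟨N, hN⟩ := hB x
  obtain ⟨M, hM⟩ := hA x
  choose f hf using fun j : ℕ => hB (A (-1 - j) x)
  obtain ⟨L, hL⟩ : ∃ L : ℤ, ∀ j ∈ range (-M).toNat, L ≤ f j - 1 - j := by
    obtain ⟨L, hL⟩ := ((range (-M).toNat).image fun j => f j - 1 - j).bddBelow
    exact ⟨L, fun j hj => hL (by simpa using ⟨j, by simpa using hj, rfl⟩)⟩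
  refine ⟨min N L, fun t ht => ?_⟩
  rw [lt_min_iff] at ht
  have h1 : ∀ j : ℕ, A j (B (t - j) x) = 0 := fun j => by rw [hN _ (by omega), map_zero]
  have h2 : ∀ j : ℕ, B (t + 1 + j) (A (-1 - j) x) = 0 := fun j => by grind
  rw [h]
  simp [h1, h2]

lemma zwMul_pow_eq_zero_of_le {X : ℤ → ℤ → V} {N M : ℕ} (h : (zwMul ^ N) X = 0) (hNM : N ≤ M) :
    (zwMul ^ M) X = 0 := by
  obtain ⟨k, rfl⟩ := Nat.exists_eq_add_of_le hNM
  rw [add_comm, pow_add, emul, h, map_zero]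

lemma zwMul_pow_apply (N : ℕ) (X : ℤ → ℤ → V) (a b : ℤ) : (zwMul ^ N) X a b = ∑ j ∈ range (N + 1),
      ((-1 : ℂ) ^ j * (N.choose j : ℂ)) • X (a - (N - j)) (b - j) := by
  induction N generalizing a b with
  | zero => simp
  | succ N ih =>
    rw [pow_succ', emul]
    change (zwMul ^ N) X (a - 1) b - (zwMul ^ N) X a (b - 1) = _
    rw [ih, ih, Finset.sum_range_succ', Finset.sum_range_succ' _ (N + 1), sum_range_succ _ N]
    have e : ∀ j ∈ range N, ((-1 : ℂ) ^ (j + 1) * ((N + 1).choose (j + 1) : ℂ)) •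
        X (a - ((N + 1 : ℕ) - (j + 1 : ℕ))) (b - (j + 1 : ℕ)) =
        ((-1 : ℂ) ^ (j + 1) * (N.choose (j + 1) : ℂ)) • X (a - 1 - (N - (j + 1 : ℕ))) (b - (j + 1 : ℕ))
        - ((-1 : ℂ) ^ j * (N.choose j : ℂ)) • X (a - (N - j)) (b - 1 - j) := by
      intro j _
      rw [Nat.choose_succ_succ, show a - 1 - ((N : ℤ) - (j + 1 : ℕ)) = a - (N - j) by push_cast; ring,
        show b - 1 - (j : ℤ) = b - (j + 1 : ℕ) by push_cast; ring,
        show a - (((N + 1 : ℕ) : ℤ) - (j + 1 : ℕ)) = a - (N - j) by push_cast; ring, ← sub_smul]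
      congr 1
      push_cast
      ring
    rw [sum_range_succ, sum_congr rfl e, sum_sub_distrib]
    have e1 : a - 1 - ((N : ℤ) - (0 : ℕ)) = a - (((N + 1 : ℕ) : ℤ) - (0 : ℕ)) := by push_cast; ring
    have e2 : a - ((N : ℤ) - N) = a - (((N + 1 : ℕ) : ℤ) - (N + 1 : ℕ)) := by push_cast; ring
    have e3 : b - 1 - (N : ℤ) = b - (N + 1 : ℕ) := by push_cast; ring
    rw [e1, e2, e3]
    simp only [pow_zero, Nat.choose_zero_right, Nat.choose_self, pow_succ]
    simp only [Nat.cast_one, mul_one, mul_neg, neg_smul, one_smul]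
    abel

lemma LocalFields.symm {A C : Modes V} {s : ℂ} (h : LocalFields A C s) (hs : s * s = 1) :
    LocalFields C A s := by
  obtain ⟨N, hN⟩ := h
  refine ⟨N, fun x => ?_⟩
  ext a b
  have := congrFun (congrFun (hN x) b) a
  rw [zwMul_pow_apply, ← Finset.sum_range_reflect] at this
  rw [zwMul_pow_apply]
  have key := congrArg (fun v => (-s * (-1) ^ N) • v) this
  simp only [smul_sum, pzero, smul_zero] at key
  refine Eq.trans ?_ key
  refine sum_congr rfl fun j hj => ?_
  have hj : j ≤ N := by simpa [Nat.lt_succ_iff] using hj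
  rw [show N + 1 - 1 - j = N - j by omega, Nat.choose_symm hj, smul_smul, Nat.cast_sub hj,
    show b - ((N : ℤ) - (N - j)) = b - j by ring]
  have e : (-1 : ℂ) ^ N = (-1) ^ (N - j) * (-1) ^ j := by rw [← pow_add]; congr 1; omega
  have e' : (-1 : ℂ) ^ (N - j) * (-1) ^ (N - j) = 1 := by rw [← mul_pow]; simp
  rw [show -s * (-1 : ℂ) ^ N * ((-1) ^ (N - j) * (N.choose j : ℂ)) =
    -s * ((-1) ^ j * (N.choose j : ℂ)) by
      grind]
  rw [show -s * ((-1) ^ j * (N.choose j : ℂ)) = ((-1) ^ j * (N.choose j : ℂ)) * -s by ring,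
    mul_smul ((-1 : ℂ) ^ j * (N.choose j : ℂ)) (-s)]
  congr 1
  rw [smul_sub, neg_smul, neg_smul, smul_smul, hs, one_smul]
  abel

lemma LocalFields.add {A A' C : Modes V} {s : ℂ} (h : LocalFields A C s)
    (h' : LocalFields A' C s) : LocalFields (A + A') C s := by
  obtain ⟨N, hN⟩ := h
  obtain ⟨N', hN'⟩ := h'
  refine ⟨N + N', fun x => ?_⟩
  have e : (fun a b => (A + A') a (C b x) - s • C b ((A + A') a x)) =
      (fun a b => A a (C b x) - s • C b (A a x)) + fun a b => A' a (C b x) - s • C b (A' a x) := by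
    ext a b
    simp only [padd, ladd, map_add, smul_add]
    abel
  rw [e, map_add, zwMul_pow_eq_zero_of_le (hN x) (by omega),
    zwMul_pow_eq_zero_of_le (hN' x) (by omega), add_zero]

lemma LocalFields.smul {A C : Modes V} {s : ℂ} (c : ℂ) (h : LocalFields A C s) :
    LocalFields (c • A) C s := by
  obtain ⟨N, hN⟩ := h
  refine ⟨N, fun x => ?_⟩
  have e : (fun a b => (c • A) a (C b x) - s • C b ((c • A) a x)) =
      c • (fun a b => A a (C b x) - s • C b (A a x)) := by
    ext a b
    simp only [psmul, lsmul, map_smul, smul_sub, smul_comm s]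
  rw [e, map_smul, hN, smul_zero]

lemma LocalFields.zero (C : Modes V) (s : ℂ) : LocalFields 0 C s := ⟨0, fun x => by
  ext; simp⟩

lemma LocalFields.sum {ι : Type*} (S : Finset ι) {A : ι → Modes V} {C : Modes V}
    {s : ℂ} (h : ∀ i ∈ S, LocalFields (A i) C s) : LocalFields (∑ i ∈ S, A i) C s := by
  classical
  induction S using Finset.induction_on with
  | empty => simpa using LocalFields.zero C s
  | insert i S hi ih =>
    rw [Finset.sum_insert hi]
    exact (h i (by simp)).add (ih fun j hj => h j (by simp [hj]))

/-- The divided derivative `∂^n A / n!`. -/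
def divDeriv (n : ℕ) (A : Modes V) : Modes V :=
  fun t => ((Ring.choose (t + n) n : ℤ) : ℂ) • A (t + n)

lemma zwMul_deriv (M : ℕ) (X : ℤ → ℤ → V) (h : (zwMul ^ M) X = 0) :
    (zwMul ^ (M + 1)) (fun a b => ((a + 1 : ℤ) : ℂ) • X (a + 1) b) = 0 := by
  have key : ∀ (M : ℕ) (X : ℤ → ℤ → V) (a b : ℤ),
      (zwMul ^ M) (fun a b => ((a + 1 : ℤ) : ℂ) • X (a + 1) b) a b =
        ((a + 1 : ℤ) : ℂ) • (zwMul ^ M) X (a + 1) b - (M : ℂ) • (zwMul ^ (M - 1)) X a b := by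
    intro M
    induction M with
    | zero => intro X a b; simp
    | succ M ih =>
      intro X a b
      have es : ∀ (Y : ℤ → ℤ → V) a b, (zwMul ^ (M + 1)) Y a b =
          (zwMul ^ M) Y (a - 1) b - (zwMul ^ M) Y a (b - 1) := by
        intro Y a b
        rw [pow_succ', emul]
        rfl
      rw [es, es, ih, ih]
      rcases M with _ | M
      · simp
        module
      · have e : ∀ a b, (zwMul ^ (M + 1)) X a b =
            (zwMul ^ M) X (a - 1) b - (zwMul ^ M) X a (b - 1) := by
          intro a b
          rw [pow_succ', emul]
          rfl
        simp only [Nat.add_sub_cancel, sub_add_cancel, add_sub_cancel_right]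
        rw [e a b]
        push_cast
        module
  ext a b
  rw [key, Nat.add_sub_cancel, h, pow_succ', emul, h]
  simp

lemma LocalFields.deriv {A C : Modes V} {s : ℂ} (h : LocalFields A C s) :
    LocalFields (fun t => ((t + 1 : ℤ) : ℂ) • A (t + 1)) C s := by
  obtain ⟨N, hN⟩ := h
  refine ⟨N + 1, fun x => ?_⟩
  have key := zwMul_deriv N _ (hN x)
  refine Eq.trans (congrArg _ ?_) key
  ext a b
  simp only [lsmul, map_smul, smul_sub, smul_comm s]

lemma divDeriv_zero (A : Modes V) : divDeriv 0 A = A := by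
  ext t
  simp [divDeriv]

lemma ringChoose_succ_mul (r : ℤ) (k : ℕ) :
    Ring.choose r (k + 1) * (k + 1) = Ring.choose (r - 1) k * r := by
  have hk : ((k + 1).factorial : ℤ) ≠ 0 := by positivity
  apply mul_left_cancel₀ (show (k.factorial : ℤ) ≠ 0 by positivity)
  have h1 := Ring.descPochhammer_eq_factorial_smul_choose r (k + 1)
  have h2 := Ring.descPochhammer_eq_factorial_smul_choose (r - 1) k
  rw [descPochhammer_succ_left, Polynomial.smeval_X_mul, Polynomial.smeval_comp] at h1
  simp only [Polynomial.smeval_sub, Polynomial.smeval_X, Polynomial.smeval_one, nsmul_eq_mul,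
    pow_one, pow_zero, one_smul, Nat.cast_succ, Nat.factorial_succ, Nat.cast_mul] at h1 h2
  rw [h2] at h1
  linear_combination -h1

lemma divDeriv_succ (n : ℕ) (A : Modes V) : divDeriv (n + 1) A =
      ((n : ℂ) + 1)⁻¹ • fun t => ((t + 1 : ℤ) : ℂ) • divDeriv n A (t + 1) := by
  ext t x
  have hn : (n : ℂ) + 1 ≠ 0 := mod_cast Nat.succ_ne_zero n
  simp only [divDeriv, psmul, lsmul, smul_smul]
  rw [show t + ((n + 1 : ℕ) : ℤ) = t + 1 + n by push_cast; ring]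
  congr 1
  rw [eq_inv_mul_iff_mul_eq₀ hn]
  have key : (Ring.choose (t + 1 + n) (n + 1)) * (n + 1 : ℤ) = (t + 1) * Ring.choose (t + 1 + n) n := by
    induction n with
    | zero => simp
    | succ n ih =>
      have h1 := ringChoose_succ_mul (t + 1 + (n + 1 : ℕ)) (n + 1)
      have h2 := ringChoose_succ_mul (t + 1 + (n + 1 : ℕ)) n
      have e : t + 1 + ((n + 1 : ℕ) : ℤ) - 1 = t + 1 + n := by push_cast; ring
      rw [e] at h1 h2
      have ih := ih (mod_cast Nat.succ_ne_zero n)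
      have hne : (n + 1 : ℤ) ≠ 0 := by positivity
      apply mul_right_cancel₀ hne
      push_cast at *
      linear_combination (n + 1 : ℤ) * h1 + (t + 1 + (n + 1)) * ih - (t + 1) * h2
  exact_mod_cast (by linarith [key] : (n + 1 : ℤ) * _ = _)

lemma LocalFields.divDeriv {A C : Modes V} {s : ℂ} (h : LocalFields A C s) (n : ℕ) :
    LocalFields (divDeriv n A) C s := by
  induction n with
  | zero => rwa [divDeriv_zero]
  | succ n ih =>
    rw [divDeriv_succ]
    exact ih.deriv.smul _

lemma Truncated.divDeriv {A : Modes V} (h : Truncated A) (n : ℕ) : Truncated (divDeriv n A) := by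
  intro x
  obtain ⟨N, hN⟩ := h x
  exact ⟨N - n, fun t ht => by simp [_root_.divDeriv, hN (t + n) (by omega)]⟩

end Fields

/-! ## Dong's lemma -/

lemma finsum_nat_succ {V : Type*} [AddCommGroup V] {f : ℕ → V} (h : (support f).Finite) :
    ∑ᶠ j, f j = f 0 + ∑ᶠ j, f (j + 1) := by
  obtain ⟨K, hK⟩ := h.bddAbove
  have h0 : ∀ j, K + 1 ≤ j → f j = 0 := fun j hj => by
    by_contra hc
    have := hK hc
    omega
  rw [finsum_eq_range (K + 2) fun j hj => h0 j (by omega),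
    finsum_eq_range (K + 1) fun j hj => h0 (j + 1) (by omega), Finset.sum_range_succ', add_comm]

section Dong

variable {V : Type*} [AddCommGroup V] [Module ℂ V]

/-- Multiplication of a three-variable formal distribution by the first variable. -/
def mulFst : Module.End ℂ (ℤ → ℤ → ℤ → V) where
  toFun X := fun a b c => X (a - 1) b c
  map_add' _ _ := rfl
  map_smul' _ _ := rfl

/-- Multiplication of a three-variable formal distribution by the second variable. -/
def mulSnd : Module.End ℂ (ℤ → ℤ → ℤ → V) where
  toFun X := fun a b c => X a (b - 1) c
  map_add' _ _ := rfl
  map_smul' _ _ := rfl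

/-- Multiplication of a three-variable formal distribution by the third variable. -/
def mulThd : Module.End ℂ (ℤ → ℤ → ℤ → V) where
  toFun X := fun a b c => X a b (c - 1)
  map_add' _ _ := rfl
  map_smul' _ _ := rfl

/-- Multiplication by the difference of the first and second variables. -/
def mul12 : Module.End ℂ (ℤ → ℤ → ℤ → V) := mulFst - mulSnd

/-- Multiplication by the difference of the first and third variables. -/
def mul13 : Module.End ℂ (ℤ → ℤ → ℤ → V) := mulFst - mulThd

/-- Multiplication by the difference of the second and third variables. -/
def mul23 : Module.End ℂ (ℤ → ℤ → ℤ → V) := mulSnd - mulThd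

lemma mul_commute : Commute (mul12 : Module.End ℂ (ℤ → ℤ → ℤ → V)) mul23 ∧
    Commute (mul13 : Module.End ℂ (ℤ → ℤ → ℤ → V)) mul23 ∧
    Commute (mul13 : Module.End ℂ (ℤ → ℤ → ℤ → V)) mul12 := by
  have h1 : Commute (mulFst : Module.End ℂ (ℤ → ℤ → ℤ → V)) mulSnd := lext fun _ => rfl
  have h2 : Commute (mulFst : Module.End ℂ (ℤ → ℤ → ℤ → V)) mulThd := lext fun _ => rfl
  have h3 : Commute (mulSnd : Module.End ℂ (ℤ → ℤ → ℤ → V)) mulThd := lext fun _ => rfl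
  have k1 := Commute.refl (mulFst : Module.End ℂ (ℤ → ℤ → ℤ → V))
  have k2 := Commute.refl (mulSnd : Module.End ℂ (ℤ → ℤ → ℤ → V))
  have k3 := Commute.refl (mulThd : Module.End ℂ (ℤ → ℤ → ℤ → V))
  exact ⟨(h1.sub_right h2).sub_left (k2.sub_right h3), (h1.sub_right h2).sub_left
    (h3.symm.sub_right k3), (k1.sub_right h1).sub_left (h2.symm.sub_right h3.symm)⟩

lemma mul12_pow_apply (N : ℕ) (X : ℤ → ℤ → ℤ → V) (a b c : ℤ) :
    (mul12 ^ N) X a b c = (zwMul ^ N) (fun a b => X a b c) a b := by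
  induction N generalizing X with
  | zero => rfl
  | succ N ih =>
    rw [pow_succ, pow_succ, emul, emul, ih]
    rfl

lemma mul13_pow_apply (N : ℕ) (X : ℤ → ℤ → ℤ → V) (a b c : ℤ) :
    (mul13 ^ N) X a b c = (zwMul ^ N) (fun a c => X a b c) a c := by
  induction N generalizing X with
  | zero => rfl
  | succ N ih =>
    rw [pow_succ, pow_succ, emul, emul, ih]
    rfl

lemma mul23_pow_apply (N : ℕ) (X : ℤ → ℤ → ℤ → V) (a b c : ℤ) :
    (mul23 ^ N) X a b c = (zwMul ^ N) (X a) b c := by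
  induction N generalizing X with
  | zero => rfl
  | succ N ih =>
    rw [pow_succ, pow_succ, emul, emul, ih]
    rfl

lemma zwMul_pow_map {W : Type*} [AddCommGroup W] [Module ℂ W] (f : V →ₗ[ℂ] W) (N : ℕ)
    (X : ℤ → ℤ → V) :
    (zwMul ^ N) (fun a b => f (X a b)) = fun a b => f ((zwMul ^ N) X a b) := by
  ext a b
  simp only [zwMul_pow_apply, map_sum, map_smul]

lemma Commute.add_pow_apply_eq_zero {W : Type*} [AddCommGroup W] [Module ℂ W]
    {x y : Module.End ℂ W} (h : Commute x y) (n p q : ℕ) (hpq : p + q ≤ n + 1) (v : W)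
    (hx : (x ^ p) v = 0) (hy : (y ^ q) v = 0) : ((x + y) ^ n) v = 0 := by
  induction n generalizing p q v with
  | zero =>
    rcases Nat.eq_zero_or_pos p with rfl | hp
    · simpa using hx
    · obtain rfl : q = 0 := by omega
      simpa using hy
  | succ n ih =>
    rcases p with _ | p
    · rw [show v = 0 by simpa using hx, map_zero]
    rcases q with _ | q
    · rw [show v = 0 by simpa using hy, map_zero]
    rw [pow_succ, emul, ladd, map_add]
    have e1 : (y ^ (q + 1)) (x v) = 0 := by
      rw [← emul, ← (h.pow_right (q + 1)).eq, emul, hy, map_zero]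
    have e2 : (x ^ (p + 1)) (y v) = 0 := by rw [← emul, (h.pow_left (p + 1)).eq, emul, hx, map_zero]
    rw [ih p (q + 1) (by omega) _ (by rw [← emul, ← pow_succ, hx]) e1,
      ih (p + 1) q (by omega) _ e2 (by rw [← emul, ← pow_succ, hy]), add_zero]

lemma neg_pow_apply {W : Type*} [AddCommGroup W] [Module ℂ W] (U : Module.End ℂ W) (n : ℕ)
    (v : W) : ((-U) ^ n) v = (-1 : ℂ) ^ n • (U ^ n) v := by
  induction n with
  | zero => simp
  | succ n ih =>
    rw [pow_succ', emul, ih, pow_succ', pow_succ', emul,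
      LinearMap.neg_apply, map_smul, mul_smul, neg_one_smul]

/-- Boundedness below in the second variable. -/
def bddSnd (V : Type*) [AddCommGroup V] [Module ℂ V] : Submodule ℂ (ℤ → ℤ → ℤ → V) where
  carrier := {X | ∀ c, ∃ β : ℤ, ∀ a b, b < β → X a b c = 0}
  add_mem' := by
    intro X Y hX hY c
    obtain ⟨β, hβ⟩ := hX c
    obtain ⟨γ, hγ⟩ := hY c
    refine ⟨min β γ, fun a b hb => ?_⟩
    rw [lt_min_iff] at hb
    simp [hβ a b hb.1, hγ a b hb.2]
  zero_mem' := fun c => ⟨0, fun a b _ => rfl⟩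
  smul_mem' := by
    intro r X hX c
    obtain ⟨β, hβ⟩ := hX c
    exact ⟨β, fun a b hb => by simp [hβ a b hb]⟩

/-- Boundedness below in the first variable. -/
def bddFst (V : Type*) [AddCommGroup V] [Module ℂ V] : Submodule ℂ (ℤ → ℤ → ℤ → V) where
  carrier := {X | ∀ c, ∃ β : ℤ, ∀ a b, a < β → X a b c = 0}
  add_mem' := by
    intro X Y hX hY c
    obtain ⟨β, hβ⟩ := hX c
    obtain ⟨γ, hγ⟩ := hY c
    refine ⟨min β γ, fun a b hb => ?_⟩
    rw [lt_min_iff] at hb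
    simp [hβ a b hb.1, hγ a b hb.2]
  zero_mem' := fun c => ⟨0, fun a b _ => rfl⟩
  smul_mem' := by
    intro r X hX c
    obtain ⟨β, hβ⟩ := hX c
    exact ⟨β, fun a b hb => by simp [hβ a b hb]⟩

/-- Multiplication by `(z - w)⁻¹`, expanded in powers of `w / z`. -/
def invSub (X : ℤ → ℤ → ℤ → V) : ℤ → ℤ → ℤ → V :=
  fun a b c => ∑ᶠ j : ℕ, X (a + 1 + j) (b - j) c

/-- Multiplication by `(w - z)⁻¹`, expanded in powers of `z / w`. -/
def invSub' (X : ℤ → ℤ → ℤ → V) : ℤ → ℤ → ℤ → V :=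
  fun a b c => ∑ᶠ j : ℕ, X (a - j) (b + 1 + j) c

lemma invSub_finite {X : ℤ → ℤ → ℤ → V} (hX : X ∈ bddSnd V) (f : ℕ → ℤ) (b c : ℤ) :
    (support fun j : ℕ => X (f j) (b - j) c).Finite := by
  obtain ⟨β, hβ⟩ := hX c
  exact finite_of_lt (b - β + 1).toNat fun j hj => hβ _ _ (by omega)

lemma invSub'_finite {X : ℤ → ℤ → ℤ → V} (hX : X ∈ bddFst V) (f : ℕ → ℤ) (a c : ℤ) :
    (support fun j : ℕ => X (a - j) (f j) c).Finite := by
  obtain ⟨β, hβ⟩ := hX c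
  exact finite_of_lt (a - β + 1).toNat fun j hj => hβ _ _ (by omega)

lemma invSub_sub {X Y : ℤ → ℤ → ℤ → V} (hX : X ∈ bddSnd V) (hY : Y ∈ bddSnd V) :
    invSub (X - Y) = invSub X - invSub Y := by
  ext a b c
  exact finsum_sub_distrib (invSub_finite hX _ b c) (invSub_finite hY _ b c)

lemma invSub'_sub {X Y : ℤ → ℤ → ℤ → V} (hX : X ∈ bddFst V) (hY : Y ∈ bddFst V) :
    invSub' (X - Y) = invSub' X - invSub' Y := by
  ext a b c
  exact finsum_sub_distrib (invSub'_finite hX _ a c) (invSub'_finite hY _ a c)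

lemma invSub_smul (r : ℂ) (X : ℤ → ℤ → ℤ → V) : invSub (r • X) = r • invSub X := by
  ext a b c
  exact (smul_finsum r _).symm

lemma invSub'_smul (r : ℂ) (X : ℤ → ℤ → ℤ → V) : invSub' (r • X) = r • invSub' X := by
  ext a b c
  exact (smul_finsum r _).symm

lemma mul_mem_bddSnd {X : ℤ → ℤ → ℤ → V} (hX : X ∈ bddSnd V) :
    mulFst X ∈ bddSnd V ∧ mulSnd X ∈ bddSnd V ∧ mulThd X ∈ bddSnd V := by
  refine ⟨fun c => ?_, fun c => ?_, fun c => ?_⟩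
  · obtain ⟨β, hβ⟩ := hX c
    exact ⟨β, fun a b hb => hβ _ _ hb⟩
  · obtain ⟨β, hβ⟩ := hX c
    exact ⟨β, fun a b hb => hβ _ _ (by omega)⟩
  · obtain ⟨β, hβ⟩ := hX (c - 1)
    exact ⟨β, fun a b hb => hβ _ _ hb⟩

lemma mul_mem_bddFst {X : ℤ → ℤ → ℤ → V} (hX : X ∈ bddFst V) :
    mulFst X ∈ bddFst V ∧ mulSnd X ∈ bddFst V ∧ mulThd X ∈ bddFst V := by
  refine ⟨fun c => ?_, fun c => ?_, fun c => ?_⟩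
  · obtain ⟨β, hβ⟩ := hX c
    exact ⟨β, fun a b hb => hβ _ _ (by omega)⟩
  · obtain ⟨β, hβ⟩ := hX c
    exact ⟨β, fun a b hb => hβ _ _ hb⟩
  · obtain ⟨β, hβ⟩ := hX (c - 1)
    exact ⟨β, fun a b hb => hβ _ _ hb⟩

lemma invSub_mul (X : ℤ → ℤ → ℤ → V) : invSub (mulFst X) = mulFst (invSub X) ∧
    invSub (mulSnd X) = mulSnd (invSub X) ∧ invSub (mulThd X) = mulThd (invSub X) := by
  refine ⟨?_, ?_, rfl⟩
  · ext a b c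
    refine finsum_congr fun j => ?_
    change X (a + 1 + j - 1) _ _ = X (a - 1 + 1 + j) _ _
    rw [show a + 1 + (j : ℤ) - 1 = a - 1 + 1 + j by ring]
  · ext a b c
    refine finsum_congr fun j => ?_
    change X _ (b - j - 1) _ = X _ (b - 1 - j) _
    rw [show b - (j : ℤ) - 1 = b - 1 - j by ring]

lemma invSub'_mul (X : ℤ → ℤ → ℤ → V) : invSub' (mulFst X) = mulFst (invSub' X) ∧
    invSub' (mulSnd X) = mulSnd (invSub' X) ∧ invSub' (mulThd X) = mulThd (invSub' X) := by
  refine ⟨?_, ?_, rfl⟩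
  · ext a b c
    refine finsum_congr fun j => ?_
    change X (a - j - 1) _ _ = X (a - 1 - j) _ _
    rw [show a - (j : ℤ) - 1 = a - 1 - j by ring]
  · ext a b c
    refine finsum_congr fun j => ?_
    change X _ (b + 1 + j - 1) _ = X _ (b - 1 + 1 + j) _
    rw [show b + 1 + (j : ℤ) - 1 = b - 1 + 1 + j by ring]

lemma pow_comm_of_step {W : Type*} [AddCommGroup W] [Module ℂ W] (P : Submodule ℂ W)
    (R : W → W) (U : Module.End ℂ W) (h : ∀ X ∈ P, U X ∈ P ∧ R (U X) = U (R X)) (n : ℕ) (X : W)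
    (hX : X ∈ P) : (U ^ n) X ∈ P ∧ R ((U ^ n) X) = (U ^ n) (R X) := by
  induction n with
  | zero => exact ⟨hX, rfl⟩
  | succ n ih =>
    simp only [pow_succ', emul]
    exact ⟨(h _ ih.1).1, by rw [(h _ ih.1).2, ih.2]⟩

lemma invSub_annihilated {X : ℤ → ℤ → ℤ → V} (hX : X ∈ bddSnd V) (m n : ℕ)
    (h : (mul13 ^ m) ((mul23 ^ n) X) = 0) :
    (mul13 ^ m) ((mul23 ^ n) (invSub X)) = 0 := by
  have s1 : ∀ Y ∈ bddSnd V, mul13 Y ∈ bddSnd V ∧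
      invSub (mul13 Y) = mul13 (invSub Y) := fun Y hY =>
    ⟨sub_mem (mul_mem_bddSnd hY).1 (mul_mem_bddSnd hY).2.2, by
      rw [mul13, lsub, invSub_sub (mul_mem_bddSnd hY).1 (mul_mem_bddSnd hY).2.2,
        (invSub_mul Y).1, (invSub_mul Y).2.2]; rfl⟩
  have s2 : ∀ Y ∈ bddSnd V, mul23 Y ∈ bddSnd V ∧
      invSub (mul23 Y) = mul23 (invSub Y) := fun Y hY =>
    ⟨sub_mem (mul_mem_bddSnd hY).2.1 (mul_mem_bddSnd hY).2.2, by
      rw [mul23, lsub, invSub_sub (mul_mem_bddSnd hY).2.1 (mul_mem_bddSnd hY).2.2,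
        (invSub_mul Y).2.1, (invSub_mul Y).2.2]; rfl⟩
  have h2 := pow_comm_of_step _ _ _ s2 n X hX
  have h1 := pow_comm_of_step _ _ _ s1 m _ h2.1
  rw [← h2.2, ← h1.2, h]
  ext a b c
  simp [invSub]

lemma invSub'_annihilated {X : ℤ → ℤ → ℤ → V} (hX : X ∈ bddFst V) (m n : ℕ)
    (h : (mul13 ^ m) ((mul23 ^ n) X) = 0) :
    (mul13 ^ m) ((mul23 ^ n) (invSub' X)) = 0 := by
  have s1 : ∀ Y ∈ bddFst V, mul13 Y ∈ bddFst V ∧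
      invSub' (mul13 Y) = mul13 (invSub' Y) := fun Y hY =>
    ⟨sub_mem (mul_mem_bddFst hY).1 (mul_mem_bddFst hY).2.2, by
      rw [mul13, lsub, invSub'_sub (mul_mem_bddFst hY).1 (mul_mem_bddFst hY).2.2,
        (invSub'_mul Y).1, (invSub'_mul Y).2.2]; rfl⟩
  have s2 : ∀ Y ∈ bddFst V, mul23 Y ∈ bddFst V ∧
      invSub' (mul23 Y) = mul23 (invSub' Y) := fun Y hY =>
    ⟨sub_mem (mul_mem_bddFst hY).2.1 (mul_mem_bddFst hY).2.2, by
      rw [mul23, lsub, invSub'_sub (mul_mem_bddFst hY).2.1 (mul_mem_bddFst hY).2.2,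
        (invSub'_mul Y).2.1, (invSub'_mul Y).2.2]; rfl⟩
  have h2 := pow_comm_of_step _ _ _ s2 n X hX
  have h1 := pow_comm_of_step _ _ _ s1 m _ h2.1
  rw [← h2.2, ← h1.2, h]
  ext a b c
  simp [invSub']

lemma mul_invSub {X : ℤ → ℤ → ℤ → V} (hX : X ∈ bddSnd V) : mul12 (invSub X) = X := by
  ext a b c
  change (∑ᶠ j : ℕ, X (a - 1 + 1 + j) (b - j) c) - ∑ᶠ j : ℕ, X (a + 1 + j) (b - 1 - j) c = _
  rw [finsum_nat_succ (invSub_finite hX _ b c)]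
  have : ∀ j : ℕ, X (a - 1 + 1 + (j + 1 : ℕ)) (b - (j + 1 : ℕ)) c =
      X (a + 1 + j) (b - 1 - j) c := fun j => by
    grind
  simp only [this]
  simp

lemma mul_invSub' {X : ℤ → ℤ → ℤ → V} (hX : X ∈ bddFst V) : mul12 (invSub' X) = -X := by
  ext a b c
  change (∑ᶠ j : ℕ, X (a - 1 - j) (b + 1 + j) c) - ∑ᶠ j : ℕ, X (a - j) (b - 1 + 1 + j) c = _
  rw [finsum_nat_succ (invSub'_finite hX _ a c)]
  have : ∀ j : ℕ, X (a - (j + 1 : ℕ)) (b - 1 + 1 + (j + 1 : ℕ)) c =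
      X (a - 1 - j) (b + 1 + j) c := fun j => by
    grind
  simp only [this]
  simp

lemma LocalFields.nop {A B C P : Modes V} {s s₂ s₃ : ℂ} (hA : Truncated A)
    (hB : Truncated B) (hP : IsNop A B s P) (hAB : LocalFields A B s) (hAC : LocalFields A C s₂)
    (hBC : LocalFields B C s₃) : LocalFields P C (s₂ * s₃) := by
  obtain ⟨n₁, h₁⟩ := hAB
  obtain ⟨n₂, h₂⟩ := hAC
  obtain ⟨n₃, h₃⟩ := hBC
  obtain ⟨c12_3, c13_3, c13_12⟩ := mul_commute (V := V)
  refine ⟨n₁ + 1 + n₂ + n₃, fun x => ?_⟩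
  set F₁ : ℤ → ℤ → ℤ → V := fun a b c => A a (B b (C c x)) with hF₁
  set F₂ : ℤ → ℤ → ℤ → V := fun a b c => B b (A a (C c x)) with hF₂
  set G₁ : ℤ → ℤ → ℤ → V := fun a b c => C c (A a (B b x)) with hG₁
  set G₂ : ℤ → ℤ → ℤ → V := fun a b c => C c (B b (A a x)) with hG₂
  have mF₁ : F₁ ∈ bddSnd V := fun c => by
    obtain ⟨N, hN⟩ := hB (C c x)
    exact ⟨N, fun a b hb => by simp [hF₁, hN b hb]⟩
  have mG₁ : G₁ ∈ bddSnd V := fun c => by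
    obtain ⟨N, hN⟩ := hB x
    exact ⟨N, fun a b hb => by simp [hG₁, hN b hb]⟩
  have mF₂ : F₂ ∈ bddFst V := fun c => by
    obtain ⟨N, hN⟩ := hA (C c x)
    exact ⟨N, fun a b hb => by simp [hF₂, hN a hb]⟩
  have mG₂ : G₂ ∈ bddFst V := fun c => by
    obtain ⟨N, hN⟩ := hA x
    exact ⟨N, fun a b hb => by simp [hG₂, hN a hb]⟩
  set K : ℤ → ℤ → ℤ → V := (invSub F₁ + s • invSub' F₂) - (s₂ * s₃) • (invSub G₁ + s • invSub' G₂)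
    with hK
  have hKres : ∀ b c, K (-1) b c = P b (C c x) - (s₂ * s₃) • C c (P b x) := by
    intro b c
    have e1 : ∀ j : ℕ, (-1 : ℤ) + 1 + j = j := fun j => by ring
    rw [hP, hP, map_add, map_smul]
    simp only [hK, psub, padd, psmul, invSub, invSub', hF₁, hF₂, hG₁, hG₂, e1]
    rw [map_finsum (C c) (hB.finite_left _ b x), map_finsum (C c) (hA.finite_right _ (-1) x)]
  have k12 : ((-mul12) ^ (n₁ + 1)) K = 0 := by
    have e : mul12 K = (F₁ - s • F₂) - (s₂ * s₃) • (G₁ - s • G₂) := by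
      rw [hK, map_sub, map_add, map_smul, map_smul, map_add, map_smul, mul_invSub mF₁,
        mul_invSub mG₁, mul_invSub' mF₂, mul_invSub' mG₂]
      simp only [smul_neg, sub_eq_add_neg]
    rw [neg_pow_apply, pow_succ mul12, emul, e, map_sub, map_smul]
    have z1 : (mul12 ^ n₁) (F₁ - s • F₂) = 0 := by
      ext a b c
      rw [mul12_pow_apply]
      exact congrFun (congrFun (h₁ (C c x)) a) b
    have z2 : (mul12 ^ n₁) (G₁ - s • G₂) = 0 := by
      ext a b c
      rw [mul12_pow_apply]
      have := zwMul_pow_map (C c) n₁ (fun a b => A a (B b x) - s • B b (A a x))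
      rw [h₁ x] at this
      refine Eq.trans (congrFun (congrFun (congrArg _ ?_) a) b)
        ((congrFun (congrFun this a) b).trans (map_zero _))
      ext a b
      simp [hG₁, hG₂]
    rw [z1, z2]
    simp
  have x₁ : (mul13 ^ n₂) ((mul23 ^ n₃) (F₁ - (s₂ * s₃) • G₁)) = 0 := by
    have e : F₁ - (s₂ * s₃) • G₁ = (fun a b c => A a (B b (C c x) - s₃ • C c (B b x))) +
        s₃ • fun a b c => (A a (C c (B b x)) - s₂ • C c (A a (B b x))) := by
      ext a b c
      simp only [hF₁, hG₁, psub, padd, psmul, map_sub, map_smul, smul_sub, smul_smul, mul_comm s₂]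
      abel
    rw [e, map_add, map_add, map_smul, map_smul]
    have z1 : (mul23 ^ n₃) (fun a b c => A a (B b (C c x) - s₃ • C c (B b x))) = 0 := by
      ext a b c
      rw [mul23_pow_apply, zwMul_pow_map, h₃]
      simp
    have z2 : (mul13 ^ n₂) (fun a b c => (A a (C c (B b x)) - s₂ • C c (A a (B b x)))) = 0 := by
      ext a b c
      rw [mul13_pow_apply, h₂]
      rfl
    rw [z1, map_zero, zero_add, ← emul, ((c13_3.pow_left _).pow_right _).eq,
      emul, z2, map_zero, smul_zero]
  have x₂ : (mul13 ^ n₂) ((mul23 ^ n₃) (F₂ - (s₂ * s₃) • G₂)) = 0 := by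
    have e : F₂ - (s₂ * s₃) • G₂ = (fun a b c => B b (A a (C c x) - s₂ • C c (A a x))) +
        s₂ • fun a b c => (B b (C c (A a x)) - s₃ • C c (B b (A a x))) := by
      ext a b c
      simp only [hF₂, hG₂, psub, padd, psmul, map_sub, map_smul, smul_sub, smul_smul]
      abel
    rw [e, map_add, map_add, map_smul, map_smul]
    have z1 : (mul13 ^ n₂) (fun a b c => B b (A a (C c x) - s₂ • C c (A a x))) = 0 := by
      ext a b c
      rw [mul13_pow_apply, zwMul_pow_map, h₂]
      simp
    have z2 : (mul23 ^ n₃) (fun a b c => (B b (C c (A a x)) - s₃ • C c (B b (A a x)))) = 0 := by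
      ext a b c
      rw [mul23_pow_apply, h₃]
      rfl
    rw [z2, map_zero, smul_zero, add_zero, ← emul,
      ((c13_3.pow_left _).pow_right _).eq, emul, z1, map_zero]
  have k13 : (mul13 ^ n₂) ((mul23 ^ n₃) K) = 0 := by
    have e : K = invSub (F₁ - (s₂ * s₃) • G₁) + s • invSub' (F₂ - (s₂ * s₃) • G₂) := by
      rw [invSub_sub mF₁ (smul_mem _ _ mG₁), invSub'_sub mF₂ (smul_mem _ _ mG₂),
        invSub_smul, invSub'_smul, hK]
      module
    rw [e, map_add, map_add, map_smul, map_smul,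
      invSub_annihilated (sub_mem mF₁ (smul_mem _ _ mG₁)) _ _ x₁,
      invSub'_annihilated (sub_mem mF₂ (smul_mem _ _ mG₂)) _ _ x₂]
    simp
  have k23 : (mul23 ^ (n₁ + 1 + n₂ + n₃)) K = 0 := by
    rw [pow_add, emul]
    have e : (mul23 : Module.End ℂ (ℤ → ℤ → ℤ → V)) = mul13 + -mul12 := by
      rw [mul12, mul13, mul23]; abel
    have e12 : ((-mul12) ^ (n₁ + 1)) ((mul23 ^ n₃) K) = 0 := by
      rw [← emul, ((c12_3.neg_left.pow_left _).pow_right _).eq, emul, k12, map_zero]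
    have := Commute.add_pow_apply_eq_zero c13_12.neg_right (n₁ + 1 + n₂) n₂ (n₁ + 1) (by omega) _ k13 e12
    rwa [← e] at this
  ext b c
  have := congrFun (congrFun (congrFun k23 (-1)) b) c
  rw [mul23_pow_apply] at this
  refine Eq.trans (congrFun (congrFun (congrArg _ ?_) b) c) this
  ext b c
  exact (hKres b c).symm

/-! ## Translation covariance, degrees, creation, uniqueness -/

/-- `[T, A(z)] = ∂ A(z)`. -/
def IsTC (T : V →ₗ[ℂ] V) (A : Modes V) : Prop :=
  ∀ n x, T (A n x) - A n (T x) = ((n + 1 : ℤ) : ℂ) • A (n + 1) x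

/-- `A(z)` applied to `vac` is regular with constant term `v`. -/
def Creates (A : Modes V) (vac v : V) : Prop := (∀ t < 0, A t vac = 0) ∧ A 0 vac = v

lemma IsTC.divDeriv {T : V →ₗ[ℂ] V} {A : Modes V} (h : IsTC T A) (n : ℕ) :
    IsTC T (divDeriv n A) := by
  induction n with
  | zero => rwa [divDeriv_zero]
  | succ n ih =>
    intro m x
    rw [divDeriv_succ]
    have := ih (m + 1) x
    simp only [psmul, lsmul, map_smul] at this ⊢
    rw [← smul_sub, ← smul_sub, this, smul_comm _ ((n : ℂ) + 1)⁻¹]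

lemma IsTC.nop {T : V →ₗ[ℂ] V} {A B C : Modes V} {s : ℂ} (hA : Truncated A)
    (hB : Truncated B) (hC : IsNop A B s C) (tA : IsTC T A) (tB : IsTC T B) : IsTC T C := by
  intro t x
  obtain ⟨N, hN⟩ := hB x
  obtain ⟨M, hM⟩ := hA x
  obtain ⟨K₁, h₁⟩ := hC.eq_range hA hB t x
  obtain ⟨K₂, h₂⟩ := hC.eq_range hA hB t (T x)
  obtain ⟨K₃, h₃⟩ := hC.eq_range hA hB (t + 1) x
  set K := K₁ + K₂ + K₃ + (t + 1 - N + 1).toNat + (-M + 1).toNat with hK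
  rw [h₁ K (by omega), h₂ K (by omega), h₃ K (by omega), map_sum, ← sum_sub_distrib,
    smul_sum, ← sub_eq_zero, ← sum_sub_distrib]
  set f : ℕ → V := fun k => (k : ℂ) • A k (B (t + 1 - k) x) + s • (k : ℂ) • B (t + 1 + k) (A (-k) x)
    with hf
  have key : ∀ k ∈ range K, T (A k (B (t - k) x) + s • B (t + 1 + k) (A (-1 - k) x)) -
      (A k (B (t - k) (T x)) + s • B (t + 1 + k) (A (-1 - k) (T x))) -
      ((t + 1 : ℤ) : ℂ) • (A k (B (t + 1 - k) x) + s • B (t + 1 + 1 + k) (A (-1 - k) x)) =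
      f (k + 1) - f k := by
    intro k _
    have a1 := tA k (B (t - k) x)
    have a2 := congrArg (A k) (tB (t - k) x)
    have a3 := tB (t + 1 + k) (A (-1 - k) x)
    have a4 := congrArg (B (t + 1 + k)) (tA (-1 - k) x)
    rw [show t - (k : ℤ) + 1 = t + 1 - k by ring, map_sub, map_smul] at a2
    rw [show t + 1 + (k : ℤ) + 1 = t + 1 + 1 + k by ring] at a3
    rw [show -1 - (k : ℤ) + 1 = -k by ring, map_sub, map_smul] at a4
    rw [sub_eq_iff_eq_add] at a1 a2 a3 a4
    simp only [map_add, map_smul, a1, a2, a3, a4, hf]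
    rw [show t + 1 - ((k + 1 : ℕ) : ℤ) = t - k by push_cast; ring,
      show t + 1 + ((k + 1 : ℕ) : ℤ) = t + 1 + 1 + k by push_cast; ring,
      show -((k + 1 : ℕ) : ℤ) = -1 - k by push_cast; ring,
      show ((k + 1 : ℕ) : ℤ) = (k : ℤ) + 1 by push_cast; ring]
    push_cast
    module
  rw [sum_congr rfl key, Finset.sum_range_sub, hf]
  simp only [hN (t + 1 - K) (by omega), hM (-K) (by omega)]
  simp

lemma IsNop.comp {A B C : Modes V} {s : ℂ} (h : IsNop A B s C) (D : V →ₗ[ℂ] V)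
    (hD : ∀ n x, A n (D x) = D (A n x)) : IsNop A (fun t => B t ∘ₗ D) s (fun t => C t ∘ₗ D) := by
  intro t x
  simp only [lcomp, h t (D x), hD]

lemma IsNop.parity {A B C : Modes V} {s : ℂ} (h : IsNop A B s C) (hA : Truncated A)
    (hB : Truncated B) (Q : V →ₗ[ℂ] V) (p q : ℂ) (pA : ∀ n x, Q (A n x) = p • A n (Q x))
    (pB : ∀ n x, Q (B n x) = q • B n (Q x)) (n : ℤ) (x : V) : Q (C n x) = (p * q) • C n (Q x) := by
  obtain ⟨K₁, h₁⟩ := h.eq_range hA hB n x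
  obtain ⟨K₂, h₂⟩ := h.eq_range hA hB n (Q x)
  rw [h₁ (K₁ + K₂) (by omega), h₂ (K₁ + K₂) (by omega), map_sum, smul_sum]
  refine sum_congr rfl fun k _ => ?_
  simp only [map_add, map_smul, pA, pB]
  module

lemma IsNop.creates {A B C : Modes V} {s : ℂ} (h : IsNop A B s C) {vac v w : V}
    (cA : Creates A vac v) (cB : Creates B vac w) : Creates C vac (A 0 w) := by
  have h2 : ∀ t : ℤ, ∑ᶠ j : ℕ, B (t + 1 + j) (A (-1 - j) vac) = 0 := fun t => by
    rw [← finsum_zero (α := ℕ)]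
    refine finsum_congr fun j => ?_
    rw [cA.1 _ (by omega), map_zero]
  refine ⟨fun t ht => ?_, ?_⟩
  · rw [h, h2, smul_zero, add_zero, ← finsum_zero (α := ℕ)]
    refine finsum_congr fun j => ?_
    rw [cB.1 _ (by omega), map_zero]
  · rw [h, h2, smul_zero, add_zero, finsum_eq_single _ 0]
    · simp [cB.2]
    · intro j hj
      rw [cB.1 _ (by omega), map_zero]

lemma IsTC.kills_vac {T : V →ₗ[ℂ] V} {A : Modes V} (h : IsTC T A) {vac : V}
    (hT : T vac = 0) (hA : Creates A vac 0) (t : ℤ) : A t vac = 0 := by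
  rcases lt_or_ge t 0 with ht | ht
  · exact hA.1 t ht
  lift t to ℕ using ht
  induction t with
  | zero => exact hA.2
  | succ t ih =>
    have := h t vac
    rw [ih, hT, map_zero, map_zero, sub_zero, eq_comm, smul_eq_zero] at this
    rcases this with h0 | h0
    · norm_cast at h0
    · exact_mod_cast h0

lemma LocalFields.eq_zero {A Y : Modes V} {s : ℂ} (h : LocalFields A Y s) {vac v : V}
    (hA : ∀ t, A t vac = 0) (hY : Creates Y vac v) (t : ℤ) : A t v = 0 := by
  obtain ⟨N, hN⟩ := h
  have := congrFun (congrFun (hN vac) (t + N)) 0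
  rw [zwMul_pow_apply, sum_eq_single 0] at this
  · simpa [hA, hY.2] using this
  · intro j _ hj
    simp only [hA, map_zero, smul_zero, sub_zero]
    rw [hY.1 _ (by omega), map_zero, smul_zero]
  · simp

end Dong

namespace LatticeInput

/-! ## Oscillators on the Fock space -/

variable {N d : ℕ} (I : LatticeInput N d)

@[simp] lemma onBasis_ket (f : State N d → Fock N d) (b : State N d) : onBasis f (ket b) = f b := by
  simp [onBasis, ket]

lemma fock_ext {M : Type*} [AddCommGroup M] [Module ℂ M] {f g : Fock N d →ₗ[ℂ] M}
    (h : ∀ b, f (ket b) = g (ket b)) : f = g :=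
  Finsupp.lhom_ext' fun b => LinearMap.ext_ring (h b)

lemma comp_ext {A B C D : Op N d} (h : ∀ b, A (B (ket b)) = C (D (ket b))) (x : Fock N d) :
    A (B x) = C (D x) :=
  lcongr (f := A ∘ₗ B) (g := C ∘ₗ D) (fock_ext h) x

lemma fock_induction {p : Fock N d → Prop} (x : Fock N d) (h0 : p 0)
    (hadd : ∀ x y, p x → p y → p (x + y)) (hket : ∀ (c : ℂ) b, p (c • ket b)) : p x := by
  induction x using Finsupp.induction_linear with
  | zero => exact h0
  | add x y hx hy => exact hadd x y hx hy
  | single b c => simpa [ket] using hket c b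

lemma diagonal_apply {Q : Op N d} {f : State N d → ℂ} (h : ∀ b, Q (ket b) = f b • ket b)
    (v : Fock N d) (b : State N d) : Q v b = f b * v b := by
  induction v using fock_induction with
  | h0 => simp
  | hadd v w hv hw => rw [map_add, fadd, fadd, hv, hw, mul_add]
  | hket c b' =>
    classical
    rw [map_smul, h, fsmul, fsmul, fsmul, ket, fsingle]
    split_ifs with hb
    · rw [hb]
      exact mul_left_comm _ _ _
    · simp

/-- The modes of the `i`-th boson; `bosMode i n` is the coefficient of `z^n`. -/
def bosMode (i : Fin N) : Modes (Fock N d)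
  | .ofNat k => bosCreate i k
  | .negSucc k => I.bosAnnihilate i k

/-- The modes of the `i`-th fermion; `fermMode i n` is the coefficient of `z^n`. -/
def fermMode (i : Fin N) : Modes (Fock N d)
  | .ofNat k => fermCreate i k
  | .negSucc k => fermAnnihilate i k

lemma bosMode_natCast (i : Fin N) (k : ℕ) : I.bosMode i k = bosCreate i k := rfl

lemma bosMode_neg (i : Fin N) (k : ℕ) : I.bosMode i (-1 - k) = I.bosAnnihilate i k := by
  rw [show -1 - (k : ℤ) = negSucc k by rw [negSucc_eq]; ring]
  rfl

lemma fermMode_natCast (i : Fin N) (k : ℕ) : fermMode (d := d) i k = fermCreate i k := rfl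

lemma fermMode_neg (i : Fin N) (k : ℕ) : fermMode (d := d) i (-1 - k) = fermAnnihilate i k := by
  rw [show -1 - (k : ℤ) = negSucc k by rw [negSucc_eq]; ring]
  rfl

lemma bosCreate_ket (i : Fin N) (k : ℕ) (b : State N d) : bosCreate i k (ket b) =
    ket { b with bos := b.bos + single (toLex (i, k)) 1 } := onBasis_ket _ _

lemma bosAnnihilate_zero_ket (i : Fin N) (b : State N d) :
    I.bosAnnihilate i 0 (ket b) = (I.momentum b.charge i : ℂ) • ket b := onBasis_ket _ _

lemma bosAnnihilate_succ_ket (i : Fin N) (k : ℕ) (b : State N d) :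
    I.bosAnnihilate i (k + 1) (ket b) = (((k + 1) * b.bos (toLex (i, k)) : ℕ) : ℂ) •
      ket { b with bos := b.bos - single (toLex (i, k)) 1 } := onBasis_ket _ _

lemma fermCreate_ket (i : Fin N) (k : ℕ) (b : State N d) : fermCreate i k (ket b) =
    if toLex (i, k) ∈ b.ferm then 0 else
      fermSign b (toLex (i, k)) • ket { b with ferm := insert (toLex (i, k)) b.ferm } :=
  onBasis_ket _ _

lemma fermAnnihilate_ket (i : Fin N) (k : ℕ) (b : State N d) : fermAnnihilate i k (ket b) =
    if toLex (i, k) ∈ b.ferm then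
      fermSign b (toLex (i, k)) • ket { b with ferm := b.ferm.erase (toLex (i, k)) } else 0 :=
  onBasis_ket _ _

lemma bosCreate_comm (i j : Fin N) (k l : ℕ) (x : Fock N d) :
    bosCreate i k (bosCreate j l x) = bosCreate j l (bosCreate i k x) := by
  refine comp_ext (fun b => ?_) x
  simp only [lcomp, bosCreate_ket, add_right_comm]

lemma bosAnnihilate_comm (i j : Fin N) (k l : ℕ) (x : Fock N d) :
    I.bosAnnihilate i k (I.bosAnnihilate j l x) = I.bosAnnihilate j l (I.bosAnnihilate i k x) := by
  refine comp_ext (fun b => ?_) x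
  rcases k with _ | k <;> rcases l with _ | l <;>
    simp only [lcomp, bosAnnihilate_zero_ket, bosAnnihilate_succ_ket, map_smul, smul_smul]
  · rw [mul_comm]
  · rw [mul_comm]
  · rw [mul_comm]
  · by_cases h : (toLex (i, k) : Osc N) = toLex (j, l)
    · grind
    · simp only [Finsupp.coe_tsub, psub, single_eq_of_ne h,
        single_eq_of_ne (Ne.symm h), tsub_zero, tsub_right_comm]
      rw [mul_comm]

lemma bosAnnihilate_bosCreate (i j : Fin N) (k l : ℕ) (x : Fock N d) :
    I.bosAnnihilate i k (bosCreate j l x) = bosCreate j l (I.bosAnnihilate i k x) +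
      (if i = j ∧ k = l + 1 then (k : ℂ) else 0) • x := by
  refine lcongr (f := I.bosAnnihilate i k ∘ₗ bosCreate j l)
    (g := bosCreate j l ∘ₗ I.bosAnnihilate i k + (if i = j ∧ k = l + 1 then (k : ℂ) else 0) • lid) (fock_ext fun b => ?_) x
  rcases k with _ | k
  · simp [bosAnnihilate_zero_ket, bosCreate_ket]
  · simp only [lcomp, ladd, lsmul,
      LinearMap.id_apply, bosCreate_ket, bosAnnihilate_succ_ket, map_smul]
    by_cases h : (toLex (i, k) : Osc N) = toLex (j, l)
    · obtain ⟨rfl, rfl⟩ := Prod.ext_iff.1 (toLex.injective h)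
      simp only [and_self, if_true, fadd, single_eq_same, add_tsub_cancel_right]
      rcases Nat.eq_zero_or_pos (b.bos (toLex (i, k))) with hb | hb
      · simp [hb]
      · rw [tsub_add_cancel_of_le (by simpa using Nat.succ_le_of_lt hb), ← add_smul]
        congr 1
        push_cast
        ring
    · rw [if_neg (by rintro ⟨rfl, h2⟩; exact h (by rw [Nat.succ_injective h2]))]
      simp only [fadd, single_eq_of_ne h, add_zero, zero_smul]
      congr 3
      ext m
      simp only [Finsupp.coe_tsub, Finsupp.coe_add, psub, padd, fsingle]
      split_ifs with h1 h2 <;> first | omega | (exact absurd (h2.trans h1.symm) h)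

lemma bosMode_comm (i j : Fin N) (m n : ℤ) (x : Fock N d) :
    I.bosMode i m (I.bosMode j n x) = I.bosMode j n (I.bosMode i m x) +
      (if i = j ∧ m + n + 2 = 0 then (-(m + 1) : ℂ) else 0) • x := by
  rcases m with k | k <;> rcases n with l | l
  · rw [if_neg (by rintro ⟨-, h⟩; simp only [Int.ofNat_eq_natCast] at h; omega)]
    simpa [bosMode] using bosCreate_comm i j k l x
  · have h := I.bosAnnihilate_bosCreate j i l k x
    change bosCreate i k (I.bosAnnihilate j l x) = I.bosAnnihilate j l (bosCreate i k x) + _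
    rw [h, add_assoc, ← add_smul, eq_comm]
    convert add_zero _ using 2
    rw [smul_eq_zero]
    left
    by_cases hc : j = i ∧ l = k + 1
    · obtain ⟨rfl, rfl⟩ := hc
      rw [if_pos ⟨rfl, rfl⟩, if_pos ⟨rfl, by rw [negSucc_eq]; push_cast; simp only [Int.ofNat_eq_natCast]; ring⟩]
      push_cast
      simp
    · grind
  · change I.bosAnnihilate i k (bosCreate j l x) = bosCreate j l (I.bosAnnihilate i k x) + _
    rw [I.bosAnnihilate_bosCreate]
    congr 2
    have : (negSucc k + Int.ofNat l + 2 = 0) ↔ k = l + 1 := by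
      rw [negSucc_eq]; simp only [Int.ofNat_eq_natCast]; omega
    simp only [this]
    split_ifs with h
    · push_cast
      ring
    · rfl
  · rw [show (if i = j ∧ negSucc k + negSucc l + 2 = 0 then
        (-((negSucc k : ℤ) + 1) : ℂ) else 0) = 0 by
      split_ifs with h
      · have h := h.2
        rw [negSucc_eq, negSucc_eq] at h
        obtain rfl : k = 0 := by omega
        simp
      · rfl]
    simpa [bosMode] using I.bosAnnihilate_comm i j k l x

lemma fermSign_sq (b : State N d) (m : Osc N) : fermSign b m * fermSign b m = 1 := by
  rw [fermSign, ← mul_pow]; simp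

lemma fermSign_insert (b : State N d) {m n : Osc N} (hm : m ∉ b.ferm) :
    fermSign { b with ferm := insert m b.ferm } n = (if m < n then -1 else 1) * fermSign b n := by
  simp only [fermSign, Finset.filter_insert]
  split_ifs
  · grind
  · rw [one_mul]

lemma fermSign_erase (b : State N d) {m n : Osc N} (hm : m ∈ b.ferm) :
    fermSign { b with ferm := b.ferm.erase m } n = (if m < n then -1 else 1) * fermSign b n := by
  have h := fermSign_insert { b with ferm := b.ferm.erase m } (m := m) (n := n) (by simp)
  simp only [insert_erase hm] at h
  rw [show fermSign b n = _ from h, ← mul_assoc]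
  split_ifs <;> simp

lemma fermCreate_anticomm (i j : Fin N) (k l : ℕ) (x : Fock N d) :
    fermCreate i k (fermCreate j l x) = -fermCreate j l (fermCreate i k x) := by
  refine lcongr (f := fermCreate i k ∘ₗ fermCreate j l)
    (g := -(fermCreate j l ∘ₗ fermCreate (d := d) i k)) (fock_ext fun b => ?_) x
  simp only [lcomp, LinearMap.neg_apply, fermCreate_ket]
  by_cases hm : toLex (i, k) ∈ b.ferm <;> by_cases hn : toLex (j, l) ∈ b.ferm <;>
    simp only [hm, hn, if_true, if_false, map_zero, map_smul, fermCreate_ket,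
      Finset.mem_insert, or_true, or_false, smul_zero, neg_zero]
  generalize (toLex (i, k) : Osc N) = m at *
  generalize (toLex (j, l) : Osc N) = n at *
  by_cases hmn : m = n
  · simp [hmn]
  · rw [if_neg hmn, if_neg (Ne.symm hmn), fermSign_insert b hm, fermSign_insert b hn, smul_smul,
      smul_smul, Finset.insert_comm, ← neg_smul]
    congr 1
    rcases lt_or_gt_of_ne hmn with h | h <;> simp [h, h.not_gt] <;> ring

lemma fermAnnihilate_anticomm (i j : Fin N) (k l : ℕ) (x : Fock N d) :
    fermAnnihilate i k (fermAnnihilate j l x) = -fermAnnihilate j l (fermAnnihilate i k x) := by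
  refine lcongr (f := fermAnnihilate i k ∘ₗ fermAnnihilate j l)
    (g := -(fermAnnihilate j l ∘ₗ fermAnnihilate (d := d) i k)) (fock_ext fun b => ?_) x
  simp only [lcomp, LinearMap.neg_apply, fermAnnihilate_ket]
  by_cases hm : toLex (i, k) ∈ b.ferm <;> by_cases hn : toLex (j, l) ∈ b.ferm <;>
    simp only [hm, hn, if_true, if_false, map_zero, map_smul, fermAnnihilate_ket,
      Finset.mem_erase, and_false, and_true, smul_zero, neg_zero]
  generalize (toLex (i, k) : Osc N) = m at *
  generalize (toLex (j, l) : Osc N) = n at *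
  by_cases hmn : m = n
  · simp [hmn]
  · rw [if_pos hmn, if_pos (Ne.symm hmn), fermSign_erase b hm, fermSign_erase b hn, smul_smul,
      smul_smul, Finset.erase_right_comm, ← neg_smul]
    congr 1
    rcases lt_or_gt_of_ne hmn with h | h <;> simp [h, h.not_gt] <;> ring

lemma fermAnnihilate_fermCreate (i j : Fin N) (k l : ℕ) (x : Fock N d) :
    fermAnnihilate i k (fermCreate j l x) = -fermCreate j l (fermAnnihilate i k x) +
      (if i = j ∧ k = l then (1 : ℂ) else 0) • x := by
  refine lcongr (f := fermAnnihilate i k ∘ₗ fermCreate j l)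
    (g := -(fermCreate j l ∘ₗ fermAnnihilate (d := d) i k) + (if i = j ∧ k = l then (1 : ℂ) else 0) • lid) (fock_ext fun b => ?_) x
  have hiff : (i = j ∧ k = l) ↔ (toLex (i, k) : Osc N) = toLex (j, l) := by simp [Prod.ext_iff]
  simp only [lcomp, LinearMap.neg_apply, ladd, lsmul,
    LinearMap.id_apply, fermAnnihilate_ket, fermCreate_ket, hiff]
  by_cases hm : toLex (i, k) ∈ b.ferm <;> by_cases hn : toLex (j, l) ∈ b.ferm <;>
    simp only [hm, hn, if_true, if_false, map_zero, map_smul, fermAnnihilate_ket, fermCreate_ket,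
      Finset.mem_erase, Finset.mem_insert, and_false, and_true, or_true, or_false, smul_zero,
      neg_zero, zero_add] <;>
  generalize (toLex (i, k) : Osc N) = m at * <;>
  generalize (toLex (j, l) : Osc N) = n at * <;>
  by_cases hmn : m = n
  · subst hmn
    simp only [ne_eq, not_true_eq_false, if_false, if_true, one_smul]
    rw [fermSign_erase b hm, insert_erase hm, smul_smul]
    simp [fermSign_sq]
  · simp [hmn, Ne.symm hmn]
  · exact absurd (hmn ▸ hm) hn
  · have hnm : n ≠ m := Ne.symm hmn
    simp only [hmn, if_false, zero_smul, add_zero]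
    rw [fermSign_insert b hn, fermSign_erase b hm, smul_smul, smul_smul,
      Finset.erase_insert_of_ne hnm, ← neg_smul]
    congr 1
    rcases lt_or_gt_of_ne hmn with h | h <;> simp [h, h.not_gt] <;> ring
  · exact absurd (hmn ▸ hn) hm
  · simp [hmn]
  · subst hmn
    simp only [if_true, one_smul]
    rw [fermSign_insert b hm, Finset.erase_insert hm, smul_smul]
    simp [fermSign_sq]
  · simp [hmn]

lemma fermMode_anticomm (i j : Fin N) (m n : ℤ) (x : Fock N d) :
    fermMode i m (fermMode j n x) = -fermMode j n (fermMode i m x) +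
      (if i = j ∧ m + n + 1 = 0 then (1 : ℂ) else 0) • x := by
  rcases m with k | k <;> rcases n with l | l
  · rw [if_neg (by rintro ⟨-, h⟩; simp only [Int.ofNat_eq_natCast] at h; omega)]
    simpa [fermMode] using fermCreate_anticomm i j k l x
  · have h := fermAnnihilate_fermCreate j i l k x
    change fermCreate i k (fermAnnihilate j l x) = -fermAnnihilate j l (fermCreate i k x) + _
    have : (i = j ∧ Int.ofNat k + negSucc l + 1 = 0) ↔ (j = i ∧ l = k) := by grind
    rw [h]
    simp only [this]
    module
  · change fermAnnihilate i k (fermCreate j l x) = -fermCreate j l (fermAnnihilate i k x) + _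
    have : (i = j ∧ negSucc k + Int.ofNat l + 1 = 0) ↔ (i = j ∧ k = l) := by grind
    rw [fermAnnihilate_fermCreate]
    simp only [this]
  · rw [if_neg (by rintro ⟨-, h⟩; rw [negSucc_eq, negSucc_eq] at h; omega)]
    simpa [fermMode] using fermAnnihilate_anticomm i j k l x

lemma bosMode_fermMode_comm (i j : Fin N) (m n : ℤ) (x : Fock N d) :
    I.bosMode i m (fermMode j n x) = fermMode j n (I.bosMode i m x) := by
  have key : ∃ (c : (Osc N →₀ ℕ) → Charge d → ℂ) (u : (Osc N →₀ ℕ) → (Osc N →₀ ℕ)),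
      ∀ b : State N d, I.bosMode i m (ket b) = c b.bos b.charge • ket { b with bos := u b.bos } := by
    rcases m with k | _ | k
    · exact ⟨fun _ _ => 1, fun B => B + single (toLex (i, k)) 1, fun b => by
        rw [one_smul]; exact bosCreate_ket i k b⟩
    · exact ⟨fun _ q => I.momentum q i, fun B => B, fun b => I.bosAnnihilate_zero_ket i b⟩
    · exact ⟨fun B _ => ((k + 1) * B (toLex (i, k)) : ℕ), fun B => B - single (toLex (i, k)) 1,
        fun b => I.bosAnnihilate_succ_ket i k b⟩
  obtain ⟨c, u, h⟩ := key
  refine comp_ext (fun b => ?_) x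
  rcases n with l | l
  · simp only [fermMode, lcomp, h, map_smul, fermCreate_ket]
    split_ifs
    · simp
    · rw [map_smul, h, smul_comm]
      rfl
  · simp only [fermMode, lcomp, h, map_smul, fermAnnihilate_ket]
    split_ifs
    · rw [map_smul, h, smul_comm]
      rfl
    · simp

/-! ## Rigidity -/

/-- The state without oscillators. -/
def bare (k : Charge d) : State N d := { bos := 0, ferm := ∅, charge := k }

lemma bosAnnihilate_succ_coeff (i : Fin N) (k : ℕ) (x : Fock N d)
    (b : State N d) : I.bosAnnihilate i (k + 1) x b = ((k : ℂ) + 1) * (b.bos (toLex (i, k)) + 1) *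
      x { b with bos := b.bos + single (toLex (i, k)) 1 } := by
  classical
  induction x using fock_induction with
  | h0 => simp
  | hadd x y hx hy => rw [map_add, fadd, fadd, hx, hy]; ring
  | hket c b' =>
    rw [map_smul, bosAnnihilate_succ_ket, fsmul, fsmul, fsmul]
    simp only [ket, fsingle, smul_eq_mul]
    by_cases h : b' = { b with bos := b.bos + single (toLex (i, k)) 1 }
    · subst h
      simp
      ring
    · rw [if_neg h]
      split_ifs with h2
      · have : b'.bos (toLex (i, k)) = 0 := by
          by_contra h0
          apply h
          rw [← h2]
          ext1
          · simp only
            rw [tsub_add_cancel_of_le]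
            simpa using Nat.one_le_iff_ne_zero.2 h0
          · rfl
          · rfl
        simp [this]
      · simp

lemma fermAnnihilate_coeff (i : Fin N) (k : ℕ) (x : Fock N d)
    (b : State N d) : fermAnnihilate i k x b = if toLex (i, k) ∈ b.ferm then 0 else
      fermSign b (toLex (i, k)) * x { b with ferm := insert (toLex (i, k)) b.ferm } := by
  classical
  induction x using fock_induction with
  | h0 => simp
  | hadd x y hx hy =>
    rw [map_add, fadd, fadd, hx, hy]
    split_ifs <;> ring
  | hket c b' =>
    rw [map_smul, fermAnnihilate_ket, fsmul, fsmul]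
    generalize (toLex (i, k) : Osc N) = m
    by_cases hm : m ∈ b.ferm
    · rw [if_pos hm]
      split_ifs
      · have : ({ b' with ferm := b'.ferm.erase m } : State N d) ≠ b := by
          rintro rfl
          simp at hm
        simp [ket, fsingle, this]
      · simp
    · rw [if_neg hm]
      by_cases h : b' = { b with ferm := insert m b.ferm }
      · subst h
        simp only [Finset.mem_insert_self, if_true, Finset.erase_insert hm]
        rw [fermSign_insert b hm]
        simp [ket]
        ring
      · have h3 : (if m ∈ b'.ferm then
            fermSign b' m • ket { b' with ferm := b'.ferm.erase m } else 0) b = (0 : ℂ) := by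
          split_ifs with h2
          · have : ({ b' with ferm := b'.ferm.erase m } : State N d) ≠ b := by
              rintro rfl
              apply h
              simp [insert_erase h2]
            simp [ket, fsingle, this]
          · rfl
        rw [h3]
        simp [ket, fsingle, h]

/-- The number of oscillators. -/
def oscCount (b : State N d) : ℕ := b.bos.degree + b.ferm.card

lemma eq_zero_of_annihilators (W : Submodule ℂ (Fock N d))
    (h1 : ∀ w ∈ W, ∀ i k, I.bosAnnihilate i (k + 1) w ∈ W)
    (h2 : ∀ w ∈ W, ∀ i k, fermAnnihilate i k w ∈ W) (h3 : ∀ w ∈ W, ∀ k, w (bare k) = 0)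
    {w : Fock N d} (hw : w ∈ W) : w = 0 := by
  suffices h : ∀ n : ℕ, ∀ b : State N d, oscCount b = n → ∀ w ∈ W, w b = 0 by
    ext b
    exact h _ b rfl w hw
  intro n
  induction n with
  | zero =>
    intro b hb w hw
    rw [oscCount, Nat.add_eq_zero_iff, Finsupp.degree_eq_zero_iff, Finset.card_eq_zero] at hb
    obtain ⟨B, F, k⟩ := b
    simp only at hb
    obtain ⟨rfl, rfl⟩ := hb
    exact h3 w hw k
  | succ n ih =>
    intro b hb w hw
    by_cases h0 : b.ferm = ∅
    · have hne : b.bos ≠ 0 := by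
        intro h
        simp [oscCount, h, h0] at hb
      obtain ⟨m, hm⟩ := Finsupp.ne_iff.1 hne
      have hm : 1 ≤ b.bos m := Nat.one_le_iff_ne_zero.2 hm
      have hle : single m 1 ≤ b.bos := by simpa using hm
      have key := I.bosAnnihilate_succ_coeff m.idx m.lvl w
        { b with bos := b.bos - single m 1 }
      have e : (toLex (m.idx, m.lvl) : Osc N) = m := rfl
      rw [e] at key
      simp only [tsub_add_cancel_of_le hle] at key
      rw [ih { b with bos := b.bos - single m 1 } _ _ (h1 w hw _ _), eq_comm, mul_eq_zero] at key
      · rcases key with h | h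
        · exact absurd h (mul_ne_zero (Nat.cast_add_one_ne_zero _) (Nat.cast_add_one_ne_zero _))
        · exact h
      · have : b.bos.degree = (b.bos - single m 1).degree + 1 := by
          conv_lhs => rw [← tsub_add_cancel_of_le hle, map_add, Finsupp.degree_single]
        simp only [oscCount] at hb ⊢
        omega
    · obtain ⟨m, hm⟩ := Finset.nonempty_iff_ne_empty.2 h0
      have key := fermAnnihilate_coeff m.idx m.lvl w { b with ferm := b.ferm.erase m }
      have e : (toLex (m.idx, m.lvl) : Osc N) = m := rfl
      rw [e, if_neg (by simp)] at key
      simp only [insert_erase hm] at key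
      rw [ih { b with ferm := b.ferm.erase m } _ _ (h2 w hw _ _), eq_comm, mul_eq_zero] at key
      · rcases key with h | h
        · have := fermSign_sq { b with ferm := b.ferm.erase m } m
          rw [h] at this
          simp at this
        · exact h
      · grind [oscCount]

lemma eq_top_of_creators (P : Submodule ℂ (Fock N d)) (h0 : ∀ k, ket (bare k) ∈ P)
    (h1 : ∀ w ∈ P, ∀ i k, bosCreate i k w ∈ P) (h2 : ∀ w ∈ P, ∀ i k, fermCreate i k w ∈ P)
    (x : Fock N d) : x ∈ P := by
  suffices h : ∀ n : ℕ, ∀ b : State N d, oscCount b = n → ket b ∈ P by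
    induction x using fock_induction with
    | h0 => exact P.zero_mem
    | hadd x y hx hy => exact P.add_mem hx hy
    | hket c b => exact P.smul_mem _ (h _ b rfl)
  intro n
  induction n with
  | zero =>
    intro b hb
    rw [oscCount, Nat.add_eq_zero_iff, Finsupp.degree_eq_zero_iff, Finset.card_eq_zero] at hb
    obtain ⟨B, F, k⟩ := b
    simp only at hb
    obtain ⟨rfl, rfl⟩ := hb
    exact h0 k
  | succ n ih =>
    intro b hb
    by_cases h0 : b.ferm = ∅
    · have hne : b.bos ≠ 0 := by
        intro h
        simp [oscCount, h, h0] at hb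
      obtain ⟨m, hm⟩ := Finsupp.ne_iff.1 hne
      have hm : 1 ≤ b.bos m := Nat.one_le_iff_ne_zero.2 hm
      have hle : single m 1 ≤ b.bos := by simpa using hm
      have key := h1 _ (ih { b with bos := b.bos - single m 1 } (by
        have : b.bos.degree = (b.bos - single m 1).degree + 1 := by
          conv_lhs => rw [← tsub_add_cancel_of_le hle, map_add, Finsupp.degree_single]
        simp only [oscCount] at hb ⊢
        omega)) m.idx m.lvl
      rw [bosCreate_ket] at key
      have e : (toLex (m.idx, m.lvl) : Osc N) = m := rfl
      simpa only [e, tsub_add_cancel_of_le hle] using key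
    · obtain ⟨m, hm⟩ := Finset.nonempty_iff_ne_empty.2 h0
      have key := h2 _ (ih { b with ferm := b.ferm.erase m } (by
        have := Finset.card_erase_add_one hm
        simp only [oscCount] at hb ⊢
        omega)) m.idx m.lvl
      have e : (toLex (m.idx, m.lvl) : Osc N) = m := rfl
      rw [fermCreate_ket, e, if_neg (by simp)] at key
      simp only [insert_erase hm] at key
      have := P.smul_mem (fermSign { b with ferm := b.ferm.erase m } m) key
      rwa [smul_smul, fermSign_sq, one_smul] at this

lemma bosAnnihilate_succ_bare (i : Fin N) (n : ℕ) (k : Charge d) :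
    I.bosAnnihilate i (n + 1) (ket (bare k)) = 0 := by
  rw [bosAnnihilate_succ_ket]
  simp [bare]

lemma fermAnnihilate_bare (i : Fin N) (n : ℕ) (k : Charge d) :
    fermAnnihilate i n (ket (bare k)) = 0 := by
  rw [fermAnnihilate_ket]
  simp [bare]

lemma family_eq_zero {ι : Type*} (X : ι → Op N d) (hb : ∀ a i (n : ℤ), n ≠ -1 →
      I.bosMode i n ∘ₗ X a - X a ∘ₗ I.bosMode i n ∈ span ℂ (Set.range X))
    (hf : ∀ a i (n : ℤ), ∃ s : ℂ, s ≠ 0 ∧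
      fermMode i n ∘ₗ X a - s • X a ∘ₗ fermMode i n ∈ span ℂ (Set.range X))
    (h0 : ∀ a k k', X a (ket (bare k)) (bare k') = 0) (a : ι) : X a = 0 := by
  have step1 : ∀ a k, X a (ket (bare k)) = 0 := by
    have hspan : ∀ f ∈ span ℂ (Set.range X), ∀ k, f (ket (bare k)) ∈
        span ℂ (Set.range fun p : ι × (Charge d) => X p.1 (ket (bare p.2))) := by
      intro f hf k
      induction hf using span_induction with
      | mem f h =>
        obtain ⟨a, rfl⟩ := h
        exact subset_span ⟨(a, k), rfl⟩
      | zero => exact szero _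
      | add f g _ _ hf hg => exact add_mem hf hg
      | smul c f _ hf => exact smul_mem _ c hf
    intro a k
    refine I.eq_zero_of_annihilators (span ℂ (Set.range fun p : ι × (Charge d) =>
      X p.1 (ket (bare p.2)))) ?_ ?_ ?_ (subset_span ⟨(a, k), rfl⟩)
    · intro w hw i n
      induction hw using span_induction with
      | mem w h =>
        obtain ⟨⟨a, k⟩, rfl⟩ := h
        have key := hspan _ (hb a i (-1 - (n + 1 : ℕ)) (by omega)) k
        rwa [bosMode_neg, lsub, lcomp, lcomp, bosAnnihilate_succ_bare, map_zero, sub_zero] at key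
      | zero => rw [map_zero]; exact szero _
      | add f g _ _ hf hg => rw [map_add]; exact add_mem hf hg
      | smul c f _ hf => rw [map_smul]; exact smul_mem _ c hf
    · intro w hw i n
      induction hw using span_induction with
      | mem w h =>
        obtain ⟨⟨a, k⟩, rfl⟩ := h
        obtain ⟨s, -, hs⟩ := hf a i (-1 - n)
        have key := hspan _ hs k
        rwa [fermMode_neg, lsub, lsmul, lcomp,
          lcomp, fermAnnihilate_bare, map_zero, smul_zero, sub_zero] at key
      | zero => rw [map_zero]; exact szero _
      | add f g _ _ hf hg => rw [map_add]; exact add_mem hf hg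
      | smul c f _ hf => rw [map_smul]; exact smul_mem _ c hf
    · intro w hw k'
      induction hw using span_induction with
      | mem w h =>
        obtain ⟨⟨a, k⟩, rfl⟩ := h
        exact h0 a k k'
      | zero => rfl
      | add f g _ _ hf hg => rw [fadd, hf, hg, add_zero]
      | smul c f _ hf => rw [fsmul, hf, smul_zero]
  have hspan : ∀ f ∈ span ℂ (Set.range X), ∀ x, (∀ a, X a x = 0) → f x = 0 := by
    intro f hf x hx
    induction hf using span_induction with
    | mem f h =>
      obtain ⟨a, rfl⟩ := h
      exact hx a
    | zero => rfl
    | add f g _ _ hf hg => rw [ladd, hf, hg, add_zero]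
    | smul c f _ hf => rw [lsmul, hf, smul_zero]
  refine lext fun x => ?_
  have := eq_top_of_creators (⨅ a, ker (X a)) (fun k => by
      simp_all []) ?_ ?_ x
  · simp only [mem_iInf, mem_ker] at this
    exact this a
  · intro w hw i n
    simp only [mem_iInf, mem_ker] at hw ⊢
    intro a
    have key := hspan _ (hb a i n (by omega)) w hw
    rw [bosMode_natCast, lsub, lcomp, lcomp, hw, map_zero, zero_sub, neg_eq_zero] at key
    exact key
  · intro w hw i n
    simp only [mem_iInf, mem_ker] at hw ⊢
    intro a
    obtain ⟨s, hs0, hs⟩ := hf a i n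
    have key := hspan _ hs w hw
    rw [fermMode_natCast, lsub, lsmul, lcomp,
      lcomp, hw, map_zero, zero_sub, neg_eq_zero, smul_eq_zero] at key
    exact key.resolve_left hs0

end LatticeInput

namespace LatticeInput

/-! ## Commutators of the vertex operators with the oscillators -/

variable {N d : ℕ} (I : LatticeInput N d)

lemma expo_add (r : Bool) (s t : ℝ) : expo r (s + t) = expo r s + expo r t := by
  cases r <;> simp [expo]

lemma expo_zero (r : Bool) : expo r 0 = 0 := by cases r <;> simp [expo]

lemma expo_neg (r : Bool) (s : ℝ) : expo r (-s) = -expo r s := by cases r <;> simp [expo]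

lemma expo_total (r : Bool) (s : ℝ) : (expo r s).1 + (expo r s).2 = s := by cases r <;> simp [expo]

/-- The weight of a multiset of bosonic oscillators. -/
def oscWt (M : Osc N →₀ ℕ) : ℕ := M.sum fun m r => r * (m.lvl + 1)

lemma oscWt_add (M M' : Osc N →₀ ℕ) : oscWt (M + M') = oscWt M + oscWt M' :=
  Finsupp.sum_add_index' (by simp) (by intros; ring)

lemma oscWt_single (m : Osc N) (r : ℕ) : oscWt (single m r) = r * (m.lvl + 1) :=
  Finsupp.sum_single_index (by simp)

lemma oscExponent_add (M M' : Osc N →₀ ℕ) :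
    I.oscExponent (M + M') = I.oscExponent M + I.oscExponent M' :=
  Finsupp.sum_add_index' (by simp [expo_zero]) (by
    intros
    rw [← expo_add]
    push_cast
    ring_nf)

lemma oscExponent_single (m : Osc N) :
    I.oscExponent (single m 1) = expo (I.isRight m.idx) (m.lvl + 1) := by
  rw [oscExponent, Finsupp.sum_single_index (by simp [expo_zero])]
  simp

lemma oscExponent_total (M : Osc N →₀ ℕ) : (I.oscExponent M).1 + (I.oscExponent M).2 = oscWt M := by
  simp only [oscExponent, oscWt, Finsupp.sum, fst_sum, snd_sum]
  rw [← sum_add_distrib, Nat.cast_sum]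
  refine sum_congr rfl fun m _ => ?_
  rw [expo_total]
  push_cast
  ring

lemma le_oscWt (M : Osc N →₀ ℕ) (m : Osc N) : M m * (m.lvl + 1) ≤ oscWt M := by
  by_cases h : m ∈ M.support
  · exact single_le_sum (f := fun m => M m * (m.lvl + 1)) (fun _ _ => Nat.zero_le _) h
  · rw [Finsupp.notMem_support_iff.1 h]
    simp

lemma finite_oscWt_le (W : ℕ) : {M : Osc N →₀ ℕ | oscWt M ≤ W}.Finite := by
  refine (Set.finite_Iic (∑ i : Fin N, ∑ k ∈ range (W + 1),
    single (toLex (i, k) : Osc N) W)).subset fun M hM => ?_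
  intro (m : Osc N)
  have h := (le_oscWt M m).trans hM
  rcases Nat.eq_zero_or_pos (M m) with h0 | h0
  · rw [h0]
    exact Nat.zero_le _
  · have h1 : m.lvl < W + 1 := by nlinarith
    have h2 : M m ≤ W := by nlinarith
    refine h2.trans ?_
    rw [finsetSum_apply]
    refine le_trans ?_ (single_le_sum (fun _ _ => Nat.zero_le _) (mem_univ m.idx))
    rw [finsetSum_apply]
    refine le_trans ?_ (single_le_sum (fun _ _ => Nat.zero_le _) (Finset.mem_range.2 h1))
    have e : (toLex (m.idx, m.lvl) : Osc N) = m := rfl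
    rw [e, single_eq_same]

/-- The multisets of oscillators of weight at most `W`. -/
def oscBounded (N W : ℕ) : Finset (Osc N →₀ ℕ) := (finite_oscWt_le W).toFinset

lemma mem_oscBounded {W : ℕ} {M : Osc N →₀ ℕ} : M ∈ oscBounded N W ↔ oscWt M ≤ W := by
  simp [oscBounded]

/-- The coefficients of the creation exponential. -/
def creCoef (l : Charge d) (M : Osc N →₀ ℕ) : ℂ :=
  M.prod fun m r => ((I.momentum l m.idx : ℂ) / (m.lvl + 1)) ^ r / (r.factorial : ℂ)

/-- The coefficients of the annihilation exponential. -/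
def annCoef (l : Charge d) (B J : Osc N →₀ ℕ) : ℂ :=
  J.prod fun m r => ((B m).choose r : ℂ) * (-(I.momentum l m.idx : ℂ)) ^ r

lemma creCoef_add_single (l : Charge d) (M : Osc N →₀ ℕ) (m : Osc N) :
    I.creCoef l (M + single m 1) * ((m.lvl + 1) * (M m + 1)) =
      I.momentum l m.idx * I.creCoef l M := by
  have h1 := Finsupp.mul_prod_erase' (M + single m 1) m (fun m r =>
    ((I.momentum l m.idx : ℂ) / (m.lvl + 1)) ^ r / (r.factorial : ℂ)) (by simp)
  have h2 := Finsupp.mul_prod_erase' M m (fun m r =>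
    ((I.momentum l m.idx : ℂ) / (m.lvl + 1)) ^ r / (r.factorial : ℂ)) (by simp)
  have e : (M + single m 1).erase m = M.erase m := by
    rw [Finsupp.erase_add, Finsupp.erase_single, add_zero]
  rw [creCoef, creCoef, ← h1, ← h2, e]
  simp only [fadd, single_eq_same, Nat.factorial_succ]
  have h3 : ((m.lvl : ℂ) + 1) ≠ 0 := mod_cast Nat.succ_ne_zero m.lvl
  have h4 : ((M m : ℂ) + 1) ≠ 0 := mod_cast Nat.succ_ne_zero (M m)
  have h5 : ((M m).factorial : ℂ) ≠ 0 := mod_cast Nat.factorial_ne_zero _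
  rw [pow_succ]
  push_cast
  generalize ((I.momentum l m.idx : ℂ) / (m.lvl + 1)) ^ M m = Q
  generalize (M.erase m).prod (fun m r =>
    ((I.momentum l m.idx : ℂ) / (m.lvl + 1)) ^ r / (r.factorial : ℂ)) = P
  field_simp

lemma annCoef_eq_zero (l : Charge d) {B J : Osc N →₀ ℕ} (h : ¬J ≤ B) : I.annCoef l B J = 0 := by
  obtain ⟨m, hm⟩ := not_forall.1 h
  rw [annCoef, Finsupp.prod]
  refine Finset.prod_eq_zero (i := m) (by simp; omega) ?_
  rw [Nat.choose_eq_zero_of_lt (by omega)]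
  simp

lemma annCoef_erase (l : Charge d) (B J : Osc N →₀ ℕ) (m : Osc N) :
    I.annCoef l B J = (((B m).choose (J m) : ℂ) * (-(I.momentum l m.idx : ℂ)) ^ (J m)) *
      I.annCoef l B (J.erase m) :=
  (Finsupp.mul_prod_erase' J m (fun m r => ((B m).choose r : ℂ) *
    (-(I.momentum l m.idx : ℂ)) ^ r) (by simp)).symm

lemma annCoef_congr (l : Charge d) {B B' : Osc N →₀ ℕ} (J : Osc N →₀ ℕ)
    (m : Osc N) (h : ∀ n ≠ m, B n = B' n) :
    I.annCoef l B (J.erase m) = I.annCoef l B' (J.erase m) := by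
  refine Finset.prod_congr rfl fun n hn => ?_
  simp only
  rw [h n (by rintro rfl; simp at hn)]

lemma sum_annCoef_add_single (l : Charge d) {V : Type*}
    [AddCommGroup V] [Module ℂ V] (B : Osc N →₀ ℕ) (m : Osc N) (G : (Osc N →₀ ℕ) → V) :
    ∑ J ∈ Finset.Iic (B + single m 1), I.annCoef l (B + single m 1) J • G J =
      ∑ J ∈ Finset.Iic B, I.annCoef l B J • G J - (I.momentum l m.idx : ℂ) •
        ∑ J ∈ Finset.Iic B, I.annCoef l B J • G (J + single m 1) := by
  have e1 : ∑ J ∈ Finset.Iic B, I.annCoef l B J • G J =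
      ∑ J ∈ Finset.Iic (B + single m 1), I.annCoef l B J • G J := by
    refine Finset.sum_subset (Finset.Iic_subset_Iic.2 le_self_add) fun J _ hJ => ?_
    rw [I.annCoef_eq_zero l (by simpa using hJ), zero_smul]
  have hoff : ∀ n ≠ m, (B + single m 1 : Osc N →₀ ℕ) n = B n := fun n hn => by
    simp [single_eq_of_ne hn]
  rw [e1, eq_sub_iff_add_eq, ← eq_sub_iff_add_eq', ← sum_sub_distrib, smul_sum,
    ← neg_inj, ← sum_neg_distrib, ← sum_neg_distrib]
  refine Finset.sum_of_injOn (fun J => J + single m 1) (add_left_injective _).injOn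
    ?_ ?_ ?_
  · intro J hJ
    simpa using hJ
  · intro J hJ hJ'
    have h0 : J m = 0 := by
      by_contra h0
      apply hJ'
      refine ⟨J - single m 1, ?_, ?_⟩
      · simp_all []
      · exact tsub_add_cancel_of_le (by simpa using Nat.one_le_iff_ne_zero.2 h0)
    rw [I.annCoef_erase l (B + single m 1) J m, I.annCoef_erase l B J m,
      I.annCoef_congr l J m hoff, h0]
    simp
  · intro J _
    have e2 : (J + single m 1).erase m = J.erase m := by
      rw [Finsupp.erase_add, Finsupp.erase_single, add_zero]
    rw [I.annCoef_erase l (B + single m 1) (J + single m 1) m,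
      I.annCoef_erase l B (J + single m 1) m, I.annCoef_erase l B J m, e2,
      I.annCoef_congr l J m hoff, smul_smul, ← sub_smul, ← neg_smul, ← neg_smul]
    congr 1
    simp only [fadd, single_eq_same, Nat.choose_succ_succ]
    push_cast
    ring

lemma annCoef_sub_single (l : Charge d) (B J : Osc N →₀ ℕ)
    (m : Osc N) : ((B m - J m : ℕ) : ℂ) * I.annCoef l B J =
      (B m : ℂ) * I.annCoef l (B - single m 1) J := by
  have hoff : ∀ n ≠ m, (B - single m 1 : Osc N →₀ ℕ) n = B n := fun n hn => by
    simp [single_eq_of_ne hn]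
  rw [I.annCoef_erase l B J m, I.annCoef_erase l (B - single m 1) J m, I.annCoef_congr l J m hoff]
  have : (B m - J m) * (B m).choose (J m) = B m * (B m - 1).choose (J m) := by
    rcases Nat.eq_zero_or_pos (B m) with h0 | h0
    · simp [h0]
    · obtain ⟨c, hc⟩ := Nat.exists_eq_succ_of_ne_zero h0.ne'
      rw [hc, Nat.succ_sub_one, mul_comm, ← Nat.choose_mul_succ_eq, mul_comm]
  simp only [Finsupp.tsub_apply, single_eq_same]
  have h2 : ((B m - J m : ℕ) : ℂ) * ((B m).choose (J m) : ℂ) = B m * ((B m - 1).choose (J m) : ℂ) := by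
    exact_mod_cast this
  linear_combination ((-(I.momentum l m.idx : ℂ)) ^ (J m) * I.annCoef l B (J.erase m)) * h2

/-- The modes of the creation exponential. -/
def cre (l : Charge d) (y : ℝ × ℝ) : Op N d :=
  onBasis fun b => ∑ M ∈ oscBounded N ⌊y.1 + y.2⌋₊, if y = I.oscExponent M then
    I.creCoef l M • ket { b with bos := b.bos + M } else 0

lemma cre_ket (l : Charge d) (y : ℝ × ℝ) (b : State N d) (W : ℕ)
    (hW : y.1 + y.2 ≤ W) : I.cre l y (ket b) = ∑ M ∈ oscBounded N W, if y = I.oscExponent M then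
      I.creCoef l M • ket { b with bos := b.bos + M } else 0 := by
  rw [cre, onBasis_ket]
  refine Finset.sum_subset (fun M hM => ?_) fun M _ hM => ?_
  · rw [mem_oscBounded] at hM ⊢
    exact hM.trans (Nat.floor_le_of_le hW)
  · rw [if_neg]
    rintro rfl
    apply hM
    rw [mem_oscBounded, oscExponent_total, Nat.floor_natCast]

lemma cre_bosCreate (l : Charge d) (y : ℝ × ℝ) (i : Fin N) (k : ℕ)
    (x : Fock N d) : I.cre l y (bosCreate i k x) = bosCreate i k (I.cre l y x) := by
  refine comp_ext (fun b => ?_) x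
  simp only [lcomp, bosCreate_ket, cre, onBasis_ket, map_sum]
  refine sum_congr rfl fun M _ => ?_
  split_ifs
  · rw [map_smul, bosCreate_ket]
    simp only [add_right_comm]
  · rw [map_zero]

lemma bosAnnihilate_zero_cre (l : Charge d) (y : ℝ × ℝ) (i : Fin N)
    (x : Fock N d) : I.bosAnnihilate i 0 (I.cre l y x) = I.cre l y (I.bosAnnihilate i 0 x) := by
  refine comp_ext (fun b => ?_) x
  simp only [lcomp, bosAnnihilate_zero_ket, map_smul, cre, onBasis_ket, map_sum, smul_sum]
  refine sum_congr rfl fun M _ => ?_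
  split_ifs
  · rw [map_smul, bosAnnihilate_zero_ket, smul_comm]
  · rw [map_zero, smul_zero]

lemma bosAnnihilate_succ_cre (l : Charge d) (y : ℝ × ℝ) (i : Fin N)
    (k : ℕ) (x : Fock N d) : I.bosAnnihilate i (k + 1) (I.cre l y x) =
      I.cre l y (I.bosAnnihilate i (k + 1) x) +
      (I.momentum l i : ℂ) • I.cre l (y - expo (I.isRight i) (k + 1)) x := by
  refine lcongr (f := I.bosAnnihilate i (k + 1) ∘ₗ I.cre l y)
    (g := I.cre l y ∘ₗ I.bosAnnihilate i (k + 1) + (I.momentum l i : ℂ) • I.cre l (y - expo (I.isRight i) (k + 1))) (fock_ext fun b => ?_) x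
  set m : Osc N := toLex (i, k) with hm
  obtain ⟨W, hW⟩ := exists_nat_ge (y.1 + y.2)
  have hW' : (y - expo (I.isRight i) (k + 1)).1 + (y - expo (I.isRight i) (k + 1)).2 ≤ (W : ℝ) := by
    have := expo_total (I.isRight i) (k + 1)
    simp only [fst_sub, snd_sub]
    have : (0 : ℝ) ≤ k := Nat.cast_nonneg k
    linarith
  have hW2 : y.1 + y.2 ≤ ((W + (k + 1) : ℕ) : ℝ) := by grind
  simp only [lcomp, ladd, lsmul]
  rw [bosAnnihilate_succ_ket, map_smul, I.cre_ket l y _ _ hW2, I.cre_ket l y _ _ hW2,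
    I.cre_ket l _ _ _ hW', map_sum, ← sub_eq_iff_eq_add', smul_sum, smul_sum,
    ← sum_sub_distrib, eq_comm]
  refine Finset.sum_of_injOn (fun M => M + single m 1) (add_left_injective _).injOn
    ?_ ?_ ?_
  · intro M hM
    simp only [Finset.mem_coe, mem_oscBounded] at hM ⊢
    rw [oscWt_add, oscWt_single, one_mul]
    exact Nat.add_le_add_right hM _
  · intro M hM hM'
    have h0 : M m = 0 := by
      by_contra h0
      apply hM'
      have hle : single m 1 ≤ M := by simpa using Nat.one_le_iff_ne_zero.2 h0
      refine ⟨M - single m 1, ?_, tsub_add_cancel_of_le hle⟩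
      have h1 := oscWt_add (M - single m 1) (single m 1)
      rw [tsub_add_cancel_of_le hle, oscWt_single, one_mul] at h1
      simp only [Finset.mem_coe, mem_oscBounded] at hM ⊢
      have e : m.lvl = k := rfl
      omega
    split_ifs
    · rw [map_smul, bosAnnihilate_succ_ket, sub_eq_zero, smul_comm]
      simp only [← hm, fadd, h0, add_zero]
      rcases Nat.eq_zero_or_pos (b.bos m) with hb | hb
      · simp [hb]
      · rw [tsub_add_eq_add_tsub (by simpa using Nat.succ_le_of_lt hb)]
    · simp
  · intro M _
    have hcond : y = I.oscExponent (M + single m 1) ↔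
        y - expo (I.isRight i) (k + 1) = I.oscExponent M := by
      rw [oscExponent_add, oscExponent_single, sub_eq_iff_eq_add]
      rfl
    simp only [hcond]
    split_ifs
    · rw [map_smul, bosAnnihilate_succ_ket]
      simp only [← hm, fadd, single_eq_same, ← add_assoc, add_tsub_cancel_right]
      have hc := I.creCoef_add_single l M m
      have e : m.lvl = k := rfl
      have e' : m.idx = i := rfl
      rw [e, e'] at hc
      rw [smul_smul (I.momentum l i : ℂ), ← hc]
      rcases Nat.eq_zero_or_pos (b.bos m) with hb | hb
      · simp only [hb, smul_smul]
        push_cast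
        simp
      · have : b.bos - single m 1 + M + single m 1 = b.bos + M := by
          rw [add_right_comm, tsub_add_cancel_of_le (by simpa using Nat.succ_le_of_lt hb)]
        rw [this, smul_smul, smul_smul, ← sub_smul]
        congr 1
        push_cast
        ring
    · simp

lemma fermMode_ket (j : Fin N) (n : ℤ) : ∃ (c : Finset (Osc N) → ℂ)
    (u : Finset (Osc N) → Finset (Osc N)), ∀ b : State N d,
      fermMode j n (ket b) = c b.ferm • ket { b with ferm := u b.ferm } := by
  rcases n with k | k
  · refine ⟨fun F => if toLex (j, k) ∈ F then 0 else (-1) ^ (F.filter (· < toLex (j, k))).card,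
      fun F => insert (toLex (j, k)) F, fun b => ?_⟩
    change fermCreate j k (ket b) = _
    rw [fermCreate_ket]
    simp only
    split_ifs
    · simp
    · rfl
  · refine ⟨fun F => if toLex (j, k) ∈ F then (-1) ^ (F.filter (· < toLex (j, k))).card else 0,
      fun F => F.erase (toLex (j, k)), fun b => ?_⟩
    change fermAnnihilate j k (ket b) = _
    rw [fermAnnihilate_ket]
    simp only
    split_ifs
    · rfl
    · simp

lemma cre_fermMode (l : Charge d) (y : ℝ × ℝ) (j : Fin N) (n : ℤ)
    (x : Fock N d) : I.cre l y (fermMode j n x) = fermMode j n (I.cre l y x) := by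
  obtain ⟨c, u, h⟩ := fermMode_ket (d := d) j n
  refine comp_ext (fun b => ?_) x
  simp only [lcomp, h, cre, onBasis_ket, map_sum, map_smul, smul_sum]
  refine sum_congr rfl fun M _ => ?_
  split_ifs
  · rw [map_smul, h, smul_comm]
  · simp

lemma vertexOp_ket (l : Charge d) (x : ℝ × ℝ) (b : State N d) :
    I.vertexOp l x (ket b) = I.cocycle l b.charge • ∑ J ∈ Finset.Iic b.bos,
      I.annCoef l b.bos J • I.cre l (x - I.leadExponent (I.momentum l) (I.momentum b.charge) +
        I.oscExponent J) (ket { b with bos := b.bos - J, charge := l + b.charge }) := by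
  rw [vertexOp, onBasis_ket]
  congr 1
  rw [finsum_eq_sum_of_support_subset (s := Finset.Iic b.bos)]
  · refine sum_congr rfl fun J hJ => ?_
    rw [mem_Iic] at hJ
    set y := x - I.leadExponent (I.momentum l) (I.momentum b.charge) + I.oscExponent J with hy
    have hcond : ∀ M, x = I.leadExponent (I.momentum l) (I.momentum b.charge) + I.oscExponent M -
        I.oscExponent J ↔ y = I.oscExponent M := fun M => by
      rw [hy]
      constructor
      · intro h
        rw [h]
        abel
      · intro h
        rw [← h]
        abel
    have hW : y.1 + y.2 ≤ ((⌊y.1 + y.2⌋₊ + 1 : ℕ) : ℝ) := by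
      push_cast
      exact (Nat.lt_floor_add_one _).le
    rw [I.cre_ket l y _ _ hW, smul_sum,
      finsum_eq_sum_of_support_subset (s := oscBounded N (⌊y.1 + y.2⌋₊ + 1))]
    · refine sum_congr rfl fun M _ => ?_
      simp only [hJ, hcond, true_and]
      split_ifs
      · rw [smul_smul]
        rfl
      · rw [smul_zero]
    · intro M hM
      simp only [hJ, hcond, true_and, Function.mem_support, ne_eq, ite_eq_right_iff,
        Classical.not_imp] at hM
      rw [Finset.mem_coe, mem_oscBounded]
      rw [hM.1, oscExponent_total] at hW ⊢
      exact_mod_cast hW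
  · intro J hJ
    by_contra hc
    apply hJ
    have : ¬J ≤ b.bos := by simpa using hc
    simp [this]

lemma vertexOp_bosCreate (l : Charge d) (x : ℝ × ℝ) (i : Fin N) (k : ℕ)
    (w : Fock N d) : I.vertexOp l x (bosCreate i k w) = bosCreate i k (I.vertexOp l x w) -
      (I.momentum l i : ℂ) • I.vertexOp l (x + expo (I.isRight i) (k + 1)) w := by
  refine lcongr (f := I.vertexOp l x ∘ₗ bosCreate i k)
    (g := bosCreate i k ∘ₗ I.vertexOp l x - (I.momentum l i : ℂ) • I.vertexOp l (x + expo (I.isRight i) (k + 1))) (fock_ext fun b => ?_) w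
  have e : ∀ J : Osc N →₀ ℕ, I.oscExponent (J + single (toLex (i, k)) 1) =
      I.oscExponent J + expo (I.isRight i) (k + 1) := fun J => by
    rw [oscExponent_add, oscExponent_single]
    rfl
  have e2 : ∀ a b c d : ℝ × ℝ, a - b + (c + d) = a + d - b + c := fun a b c d => by abel
  rw [lcomp, bosCreate_ket, vertexOp_ket, lsub, lcomp, lsmul, vertexOp_ket, vertexOp_ket]
  dsimp only
  rw [sum_annCoef_add_single, smul_sub, map_smul, map_sum,
    smul_comm (I.momentum l i : ℂ) (I.cocycle l b.charge)]
  refine congrArg₂ (· - ·) (congrArg _ (sum_congr rfl fun J hJ => ?_))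
    (congrArg _ (congrArg _ (sum_congr rfl fun J hJ => ?_)))
  · rw [map_smul, ← cre_bosCreate, bosCreate_ket, tsub_add_eq_add_tsub (Finset.mem_Iic.1 hJ)]
  · rw [e, e2, add_tsub_add_eq_tsub_right]

lemma bosAnnihilate_succ_vertexOp (l : Charge d) (x : ℝ × ℝ) (i : Fin N)
    (k : ℕ) (w : Fock N d) : I.bosAnnihilate i (k + 1) (I.vertexOp l x w) =
      I.vertexOp l x (I.bosAnnihilate i (k + 1) w) +
      (I.momentum l i : ℂ) • I.vertexOp l (x - expo (I.isRight i) (k + 1)) w := by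
  refine lcongr (f := I.bosAnnihilate i (k + 1) ∘ₗ I.vertexOp l x)
    (g := I.vertexOp l x ∘ₗ I.bosAnnihilate i (k + 1) + (I.momentum l i : ℂ) • I.vertexOp l (x - expo (I.isRight i) (k + 1))) (fock_ext fun b => ?_) w
  set m : Osc N := toLex (i, k) with hm
  simp only [lcomp, ladd, lsmul, vertexOp_ket,
    map_smul, map_sum, bosAnnihilate_succ_cre, smul_add, sum_add_distrib,
    bosAnnihilate_succ_ket]
  congr 1
  · rw [smul_comm _ (I.cocycle l b.charge)]
    congr 1
    rw [smul_sum, ← hm]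
    symm
    refine (Finset.sum_subset (Finset.Iic_subset_Iic.2 (tsub_le_self :
      b.bos - single m 1 ≤ b.bos)) ?_).trans ?_
    rotate_left
    · refine sum_congr rfl fun J hJ => ?_
      rw [mem_Iic] at hJ
      have h2 := I.annCoef_sub_single l b.bos J m
      simp only [Finsupp.tsub_apply, smul_smul, tsub_right_comm (a := b.bos) (b := J)]
      congr 1
      push_cast at h2 ⊢
      linear_combination -(k + 1 : ℂ) * h2
    · simp_all [I.annCoef_eq_zero, zero_smul]
  · simp only [smul_sum]
    refine sum_congr rfl fun J hJ => ?_
    rw [smul_comm (I.momentum l i : ℂ) (I.cocycle l b.charge), smul_comm (I.momentum l i : ℂ)]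
    congr 5
    abel

lemma momentum_add (k l : Charge d) : I.momentum (k + l) = I.momentum k + I.momentum l := by
  ext i
  simp only [momentum, padd, Int.cast_add, add_mul, sum_add_distrib]

lemma momentum_zero : I.momentum 0 = 0 := by
  ext i
  simp [momentum]

lemma bosAnnihilate_zero_vertexOp (l : Charge d) (x : ℝ × ℝ) (i : Fin N)
    (w : Fock N d) : I.bosAnnihilate i 0 (I.vertexOp l x w) =
      I.vertexOp l x (I.bosAnnihilate i 0 w) + (I.momentum l i : ℂ) • I.vertexOp l x w := by
  refine lcongr (f := I.bosAnnihilate i 0 ∘ₗ I.vertexOp l x)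
    (g := I.vertexOp l x ∘ₗ I.bosAnnihilate i 0 + (I.momentum l i : ℂ) • I.vertexOp l x) (fock_ext fun b => ?_) w
  simp only [lcomp, ladd, lsmul, vertexOp_ket,
    map_smul, map_sum, bosAnnihilate_zero_cre, bosAnnihilate_zero_ket, momentum_add,
    smul_sum, ← sum_add_distrib, padd]
  refine sum_congr rfl fun J hJ => ?_
  push_cast
  module

lemma vertexOp_fermMode (l : Charge d) (x : ℝ × ℝ) (j : Fin N) (n : ℤ)
    (w : Fock N d) : I.vertexOp l x (fermMode j n w) = fermMode j n (I.vertexOp l x w) := by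
  obtain ⟨c, u, h⟩ := fermMode_ket (d := d) j n
  refine comp_ext (fun b => ?_) w
  simp only [lcomp, h, vertexOp_ket, map_sum, map_smul, smul_sum, ← cre_fermMode]
  refine sum_congr rfl fun J _ => ?_
  module

lemma bosMode_vertexOp (l : Charge d) (x : ℝ × ℝ) (i : Fin N) (n : ℤ)
    (w : Fock N d) : I.bosMode i n (I.vertexOp l x w) = I.vertexOp l x (I.bosMode i n w) +
      (I.momentum l i : ℂ) • I.vertexOp l (x + expo (I.isRight i) (n + 1)) w := by
  rcases n with k | _ | k
  · have := I.vertexOp_bosCreate l x i k w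
    change bosCreate i k _ = I.vertexOp l x (bosCreate i k w) + _
    rw [this]
    simp
  · change I.bosAnnihilate i 0 _ = I.vertexOp l x (I.bosAnnihilate i 0 w) + _
    rw [bosAnnihilate_zero_vertexOp]
    simp [expo_zero]
  · change I.bosAnnihilate i (k + 1) _ = I.vertexOp l x (I.bosAnnihilate i (k + 1) w) + _
    rw [bosAnnihilate_succ_vertexOp, show ((negSucc (k + 1) : ℤ) : ℝ) + 1 = -((k : ℝ) + 1) by
      push_cast [negSucc_eq]; ring, expo_neg, sub_eq_add_neg]

lemma vertexOp_mem (l : Charge d) (x : ℝ × ℝ) (b : State N d) :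
    I.vertexOp l x (ket b) ∈ span ℂ (ket '' {b' : State N d |
      b'.charge = l + b.charge ∧ b'.ferm = b.ferm ∧
      x.1 + x.2 + oscWt b.bos = ∑ i, I.momentum l i * I.momentum b.charge i + oscWt b'.bos}) := by
  rw [vertexOp_ket]
  refine smul_mem _ _ (sum_mem fun J hJ => smul_mem _ _ ?_)
  rw [mem_Iic] at hJ
  rw [cre, onBasis_ket]
  refine sum_mem fun M _ => ?_
  split_ifs with h
  · refine smul_mem _ _ (subset_span ⟨{ bos := b.bos - J + M, ferm := b.ferm, charge := l + b.charge },
      ⟨rfl, rfl, ?_⟩, rfl⟩)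
    have h1 := I.oscExponent_total M
    rw [← h] at h1
    have h2 := I.oscExponent_total J
    have h3 := oscWt_add (b.bos - J) J
    rw [tsub_add_cancel_of_le hJ] at h3
    have h4 : (I.leadExponent (I.momentum l) (I.momentum b.charge)).1 +
        (I.leadExponent (I.momentum l) (I.momentum b.charge)).2 =
        ∑ i, I.momentum l i * I.momentum b.charge i := by
      simp only [leadExponent, fst_sum, snd_sum]
      rw [← sum_add_distrib]
      exact sum_congr rfl fun i _ => expo_total _ _
    simp only [fst_add, fst_sub, Prod.snd_add, snd_sub] at h1
    rw [oscWt_add, h3]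
    push_cast
    linarith
  · exact szero _

lemma vertexOp_finite (l : Charge d) (t : ℝ) (b : State N d) :
    {r : ℝ | I.vertexOp l (r, t - r) (ket b) ≠ 0}.Finite := by
  set e := I.leadExponent (I.momentum l) (I.momentum b.charge) with he
  obtain ⟨W, hW⟩ := exists_nat_ge (t - (e.1 + e.2) + oscWt b.bos)
  refine (((Finset.Iic b.bos) ×ˢ oscBounded N W).image fun p =>
    (e + I.oscExponent p.2 - I.oscExponent p.1).1).finite_toSet.subset fun r hr => ?_
  by_contra hc
  apply hr
  rw [vertexOp_ket, sum_eq_zero, smul_zero]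
  intro J hJ
  have hJ' : oscWt J ≤ oscWt b.bos := by
    have h3 := oscWt_add (b.bos - J) J
    rw [tsub_add_cancel_of_le (Finset.mem_Iic.1 hJ)] at h3
    omega
  have hJ'' : (oscWt J : ℝ) ≤ oscWt b.bos := mod_cast hJ'
  have h2 := I.oscExponent_total J
  rw [I.cre_ket l _ _ W (by
    simp only [fst_add, fst_sub, Prod.snd_add, snd_sub]
    linarith), sum_eq_zero, smul_zero]
  intro M hM
  rw [if_neg]
  intro h
  apply hc
  simp only [Finset.coe_image, Set.mem_image]
  refine ⟨(J, M), by simp only [Finset.mem_coe, Finset.mem_product]; exact ⟨hJ, hM⟩, ?_⟩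
  simp only [← h, ← he, fst_add, fst_sub]
  ring

end LatticeInput

namespace LatticeInput

/-! ## Reflecting non-chiral fields -/

variable {N d : ℕ}

/-- The fields for which `z̄` may be replaced by `z`: on every state the total exponents are
integers, bounded below, and each is attained finitely often. -/
structure Reflectable (B : ℝ × ℝ → Op N d) : Prop where
  int : ∀ w x, B x w ≠ 0 → ∃ n : ℤ, x.1 + x.2 = n
  fin : ∀ w (t : ℝ), {r : ℝ | B (r, t - r) w ≠ 0}.Finite
  bdd : ∀ w, ∃ M : ℤ, ∀ x, B x w ≠ 0 → (M : ℝ) ≤ x.1 + x.2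

lemma Reflectable.of_ket {B : ℝ × ℝ → Op N d} (h1 : ∀ b x, B x (ket b) ≠ 0 → ∃ n : ℤ, x.1 + x.2 = n)
    (h2 : ∀ b (t : ℝ), {r : ℝ | B (r, t - r) (ket b) ≠ 0}.Finite)
    (h3 : ∀ b, ∃ M : ℤ, ∀ x, B x (ket b) ≠ 0 → (M : ℝ) ≤ x.1 + x.2) : Reflectable B := by
  have key : ∀ {x w w'}, B x (w + w') ≠ 0 → B x w ≠ 0 ∨ B x w' ≠ 0 := fun {x w w'} h => by
    by_contra! hc
    rw [map_add, hc.1, hc.2, add_zero] at h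
    exact h rfl
  have key' : ∀ {x} {c : ℂ} {w}, B x (c • w) ≠ 0 → B x w ≠ 0 := fun {x c w} h hc => by
    rw [map_smul, hc, smul_zero] at h
    exact h rfl
  refine ⟨fun w => ?_, fun w => ?_, fun w => ?_⟩
  · induction w using fock_induction with
    | h0 => simp
    | hadd w w' hw hw' => exact fun x h => (key h).elim (hw x) (hw' x)
    | hket c b => exact fun x h => h1 b x (key' h)
  · induction w using fock_induction with
    | h0 => simp
    | hadd w w' hw hw' => exact fun t => ((hw t).union (hw' t)).subset fun r h => key h
    | hket c b => exact fun t => (h2 b t).subset fun r h => key' h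
  · induction w using fock_induction with
    | h0 => simp
    | hadd w w' hw hw' =>
      obtain ⟨M, hM⟩ := hw
      obtain ⟨M', hM'⟩ := hw'
      refine ⟨min M M', fun x h => ?_⟩
      push_cast
      exact (key h).elim (fun h => (min_le_left _ _).trans (hM x h))
        (fun h => (min_le_right _ _).trans (hM' x h))
    | hket c b =>
      obtain ⟨M, hM⟩ := h3 b
      exact ⟨M, fun x h => hM x (key' h)⟩

/-- The field obtained by replacing `z̄` by `z`. -/
def refl (B : ℝ × ℝ → Op N d) (t : ℤ) : Op N d :=
  onBasis fun b => ∑ᶠ r : ℝ, B (r, t - r) (ket b)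

lemma refl_apply {B : ℝ × ℝ → Op N d} (hB : Reflectable B) (t : ℤ)
    (w : Fock N d) : refl B t w = ∑ᶠ r : ℝ, B (r, t - r) w := by
  induction w using fock_induction with
  | h0 => simp
  | hadd w w' hw hw' =>
    rw [map_add, hw, hw', ← finsum_add_distrib (hB.fin w t) (hB.fin w' t)]
    simp only [map_add]
  | hket c b =>
    rw [map_smul, refl, onBasis_ket]
    simp only [map_smul]
    rw [smul_finsum' c (hB.fin (ket b) t)]

lemma Reflectable.truncated {B : ℝ × ℝ → Op N d} (hB : Reflectable B) : Truncated (refl B) := by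
  intro w
  obtain ⟨M, hM⟩ := hB.bdd w
  refine ⟨M, fun t ht => ?_⟩
  rw [refl_apply hB]
  refine (finsum_congr fun r => ?_).trans finsum_zero
  by_contra hc
  have := hM _ hc
  simp only [add_sub_cancel] at this
  exact absurd ht (not_lt.2 (mod_cast this))

lemma Reflectable.finite_shift {B : ℝ × ℝ → Op N d} (hB : Reflectable B)
    (right : Bool) (t u : ℝ) (w : Fock N d) :
    (support fun r : ℝ => B ((r, t - r) + expo right u) w).Finite := by
  cases right
  · refine ((hB.fin w (t + u)).image fun r => r - u).subset fun r hr => ⟨r + u, ?_, by simp⟩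
    have e : t + u - (r + u) = t - r := by ring
    simpa [expo, e] using hr
  · refine (hB.fin w (t + u)).subset fun r hr => ?_
    have e : t + u - r = t - r + u := by ring
    simpa [expo, e] using hr

lemma finsum_shift {B : ℝ × ℝ → Op N d} (hB : Reflectable B) (right : Bool)
    (t u : ℤ) (w : Fock N d) :
    ∑ᶠ r : ℝ, B ((r, t - r) + expo right u) w = refl B (t + u) w := by
  rw [refl_apply hB]
  cases right
  · conv_rhs => rw [← finsum_comp_equiv (Equiv.addRight (u : ℝ))]
    refine finsum_congr fun r => ?_
    have e : ((t + u : ℤ) : ℝ) - (r + u) = t - r := by push_cast; ring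
    rw [Equiv.coe_addRight, e]
    simp [expo]
  · refine finsum_congr fun r => ?_
    have e : ((t + u : ℤ) : ℝ) - r = t - r + u := by push_cast; ring
    rw [e]
    simp [expo]

variable {right : Bool} {c a : ℕ → Op N d} {n : ℕ} {s : ℂ}
  {B : ℝ × ℝ → Op N d}

lemma normalOrder_range (hB : Reflectable B) (ha : ∀ w, ∃ K, ∀ k ≥ K, a k w = 0) (T : ℝ)
    (w : Fock N d) : ∃ K₀ : ℕ, ∀ K ≥ K₀, ∀ K' ≥ K₀, ∀ x : ℝ × ℝ, x.1 + x.2 ≤ T →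
      normalOrder right c a n s B x w =
        ∑ k ∈ range K, (k.choose n : ℂ) • c k (B (x - expo right (k - n)) w) +
        s • ∑ k ∈ range K', ((-1 : ℂ) ^ n * ((k + n).choose n : ℂ)) •
          B (x + expo right (k + 1 + n)) (a k w) := by
  induction w using fock_induction with
  | h0 => exact ⟨0, fun K _ K' _ x _ => by simp⟩
  | hadd w w' hw hw' =>
    obtain ⟨K₀, h⟩ := hw
    obtain ⟨K₁, h'⟩ := hw'
    refine ⟨max K₀ K₁, fun K hK K' hK' x hx => ?_⟩
    rw [map_add, h K (le_of_max_le_left hK) K' (le_of_max_le_left hK') x hx,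
      h' K (le_of_max_le_right hK) K' (le_of_max_le_right hK') x hx]
    simp only [map_add, smul_add, sum_add_distrib]
    abel
  | hket z b =>
    obtain ⟨M, hM⟩ := hB.bdd (ket b)
    obtain ⟨K₁, h₁⟩ := ha (ket b)
    obtain ⟨K₂, h₂⟩ := exists_nat_gt (T + n - M)
    refine ⟨max K₁ K₂, fun K hK K' hK' x hx => ?_⟩
    have hK := le_of_max_le_right hK
    have hK' := le_of_max_le_left hK'
    rw [map_smul, normalOrder, onBasis_ket, finsum_eq_range K, finsum_eq_range K', smul_add,
      smul_comm z s]
    · simp only [map_smul, smul_sum]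
      refine congrArg₂ (· + ·) (sum_congr rfl fun k _ => smul_comm _ _ _)
        (sum_congr rfl fun k _ => ?_)
      rw [smul_comm z]
    · intro k hk
      rw [h₁ k (hK'.trans hk), map_zero, smul_zero]
    · intro k hk
      have : B (x - expo right (k - n)) (ket b) = 0 := by
        by_contra hc
        have h3 := hM _ hc
        have h4 := expo_total right (k - n)
        have h5 : (K₂ : ℝ) ≤ k := mod_cast hK.trans hk
        simp only [fst_sub, snd_sub] at h3
        linarith
      rw [this, map_zero, smul_zero]

lemma Reflectable.normalOrder (hB : Reflectable B) (ha : ∀ w, ∃ K, ∀ k ≥ K, a k w = 0) :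
    Reflectable (normalOrder right c a n s B) := by
  have key : ∀ b x, LatticeInput.normalOrder right c a n s B x (ket b) ≠ 0 →
      (∃ k : ℕ, B (x - expo right (k - n)) (ket b) ≠ 0) ∨
      ∃ k : ℕ, B (x + expo right (k + 1 + n)) (a k (ket b)) ≠ 0 := by
    intro b x h
    by_contra! hc
    apply h
    rw [LatticeInput.normalOrder, onBasis_ket]
    simp only [hc.1, hc.2, map_zero, smul_zero, finsum_zero, add_zero]
  refine Reflectable.of_ket (fun b x h => ?_) (fun b t => ?_) (fun b => ?_)
  · rcases key b x h with ⟨k, hk⟩ | ⟨k, hk⟩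
    · obtain ⟨m, hm⟩ := hB.int _ _ hk
      have h4 := expo_total right (k - n)
      simp only [fst_sub, snd_sub] at hm
      refine ⟨m + k - n, ?_⟩
      push_cast
      linarith
    · obtain ⟨m, hm⟩ := hB.int _ _ hk
      have h4 := expo_total right (k + 1 + n)
      simp only [fst_add, Prod.snd_add] at hm
      refine ⟨m - k - 1 - n, ?_⟩
      push_cast
      linarith
  · obtain ⟨K, hK⟩ := normalOrder_range (right := right) (c := c) (n := n) (s := s) hB ha t (ket b)
    have hK := hK K le_rfl K le_rfl
    refine (((range K).finite_toSet.biUnion fun k _ =>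
      hB.finite_shift right t (-((k : ℝ) - n)) (ket b)).union
      ((range K).finite_toSet.biUnion fun k _ =>
      hB.finite_shift right t (k + 1 + n) (a k (ket b)))).subset fun r hr => ?_
    by_contra hc
    apply hr
    rw [hK (r, t - r) (by simp)]
    simp only [Set.mem_union, Set.mem_iUnion, Function.mem_support, not_or, not_exists, not_not,
      expo_neg, ← sub_eq_add_neg] at hc
    rw [sum_eq_zero, sum_eq_zero, smul_zero, add_zero]
    · intro k hk
      rw [hc.2 k hk, smul_zero]
    · intro k hk
      rw [hc.1 k hk, map_zero, smul_zero]
  · obtain ⟨M, hM⟩ := hB.bdd (ket b)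
    obtain ⟨K, hK⟩ := ha (ket b)
    choose f hf using fun k : ℕ => hB.bdd (a k (ket b))
    obtain ⟨L, hL⟩ : ∃ L : ℤ, ∀ k ∈ range K, L ≤ f k - k - 1 - n := by
      obtain ⟨L, hL⟩ := ((range K).image fun k : ℕ => f k - k - 1 - n).bddBelow
      exact ⟨L, fun k hk => hL (by simpa using ⟨k, by simpa using hk, rfl⟩)⟩
    refine ⟨min (M - n) L, fun x h => ?_⟩
    rcases key b x h with ⟨k, hk⟩ | ⟨k, hk⟩
    · have h3 := hM _ hk
      have h4 := expo_total right (k - n)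
      simp only [fst_sub, snd_sub] at h3
      have h5 : (0 : ℝ) ≤ k := Nat.cast_nonneg k
      push_cast
      exact (min_le_left _ _).trans (by linarith)
    · have hkK : k < K := by
        by_contra hc
        rw [hK k (not_lt.1 hc), map_zero] at hk
        exact hk rfl
      have h3 := hf k _ hk
      have h4 := expo_total right (k + 1 + n)
      simp only [fst_add, Prod.snd_add] at h3
      have h6 : (L : ℝ) ≤ f k - k - 1 - n := mod_cast hL k (Finset.mem_range.2 hkK)
      push_cast
      exact (min_le_right _ _).trans (by linarith)

lemma ringChoose_neg (k n : ℕ) :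
    (Ring.choose (-1 - k : ℤ) n : ℤ) = (-1) ^ n * ((k + n).choose n : ℤ) := by
  rw [show (-1 - k : ℤ) = -((k + 1 : ℕ) : ℤ) by push_cast; ring, Ring.choose_neg]
  rw [show ((k + 1 : ℕ) : ℤ) + n - 1 = ((k + n : ℕ) : ℤ) by push_cast; ring, choose_natCast]
  simp [Int.negOnePow_def, Units.smul_def]

lemma isNop_refl (hB : Reflectable B) (φ : Modes (Fock N d))
    (hc : ∀ k : ℕ, φ k = c k) (ha' : ∀ k : ℕ, φ (-1 - k) = a k)
    (ha : ∀ w, ∃ K, ∀ k ≥ K, a k w = 0) :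
    IsNop (divDeriv n φ) (refl B) s (refl (normalOrder right c a n s B)) := by
  intro t w
  rw [refl_apply (hB.normalOrder ha)]
  obtain ⟨K₀, hK₀⟩ := normalOrder_range (right := right) (c := c) (n := n) (s := s) hB ha t w
  obtain ⟨M, hM⟩ := hB.truncated w
  obtain ⟨K₁, hK₁⟩ := ha w
  set K := max K₀ (max (t - M + 1).toNat K₁) with hK
  have h1 : K₀ ≤ K := le_max_left _ _
  have h2 : (t - M + 1).toNat ≤ K := (le_max_left _ _).trans (le_max_right _ _)
  have h3 : K₁ ≤ K := (le_max_right _ _).trans (le_max_right _ _)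
  rw [finsum_eq_range K, finsum_eq_range (n + K)]
  · have hx : ∀ r : ℝ, normalOrder right c a n s B (r, t - r) w = _ := fun r =>
      hK₀ (n + K) (by omega) K h1 (r, t - r) (by simp)
    simp only [hx]
    have hl : ∀ k : ℕ, ∀ r : ℝ, (r, (t : ℝ) - r) - expo right (k - n) =
        (r, (t : ℝ) - r) + expo right ((n - k : ℤ) : ℝ) := fun k r => by
      rw [sub_eq_add_neg, ← expo_neg]
      push_cast
      ring_nf
    have hr : ∀ k : ℕ, expo right ((k : ℝ) + 1 + n) = expo right ((k + 1 + n : ℤ) : ℝ) :=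
      fun k => by push_cast; rfl
    simp only [hl, hr]
    have f1 : ∀ k : ℕ, (support fun r : ℝ => ((k.choose n : ℕ) : ℂ) •
        c k (B ((r, (t : ℝ) - r) + expo right ((n - k : ℤ) : ℝ)) w)).Finite := fun k =>
      (hB.finite_shift right t ((n - k : ℤ) : ℝ) w).subset fun r hr h0 => hr (by
        simp only at h0 ⊢
        rw [h0, map_zero, smul_zero])
    have f2 : ∀ k : ℕ, (support fun r : ℝ => ((-1 : ℂ) ^ n * ((k + n).choose n : ℂ)) •
        B ((r, (t : ℝ) - r) + expo right ((k + 1 + n : ℤ) : ℝ)) (a k w)).Finite := fun k =>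
      (hB.finite_shift right t ((k + 1 + n : ℤ) : ℝ) (a k w)).subset fun r hr h0 => hr (by
        simp only at h0 ⊢
        rw [h0, smul_zero])
    have F1 : (support fun r : ℝ => ∑ k ∈ range (n + K), ((k.choose n : ℕ) : ℂ) •
        c k (B ((r, (t : ℝ) - r) + expo right ((n - k : ℤ) : ℝ)) w)).Finite :=
      ((range (n + K)).finite_toSet.biUnion fun k _ => f1 k).subset fun r hr => by
        obtain ⟨k, hk, h⟩ := Finset.exists_ne_zero_of_sum_ne_zero hr
        exact Set.mem_biUnion hk h
    have F2 : (support fun r : ℝ => ∑ k ∈ range K, ((-1 : ℂ) ^ n * ((k + n).choose n : ℂ)) •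
        B ((r, (t : ℝ) - r) + expo right ((k + 1 + n : ℤ) : ℝ)) (a k w)).Finite :=
      ((range K).finite_toSet.biUnion fun k _ => f2 k).subset fun r hr => by
        obtain ⟨k, hk, h⟩ := Finset.exists_ne_zero_of_sum_ne_zero hr
        exact Set.mem_biUnion hk h
    rw [finsum_add_distrib F1 (F2.subset fun r hr h0 => hr (by simp only [h0, smul_zero])),
      ← smul_finsum' s F2, finsum_sum_comm _ _ (fun k _ => f1 k),
      finsum_sum_comm _ _ (fun k _ => f2 k)]
    congr 1
    · rw [Finset.sum_range_add, sum_eq_zero, zero_add]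
      · refine sum_congr rfl fun k _ => ?_
        rw [← smul_finsum' _ ((hB.finite_shift right t ((n - (n + k : ℕ) : ℤ) : ℝ) w).subset
          fun r hr h0 => hr (by simp only [h0, map_zero])), show (∑ᶠ i : ℝ, c (n + k) (B ((i, t - i) + expo right ((n - (n + k : ℕ) : ℤ) : ℝ)) w)) =
          c (n + k) (∑ᶠ i : ℝ, B ((i, t - i) + expo right ((n - (n + k : ℕ) : ℤ) : ℝ)) w) from
          ((c (n + k)).toAddMonoidHom.map_finsum (hB.finite_shift right t _ w)).symm,
          finsum_shift hB, divDeriv, lsmul,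
          show (k : ℤ) + n = ((n + k : ℕ) : ℤ) by push_cast; ring, hc, choose_natCast,
          show t + ((n : ℤ) - ((n + k : ℕ) : ℤ)) = t - k by push_cast; ring]
        simp
      · intro k hk
        rw [Nat.choose_eq_zero_of_lt (Finset.mem_range.1 hk)]
        simp
    · congr 1
      symm
      rw [Finset.sum_range_add, sum_eq_zero, zero_add]
      · refine sum_congr rfl fun k _ => ?_
        rw [← smul_finsum' _ (hB.finite_shift right t _ _), finsum_shift hB, divDeriv,
          lsmul, map_smul,
          show -1 - ((n + k : ℕ) : ℤ) + n = -1 - k by push_cast; ring, ha', ringChoose_neg,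
          show t + ((k : ℤ) + 1 + n) = t + 1 + ((n + k : ℕ) : ℤ) by push_cast; ring]
        push_cast
        rfl
      · intro k hk
        have hk := Finset.mem_range.1 hk
        rw [divDeriv, show -1 - (k : ℤ) + n = ((n - 1 - k : ℕ) : ℤ) by omega, choose_natCast,
          Nat.choose_eq_zero_of_lt (by omega)]
        simp
  · intro j hj
    have : divDeriv n φ (-1 - j) w = 0 := by
      rw [divDeriv, lsmul, show -1 - (j : ℤ) + n = -1 - ((j - n : ℕ) : ℤ) by omega,
        ha', hK₁ _ (by omega), smul_zero]
    rw [this, map_zero]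
  · intro j hj
    rw [hM _ (by omega), map_zero]

end LatticeInput

namespace LatticeInput

/-! ## The reflected fields of the states -/

variable {N d : ℕ} (I : LatticeInput N d)

/-- The Euclidean pairing of the momenta. -/
def pair (l m : Charge d) : ℝ := ∑ i, I.momentum l i * I.momentum m i

lemma pair_comm (l m : Charge d) : I.pair l m = I.pair m l :=
  sum_congr rfl fun _ _ => mul_comm _ _

lemma pair_add (l m k : Charge d) : I.pair l (m + k) = I.pair l m + I.pair l k := by
  simp only [pair, momentum_add, padd, mul_add, sum_add_distrib]

/-- All pairings of momenta are integers. -/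
def Integral : Prop := ∀ l m, ∃ n : ℤ, I.pair l m = n

lemma leadExponent_total (l m : Charge d) : (I.leadExponent (I.momentum l) (I.momentum m)).1 +
      (I.leadExponent (I.momentum l) (I.momentum m)).2 = I.pair l m := by
  simp only [leadExponent, fst_sum, snd_sum]
  rw [← sum_add_distrib]
  exact sum_congr rfl fun i _ => expo_total _ _

lemma mem_span_ket_of_ne {P : State N d → Prop} {x : Fock N d}
    (hx : x ∈ span ℂ (ket '' {b | P b})) {b : State N d} (hb : ¬P b) : x b = 0 := by
  classical
  induction hx using span_induction with
  | mem x h =>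
    obtain ⟨b', hb', rfl⟩ := h
    rw [ket, fsingle, if_neg]
    rintro rfl
    exact hb hb'
  | zero => rfl
  | add x y _ _ hx hy => rw [fadd, hx, hy, add_zero]
  | smul c x _ hx => rw [fsmul, hx, smul_zero]

lemma exists_of_mem_span_ket {P : State N d → Prop} {x : Fock N d}
    (hx : x ∈ span ℂ (ket '' {b | P b})) (h0 : x ≠ 0) : ∃ b, P b := by
  by_contra! hc
  exact h0 (Finsupp.ext fun b => mem_span_ket_of_ne hx (hc b))

lemma vertexOp_reflectable {I : LatticeInput N d} (hI : I.Integral) (l : Charge d) :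
    Reflectable (I.vertexOp l) := by
  refine Reflectable.of_ket (fun b x h => ?_) (fun b t => I.vertexOp_finite l t b) (fun b => ?_)
  · obtain ⟨b', -, -, hb'⟩ := exists_of_mem_span_ket (I.vertexOp_mem l x b) h
    obtain ⟨n, hn⟩ := hI l b.charge
    rw [pair] at hn
    refine ⟨n + oscWt b'.bos - oscWt b.bos, ?_⟩
    push_cast
    linarith
  · obtain ⟨n, hn⟩ := hI l b.charge
    rw [pair] at hn
    refine ⟨n - oscWt b.bos, fun x h => ?_⟩
    obtain ⟨b', -, -, hb'⟩ := exists_of_mem_span_ket (I.vertexOp_mem l x b) h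
    have : (0 : ℝ) ≤ oscWt b'.bos := Nat.cast_nonneg _
    push_cast
    linarith

lemma eventually_eq_zero {f : ℕ → Op N d} (h : ∀ b, ∃ K, ∀ k ≥ K, f k (ket b) = 0)
    (w : Fock N d) : ∃ K, ∀ k ≥ K, f k w = 0 := by
  induction w using fock_induction with
  | h0 => exact ⟨0, fun k _ => map_zero _⟩
  | hadd x y hx hy =>
    obtain ⟨K, h⟩ := hx
    obtain ⟨K', h'⟩ := hy
    exact ⟨max K K', fun k hk => by grind⟩
  | hket c b =>
    obtain ⟨K, hK⟩ := h b
    exact ⟨K, fun k hk => by rw [map_smul, hK k hk, smul_zero]⟩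

lemma fermAnnihilate_eventually (i : Fin N) (w : Fock N d) :
    ∃ K, ∀ k ≥ K, fermAnnihilate i k w = 0 := by
  refine eventually_eq_zero (fun b => ?_) w
  obtain ⟨K, hK⟩ := (b.ferm.image Osc.lvl).bddAbove
  refine ⟨K + 1, fun k hk => ?_⟩
  rw [fermAnnihilate_ket, if_neg]
  intro h
  have := hK (Finset.mem_coe.2 (Finset.mem_image_of_mem Osc.lvl h))
  simp only [Osc.lvl, ofLex_toLex] at this
  omega

lemma bosAnnihilate_eventually (i : Fin N) (w : Fock N d) :
    ∃ K, ∀ k ≥ K, I.bosAnnihilate i k w = 0 := by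
  refine eventually_eq_zero (fun b => ?_) w
  obtain ⟨K, hK⟩ := (b.bos.support.image Osc.lvl).bddAbove
  refine ⟨K + 2, fun k hk => ?_⟩
  obtain ⟨k, rfl⟩ := Nat.exists_eq_add_of_le' (show 1 ≤ k by omega)
  rw [bosAnnihilate_succ_ket]
  have : b.bos (toLex (i, k)) = 0 := by
    by_contra h
    have := hK (Finset.mem_coe.2 (Finset.mem_image_of_mem Osc.lvl (Finsupp.mem_support_iff.2 h)))
    simp only [Osc.lvl, ofLex_toLex] at this
    omega
  simp [this]

lemma fermMode_truncated (i : Fin N) : Truncated (fermMode (d := d) i) := by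
  intro w
  obtain ⟨K, hK⟩ := fermAnnihilate_eventually i w
  refine ⟨-K, fun n hn => ?_⟩
  have := hK (-1 - n).toNat (by omega)
  rw [← fermMode_neg] at this
  rwa [show -1 - ((-1 - n).toNat : ℤ) = n by omega] at this

lemma bosMode_truncated (i : Fin N) : Truncated (I.bosMode i) := by
  intro w
  obtain ⟨K, hK⟩ := I.bosAnnihilate_eventually i w
  refine ⟨-K, fun n hn => ?_⟩
  have := hK (-1 - n).toNat (by omega)
  rw [← bosMode_neg] at this
  rwa [show -1 - ((-1 - n).toNat : ℤ) = n by omega] at this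

lemma fermField_reflectable {I : LatticeInput N d} (hI : I.Integral) (l : Charge d) :
    ∀ L, Reflectable (I.fermField l L)
  | [] => vertexOp_reflectable hI l
  | m :: L => (fermField_reflectable hI l L).normalOrder (fermAnnihilate_eventually m.idx)

lemma bosField_reflectable {B : ℝ × ℝ → Op N d}
    (hB : Reflectable B) : ∀ L, Reflectable (I.bosField B L)
  | [] => hB
  | m :: L => (bosField_reflectable hB L).normalOrder (I.bosAnnihilate_eventually m.idx)

/-- The operator that multiplies a state by a function of its charge. -/
def chargeMul (f : Charge d → ℂ) : Op N d :=
  onBasis fun b => f b.charge • ket b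

lemma chargeMul_ket (f : Charge d → ℂ) (b : State N d) :
    chargeMul f (ket b) = f b.charge • ket b := onBasis_ket _ _

lemma chargeMul_comm_of_charge {A : Op N d} (k : Charge d)
    (hA : ∀ b, A (ket b) ∈ span ℂ (ket '' {b' : State N d | b'.charge = k + b.charge}))
    (f : Charge d → ℂ) (x : Fock N d) :
    chargeMul f (A x) = A (chargeMul (fun l => f (k + l)) x) := by
  rw [← lcomp, ← lcomp]
  congr 1
  refine fock_ext fun b => ?_
  rw [lcomp, lcomp, chargeMul_ket, map_smul]
  have : ∀ y ∈ span ℂ (ket '' {b' : State N d | b'.charge = k + b.charge}),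
      chargeMul f y = f (k + b.charge) • y := by
    intro y hy
    induction hy using span_induction with
    | mem y h =>
      grind [chargeMul_ket]
    | zero => simp
    | add y z _ _ hy hz => rw [map_add, hy, hz, smul_add]
    | smul c y _ hy => rw [map_smul, hy, smul_comm]
  exact this _ (hA b)

lemma fermMode_charge (i : Fin N) (n : ℤ) (b : State N d) : fermMode i n (ket b) ∈
    span ℂ (ket '' {b' : State N d | b'.charge = 0 + b.charge}) := by
  obtain ⟨c, u, h⟩ := fermMode_ket (d := d) i n
  rw [h]
  refine smul_mem _ _ (subset_span ⟨_, ?_, rfl⟩)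
  simp

lemma bosMode_charge (i : Fin N) (n : ℤ) (b : State N d) : I.bosMode i n (ket b) ∈
    span ℂ (ket '' {b' : State N d | b'.charge = 0 + b.charge}) := by
  rcases n with k | _ | k
  · rw [show I.bosMode i (Int.ofNat k) = bosCreate i k from rfl, bosCreate_ket]
    exact subset_span ⟨_, by simp, rfl⟩
  · rw [show I.bosMode i (negSucc 0) = I.bosAnnihilate i 0 from rfl, bosAnnihilate_zero_ket]
    exact smul_mem _ _ (subset_span ⟨_, by simp, rfl⟩)
  · rw [show I.bosMode i (negSucc (k + 1)) = I.bosAnnihilate i (k + 1) from rfl,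
      bosAnnihilate_succ_ket]
    exact smul_mem _ _ (subset_span ⟨_, by simp, rfl⟩)

lemma fermMode_chargeMul (i : Fin N) (n : ℤ) (f : Charge d → ℂ) (x : Fock N d) :
    fermMode i n (chargeMul f x) = chargeMul f (fermMode i n x) := by
  rw [chargeMul_comm_of_charge 0 (fermMode_charge i n)]
  simp only [zero_add]

lemma bosMode_chargeMul (i : Fin N) (n : ℤ) (f : Charge d → ℂ)
    (x : Fock N d) : I.bosMode i n (chargeMul f x) = chargeMul f (I.bosMode i n x) := by
  rw [chargeMul_comm_of_charge 0 (I.bosMode_charge i n)]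
  simp only [zero_add]

lemma chargeMul_chargeMul (f g : Charge d → ℂ) (x : Fock N d) :
    chargeMul f (chargeMul g x) = chargeMul (fun l => f l * g l) x := by
  rw [← lcomp]
  congr 1
  refine fock_ext fun b => ?_
  rw [lcomp, chargeMul_ket, chargeMul_ket, map_smul, chargeMul_ket, smul_smul, mul_comm]

lemma chargeMul_one (x : Fock N d) : chargeMul (fun _ => 1) x = x := by
  have : (chargeMul (fun _ => 1) : Op N d) = lid :=
    fock_ext fun b => by rw [chargeMul_ket, one_smul]; rfl
  rw [this]
  rfl

lemma cocycle_ne_zero (l m : Charge d) : I.cocycle l m ≠ 0 :=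
  Complex.exp_ne_zero _

/-- The modes of the reflected vertex operator of charge `l`, without the cocycle. -/
def vertexMode (l : Charge d) (t : ℤ) : Op N d :=
  refl (I.vertexOp l) t ∘ₗ chargeMul fun m => (I.cocycle l m)⁻¹

lemma refl_vertexOp (l : Charge d) (t : ℤ) (x : Fock N d) :
    refl (I.vertexOp l) t x = I.vertexMode l t (chargeMul (I.cocycle l) x) := by
  rw [vertexMode, lcomp, chargeMul_chargeMul]
  simp only [inv_mul_cancel₀ (I.cocycle_ne_zero l _)]
  rw [chargeMul_one]

lemma vertexMode_truncated {I : LatticeInput N d} (hI : I.Integral) (l : Charge d) :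
    Truncated (I.vertexMode l) := fun x =>
  (vertexOp_reflectable hI l).truncated (chargeMul (fun m => (I.cocycle l m)⁻¹) x)

lemma bosMode_vertexMode {I : LatticeInput N d} (hI : I.Integral) (l : Charge d) (i : Fin N)
    (n t : ℤ) (x : Fock N d) : I.bosMode i n (I.vertexMode l t x) =
      I.vertexMode l t (I.bosMode i n x) + (I.momentum l i : ℂ) • I.vertexMode l (t + n + 1) x := by
  have hV := vertexOp_reflectable hI l
  simp only [vertexMode, lcomp, ← bosMode_chargeMul]
  set y := chargeMul (fun m => (I.cocycle l m)⁻¹) x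
  rw [add_assoc t n 1, ← finsum_shift hV (I.isRight i) t (n + 1) y, refl_apply hV, refl_apply hV,
    ← toAddMonoidHom_coe, AddMonoidHom.map_finsum _ (hV.fin y t),
    smul_finsum' _ (hV.finite_shift _ t ((n + 1 : ℤ) : ℝ) y), ← finsum_add_distrib (hV.fin _ t)
    ((hV.finite_shift (I.isRight i) t ((n + 1 : ℤ) : ℝ) y).subset fun r hr h0 => hr (by
      simp only at h0 ⊢
      rw [h0, smul_zero]))]
  refine finsum_congr fun r => ?_
  rw [toAddMonoidHom_coe, bosMode_vertexOp]
  push_cast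
  rfl

lemma fermMode_vertexMode {I : LatticeInput N d} (hI : I.Integral) (l : Charge d) (i : Fin N)
    (n t : ℤ) (x : Fock N d) : fermMode i n (I.vertexMode l t x) =
      I.vertexMode l t (fermMode i n x) := by
  have hV := vertexOp_reflectable hI l
  simp only [vertexMode, lcomp, ← fermMode_chargeMul]
  rw [refl_apply hV, refl_apply hV, ← toAddMonoidHom_coe, AddMonoidHom.map_finsum _ (hV.fin _ t)]
  refine finsum_congr fun r => ?_
  rw [toAddMonoidHom_coe, vertexOp_fermMode]

lemma finsum_mem_submodule {ι M : Type*} [AddCommGroup M] [Module ℂ M] (P : Submodule ℂ M)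
    {f : ι → M} (h : ∀ i, f i ∈ P) : ∑ᶠ i, f i ∈ P :=
  finsum_induction (· ∈ P) P.zero_mem (fun _ _ => P.add_mem) h

lemma vertexMode_mem (l : Charge d) (t : ℤ) (b : State N d) :
    I.vertexMode l t (ket b) ∈ span ℂ (ket '' {b' : State N d |
      b'.charge = l + b.charge ∧ b'.ferm = b.ferm ∧
      t + oscWt b.bos = I.pair l b.charge + oscWt b'.bos}) := by
  rw [vertexMode, lcomp, chargeMul_ket, map_smul, refl, onBasis_ket]
  refine smul_mem _ _ (finsum_mem_submodule _ fun r => ?_)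
  have := I.vertexOp_mem l (r, t - r) b
  simpa [pair] using this

lemma vertexOp_lead (l m : Charge d) (x : ℝ × ℝ) (k : Charge d) :
    I.vertexOp l x (ket (bare m)) (bare k) =
      if k = l + m ∧ x = I.leadExponent (I.momentum l) (I.momentum m) then I.cocycle l m else 0 := by
  classical
  have e : (bare m : State N d).bos = ⊥ := rfl
  have e' : (bare m : State N d).charge = m := rfl
  obtain ⟨W, hW⟩ := exists_nat_ge ((x - I.leadExponent (I.momentum l) (I.momentum m)).1 +
    (x - I.leadExponent (I.momentum l) (I.momentum m)).2)
  rw [vertexOp_ket, e, e', Finset.Iic_bot, Finset.sum_singleton,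
    show I.oscExponent ⊥ = 0 from sum_zero_index, add_zero, I.cre_ket l _ _ W hW,
    show I.annCoef l ⊥ ⊥ = 1 from Finsupp.prod_zero_index, one_smul, fsmul,
    finsetSum_apply, sum_eq_single 0]
  · rw [show I.oscExponent 0 = 0 from sum_zero_index,
      show I.creCoef l 0 = 1 from Finsupp.prod_zero_index]
    simp only [sub_eq_zero]
    by_cases h : x = I.leadExponent (I.momentum l) (I.momentum m)
    · by_cases h' : k = l + m
      · simp [h, h', ket, bare]
      · simp_all [ket, bare, State.ext_iff]
    · simp [h]
  · intro M _ hM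
    split_ifs
    · simp_all [ket, if_neg, bare]
    · rfl
  · simp [mem_oscBounded, oscWt]

lemma vertexMode_bare {I : LatticeInput N d} (hI : I.Integral) (l m k : Charge d) (t : ℤ) :
    I.vertexMode l t (ket (bare m)) (bare k) = if k = l + m ∧ t = I.pair l m then 1 else 0 := by
  have hV := vertexOp_reflectable hI l
  rw [vertexMode, lcomp, chargeMul_ket, map_smul, fsmul, smul_eq_mul, refl_apply hV]
  have e : (∑ᶠ r : ℝ, I.vertexOp l (r, t - r) (ket (bare m))) (bare k) =
      ∑ᶠ r : ℝ, I.vertexOp l (r, t - r) (ket (bare m)) (bare k) :=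
    (Finsupp.applyAddHom (bare k)).map_finsum (hV.fin _ t)
  rw [e, finsum_eq_single _ (I.leadExponent (I.momentum l) (I.momentum m)).1]
  · rw [vertexOp_lead, ← leadExponent_total]
    have h1 : ((I.leadExponent (I.momentum l) (I.momentum m)).1,
        (t : ℝ) - (I.leadExponent (I.momentum l) (I.momentum m)).1) =
        I.leadExponent (I.momentum l) (I.momentum m) ↔
        (t : ℝ) = (I.leadExponent (I.momentum l) (I.momentum m)).1 +
          (I.leadExponent (I.momentum l) (I.momentum m)).2 := by
      grind
    simp only [h1]
    split_ifs
    · exact inv_mul_cancel₀ (I.cocycle_ne_zero l m)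
    · exact mul_zero _
  · intro r hr
    rw [vertexOp_lead, if_neg]
    rintro ⟨-, h⟩
    exact hr (congrArg Prod.fst h)

lemma eq_smul_bare_of_mem {x : Fock N d} {k : Charge d}
    (hx : x ∈ span ℂ (ket '' {b : State N d | b = bare k})) :
    x = x (bare k) • ket (bare k) := by
  classical
  ext b
  rw [fsmul, ket, fsingle]
  split_ifs with h
  · rw [h, smul_eq_mul, mul_one]
  · rw [mem_span_ket_of_ne hx (Ne.symm h), smul_zero]

lemma oscWt_eq_zero {M : Osc N →₀ ℕ} (h : oscWt M = 0) : M = 0 := by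
  ext m
  have := le_oscWt M m
  rw [h] at this
  simpa using this

lemma vertexMode_lead {I : LatticeInput N d} (hI : I.Integral) (l m : Charge d) (t : ℤ)
    (ht : t = I.pair l m) : I.vertexMode l t (ket (bare m)) = ket (bare (l + m)) := by
  have h := I.vertexMode_mem l t (bare m)
  rw [eq_smul_bare_of_mem (k := l + m) (x := I.vertexMode l t (ket (bare m))),
    vertexMode_bare hI, if_pos ⟨rfl, ht⟩, one_smul]
  refine span_mono (Set.image_mono ?_) h
  rintro b ⟨h1, h2, h3⟩
  rw [ht] at h3
  have h4 : oscWt b.bos = 0 := by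
    have : ((oscWt b.bos : ℕ) : ℝ) = oscWt (bare m : State N d).bos := by
      simp only [show (bare m : State N d).charge = m from rfl] at h3
      linarith
    rw [show oscWt (bare m : State N d).bos = 0 from sum_zero_index] at this
    exact_mod_cast this
  exact State.ext (oscWt_eq_zero h4) h2 h1

lemma vertexMode_eq_zero (l m : Charge d) (t : ℤ)
    (ht : t < I.pair l m) : I.vertexMode l t (ket (bare m)) = 0 := by
  have h := I.vertexMode_mem l t (bare m)
  by_contra hc
  obtain ⟨b, -, -, h3⟩ := exists_of_mem_span_ket h hc
  rw [show oscWt (bare m : State N d).bos = 0 from sum_zero_index] at h3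
  simp only [show (bare m : State N d).charge = m from rfl] at h3
  have : (0 : ℝ) ≤ oscWt b.bos := Nat.cast_nonneg _
  push_cast at h3
  linarith

lemma vertexMode_chargeMul (l : Charge d) (t : ℤ) (f : Charge d → ℂ)
    (x : Fock N d) : chargeMul f (I.vertexMode l t x) =
      I.vertexMode l t (chargeMul (fun m => f (l + m)) x) :=
  chargeMul_comm_of_charge l (fun b => span_mono (Set.image_mono fun _ h => h.1)
    (I.vertexMode_mem l t b)) f x

end LatticeInput

namespace LatticeInput

/-! ## The reflected theory -/

variable {N d : ℕ} {I : LatticeInput N d}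

/-- The fermion parity. -/
def fermParity : Op N d := onBasis fun b => (-1 : ℂ) ^ b.ferm.card • ket b

lemma fermParity_ket (b : State N d) : fermParity (ket b) = (-1 : ℂ) ^ b.ferm.card • ket b :=
  onBasis_ket _ _

lemma fermParity_comm_of_card {A : Op N d} (q : ℕ)
    (hA : ∀ b, A (ket b) ∈ span ℂ (ket '' {b' : State N d |
      (-1 : ℂ) ^ b'.ferm.card = (-1) ^ (q + b.ferm.card)})) (x : Fock N d) :
    fermParity (A x) = (-1 : ℂ) ^ q • A (fermParity x) := by
  rw [← lcomp, ← lcomp, ← lsmul]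
  congr 1
  refine fock_ext fun b => ?_
  rw [lcomp, lsmul, lcomp, fermParity_ket, map_smul, smul_smul, ← pow_add]
  have : ∀ y ∈ span ℂ (ket '' {b' : State N d |
      (-1 : ℂ) ^ b'.ferm.card = (-1) ^ (q + b.ferm.card)}),
      fermParity y = (-1 : ℂ) ^ (q + b.ferm.card) • y := by
    intro y hy
    induction hy using span_induction with
    | mem y h =>
      grind [fermParity_ket]
    | zero => simp
    | add y z _ _ hy hz => rw [map_add, hy, hz, smul_add]
    | smul c y _ hy => rw [map_smul, hy, smul_comm]
  exact this _ (hA b)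

lemma fermParity_vertexMode (I : LatticeInput N d) (l : Charge d) (t : ℤ) (x : Fock N d) :
    fermParity (I.vertexMode l t x) = I.vertexMode l t (fermParity x) := by
  have := fermParity_comm_of_card (A := I.vertexMode l t) 0 (fun b =>
    span_mono (Set.image_mono fun b' h => ?_) (I.vertexMode_mem l t b)) x
  · rwa [pow_zero, one_smul] at this
  · simp only [Set.mem_ofPred_eq] at h ⊢
    rw [h.2.1, zero_add]

lemma fermParity_chargeMul (f : Charge d → ℂ) (x : Fock N d) :
    fermParity (chargeMul f x) = chargeMul f (fermParity x) := by
  rw [← lcomp, ← lcomp]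
  congr 1
  refine fock_ext fun b => ?_
  simp only [lcomp, chargeMul_ket, fermParity_ket, map_smul]
  rw [smul_comm]

lemma fermParity_bosMode (I : LatticeInput N d) (i : Fin N) (n : ℤ) (x : Fock N d) :
    fermParity (I.bosMode i n x) = I.bosMode i n (fermParity x) := by
  rw [← lcomp, ← lcomp]
  congr 1
  refine fock_ext fun b => ?_
  simp only [lcomp, fermParity_ket, map_smul]
  rcases n with k | _ | k
  · rw [show I.bosMode i (Int.ofNat k) = bosCreate i k from rfl, bosCreate_ket, fermParity_ket]
  · rw [show I.bosMode i (negSucc 0) = I.bosAnnihilate i 0 from rfl, bosAnnihilate_zero_ket,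
      map_smul, fermParity_ket, smul_comm]
  · rw [show I.bosMode i (negSucc (k + 1)) = I.bosAnnihilate i (k + 1) from rfl,
      bosAnnihilate_succ_ket, map_smul, fermParity_ket, smul_comm]

lemma fermParity_fermMode (i : Fin N) (n : ℤ) (x : Fock N d) :
    fermParity (fermMode i n x) = (-1 : ℂ) • fermMode i n (fermParity x) := by
  have := fermParity_comm_of_card (A := fermMode (d := d) i n) 1 (fun b => ?_) x
  · rwa [pow_one] at this
  · rcases n with k | k
    · rw [show fermMode i (Int.ofNat k) = fermCreate i k from rfl, fermCreate_ket]
      split_ifs with h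
      · exact szero _
      · refine smul_mem _ _ (subset_span ⟨_, ?_, rfl⟩)
        simp only [Set.mem_ofPred_eq]
        rw [Finset.card_insert_of_notMem h, add_comm]
    · rw [show fermMode i (negSucc k) = fermAnnihilate i k from rfl, fermAnnihilate_ket]
      split_ifs with h
      · refine smul_mem _ _ (subset_span ⟨_, ?_, rfl⟩)
        simp only [Set.mem_ofPred_eq]
        rw [← Finset.card_erase_add_one h, ← add_assoc, add_comm 1, add_assoc, pow_add]
        norm_num
      · exact szero _

/-- The reflected field of a basis state; `κ` readjusts the cocycles. -/
def stateMode (I : LatticeInput N d) (κ : Cocycle d) (b : State N d) (t : ℤ) : Op N d :=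
  refl (I.stateField b) t ∘ₗ chargeMul (κ b.charge)

/-- The modes of the vertex operator of charge `l` with the cocycle `ε(l, ·)`. -/
def twistedMode (I : LatticeInput N d) (ε : Cocycle d) (l : Charge d) (t : ℤ) : Op N d :=
  I.vertexMode l t ∘ₗ chargeMul (ε l)

lemma twistedMode_truncated (hI : I.Integral)
    (ε : Cocycle d) (l : Charge d) : Truncated (I.twistedMode ε l) := fun x =>
  vertexMode_truncated hI l (chargeMul (ε l) x)

lemma refl_chargeMul_truncated {B : ℝ × ℝ → Op N d} (hB : Reflectable B)
    (f : Charge d → ℂ) : Truncated fun t => refl B t ∘ₗ chargeMul f := fun x =>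
  hB.truncated (chargeMul f x)

/-- The cocycle of `I` readjusted by `κ`. -/
abbrev twist (I : LatticeInput N d) (κ : Cocycle d) : Cocycle d := fun l m => I.cocycle l m * κ l m

lemma stateMode_induction (hI : I.Integral) (κ : Cocycle d) (P : ℕ → (Modes (Fock N d)) → Prop)
    (b : State N d)
    (h0 : P 0 (I.twistedMode (I.twist κ) b.charge))
    (hf : ∀ i n q A C, Truncated A → P q A →
      IsNop (divDeriv n (fermMode i)) A ((-1) ^ q) C → P (q + 1) C)
    (hb : ∀ i n q A C, Truncated A → P q A → IsNop (divDeriv n (I.bosMode i)) A 1 C → P q C) :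
    P b.ferm.card (I.stateMode κ b) := by
  have key : ∀ L : List (Osc N), P L.length fun t =>
      refl (I.fermField b.charge L) t ∘ₗ chargeMul (κ b.charge) := by
    intro L
    induction L with
    | nil =>
      have e : I.twistedMode (I.twist κ) b.charge = fun t =>
          refl (I.fermField b.charge []) t ∘ₗ chargeMul (κ b.charge) := by
        funext t
        refine lext fun x => ?_
        simp only [fermField, lcomp, twistedMode]
        rw [refl_vertexOp, chargeMul_chargeMul]
      rwa [e] at h0
    | cons m L ih =>
      refine hf m.idx m.lvl L.length _ _
        (refl_chargeMul_truncated (fermField_reflectable hI b.charge L) _) ih ?_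
      refine IsNop.comp (isNop_refl (fermField_reflectable hI b.charge L) (fermMode m.idx)
        (fun k => fermMode_natCast _ k) (fun k => fermMode_neg _ k)
        (fermAnnihilate_eventually m.idx)) _ fun t x => ?_
      rw [divDeriv, lsmul, lsmul, fermMode_chargeMul, map_smul]
  have key' : ∀ L : List (Osc N), P b.ferm.card fun t =>
      refl (I.bosField (I.fermField b.charge (b.ferm.sort (· ≤ ·))) L) t ∘ₗ
        chargeMul (κ b.charge) := by
    intro L
    induction L with
    | nil => simpa [bosField] using key (b.ferm.sort (· ≤ ·))
    | cons m L ih =>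
      have hR := bosField_reflectable I (fermField_reflectable hI b.charge (b.ferm.sort (· ≤ ·))) L
      refine hb m.idx m.lvl b.ferm.card _ _ (refl_chargeMul_truncated hR _) ih ?_
      refine IsNop.comp (isNop_refl hR (I.bosMode m.idx)
        (fun k => bosMode_natCast _ _ k) (fun k => bosMode_neg _ _ k)
        (I.bosAnnihilate_eventually m.idx)) _ fun t x => ?_
      rw [divDeriv, lsmul, lsmul, bosMode_chargeMul, map_smul]
  exact key' _

/-! ### Locality -/

lemma bosMode_local (I : LatticeInput N d) (i j : Fin N) :
    LocalFields (I.bosMode i) (I.bosMode j) 1 := by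
  refine ⟨2, fun x => ?_⟩
  ext1 a
  ext1 b
  simp only [pow_two, emul, zwMul, LinearMap.coe_mk, AddHom.coe_mk, one_smul,
    I.bosMode_comm i j, add_sub_cancel_left, pzero]
  have e1 : a - 1 - 1 + b + 2 = a + b := by ring
  have e2 : a - 1 + (b - 1) + 2 = a + b := by ring
  have e3 : a + (b - 1 - 1) + 2 = a + b := by ring
  rw [e1, e2, e3]
  split_ifs
  · rw [← sub_smul, ← sub_smul, ← sub_smul]
    push_cast
    convert zero_smul ℂ x
    ring
  · simp

lemma fermMode_local (i j : Fin N) : LocalFields (fermMode (d := d) i) (fermMode j) (-1) := by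
  refine ⟨1, fun x => ?_⟩
  ext1 a
  ext1 b
  simp only [pow_one, zwMul, LinearMap.coe_mk, AddHom.coe_mk, neg_smul, one_smul, sub_neg_eq_add,
    fermMode_anticomm i j, pzero]
  have e1 : a - 1 + b + 1 = a + b := by ring
  have e2 : a + (b - 1) + 1 = a + b := by ring
  rw [e1, e2]
  abel

lemma bosMode_fermMode_local (I : LatticeInput N d) (i j : Fin N) :
    LocalFields (I.bosMode i) (fermMode j) 1 := by
  refine ⟨0, fun x => ?_⟩
  ext1 a
  ext1 b
  simp only [pow_zero, Module.End.one_apply, one_smul, bosMode_fermMode_comm, sub_self, pzero]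

lemma bosMode_twistedMode (hI : I.Integral)
    (ε : Cocycle d) (l : Charge d) (i : Fin N) (n t : ℤ) (x : Fock N d) :
    I.bosMode i n (I.twistedMode ε l t x) = I.twistedMode ε l t (I.bosMode i n x) +
      (I.momentum l i : ℂ) • I.twistedMode ε l (t + n + 1) x := by
  simp_all [twistedMode, bosMode_vertexMode, bosMode_chargeMul]

lemma fermMode_twistedMode (hI : I.Integral)
    (ε : Cocycle d) (l : Charge d) (i : Fin N) (n t : ℤ) (x : Fock N d) :
    fermMode i n (I.twistedMode ε l t x) = I.twistedMode ε l t (fermMode i n x) := by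
  simp_all [twistedMode, fermMode_vertexMode, fermMode_chargeMul]

lemma bosMode_twistedMode_local (hI : I.Integral) (ε : Cocycle d) (l : Charge d) (i : Fin N) :
    LocalFields (I.bosMode i) (I.twistedMode ε l) 1 := by
  refine ⟨1, fun x => ?_⟩
  ext1 a
  ext1 b
  simp only [pow_one, zwMul, LinearMap.coe_mk, AddHom.coe_mk, one_smul, bosMode_twistedMode hI,
    add_sub_cancel_left, pzero]
  rw [show b + (a - 1) + 1 = b - 1 + a + 1 by ring, sub_self]

lemma fermMode_twistedMode_local (hI : I.Integral) (ε : Cocycle d) (l : Charge d) (i : Fin N) :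
    LocalFields (fermMode i) (I.twistedMode ε l) 1 := by
  refine ⟨0, fun x => ?_⟩
  ext1 a
  ext1 b
  simp only [pow_zero, Module.End.one_apply, one_smul, fermMode_twistedMode hI, sub_self, pzero]

lemma neg_one_pow_mul_self (q : ℕ) : (-1 : ℂ) ^ q * (-1) ^ q = 1 := by
  rw [← mul_pow]
  norm_num

lemma stateMode_local_free (hI : I.Integral) (κ : Cocycle d) (b : State N d) :
    Truncated (I.stateMode κ b) ∧ (∀ i, LocalFields (I.bosMode i) (I.stateMode κ b) 1) ∧
      ∀ i, LocalFields (fermMode i) (I.stateMode κ b) ((-1) ^ b.ferm.card) := by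
  refine stateMode_induction hI κ (fun q A => Truncated A ∧
    (∀ i, LocalFields (I.bosMode i) A 1) ∧ ∀ i, LocalFields (fermMode i) A ((-1) ^ q)) b ?_ ?_ ?_
  · exact ⟨twistedMode_truncated hI _ _, bosMode_twistedMode_local hI _ _, by
      simpa using fermMode_twistedMode_local hI _ _⟩
  · rintro i n q A C hA ⟨-, h1, h2⟩ hC
    have hT := (fermMode_truncated (d := d) i).divDeriv n
    refine ⟨hC.isField hT hA, fun j => ?_, fun j => ?_⟩
    · have := LocalFields.nop hT hA hC ((h2 i).divDeriv n)
        (((bosMode_fermMode_local I j i).symm (one_mul 1)).divDeriv n) ((h1 j).symm (one_mul 1))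
      rw [one_mul] at this
      exact this.symm (one_mul 1)
    · have := LocalFields.nop hT hA hC ((h2 i).divDeriv n) ((fermMode_local i j).divDeriv n)
        ((h2 j).symm (neg_one_pow_mul_self q))
      rw [pow_succ']
      exact this.symm (by rw [← pow_succ']; exact neg_one_pow_mul_self _)
  · rintro i n q A C hA ⟨-, h1, h2⟩ hC
    have hT := (I.bosMode_truncated i).divDeriv n
    refine ⟨hC.isField hT hA, fun j => ?_, fun j => ?_⟩
    · have := LocalFields.nop hT hA hC ((h1 i).divDeriv n) ((bosMode_local I i j).divDeriv n)
        ((h1 j).symm (one_mul 1))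
      rw [one_mul] at this
      exact this.symm (one_mul 1)
    · have := LocalFields.nop hT hA hC ((h1 i).divDeriv n)
        ((bosMode_fermMode_local I i j).divDeriv n) ((h2 j).symm (neg_one_pow_mul_self q))
      rw [one_mul] at this
      exact this.symm (neg_one_pow_mul_self q)

lemma stateMode_local (hI : I.Integral)
    (κ : Cocycle d) (b : State N d) (p : ℕ) {C : Modes (Fock N d)}
    (hb : ∀ i, LocalFields (I.bosMode i) C 1)
    (hf : ∀ i, LocalFields (fermMode i) C ((-1) ^ p))
    (hE : LocalFields (I.twistedMode (I.twist κ) b.charge) C 1) :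
    LocalFields (I.stateMode κ b) C ((-1) ^ (p * b.ferm.card)) := by
  refine (stateMode_induction hI κ (fun q A => ((∀ i, LocalFields (I.bosMode i) A 1) ∧
    ∀ i, LocalFields (fermMode i) A ((-1) ^ q)) ∧ LocalFields A C ((-1) ^ (p * q))) b ?_ ?_ ?_).2
  · exact ⟨⟨bosMode_twistedMode_local hI _ _, by
      simpa using fermMode_twistedMode_local hI _ _⟩, by simpa using hE⟩
  · rintro i n q A C' hA ⟨⟨h1, h2⟩, h3⟩ hC
    have hT := (fermMode_truncated (d := d) i).divDeriv n
    refine ⟨⟨fun j => ?_, fun j => ?_⟩, ?_⟩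
    · have := LocalFields.nop hT hA hC ((h2 i).divDeriv n)
        (((bosMode_fermMode_local I j i).symm (one_mul 1)).divDeriv n) ((h1 j).symm (one_mul 1))
      rw [one_mul] at this
      exact this.symm (one_mul 1)
    · have := LocalFields.nop hT hA hC ((h2 i).divDeriv n) ((fermMode_local i j).divDeriv n)
        ((h2 j).symm (neg_one_pow_mul_self q))
      rw [pow_succ']
      exact this.symm (by rw [← pow_succ']; exact neg_one_pow_mul_self _)
    · have := LocalFields.nop hT hA hC ((h2 i).divDeriv n) ((hf i).divDeriv n) h3
      rwa [← pow_add, show p + p * q = p * (q + 1) by ring] at this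
  · rintro i n q A C' hA ⟨⟨h1, h2⟩, h3⟩ hC
    have hT := (I.bosMode_truncated i).divDeriv n
    refine ⟨⟨fun j => ?_, fun j => ?_⟩, ?_⟩
    · have := LocalFields.nop hT hA hC ((h1 i).divDeriv n) ((bosMode_local I i j).divDeriv n)
        ((h1 j).symm (one_mul 1))
      rw [one_mul] at this
      exact this.symm (one_mul 1)
    · have := LocalFields.nop hT hA hC ((h1 i).divDeriv n)
        ((bosMode_fermMode_local I i j).divDeriv n) ((h2 j).symm (neg_one_pow_mul_self q))
      rw [one_mul] at this
      exact this.symm (neg_one_pow_mul_self q)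
    · have := LocalFields.nop hT hA hC ((h1 i).divDeriv n) ((hb i).divDeriv n) h3
      rwa [one_mul] at this

lemma stateMode_parity (hI : I.Integral) (κ : Cocycle d) (b : State N d) (n : ℤ) (x : Fock N d) :
    fermParity (I.stateMode κ b n x) =
      (-1 : ℂ) ^ b.ferm.card • I.stateMode κ b n (fermParity x) := by
  refine stateMode_induction hI κ (fun q A => ∀ n x,
    fermParity (A n x) = (-1 : ℂ) ^ q • A n (fermParity x)) b ?_ ?_ ?_ n x
  · simp [twistedMode, fermParity_vertexMode, fermParity_chargeMul, one_smul]
  · intro i n q A C hA h hC t x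
    rw [pow_succ']
    refine hC.parity ((fermMode_truncated i).divDeriv n) hA _ _ _ (fun t x => ?_) h t x
    rw [divDeriv, lsmul, lsmul, map_smul, fermParity_fermMode, smul_comm]
  · intro i n q A C hA h hC t x
    rw [← one_mul ((-1 : ℂ) ^ q)]
    refine hC.parity ((I.bosMode_truncated i).divDeriv n) hA _ _ _ (fun t x => ?_) h t x
    rw [divDeriv, lsmul, lsmul, map_smul, fermParity_bosMode, one_smul]

lemma stateMode_isTC (hI : I.Integral) (κ : Cocycle d) (b : State N d) {T : Op N d}
    (hb : ∀ i, IsTC T (I.bosMode i)) (hf : ∀ i, IsTC T (fermMode i))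
    (hE : IsTC T (I.twistedMode (I.twist κ) b.charge)) :
    IsTC T (I.stateMode κ b) :=
  stateMode_induction hI κ (fun _ A => IsTC T A) b hE
    (fun i n _ _ _ hA h hC =>
      IsTC.nop ((fermMode_truncated i).divDeriv n) hA hC ((hf i).divDeriv n) h)
    (fun i n _ _ _ hA h hC =>
      IsTC.nop ((I.bosMode_truncated i).divDeriv n) hA hC ((hb i).divDeriv n) h)

/-! ### Creation -/

lemma Creates.divDeriv_of_field {A : Modes (Fock N d)} {vac : Fock N d}
    (h : ∀ t < 0, A t vac = 0) (n : ℕ) : Creates (divDeriv n A) vac (A n vac) := by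
  refine ⟨fun t ht => ?_, ?_⟩
  · rw [divDeriv, lsmul]
    by_cases h' : t + n < 0
    · rw [h _ h', smul_zero]
    · obtain ⟨k, hk⟩ := eq_ofNat_of_zero_le (not_lt.1 h')
      rw [hk, choose_natCast, Nat.choose_eq_zero_of_lt (by omega)]
      simp
  · rw [divDeriv, zero_add, choose_natCast]
    simp

lemma cocycle_zero_right (I : LatticeInput N d) (l : Charge d) : I.cocycle l 0 = 1 := by
  simp [cocycle]

lemma cocycle_zero_left (I : LatticeInput N d) (l : Charge d) : I.cocycle 0 l = 1 := by
  simp [cocycle]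

lemma pair_zero_right (I : LatticeInput N d) (l : Charge d) : I.pair l 0 = 0 := by
  simp [pair, momentum_zero]

lemma pair_zero_left (I : LatticeInput N d) (l : Charge d) : I.pair 0 l = 0 := by
  simp [pair, momentum_zero]

lemma vacuum_eq_bare : (vacuum : Fock N d) = ket (bare 0) := rfl

lemma vertexMode_creates (hI : I.Integral) (l : Charge d) :
    Creates (I.vertexMode l) vacuum (ket (bare l)) := by
  refine ⟨fun t ht => ?_, ?_⟩
  · rw [vacuum_eq_bare]
    refine vertexMode_eq_zero _ _ _ _ ?_
    rw [pair_zero_right]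
    exact_mod_cast ht
  · rw [vacuum_eq_bare, vertexMode_lead hI l 0 0 (by rw [pair_zero_right]; simp), add_zero]

lemma fermMode_vacuum (i : Fin N) (t : ℤ) (ht : t < 0) : fermMode i t (vacuum : Fock N d) = 0 := by
  obtain ⟨k, hk⟩ := eq_ofNat_of_zero_le (show 0 ≤ -1 - t by omega)
  rw [show t = -1 - (k : ℤ) by omega, fermMode_neg, vacuum_eq_bare, fermAnnihilate_bare]

lemma bosMode_vacuum (I : LatticeInput N d) (i : Fin N) (t : ℤ) (ht : t < 0) :
    I.bosMode i t (vacuum : Fock N d) = 0 := by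
  obtain ⟨k, hk⟩ := eq_ofNat_of_zero_le (show 0 ≤ -1 - t by omega)
  rw [show t = -1 - (k : ℤ) by omega, bosMode_neg, vacuum_eq_bare]
  rcases k with _ | k
  · rw [bosAnnihilate_zero_ket]
    simp [bare, momentum_zero]
  · rw [bosAnnihilate_succ_bare]

lemma fermField_creates (hI : I.Integral) (l : Charge d) :
    ∀ L : List (Osc N), L.Pairwise (· < ·) → Creates (refl (I.fermField l L)) vacuum
      (ket { bos := 0, ferm := L.toFinset, charge := l })
  | [], _ => by
    have h := vertexMode_creates hI l
    have e : ∀ t, refl (I.vertexOp l) t vacuum = I.vertexMode l t vacuum := fun t => by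
      rw [refl_vertexOp, vacuum_eq_bare, chargeMul_ket,
        show (bare 0 : State N d).charge = 0 from rfl, cocycle_zero_right, one_smul]
    refine ⟨fun t ht => ?_, ?_⟩
    · rw [fermField, e, h.1 t ht]
    · rw [fermField, e, h.2]
      rfl
  | m :: L, hL => by
    rw [List.pairwise_cons] at hL
    have ih := fermField_creates hI l L hL.2
    have h1 := isNop_refl (right := I.isRight m.idx) (n := m.lvl) (s := (-1) ^ L.length)
      (fermField_reflectable hI l L) (fermMode m.idx) (fun k => fermMode_natCast _ k)
      (fun k => fermMode_neg _ k) (fermAnnihilate_eventually m.idx)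
    have h2 := h1.creates (Creates.divDeriv_of_field (fermMode_vacuum m.idx) m.lvl) ih
    have h3 : divDeriv m.lvl (fermMode m.idx) 0
        (ket { bos := 0, ferm := L.toFinset, charge := l } : Fock N d) =
        ket { bos := 0, ferm := (m :: L).toFinset, charge := l } := by
      have hm : m ∉ L.toFinset := fun h => lt_irrefl _ (hL.1 m (List.mem_toFinset.1 h))
      rw [divDeriv, zero_add, choose_natCast, Nat.choose_self, lsmul,
        fermMode_natCast, fermCreate_ket, show (toLex (m.idx, m.lvl) : Osc N) = m from rfl,
        if_neg hm, fermSign, Finset.filter_eq_empty_iff.2, List.toFinset_cons]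
      · simp
      · intro m' hm'
        exact not_lt.2 (hL.1 m' (List.mem_toFinset.1 hm')).le
    rw [h3] at h2
    exact h2

lemma bosField_creates {B : ℝ × ℝ → Op N d} (hB : Reflectable B) {F : Finset (Osc N)} {l : Charge d}
    (h : Creates (refl B) vacuum (ket { bos := 0, ferm := F, charge := l })) :
    ∀ L : List (Osc N), Creates (refl (I.bosField B L)) vacuum
      (ket { bos := toFinsupp (L : Multiset (Osc N)), ferm := F, charge := l })
  | [] => by simpa [bosField] using h
  | m :: L => by
    have h1 := isNop_refl (right := I.isRight m.idx) (n := m.lvl) (s := 1)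
      (bosField_reflectable I hB L) (I.bosMode m.idx) (fun k => bosMode_natCast _ _ k)
      (fun k => bosMode_neg _ _ k) (I.bosAnnihilate_eventually m.idx)
    have h2 := h1.creates (Creates.divDeriv_of_field (I.bosMode_vacuum m.idx) m.lvl)
      (bosField_creates hB h L)
    have h3 : divDeriv m.lvl (I.bosMode m.idx) 0 (ket ⟨toFinsupp ↑L, F, l⟩ : Fock N d) =
        ket ⟨toFinsupp ↑(m :: L), F, l⟩ := by
      rw [divDeriv, zero_add, choose_natCast, Nat.choose_self, lsmul,
        bosMode_natCast, bosCreate_ket, show (toLex (m.idx, m.lvl) : Osc N) = m from rfl,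
        ← Multiset.cons_coe, ← Multiset.singleton_add, map_add, Multiset.toFinsupp_singleton,
        add_comm]
      simp
    rw [h3] at h2
    exact h2

lemma stateMode_creates (hI : I.Integral) (κ : Cocycle d) (b : State N d) :
    Creates (I.stateMode κ b) vacuum (κ b.charge 0 • ket b) := by
  have h := bosField_creates (I := I) (fermField_reflectable hI b.charge (b.ferm.sort (· ≤ ·)))
    (fermField_creates hI b.charge (b.ferm.sort (· ≤ ·)) b.ferm.sortedLT_sort.pairwise)
    (b.bos.toMultiset.sort (· ≤ ·))
  rw [Multiset.sort_eq, Finsupp.toMultiset_toFinsupp, Finset.sort_toFinset] at h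
  have e : ∀ t, I.stateMode κ b t vacuum = κ b.charge 0 • refl (I.stateField b) t vacuum :=
    fun t => by
      rw [stateMode, lcomp, vacuum_eq_bare, chargeMul_ket, map_smul]
      rfl
  refine ⟨fun t ht => ?_, ?_⟩
  · rw [e, stateField, h.1 t ht, smul_zero]
  · rw [e, stateField, h.2]

end LatticeInput

namespace LatticeInput

/-! ## The stress field -/

variable {N d : ℕ} {I : LatticeInput N d}

lemma sum_range_ite_add {M : Type*} [AddCommMonoid M] (p : ℤ) (v : M) {K : ℕ} (hK : p.natAbs < K) :
    ∑ j ∈ range K, ((if (j : ℤ) = p then v else 0) + if (j : ℤ) = -1 - p then v else 0) = v := by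
  rw [Finset.sum_eq_single_of_mem (if 0 ≤ p then p.toNat else (-1 - p).toNat)
    (mem_range.2 (by split_ifs <;> omega))]
  · split_ifs <;> first | omega | simp
  · intro j _ hj
    rw [if_neg, if_neg, add_zero] <;> (split_ifs at hj <;> omega)

lemma isNop_commutator {V : Type*} [AddCommGroup V] [Module ℂ V] {A B C : Modes V}
    {s : ℂ} (hC : IsNop A B s C) (hA : Truncated A) (hB : Truncated B) (X : V →ₗ[ℂ] V) (e e' a b : ℂ)
    (k₀ k₁ : ℤ) (h1 : ∀ k x, A k (X x) = e • X (A k x) + (if k = k₀ then a else 0) • x)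
    (h2 : ∀ k x, B k (X x) = e' • X (B k x) + (if k = k₁ then b else 0) • x)
    (ha : e' * a = s * a) (hb : s * e * b = b) (t : ℤ) (x : V) :
    C t (X x) = (e * e') • X (C t x) + (s * a) • B (t - k₀) x + b • A (t - k₁) x := by
  obtain ⟨K₁, e1⟩ := hC.eq_range hA hB t x
  obtain ⟨K₂, e2⟩ := hC.eq_range hA hB t (X x)
  have hK : ∃ K, K₁ ≤ K ∧ K₂ ≤ K ∧ k₀.natAbs < K ∧ (t - k₁).natAbs < K :=
    ⟨K₁ + K₂ + k₀.natAbs + (t - k₁).natAbs + 1, by omega⟩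
  obtain ⟨K, i1, i2, i3, i4⟩ := hK
  rw [e1 K i1, e2 K i2, map_sum, smul_sum]
  conv_rhs => rw [← sum_range_ite_add k₀ (_ • B _ x) i3, ← sum_range_ite_add (t - k₁) (b • A _ x) i4]
  rw [← sum_add_distrib, ← sum_add_distrib]
  refine sum_congr rfl fun j _ => ?_
  have c1 : A j (B (t - j) (X x)) = (e * e') • X (A j (B (t - j) x)) +
      (if (j : ℤ) = k₀ then (s * a) • B (t - k₀) x else 0) +
      (if (j : ℤ) = t - k₁ then b • A (t - k₁) x else 0) := by
    rw [h2, map_add, map_smul, map_smul, h1, smul_add, smul_smul, mul_comm e', smul_smul, ← ha]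
    congr 1
    · congr 1
      split_ifs with h
      · rw [h]
      · simp
    · split_ifs <;> first | omega | simp_all
  have c2 : s • B (t + 1 + j) (A (-1 - j) (X x)) =
      (e * e') • X (s • B (t + 1 + j) (A (-1 - j) x)) +
      (if (j : ℤ) = -1 - k₀ then (s * a) • B (t - k₀) x else 0) +
      (if (j : ℤ) = -1 - (t - k₁) then b • A (t - k₁) x else 0) := by
    rw [h1, map_add, map_smul, map_smul, h2, smul_add, smul_add, smul_add, smul_smul, smul_smul,
      smul_smul, smul_smul, smul_smul, map_smul, smul_smul, add_right_comm]
    congr 1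
    · congr 1
      · congr 1
        ring
      · split_ifs <;> first | omega | simp [*]
        rw [show t + 1 + (-1 - k₀) = t - k₀ by ring]
    · split_ifs <;> first | omega | simp [*]
  rw [c1, c2, map_add, smul_add]
  abel

/-- `ω` is the sum of the normally ordered products `½ :a^i a^i: + ½ :∂ψ^i ψ^i:`. -/
def IsStress (I : LatticeInput N d) (ω : Modes (Fock N d)) : Prop :=
  ∃ P Q : Fin N → Modes (Fock N d),
    (∀ i, IsNop (I.bosMode i) (I.bosMode i) 1 (P i)) ∧
    (∀ i, IsNop (fermMode i) (divDeriv 1 (fermMode i)) (-1) (Q i)) ∧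
    ∀ t x, ω t x = ∑ i, (1 / 2 : ℂ) • (P i t x - Q i t x)

lemma divDeriv_one (A : Modes (Fock N d)) (t : ℤ) (x : Fock N d) :
    divDeriv 1 A t x = ((t + 1 : ℤ) : ℂ) • A (t + 1) x := by
  simp [divDeriv]

lemma IsStress.bos {ω : Modes (Fock N d)}
    (h : I.IsStress ω) (t : ℤ) (i : Fin N) (n : ℤ) (x : Fock N d) :
    ω t (I.bosMode i n x) = I.bosMode i n (ω t x) +
      ((n + 1 : ℤ) : ℂ) • I.bosMode i (t + n + 2) x := by
  obtain ⟨P, Q, hP, hQ, hω⟩ := h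
  have c1 : ∀ j, P j t (I.bosMode i n x) = I.bosMode i n (P j t x) +
      if j = i then ((2 * (n + 1) : ℤ) : ℂ) • I.bosMode i (t + n + 2) x else 0 := by
    intro j
    have hc : ∀ (k : ℤ) (y : Fock N d), I.bosMode j k (I.bosMode i n y) =
        (1 : ℂ) • I.bosMode i n (I.bosMode j k y) +
        (if k = -n - 2 then (if j = i then ((n + 1 : ℤ) : ℂ) else 0) else 0) • y := by
      intro k y
      rw [I.bosMode_comm j i, one_smul]
      congr 2
      by_cases h1 : k = -n - 2
      · by_cases h2 : j = i
        · rw [if_pos ⟨h2, by omega⟩, if_pos h1, if_pos h2, h1]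
          push_cast
          ring
        · rw [if_neg (fun h => h2 h.1), if_pos h1, if_neg h2]
      · rw [if_neg (fun h => h1 (by omega)), if_neg h1]
    have := isNop_commutator (hP j) (I.bosMode_truncated j) (I.bosMode_truncated j) (I.bosMode i n)
      1 1 _ _ _ _ hc hc (by ring) (by ring) t x
    rw [this, show t - (-n - 2) = t + n + 2 by ring]
    split_ifs with h
    · subst h
      rw [one_mul, one_mul, one_smul, add_assoc, ← add_smul]
      push_cast
      congr 2
      ring
    · simp
  have c2 : ∀ j, Q j t (I.bosMode i n x) = I.bosMode i n (Q j t x) := by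
    intro j
    have := isNop_commutator (hQ j) (fermMode_truncated j) ((fermMode_truncated j).divDeriv 1)
      (I.bosMode i n) 1 1 0 0 0 0 (fun k y => by rw [bosMode_fermMode_comm]; simp)
      (fun k y => by rw [divDeriv_one, divDeriv_one, map_smul, bosMode_fermMode_comm]; simp)
      (by ring) (by ring) t x
    simpa using this
  simp only [hω, c1, c2, map_sum, map_smul, map_sub]
  rw [← sub_eq_iff_eq_add', ← sum_sub_distrib, sum_eq_single i]
  · rw [if_pos rfl, ← smul_sub, add_sub_right_comm, add_sub_cancel_left, smul_smul]
    push_cast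
    congr 1
    ring
  · intro j _ hj
    rw [if_neg hj]
    simp
  · intro h
    exact absurd (mem_univ i) h

lemma IsStress.ferm {ω : Modes (Fock N d)}
    (h : I.IsStress ω) (t : ℤ) (i : Fin N) (n : ℤ) (x : Fock N d) :
    ω t (fermMode i n x) = fermMode i n (ω t x) +
      ((t + 2 * n + 3 : ℤ) / 2 : ℂ) • fermMode i (t + n + 2) x := by
  obtain ⟨P, Q, hP, hQ, hω⟩ := h
  have c1 : ∀ j, P j t (fermMode i n x) = fermMode i n (P j t x) := by
    intro j
    have := isNop_commutator (hP j) (I.bosMode_truncated j) (I.bosMode_truncated j)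
      (fermMode i n) 1 1 0 0 0 0 (fun k y => by rw [bosMode_fermMode_comm]; simp)
      (fun k y => by rw [bosMode_fermMode_comm]; simp) (by ring) (by ring) t x
    simpa using this
  have c2 : ∀ j, Q j t (fermMode i n x) = fermMode i n (Q j t x) -
      if j = i then ((t + 2 * n + 3 : ℤ) : ℂ) • fermMode i (t + n + 2) x else 0 := by
    intro j
    have hc : ∀ (k : ℤ) (y : Fock N d), fermMode j k (fermMode i n y) =
        (-1 : ℂ) • fermMode i n (fermMode j k y) +
        (if k = -n - 1 then (if j = i then (1 : ℂ) else 0) else 0) • y := by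
      intro k y
      rw [fermMode_anticomm j i, neg_one_smul]
      congr 2
      by_cases h1 : k = -n - 1
      · grind
      · rw [if_neg (fun h => h1 (by omega)), if_neg h1]
    have hc' : ∀ (k : ℤ) (y : Fock N d), divDeriv 1 (fermMode j) k
        (fermMode i n y) =
        (-1 : ℂ) • fermMode i n (divDeriv 1 (fermMode j) k y) +
        (if k = -n - 2 then (if j = i then (-(n + 1) : ℂ) else 0) else 0) • y := by
      intro k y
      rw [divDeriv_one, divDeriv_one, hc, smul_add, map_smul, smul_comm, smul_smul ((k + 1 : ℤ) : ℂ) _ y]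
      congr 2
      by_cases h1 : k = -n - 2
      · rw [if_pos h1, if_pos (by omega)]
        split_ifs
        · rw [h1]
          push_cast
          ring
        · simp
      · rw [if_neg h1, if_neg (by omega), mul_zero]
    have := isNop_commutator (hQ j) (fermMode_truncated j) ((fermMode_truncated j).divDeriv 1)
      (fermMode i n) (-1) (-1) _ _ _ _ hc hc' (by ring) (by ring) t x
    rw [this, divDeriv_one, show t - (-n - 1) + 1 = t + n + 2 by ring,
      show t - (-n - 2) = t + n + 2 by ring]
    split_ifs with h
    · subst h
      rw [smul_smul, add_assoc, ← add_smul]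
      push_cast
      rw [show (-1 : ℂ) * -1 = 1 by ring, one_smul, sub_eq_add_neg, ← neg_smul]
      congr 2
      ring
    · simp
  simp only [hω, c1, c2, map_sum, map_smul, map_sub]
  rw [← sub_eq_iff_eq_add', ← sum_sub_distrib, sum_eq_single i]
  · rw [if_pos rfl, ← smul_sub, sub_sub_eq_add_sub, add_sub_right_comm, sub_sub_cancel_left]
    rw [neg_sub, sub_add_cancel, smul_smul]
    congr 1
    ring
  · intro j _ hj
    rw [if_neg hj]
    simp
  · intro h
    exact absurd (mem_univ i) h

/-! ### Matrix elements of the stress field -/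

lemma bosMode_coeff_bare (I : LatticeInput N d) (i : Fin N) (n : ℤ) (hn : 0 ≤ n) (x : Fock N d)
    (k : Charge d) : I.bosMode i n x (bare k) = 0 := by
  classical
  obtain ⟨n, rfl⟩ := eq_ofNat_of_zero_le hn
  rw [bosMode_natCast]
  induction x using fock_induction with
  | h0 => simp
  | hadd x y hx hy => rw [map_add, fadd, hx, hy, add_zero]
  | hket c b =>
    rw [map_smul, bosCreate_ket, fsmul, ket, fsingle, if_neg, smul_zero]
    intro h
    have := DFunLike.congr_fun (congrArg State.bos h) (toLex (i, n))
    simp [bare] at this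

lemma fermMode_coeff_bare (i : Fin N) (n : ℤ) (hn : 0 ≤ n) (x : Fock N d)
    (k : Charge d) : fermMode i n x (bare k) = 0 := by
  classical
  obtain ⟨n, rfl⟩ := eq_ofNat_of_zero_le hn
  rw [fermMode_natCast]
  induction x using fock_induction with
  | h0 => simp
  | hadd x y hx hy => rw [map_add, fadd, hx, hy, add_zero]
  | hket c b =>
    rw [map_smul, fermCreate_ket]
    split_ifs
    · simp
    · simp [ket, if_neg, bare]

lemma bosMode_bare (I : LatticeInput N d) (i : Fin N) (n : ℤ) (hn : n < -1) (k : Charge d) :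
    I.bosMode i n (ket (bare k)) = 0 := by
  obtain ⟨m, hm⟩ := eq_ofNat_of_zero_le (show 0 ≤ -2 - n by omega)
  rw [show n = -1 - ((m + 1 : ℕ) : ℤ) by push_cast; omega, bosMode_neg, bosAnnihilate_succ_bare]

lemma bosMode_zero_bare (I : LatticeInput N d) (i : Fin N) (k : Charge d) :
    I.bosMode i (-1) (ket (bare k)) = (I.momentum k i : ℂ) • ket (bare k) :=
  I.bosAnnihilate_zero_ket i (bare k)

lemma fermMode_bare (i : Fin N) (n : ℤ) (hn : n < 0) (k : Charge d) :
    fermMode i n (ket (bare k)) = 0 := by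
  obtain ⟨m, hm⟩ := eq_ofNat_of_zero_le (show 0 ≤ -1 - n by omega)
  rw [show n = -1 - (m : ℤ) by omega, fermMode_neg, fermAnnihilate_bare]

lemma IsStress.coeff_bare {ω : Modes (Fock N d)}
    (h : I.IsStress ω) (t : ℤ) (ht : -1 ≤ t) (x : Fock N d) (k : Charge d) :
    ω t x (bare k) = 0 := by
  obtain ⟨P, Q, hP, hQ, hω⟩ := h
  set S : Submodule ℂ (Fock N d) := ker (lapply (bare k)) with hS
  have hb : ∀ i n y, 0 ≤ n → I.bosMode i n y ∈ S := fun i n y hn => by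
    rw [hS, mem_ker]
    exact I.bosMode_coeff_bare i n hn y k
  have hf : ∀ i n y, 0 ≤ n → fermMode i n y ∈ S := fun i n y hn => by
    rw [hS, mem_ker]
    exact fermMode_coeff_bare i n hn y k
  suffices ω t x ∈ S by rwa [hS, mem_ker] at this
  rw [hω]
  refine sum_mem fun i _ => smul_mem _ _ (sub_mem ?_ ?_)
  · rw [hP i t x]
    exact add_mem (finsum_mem_submodule _ fun j => hb _ _ _ (by omega))
      (smul_mem _ _ (finsum_mem_submodule _ fun j => hb _ _ _ (by omega)))
  · rw [hQ i t x]
    refine add_mem (finsum_mem_submodule _ fun j => hf _ _ _ (by omega))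
      (smul_mem _ _ (finsum_mem_submodule _ fun j => ?_))
    rw [divDeriv_one]
    exact smul_mem _ _ (hf _ _ _ (by omega))

lemma IsStress.bare_eq_zero {ω : Modes (Fock N d)}
    (h : I.IsStress ω) (t : ℤ) (ht : t < -2) (k : Charge d) : ω t (ket (bare k)) = 0 := by
  obtain ⟨P, Q, hP, hQ, hω⟩ := h
  rw [hω]
  refine sum_eq_zero fun i _ => ?_
  rw [hP i t, hQ i t]
  have h1 : ∀ j : ℕ, I.bosMode i j (I.bosMode i (t - j) (ket (bare k))) = 0 := fun j => by
    rw [bosMode_bare _ _ _ (by omega), map_zero]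
  have h2 : ∀ j : ℕ, I.bosMode i (t + 1 + j) (I.bosMode i (-1 - j) (ket (bare k))) = 0 := fun j => by
    rcases j with _ | j
    · rw [show -1 - ((0 : ℕ) : ℤ) = -1 by simp, bosMode_zero_bare, map_smul,
        bosMode_bare _ _ _ (by push_cast; omega), smul_zero]
    · simp [bosMode_bare]
  have h3 : ∀ j : ℕ, fermMode i j (divDeriv 1 (fermMode i) (t - j)
      (ket (bare k))) = 0 := fun j => by
    rw [divDeriv_one, fermMode_bare _ _ (by omega), smul_zero, map_zero]
  have h4 : ∀ j : ℕ, divDeriv 1 (fermMode i) (t + 1 + j)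
      (fermMode i (-1 - j) (ket (bare k))) = 0 := fun j => by
    rw [fermMode_bare _ _ (by omega), map_zero]
  simp only [h1, h2, h3, h4, finsum_zero, smul_zero, add_zero, sub_zero]

lemma IsStress.bare_zero {ω : Modes (Fock N d)} (h : I.IsStress ω) (k : Charge d) :
    ω (-2) (ket (bare k)) = ((I.pair k k / 2 : ℝ) : ℂ) • ket (bare k) := by
  obtain ⟨P, Q, hP, hQ, hω⟩ := h
  rw [hω]
  have key : ∀ i, (1 / 2 : ℂ) • (P i (-2) (ket (bare k)) - Q i (-2) (ket (bare k))) =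
      ((I.momentum k i * I.momentum k i / 2 : ℝ) : ℂ) • ket (bare k) := by
    intro i
    rw [hP i, hQ i]
    have h1 : ∀ j : ℕ, I.bosMode i j (I.bosMode i (-2 - j) (ket (bare k))) = 0 := fun j => by
      rw [bosMode_bare _ _ _ (by omega), map_zero]
    have h2 : ∀ j : ℕ, 1 ≤ j → I.bosMode i (-2 + 1 + j) (I.bosMode i (-1 - j) (ket (bare k))) = 0 :=
      fun j hj => by rw [bosMode_bare _ _ _ (by omega), map_zero]
    have h3 : ∀ j : ℕ, fermMode i j (divDeriv 1 (fermMode i) (-2 - j)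
        (ket (bare k))) = 0 := fun j => by
      rw [divDeriv_one, fermMode_bare _ _ (by omega), smul_zero, map_zero]
    have h4 : ∀ j : ℕ, divDeriv 1 (fermMode i) (-2 + 1 + j)
        (fermMode i (-1 - j) (ket (bare k))) = 0 := fun j => by
      rw [fermMode_bare _ _ (by omega), map_zero]
    rw [finsum_eq_range 1 h2]
    simp only [h1, h3, h4, finsum_zero, smul_zero, add_zero, sub_zero, zero_add, one_smul,
      Finset.sum_range_one, Nat.cast_zero]
    rw [bosMode_zero_bare, show (-2 : ℤ) + 1 = -1 by norm_num, map_smul, bosMode_zero_bare,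
      smul_smul, smul_smul]
    push_cast
    congr 1
    ring
  simp only [key]
  rw [← sum_smul, pair, sum_div]
  push_cast
  rfl

lemma IsStress.bare_neg {ω : Modes (Fock N d)} (h : I.IsStress ω) (n : ℕ) (k : Charge d) :
    ω (n - 1) (ket (bare k)) = ∑ i, ((I.momentum k i : ℂ) • I.bosMode i n (ket (bare k)) +
      (1 / 2 : ℂ) • ∑ j ∈ range n, I.bosMode i j (I.bosMode i (n - 1 - j) (ket (bare k))) -
      (1 / 2 : ℂ) • ∑ j ∈ range (n + 1), ((n - j : ℤ) : ℂ) •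
        fermMode i j (fermMode i (n - j) (ket (bare k)))) := by
  obtain ⟨P, Q, hP, hQ, hω⟩ := h
  rw [hω]
  refine sum_congr rfl fun i _ => ?_
  rw [hP i, hQ i]
  have h1 : ∀ j : ℕ, n + 1 ≤ j → I.bosMode i j (I.bosMode i (n - 1 - j) (ket (bare k))) = 0 :=
    fun j hj => by rw [bosMode_bare _ _ _ (by omega), map_zero]
  have h2 : ∀ j : ℕ, 1 ≤ j →
      I.bosMode i (n - 1 + 1 + j) (I.bosMode i (-1 - j) (ket (bare k))) = 0 :=
    fun j hj => by rw [bosMode_bare _ _ _ (by omega), map_zero]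
  have h3 : ∀ j : ℕ, n + 1 ≤ j → fermMode i j
      (divDeriv 1 (fermMode i) (n - 1 - j) (ket (bare k))) = 0 := fun j hj => by
    rw [divDeriv_one, fermMode_bare _ _ (by omega), smul_zero, map_zero]
  have h4 : ∀ j : ℕ, divDeriv 1 (fermMode i) (n - 1 + 1 + j)
      (fermMode i (-1 - j) (ket (bare k))) = 0 := fun j => by
    rw [fermMode_bare _ _ (by omega), map_zero]
  rw [finsum_eq_range 1 h2, finsum_eq_range _ h1, finsum_eq_range _ h3]
  simp only [h4, finsum_zero]
  simp only [smul_zero, add_zero, one_smul, Finset.sum_range_one, Nat.cast_zero, sub_zero,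
    sub_add_cancel]
  rw [sum_range_succ, show (n : ℤ) - 1 - n = -1 by ring, bosMode_zero_bare, map_smul]
  have h5 : ∀ j : ℕ, fermMode i j
      (divDeriv 1 (fermMode i) (n - 1 - j) (ket (bare k))) = ((n - j : ℤ) : ℂ) •
        fermMode i j (fermMode i (n - j) (ket (bare k))) := fun j => by
    simp [divDeriv_one]
    ring
  simp only [h5]
  module

lemma ket_bare_coeff (k k' : Charge d) :
    (ket (bare k) : Fock N d) (bare k') = if k' = k then 1 else 0 := by
  classical
  rw [ket, fsingle]
  congr 1
  rw [eq_iff_iff]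
  constructor
  · intro h
    exact (congrArg State.charge h).symm
  · rintro rfl
    rfl

lemma sum_central_bos (n : ℕ) : ∑ j ∈ range n, ((j : ℂ) + 1) * (n - j) =
    ((n : ℂ) + 1) * n * (n + 2) / 6 := by
  have key : ∀ m : ℕ, ∑ j ∈ range m, ((j : ℂ) + 1) * (n - j) =
      (m : ℂ) * (m + 1) * (3 * n - 2 * m + 2) / 6 := by
    intro m
    induction m with
    | zero => simp
    | succ m ih =>
      rw [sum_range_succ, ih]
      push_cast
      ring
  rw [key]
  ring

lemma sum_central_ferm (n : ℕ) : ∑ j ∈ range (n + 1), ((n : ℂ) - j) * (2 * j - n) =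
    -(((n : ℂ) + 1) * n * (n + 2) / 6) := by
  have key : ∀ m : ℕ, ∑ j ∈ range m, ((n : ℂ) - j) * (2 * j - n) =
      (m : ℂ) * (-6 * n ^ 2 + 9 * n * (m - 1) - 2 * (m - 1) * (2 * m - 1)) / 6 := by
    intro m
    induction m with
    | zero => simp
    | succ m ih =>
      rw [sum_range_succ, ih]
      push_cast
      ring
  rw [key]
  push_cast
  ring

lemma IsStress.coeff_bare_bare {ω : Modes (Fock N d)}
    (h : I.IsStress ω) (m n : ℕ) (k k' : Charge d) :
    ω (-m - 3) (ω (n - 1) (ket (bare k))) (bare k') = if n = m ∧ k' = k then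
      ((m : ℂ) + 1) * (I.pair k k : ℂ) + N * ((m + 1) * m * (m + 2) / 8) else 0 := by
  have cb : ∀ i (j : ℤ) y, 0 ≤ j → ω (-m - 3) (I.bosMode i j y) (bare k') =
      (j + 1 : ℂ) * I.bosMode i (j - m - 1) y (bare k') := fun i j y hj => by
    rw [h.bos, fadd, fsmul, I.bosMode_coeff_bare i j hj, zero_add,
      show -(m : ℤ) - 3 + j + 2 = j - m - 1 by ring]
    push_cast
    rfl
  have cf : ∀ i (j : ℤ) y, 0 ≤ j → ω (-m - 3) (fermMode i j y) (bare k') =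
      ((2 * j - m) / 2 : ℂ) * fermMode i (j - m - 1) y (bare k') := fun i j y hj => by
    rw [h.ferm, fadd, fsmul, fermMode_coeff_bare i j hj, zero_add,
      show -(m : ℤ) - 3 + j + 2 = j - m - 1 by ring,
      show -(m : ℤ) - 3 + 2 * j + 3 = 2 * j - m by ring]
    push_cast
    rfl
  have vb : ∀ i (j j' : ℤ), 0 ≤ j' → I.bosMode i (j - m - 1) (I.bosMode i j' (ket (bare k)))
      (bare k') = if j + j' + 1 = m ∧ k' = k then (m - j : ℂ) else 0 := fun i j j' hj' => by
    rw [bosMode_comm, fadd, I.bosMode_coeff_bare i j' hj', fsmul, ket_bare_coeff, zero_add]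
    by_cases h1 : j + j' + 1 = m
    · rw [if_pos ⟨rfl, by omega⟩]
      by_cases h2 : k' = k
      · simp_all [if_pos]
      · rw [if_neg h2, if_neg fun h => h2 h.2, smul_zero]
    · rw [if_neg (c := i = i ∧ j - m - 1 + j' + 2 = 0) (fun h => h1 (by have := h.2; omega)),
        zero_smul, if_neg fun h => h1 h.1]
  have vf : ∀ (i : Fin N) (j j' : ℤ), 0 ≤ j' → fermMode i (j - m - 1)
      (fermMode i j' (ket (bare k))) (bare k') =
      if j + j' = m ∧ k' = k then 1 else 0 := fun i j j' hj' => by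
    rw [fermMode_anticomm, fadd, Finsupp.neg_apply, fermMode_coeff_bare i j' hj',
      fsmul, ket_bare_coeff, neg_zero, zero_add]
    by_cases h1 : j + j' = m
    · rw [if_pos ⟨rfl, by omega⟩, one_smul]
      by_cases h2 : k' = k
      · rw [if_pos h2, if_pos ⟨h1, h2⟩]
      · rw [if_neg h2, if_neg fun h => h2 h.2]
    · rw [if_neg (c := i = i ∧ j - m - 1 + j' + 1 = 0) (fun h => h1 (by have := h.2; omega)),
        zero_smul, if_neg fun h => h1 h.1]
  have v0 : ∀ i, I.bosMode i (n - m - 1) (ket (bare k)) (bare k') =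
      if n = m ∧ k' = k then (I.momentum k i : ℂ) else 0 := fun i => by
    rcases lt_trichotomy n m with h1 | h1 | h1
    · rw [bosMode_bare _ _ _ (by omega), if_neg fun h => h1.ne h.1]
      rfl
    · simp_all [bosMode_zero_bare, ket_bare_coeff, if_pos, if_neg]
    · rw [I.bosMode_coeff_bare _ _ (by omega), if_neg fun h => h1.ne' h.1]
  rw [h.bare_neg, map_sum, finsetSum_apply]
  have key : ∀ i, ω (-m - 3) ((I.momentum k i : ℂ) • I.bosMode i n (ket (bare k)) +
      (1 / 2 : ℂ) • ∑ j ∈ range n, I.bosMode i j (I.bosMode i (n - 1 - j) (ket (bare k))) -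
      (1 / 2 : ℂ) • ∑ j ∈ range (n + 1), ((n - j : ℤ) : ℂ) •
        fermMode i j (fermMode i (n - j) (ket (bare k)))) (bare k') =
      if n = m ∧ k' = k then ((m : ℂ) + 1) * ((I.momentum k i : ℂ) * I.momentum k i) +
        (m + 1) * m * (m + 2) / 8 else 0 := by
    intro i
    simp only [map_sub, map_add, map_smul, map_sum, fsub, fadd, fsmul, finsetSum_apply]
    have e1 : ∑ j ∈ range n, ω (-m - 3) (I.bosMode i j (I.bosMode i (n - 1 - j)
        (ket (bare k)))) (bare k') = if n = m ∧ k' = k then ((m : ℂ) + 1) * m * (m + 2) / 6 else 0 := by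
      rw [← sum_central_bos]
      split_ifs with hc
      · rw [← hc.1]
        refine sum_congr rfl fun j hj => ?_
        rw [mem_range] at hj
        rw [hc.1] at hj ⊢
        rw [cb _ _ _ (by omega), vb _ _ _ (by omega), if_pos ⟨by ring, hc.2⟩]
        push_cast
        ring
      · refine sum_eq_zero fun j hj => ?_
        rw [mem_range] at hj
        rw [cb _ _ _ (by omega), vb _ _ _ (by omega), if_neg (fun h => hc ⟨by omega, h.2⟩),
          mul_zero]
    have e2 : ∑ j ∈ range (n + 1), ((n - j : ℤ) : ℂ) • ω (-m - 3)
        (fermMode i j (fermMode i (n - j) (ket (bare k)))) (bare k') =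
        if n = m ∧ k' = k then -(((m : ℂ) + 1) * m * (m + 2) / 6) / 2 else 0 := by
      rw [← sum_central_ferm, sum_div]
      split_ifs with hc
      · rw [hc.1]
        refine sum_congr rfl fun j hj => ?_
        rw [mem_range] at hj
        rw [cf i j _ (by omega), vf i j _ (by omega), if_pos ⟨by ring, hc.2⟩]
        push_cast
        rw [smul_eq_mul]
        ring
      · refine sum_eq_zero fun j hj => ?_
        rw [mem_range] at hj
        rw [cf i j _ (by omega), vf i j _ (by omega), if_neg (fun h => hc ⟨by omega, h.2⟩),
          mul_zero, smul_zero]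
    rw [e1, e2, cb _ _ _ (by omega), v0]
    split_ifs with hc
    · rw [hc.1]
      simp only [smul_eq_mul]
      push_cast
      ring
    · simp
  simp only [key]
  split_ifs with hc
  · rw [sum_add_distrib, ← mul_sum, pair, Finset.sum_const, Finset.card_univ,
      Fintype.card_fin, nsmul_eq_mul]
    push_cast
    rfl
  · exact Finset.sum_const_zero

end LatticeInput

namespace LatticeInput

/-! ## Virasoro relations, translation covariance and the weight grading -/

variable {N d : ℕ} {I : LatticeInput N d} {ω : Modes (Fock N d)}

/-- The weight of a basis state. -/
def weight (I : LatticeInput N d) (b : State N d) : ℝ :=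
  oscWt b.bos + ∑ m ∈ b.ferm, ((m.lvl : ℝ) + 1 / 2) + I.pair b.charge b.charge / 2

lemma IsStress.zero (h : I.IsStress ω) (b : State N d) :
    ω (-2) (ket b) = (I.weight b : ℂ) • ket b := by
  set Q : Op N d := onBasis fun b => (I.weight b : ℂ) • ket b with hQ
  have hQb : ∀ b, Q (ket b) = (I.weight b : ℂ) • ket b :=
    fun b => onBasis_ket _ _
  suffices ∀ x, x ∈ ker (ω (-2) - Q) by
    have := this (ket b)
    rwa [mem_ker, lsub, sub_eq_zero, hQb] at this
  refine fun x => eq_top_of_creators _ (fun k => ?_) (fun w hw i k => ?_) (fun w hw i k => ?_) x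
  · rw [mem_ker, lsub, h.bare_zero, hQb, sub_eq_zero]
    simp [weight, bare, oscWt]
  · have hc : ∀ y, Q (bosCreate i k y) = bosCreate i k (Q y) + (k + 1 : ℂ) • bosCreate i k y := by
      intro y
      induction y using fock_induction with
      | h0 => simp
      | hadd x y hx hy => simp only [map_add, hx, hy, smul_add]; abel
      | hket c b =>
        simp only [map_smul, bosCreate_ket, hQb, smul_comm _ c, ← smul_add, ← add_smul]
        congr 2
        simp only [weight, oscWt_add, oscWt_single, Osc.lvl, ofLex_toLex]
        push_cast
        ring
    rw [mem_ker, lsub, sub_eq_zero] at hw ⊢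
    have := h.bos (-2) i k w
    rw [show (-2 : ℤ) + k + 2 = k by ring, bosMode_natCast] at this
    rw [this, hw, hc]
    push_cast
    rfl
  · have hc : ∀ y, Q (fermCreate i k y) = fermCreate i k (Q y) +
        (k + 1 / 2 : ℂ) • fermCreate i k y := by
      intro y
      induction y using fock_induction with
      | h0 => simp
      | hadd x y hx hy => simp only [map_add, hx, hy, smul_add]; abel
      | hket c b =>
        rw [map_smul, map_smul, map_smul, fermCreate_ket, hQb]
        split_ifs with hm
        · simp_all [fermCreate_ket, if_pos]
        · have hwt : (I.weight { b with ferm := insert (toLex (i, k)) b.ferm } : ℂ) =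
              I.weight b + (k + 1 / 2) := by
            simp only [weight, Finset.sum_insert hm, Osc.lvl, ofLex_toLex]
            push_cast
            ring
          rw [map_smul, map_smul, hQb, map_smul, fermCreate_ket, if_neg hm, hwt]
          module
    rw [mem_ker, lsub, sub_eq_zero] at hw ⊢
    have := h.ferm (-2) i k w
    rw [show (-2 : ℤ) + k + 2 = k by ring, fermMode_natCast] at this
    rw [this, hw, hc]
    push_cast
    congr 2
    ring

lemma weight_bare (k : Charge d) : I.weight (bare k) = I.pair k k / 2 := by
  simp [weight, bare, oscWt]

lemma IsStress.apply (h : I.IsStress ω) (v : Fock N d) (b : State N d) :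
    ω (-2) v b = (I.weight b : ℂ) * v b :=
  diagonal_apply h.zero v b

lemma IsStress.coeff_bare_zero (h : I.IsStress ω) (x : Fock N d) (k : Charge d) :
    ω (-2) x (bare k) = ((I.pair k k / 2 : ℝ) : ℂ) * x (bare k) := by
  rw [h.apply, weight_bare]

lemma IsStress.virasoro (h : I.IsStress ω) (m n : ℤ) (x : Fock N d) :
    ω (-m - 2) (ω (-n - 2) x) - ω (-n - 2) (ω (-m - 2) x) = ((m - n : ℤ) : ℂ) • ω (-(m + n) - 2) x +
      (if m + n = 0 then ((m : ℂ) ^ 3 - m) / 12 * (3 * N / 2) else 0) • x := by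
  set Z : ℤ × ℤ → Op N d := fun p =>
    ω (-p.1 - 2) ∘ₗ ω (-p.2 - 2) - ω (-p.2 - 2) ∘ₗ ω (-p.1 - 2) -
      (((p.1 - p.2 : ℤ) : ℂ) • ω (-(p.1 + p.2) - 2) +
      (if p.1 + p.2 = 0 then ((p.1 : ℂ) ^ 3 - p.1) / 12 * (3 * N / 2) else 0) • lid)
      with hZ
  have hZx : ∀ p x, Z p x = ω (-p.1 - 2) (ω (-p.2 - 2) x) - ω (-p.2 - 2) (ω (-p.1 - 2) x) -
      (((p.1 - p.2 : ℤ) : ℂ) • ω (-(p.1 + p.2) - 2) x +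
      (if p.1 + p.2 = 0 then ((p.1 : ℂ) ^ 3 - p.1) / 12 * (3 * N / 2) else 0) • x) :=
    fun p x => rfl
  suffices Z (m, n) = 0 by
    have := lcongr this x
    rw [hZx, lzero, sub_eq_zero] at this
    exact this
  refine I.family_eq_zero Z (fun p i r _ => ?_) (fun p i r => ⟨1, one_ne_zero, ?_⟩) ?_ (m, n)
  · convert szero _
    refine lext fun x => ?_
    rw [lsub, lcomp, lcomp, hZx, hZx]
    simp only [h.bos, map_add, map_sub, map_smul, lzero]
    rw [show -p.1 - 2 + (-p.2 - 2 + r + 2) + 2 = -p.2 - 2 + (-p.1 - 2 + r + 2) + 2 by ring,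
      show -(p.1 + p.2) - 2 + r + 2 = -p.2 - 2 + (-p.1 - 2 + r + 2) + 2 by ring]
    generalize I.bosMode i (-p.2 - 2 + (-p.1 - 2 + r + 2) + 2) x = y
    push_cast
    module
  · convert szero _
    refine lext fun x => ?_
    rw [lsub, lsmul, lcomp, lcomp, hZx, hZx]
    simp only [h.ferm, map_add, map_sub, map_smul, lzero]
    rw [show -p.1 - 2 + (-p.2 - 2 + r + 2) + 2 = -p.2 - 2 + (-p.1 - 2 + r + 2) + 2 by ring,
      show -(p.1 + p.2) - 2 + r + 2 = -p.2 - 2 + (-p.1 - 2 + r + 2) + 2 by ring]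
    generalize fermMode i (-p.2 - 2 + (-p.1 - 2 + r + 2) + 2) x = y
    push_cast
    module
  · have hanti : ∀ p x, Z (p.2, p.1) x = -Z p x := by
      intro p x
      rw [hZx, hZx, add_comm p.2 p.1]
      split_ifs with hp
      · have e : (p.2 : ℂ) = -p.1 := by
          rw [eq_neg_iff_add_eq_zero, add_comm]
          exact_mod_cast hp
        push_cast
        rw [e]
        module
      · push_cast
        module
    have key : ∀ p : ℤ × ℤ, p.2 ≤ p.1 → ∀ k k',
        Z p (ket (bare k)) (bare k') = 0 := by
      rintro ⟨m, n⟩ hmn k k'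
      simp only at hmn
      rw [hZx]
      simp only [fsub, fadd, fsmul]
      rcases lt_trichotomy n 0 with hn | hn | hn
      · rw [h.coeff_bare (-n - 2) (by omega), sub_zero]
        rcases lt_trichotomy m 0 with hm | hm | hm
        · rw [h.coeff_bare (-m - 2) (by omega), h.coeff_bare (-(m + n) - 2) (by omega),
            if_neg (by omega)]
          simp
        · subst hm
          rw [show -(0 : ℤ) - 2 = -2 by ring, h.coeff_bare_zero, h.coeff_bare (-n - 2) (by omega),
            h.coeff_bare (-(0 + n) - 2) (by omega), if_neg (by omega)]
          simp
        · obtain ⟨a, ha⟩ := eq_ofNat_of_zero_le (show 0 ≤ m - 1 by omega)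
          obtain ⟨c, hc⟩ := eq_ofNat_of_zero_le (show 0 ≤ -n - 1 by omega)
          obtain rfl : m = a + 1 := by omega
          obtain rfl : n = -c - 1 := by omega
          rw [show -((a : ℤ) + 1) - 2 = -a - 3 by ring, show -(-(c : ℤ) - 1) - 2 = c - 1 by ring,
            h.coeff_bare_bare, ket_bare_coeff]
          by_cases hac : c = a
          · subst hac
            rw [show -((c : ℤ) + 1 + (-c - 1)) - 2 = -2 by ring, h.bare_zero, fsmul,
              ket_bare_coeff,
              if_pos (c := (c : ℤ) + 1 + (-c - 1) = 0) (by ring)]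
            by_cases hk : k' = k
            · rw [if_pos ⟨rfl, hk⟩, if_pos hk]
              simp only [smul_eq_mul]
              push_cast
              ring
            · rw [if_neg (fun h => hk h.2), if_neg hk]
              simp
          · rw [if_neg (fun h => hac h.1), if_neg (by omega), zero_smul, add_zero]
            rcases lt_or_gt_of_ne hac with h1 | h1
            · rw [h.bare_eq_zero _ (by omega)]
              simp
            · rw [h.coeff_bare _ (by omega)]
              simp
      · subst hn
        rcases eq_or_lt_of_le hmn with hm | hm
        · subst hm
          simp
        · rw [h.bare_eq_zero (-m - 2) (by omega), show -(0 : ℤ) - 2 = -2 by ring, h.bare_zero,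
            map_smul, h.bare_eq_zero (-m - 2) (by omega), h.bare_eq_zero (-(m + 0) - 2) (by omega),
            if_neg (by omega)]
          simp
      · rw [h.bare_eq_zero (-n - 2) (by omega), h.bare_eq_zero (-m - 2) (by omega),
          h.bare_eq_zero (-(m + n) - 2) (by omega), if_neg (by omega)]
        simp
    intro p k k'
    rcases le_total p.2 p.1 with hp | hp
    · exact key p hp k k'
    · have := key (p.2, p.1) hp k k'
      rw [hanti] at this
      simpa using this

lemma IsStress.isTC_bosMode (h : I.IsStress ω) (i : Fin N) : IsTC (ω (-1)) (I.bosMode i) := by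
  intro n x
  rw [h.bos, add_sub_cancel_left, show -1 + n + 2 = n + 1 by ring]

lemma IsStress.isTC_fermMode (h : I.IsStress ω) (i : Fin N) : IsTC (ω (-1)) (fermMode i) := by
  intro n x
  rw [h.ferm, add_sub_cancel_left, show -1 + n + 2 = n + 1 by ring]
  push_cast
  congr 1
  ring

lemma IsStress.translate_bare (h : I.IsStress ω) (k : Charge d) : ω (-1) (ket (bare k)) =
      ∑ i, (I.momentum k i : ℂ) • I.bosMode i 0 (ket (bare k)) := by
  have := h.bare_neg 0 k
  simpa using this

lemma IsStress.isTC_vertexMode (hI : I.Integral) (h : I.IsStress ω) (l : Charge d) :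
    IsTC (ω (-1)) (I.vertexMode l) := by
  set Z : Modes (Fock N d) := fun n => ω (-1) ∘ₗ I.vertexMode l n -
    I.vertexMode l n ∘ₗ ω (-1) - ((n + 1 : ℤ) : ℂ) • I.vertexMode l (n + 1) with hZ
  have hZx : ∀ n x, Z n x = ω (-1) (I.vertexMode l n x) - I.vertexMode l n (ω (-1) x) -
    ((n + 1 : ℤ) : ℂ) • I.vertexMode l (n + 1) x := fun _ _ => rfl
  suffices ∀ n, Z n = 0 by
    intro n x
    have := lcongr (this n) x
    rwa [hZx, lzero, sub_eq_zero] at this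
  intro n
  refine I.family_eq_zero Z (fun t i r _ => ?_) (fun t i r => ⟨1, one_ne_zero, ?_⟩) ?_ n
  · have : I.bosMode i r ∘ₗ Z t - Z t ∘ₗ I.bosMode i r =
        (I.momentum l i : ℂ) • Z (t + r + 1) := by
      refine lext fun x => ?_
      rw [lsub, lcomp, lcomp, lsmul, hZx, hZx, hZx]
      have e : ∀ y, I.bosMode i r (ω (-1) y) = ω (-1) (I.bosMode i r y) -
          ((r + 1 : ℤ) : ℂ) • I.bosMode i (r + 1) y := fun y => by
        grind [h.bos]
      simp only [map_sub, map_add, map_smul, e, bosMode_vertexMode hI]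
      rw [show t + (r + 1) + 1 = t + r + 1 + 1 by ring, show t + 1 + r + 1 = t + r + 1 + 1 by ring]
      generalize I.vertexMode l (t + r + 1 + 1) x = y
      push_cast
      module
    rw [this]
    exact smul_mem _ _ (subset_span ⟨_, rfl⟩)
  · convert szero _
    refine lext fun x => ?_
    rw [lsub, lcomp, lsmul, lcomp, hZx, hZx]
    have e : ∀ y, fermMode i r (ω (-1) y) = ω (-1) (fermMode i r y) -
        ((r + 1 : ℤ) : ℂ) • fermMode i (r + 1) y := fun y => by
      grind [h.ferm]
    simp only [map_sub, map_smul, e, fermMode_vertexMode hI, lzero]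
    module
  · intro n k k'
    rw [hZx]
    simp only [fsub, fsmul]
    rw [h.coeff_bare _ le_rfl, h.translate_bare, map_sum, finsetSum_apply]
    have e : ∀ i, I.vertexMode l n ((I.momentum k i : ℂ) • I.bosMode i 0
        (ket (bare k))) (bare k') = -((I.momentum l i : ℂ) * I.momentum k i *
        I.vertexMode l (n + 1) (ket (bare k)) (bare k')) := fun i => by
      have h1 := bosMode_vertexMode hI l i 0 n (ket (bare k))
      have h2 := congrArg (fun y : Fock N d => y (bare k')) h1
      simp only [fadd, fsmul] at h2
      rw [I.bosMode_coeff_bare _ _ le_rfl, add_zero] at h2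
      rw [map_smul, fsmul, smul_eq_mul]
      rw [smul_eq_mul] at h2
      linear_combination -(I.momentum k i : ℂ) * h2
    simp only [e]
    rw [sum_neg_distrib, ← Finset.sum_mul, zero_sub, neg_neg, smul_eq_mul, ← sub_mul,
      vertexMode_bare hI]
    split_ifs with hc
    · rw [mul_one]
      have : ((n + 1 : ℤ) : ℝ) = I.pair l k := hc.2
      have h3 : ((n + 1 : ℤ) : ℂ) = ((I.pair l k : ℝ) : ℂ) := by rw [← this]; push_cast; rfl
      rw [h3, pair]
      push_cast
      ring
    · rw [mul_zero]

lemma IsTC.comp {T D : Op N d} {A : Modes (Fock N d)} (h : IsTC T A)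
    (hD : ∀ x, T (D x) = D (T x)) : IsTC T fun t => A t ∘ₗ D := by
  intro n x
  simp only [lcomp]
  rw [← hD, h n (D x)]

lemma IsStress.map_chargeMul (h : I.IsStress ω) (f : Charge d → ℂ) (t : ℤ) (x : Fock N d) :
    ω t (chargeMul f x) = chargeMul f (ω t x) := by
  obtain ⟨P, Q, hP, hQ, hω⟩ := h
  have fin : ∀ (F : ℕ → Fock N d), (support F).Finite →
      chargeMul f (∑ᶠ j, F j) = ∑ᶠ j, chargeMul f (F j) :=
    fun F hF => (chargeMul f).toAddMonoidHom.map_finsum hF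
  rw [hω, hω, map_sum]
  refine sum_congr rfl fun i _ => ?_
  have hA := I.bosMode_truncated i
  have hB := fermMode_truncated (d := d) i
  rw [hP i t, hQ i t, hP i t, hQ i t]
  simp only [map_smul, map_sub, map_add]
  rw [fin _ (hA.finite_left (A := I.bosMode i) (fun j => j) t x),
    fin _ (hA.finite_right (B := I.bosMode i) (fun j => t + 1 + j) (-1) x),
    fin _ ((hB.divDeriv 1).finite_left (A := fermMode i) (fun j => j) t x),
    fin _ (hB.finite_right (B := divDeriv 1 (fermMode i)) (fun j => t + 1 + j) (-1) x)]
  have hd : ∀ n y, divDeriv 1 (fermMode i) n (chargeMul f y) =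
      chargeMul f (divDeriv 1 (fermMode i) n y) := fun n y => by
    simp [divDeriv_one, fermMode_chargeMul]
  simp only [bosMode_chargeMul, fermMode_chargeMul, hd]

lemma IsStress.isTC_twistedMode (hI : I.Integral) (h : I.IsStress ω)
    (ε : Cocycle d) (l : Charge d) : IsTC (ω (-1)) (I.twistedMode ε l) :=
  IsTC.comp (h.isTC_vertexMode hI l) fun x => h.map_chargeMul _ _ x

end LatticeInput

namespace LatticeInput

/-! ## Locality of the vertex operators -/

lemma zwMul_pow_shift {V : Type*} [AddCommGroup V] [Module ℂ V] (K : ℕ) (X : ℤ → ℤ → V)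
    (c e a b : ℤ) : (zwMul ^ K) (fun a b => X (a + c) (b + e)) a b =
      (zwMul ^ K) X (a + c) (b + e) := by
  rw [zwMul_pow_apply, zwMul_pow_apply]
  refine sum_congr rfl fun j _ => ?_
  rw [show a - (K - j) + c = a + c - (K - j) by ring, show b - j + e = b + e - j by ring]

/-- The recursion `((∂_z - α / z) + (∂_w - β / w)) g = 0`, which is preserved by multiplication
with `z - w`. -/
def TranslationRec (α β : ℤ) (g : ℤ → ℤ → ℂ) : Prop :=
  ∀ a b, ((a + 1 - α : ℤ) : ℂ) * g (a + 1) b + ((b + 1 - β : ℤ) : ℂ) * g a (b + 1) = 0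

lemma TranslationRec.zwMul_pow {α β : ℤ} {g : ℤ → ℤ → ℂ} (h : TranslationRec α β g) (K : ℕ) :
    TranslationRec α β ((zwMul ^ K) g) := by
  induction K with
  | zero => simpa using h
  | succ K ih =>
    rw [pow_succ', emul]
    generalize (zwMul ^ K) g = f at ih
    intro a b
    simp only [zwMul, LinearMap.coe_mk, AddHom.coe_mk, add_sub_cancel_right]
    have h1 := ih (a - 1) b
    have h2 := ih a (b - 1)
    simp only [sub_add_cancel] at h1 h2
    push_cast at h1 h2 ⊢
    linear_combination h1 - h2

lemma rec_eq_zero {n : ℕ} {H : ℤ → ℂ}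
    (h : ∀ j : ℤ, ((n - j : ℤ) : ℂ) * H j + ((j + 1 : ℤ) : ℂ) * H (j + 1) = 0) (j : ℕ) :
    H (-1 - j) = 0 := by
  induction j with
  | zero =>
    have := h (-1)
    have hn : ((n : ℂ) + 1) ≠ 0 := mod_cast Nat.succ_ne_zero n
    simpa [hn] using this
  | succ j ih =>
    have := h (-1 - (j + 1 : ℕ))
    rw [show -1 - ((j + 1 : ℕ) : ℤ) + 1 = -1 - j by push_cast; ring, ih, mul_zero, add_zero,
      mul_eq_zero] at this
    refine this.resolve_left ?_
    exact_mod_cast (by omega : (n : ℤ) - (-1 - ((j + 1 : ℕ) : ℤ)) ≠ 0)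

lemma rec_eq_choose {n : ℕ} {H : ℤ → ℂ}
    (h : ∀ j : ℤ, ((n - j : ℤ) : ℂ) * H j + ((j + 1 : ℤ) : ℂ) * H (j + 1) = 0) (j : ℕ) :
    H j = (-1) ^ j * (n.choose j : ℂ) * H 0 := by
  induction j with
  | zero => simp
  | succ j ih =>
    have h1 := h j
    rw [ih] at h1
    have hj : ((j : ℂ) + 1) ≠ 0 := mod_cast Nat.succ_ne_zero j
    have h2 : (n.choose (j + 1) : ℂ) * (j + 1) = n.choose j * (n - j) := by
      rcases le_or_gt j n with hjn | hjn
      · have := Nat.choose_succ_right_eq n j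
        rw [← Nat.cast_sub hjn]
        exact_mod_cast this
      · rw [Nat.choose_eq_zero_of_lt hjn, Nat.choose_eq_zero_of_lt (by omega)]
        simp
    apply mul_left_cancel₀ hj
    push_cast at h1 ⊢
    rw [pow_succ]
    linear_combination h1 + (-1) ^ j * H 0 * h2

variable {N d : ℕ} {I : LatticeInput N d}

lemma vertexMode_rec (hI : I.Integral) {ω : Modes (Fock N d)} (hω : I.IsStress ω)
    (l m k k' : Charge d) (lk mk : ℤ) (hlk : I.pair l k = lk) (hmk : I.pair m k = mk) :
    TranslationRec lk mk fun a b =>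
      I.vertexMode l a (I.vertexMode m b (ket (bare k))) (bare k') := by
  intro a b
  have h1 : ω (-1) (I.vertexMode l a (I.vertexMode m b (ket (bare k)))) (bare k') = 0 :=
    hω.coeff_bare _ le_rfl _ _
  have tl := hω.isTC_vertexMode hI l a (I.vertexMode m b (ket (bare k)))
  have tm := hω.isTC_vertexMode hI m b (ket (bare k))
  rw [sub_eq_iff_eq_add] at tl tm
  rw [tl, tm, hω.translate_bare] at h1
  simp only [map_add, map_smul, map_sum, fadd, fsmul, finsetSum_apply, smul_eq_mul] at h1
  have e : ∀ i, (I.momentum k i : ℂ) * I.vertexMode l a (I.vertexMode m b (I.bosMode i 0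
      (ket (bare k)))) (bare k') = -((I.momentum l i : ℂ) * I.momentum k i *
        I.vertexMode l (a + 1) (I.vertexMode m b (ket (bare k))) (bare k')) -
      ((I.momentum m i : ℂ) * I.momentum k i *
        I.vertexMode l a (I.vertexMode m (b + 1) (ket (bare k))) (bare k')) := fun i => by
    have h1 := bosMode_vertexMode hI l i 0 a (I.vertexMode m b (ket (bare k)))
    rw [bosMode_vertexMode hI m i 0 b] at h1
    have h2 := congrArg (fun y : Fock N d => y (bare k')) h1
    simp only [map_add, map_smul, fadd, fsmul, add_zero, smul_eq_mul] at h2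
    rw [I.bosMode_coeff_bare _ _ le_rfl] at h2
    linear_combination -(I.momentum k i : ℂ) * h2
  simp only [e] at h1
  rw [sum_sub_distrib, sum_neg_distrib, ← Finset.sum_mul, ← Finset.sum_mul] at h1
  have hl : ∑ i, (I.momentum l i : ℂ) * I.momentum k i = lk := by
    rw [← Complex.ofReal_intCast, ← hlk, pair]
    push_cast
    rfl
  have hm : ∑ i, (I.momentum m i : ℂ) * I.momentum k i = mk := by
    rw [← Complex.ofReal_intCast, ← hmk, pair]
    push_cast
    rfl
  rw [hl, hm] at h1
  push_cast at h1 ⊢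
  linear_combination h1

lemma exists_coeff_bare_ne {A : Op N d} {P : State N d → Prop} {x : Fock N d}
    (hx : x ∈ span ℂ (ket '' {b | P b})) {c : State N d} (h : A x c ≠ 0) :
    ∃ b, P b ∧ A (ket b) c ≠ 0 := by
  by_contra! hc
  apply h
  clear h
  induction hx using span_induction with
  | mem x h =>
    obtain ⟨b, hb, rfl⟩ := h
    exact hc b hb
  | zero => simp
  | add x y _ _ hx hy => rw [map_add, fadd, hx, hy, add_zero]
  | smul c x _ hx => rw [map_smul, fsmul, hx, smul_zero]

lemma vertexMode_coeff_ne {l m k k' : Charge d} {a b : ℤ}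
    (h : I.vertexMode l a (I.vertexMode m b (ket (bare k))) (bare k') ≠ 0) :
    ((a + b : ℤ) : ℝ) = I.pair l k + I.pair m k + I.pair l m := by
  obtain ⟨c, ⟨h1, -, h3⟩, h4⟩ := exists_coeff_bare_ne (I.vertexMode_mem m b (bare k)) h
  have h5 := I.vertexMode_mem l a c
  have h6 := not_not.1 (mt (mem_span_ket_of_ne h5) h4)
  obtain ⟨-, -, h8⟩ := h6
  rw [h1] at h8
  have e : oscWt (bare k : State N d).bos = 0 := sum_zero_index
  have e' : oscWt (bare k' : State N d).bos = 0 := sum_zero_index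
  rw [e] at h3
  rw [e', pair_add] at h8
  simp only [show (bare k : State N d).charge = k from rfl] at h3 h8
  push_cast at h3 h8 ⊢
  linarith

lemma vertexMode_coeff (hI : I.Integral) {ω : Modes (Fock N d)} (hω : I.IsStress ω)
    (l m k k' : Charge d) (lk mk lm : ℤ) (hlk : I.pair l k = lk) (hmk : I.pair m k = mk)
    (hlm : I.pair l m = lm) (K n : ℕ) (hn : (n : ℤ) = K + lm) :
    ((zwMul ^ K) (fun a b => I.vertexMode l a (I.vertexMode m b (ket (bare k))) (bare k'))
      (lk + n) mk = if k' = l + (m + k) then 1 else 0) ∧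
    ∀ a b, (zwMul ^ K) (fun a b => I.vertexMode l a (I.vertexMode m b (ket (bare k))) (bare k')) a b
      = (-1) ^ lm *
      (zwMul ^ K) (fun a b => I.vertexMode m b (I.vertexMode l a (ket (bare k))) (bare k')) a b := by
  set G := (zwMul ^ K) (fun a b => I.vertexMode l a (I.vertexMode m b (ket (bare k))) (bare k'))
    with hG
  set G' := (zwMul ^ K) (fun a b => I.vertexMode m b (I.vertexMode l a (ket (bare k))) (bare k'))
    with hG'
  have rG : TranslationRec lk mk G := (vertexMode_rec hI hω l m k k' lk mk hlk hmk).zwMul_pow K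
  have rG' : TranslationRec lk mk G' := by
    refine TranslationRec.zwMul_pow (fun a b => ?_) K
    have := vertexMode_rec hI hω m l k k' mk lk hmk hlk b a
    rw [add_comm]
    exact this
  have sG : ∀ a b, a + b ≠ lk + mk + n → G a b = 0 ∧ G' a b = 0 := by
    refine fun a b hab => ⟨?_, ?_⟩ <;> simp only [hG, hG', zwMul_pow_apply] <;>
      refine sum_eq_zero fun j _ => ?_ <;> by_contra hc <;>
      have := vertexMode_coeff_ne (right_ne_zero_of_smul hc) <;>
      simp only [hlk, hmk, I.pair_comm m l, hlm] at this <;> push_cast at this <;>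
      refine hab ?_ <;> rw [hn] <;> rify <;> linarith
  have recur : ∀ F : ℤ → ℤ → ℂ, TranslationRec lk mk F → ∀ j : ℤ,
      ((n - j : ℤ) : ℂ) * F (lk + n - j) (mk + j) +
      ((j + 1 : ℤ) : ℂ) * F (lk + n - (j + 1)) (mk + (j + 1)) = 0 := by
    intro F hF j
    have := hF (lk + n - j - 1) (mk + j)
    rw [sub_add_cancel] at this
    rw [show lk + n - (j + 1) = lk + n - j - 1 by ring, ← add_assoc]
    convert this using 3
    · push_cast
      ring
    · push_cast
      ring
  have v1 : G (lk + n) mk = if k' = l + (m + k) then 1 else 0 := by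
    rw [hG, zwMul_pow_apply, sum_eq_single 0]
    · rw [show mk - ((0 : ℕ) : ℤ) = mk by simp, vertexMode_lead hI m k mk hmk.symm,
        vertexMode_bare hI]
      have : ((lk + n - (K - ((0 : ℕ) : ℤ)) : ℤ) : ℝ) = I.pair l (m + k) := by
        rw [pair_add, hlm, hlk, hn]
        push_cast
        ring
      simp only [this, and_true, Nat.choose_zero_right, pow_zero, Nat.cast_one, one_mul, one_smul]
    · intro j _ hj
      rw [I.vertexMode_eq_zero m k (mk - j), map_zero]
      · simp
      · rw [hmk]
        exact_mod_cast (by omega : mk - (j : ℤ) < mk)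
    · intro h
      simp at h
  have v2 : G' lk (mk + n) = (-1) ^ K * if k' = l + (m + k) then 1 else 0 := by
    rw [hG', zwMul_pow_apply, sum_eq_single K]
    · rw [sub_self, sub_zero, vertexMode_lead hI l k lk hlk.symm, vertexMode_bare hI]
      have : ((mk + n - K : ℤ) : ℝ) = I.pair m (l + k) := by
        simp [pair_add, I.pair_comm, hlm, hmk, hn]
        ring
      simp [this, add_left_comm m l k]
    · intro j hj hjK
      rw [I.vertexMode_eq_zero l k (lk - (K - j)), map_zero]
      · simp
      · rw [mem_range] at hj
        rw [hlk]
        exact_mod_cast (by omega : lk - ((K : ℤ) - j) < lk)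
    · intro h
      simp at h
  refine ⟨v1, fun a b => ?_⟩
  by_cases hab : a + b = lk + mk + n
  · obtain ⟨j, rfl⟩ : ∃ j, b = mk + j := ⟨b - mk, by ring⟩
    obtain rfl : a = lk + n - j := by omega
    have r1 := recur G rG
    have r2 := recur G' rG'
    rcases lt_or_ge j 0 with hj | hj
    · obtain ⟨i, hi⟩ := eq_ofNat_of_zero_le (show 0 ≤ -1 - j by omega)
      obtain rfl : j = -1 - i := by omega
      rw [rec_eq_zero (H := fun j => G (lk + n - j) (mk + j)) r1 i,
        rec_eq_zero (H := fun j => G' (lk + n - j) (mk + j)) r2 i, mul_zero]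
    · obtain ⟨i, rfl⟩ := eq_ofNat_of_zero_le hj
      have e1 := rec_eq_choose (H := fun j => G (lk + n - j) (mk + j)) r1 i
      have e2 := rec_eq_choose (H := fun j => G' (lk + n - j) (mk + j)) r2 i
      have e3 := rec_eq_choose (H := fun j => G' (lk + n - j) (mk + j)) r2 n
      simp only [sub_zero, add_zero, add_sub_cancel_right] at e1 e2 e3
      rw [v1] at e1
      rw [v2, Nat.choose_self, Nat.cast_one, mul_one] at e3
      have e4 : G' (lk + n) mk = (-1) ^ n * ((-1) ^ K * if k' = l + (m + k) then 1 else 0) := by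
        rw [e3, ← mul_assoc, ← pow_add, Even.neg_one_pow ⟨n, rfl⟩, one_mul]
      rw [e1, e2, e4]
      have e5 : (-1 : ℂ) ^ lm * ((-1) ^ n * (-1) ^ K) = 1 := by
        rw [← zpow_natCast, ← zpow_natCast, ← zpow_add₀ (by norm_num), ← zpow_add₀ (by norm_num), hn,
          Even.neg_one_zpow ⟨lm + K, by ring⟩]
      linear_combination -((-1) ^ i * (n.choose i : ℂ) * if k' = l + (m + k) then 1 else 0) * e5
  · rw [(sG a b hab).1, (sG a b hab).2, mul_zero]

lemma vertexMode_local (hI : I.Integral) {ω : Modes (Fock N d)} (hω : I.IsStress ω)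
    (l m : Charge d) (lm : ℤ) (hlm : I.pair l m = lm) :
    LocalFields (I.vertexMode l) (I.vertexMode m) ((-1) ^ lm) := by
  set K := (-lm).toNat
  obtain ⟨n, hn⟩ := eq_ofNat_of_zero_le (show 0 ≤ (K : ℤ) + lm by omega)
  obtain ⟨g, hg⟩ : ∃ g : Fock N d → ℤ → ℤ → Fock N d, g = fun x a b =>
    I.vertexMode l a (I.vertexMode m b x) - (-1 : ℂ) ^ lm •
      I.vertexMode m b (I.vertexMode l a x) := ⟨_, rfl⟩
  obtain ⟨Z, hZ⟩ : ∃ Z : ℤ × ℤ → Op N d, Z = fun p =>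
    (zwMul ^ K) (fun a b => I.vertexMode l a ∘ₗ I.vertexMode m b - (-1 : ℂ) ^ lm •
      I.vertexMode m b ∘ₗ I.vertexMode l a) p.1 p.2 := ⟨_, rfl⟩
  have hZx : ∀ p x, Z p x = (zwMul ^ K) (g x) p.1 p.2 := by
    intro p x
    simp only [hZ, hg, zwMul_pow_apply, lsum, lsmul, lsub, lcomp]
  have map_g : ∀ (f : Op N d) p x,
      f (Z p x) = (zwMul ^ K) (fun a b => f (g x a b)) p.1 p.2 := fun f p x => by
    rw [hZx, zwMul_pow_map f K (g x)]
  suffices ∀ p, Z p = 0 by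
    refine ⟨K, fun x => ?_⟩
    ext1 a
    ext1 b
    have h0 := hZx (a, b) x
    rw [this, hg] at h0
    exact h0.symm
  refine I.family_eq_zero Z (fun p i r _ => ?_) (fun p i r => ⟨1, one_ne_zero, ?_⟩) ?_
  · have : I.bosMode i r ∘ₗ Z p - Z p ∘ₗ I.bosMode i r =
        (I.momentum l i : ℂ) • Z (p.1 + (r + 1), p.2) +
        (I.momentum m i : ℂ) • Z (p.1, p.2 + (r + 1)) := by
      refine lext fun x => ?_
      have h2 : (fun a b => I.bosMode i r (g x a b)) = g (I.bosMode i r x) +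
          ((I.momentum l i : ℂ) • (fun a b => g x (a + (r + 1)) (b + 0)) +
          (I.momentum m i : ℂ) • fun a b => g x (a + 0) (b + (r + 1))) := by
        ext1 a
        ext1 b
        simp only [hg, map_sub, map_smul, bosMode_vertexMode hI, padd, psmul,
          map_add, add_zero, ← add_assoc]
        module
      rw [lsub, lcomp, lcomp, map_g, h2, map_add, map_add, map_smul, map_smul]
      simp only [padd, psmul, ladd, lsmul]
      rw [zwMul_pow_shift, zwMul_pow_shift, hZx, hZx, hZx, add_sub_cancel_left, add_zero, add_zero]
    rw [this]
    exact add_mem (smul_mem _ _ (subset_span ⟨_, rfl⟩))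
      (smul_mem _ _ (subset_span ⟨_, rfl⟩))
  · convert szero _
    refine lext fun x => ?_
    have h2 : (fun a b => fermMode i r (g x a b)) = g (fermMode i r x) := by
      ext1 a
      ext1 b
      simp [hg, fermMode_vertexMode hI]
    rw [lsub, lsmul, one_smul, lcomp, lcomp, map_g, h2, ← hZx, sub_self, lzero]
  · rintro ⟨a, b⟩ k k'
    obtain ⟨lk, hlk⟩ := hI l k
    obtain ⟨mk, hmk⟩ := hI m k
    have key := (vertexMode_coeff hI hω l m k k' lk mk lm hlk hmk hlm K n hn.symm).2 a b
    have h1 := congrFun (congrFun (zwMul_pow_map (lapply (R := ℂ) (bare k')) K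
      (g (ket (bare k)))) a) b
    have h2 : (fun a b => lapply (R := ℂ) (bare k') (g (ket (bare k)) a b)) =
        (fun a b => I.vertexMode l a (I.vertexMode m b (ket (bare k))) (bare k')) -
        (-1 : ℂ) ^ lm • fun a b => I.vertexMode m b (I.vertexMode l a (ket (bare k))) (bare k') := by
      ext1 a
      ext1 b
      simp [hg]
    rw [h2, map_sub, map_smul] at h1
    simp only [psub, psmul] at h1
    rw [key, smul_eq_mul, sub_self] at h1
    rw [hZx]
    exact h1.symm

/-- The conditions on the cocycles `ε` of the vertex operators for which these are mutually local
and the vertex operator of charge `0` is the identity. -/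
structure IsLocalCocycle (I : LatticeInput N d) (ε : Cocycle d) : Prop where
  zero_left : ∀ k, ε 0 k = 1
  zero_right : ∀ l, ε l 0 = 1
  comm : ∀ l m k (n : ℤ), I.pair l m = n →
    ε l (m + k) * ε m k = (-1) ^ n * (ε m (l + k) * ε l k)

lemma neg_one_zpow_mul_self (n : ℤ) : (-1 : ℂ) ^ n * (-1) ^ n = 1 := by
  rw [← zpow_add₀ (by norm_num), Even.neg_one_zpow ⟨n, rfl⟩]

lemma twistedMode_twistedMode (I : LatticeInput N d) (ε : Cocycle d)
    (l m : Charge d) (a b : ℤ) (x : Fock N d) :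
    I.twistedMode ε l a (I.twistedMode ε m b x) =
      I.vertexMode l a (I.vertexMode m b (chargeMul (fun k => ε l (m + k) * ε m k) x)) := by
  simp [twistedMode, vertexMode_chargeMul, chargeMul_chargeMul]

lemma twistedMode_local (hI : I.Integral) {ω : Modes (Fock N d)} (hω : I.IsStress ω)
    {ε : Cocycle d} (hε : I.IsLocalCocycle ε) (l m : Charge d) :
    LocalFields (I.twistedMode ε l) (I.twistedMode ε m) 1 := by
  obtain ⟨lm, hlm⟩ := hI l m
  obtain ⟨K, hK⟩ := vertexMode_local hI hω l m lm hlm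
  refine ⟨K, fun x => ?_⟩
  have h : chargeMul (fun k => ε m (l + k) * ε l k) x =
      (-1 : ℂ) ^ lm • chargeMul (fun k => ε l (m + k) * ε m k) x := by
    refine lcongr (g := (-1 : ℂ) ^ lm • chargeMul fun k => ε l (m + k) * ε m k)
      (fock_ext fun b => ?_) x
    rw [lsmul, chargeMul_ket, chargeMul_ket, smul_smul, hε.comm l m _ lm hlm,
      ← mul_assoc, neg_one_zpow_mul_self, one_mul]
  have h' : (fun a b => I.twistedMode ε l a (I.twistedMode ε m b x) -
      (1 : ℂ) • I.twistedMode ε m b (I.twistedMode ε l a x)) = fun a b =>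
      I.vertexMode l a (I.vertexMode m b (chargeMul (fun k => ε l (m + k) * ε m k) x)) -
      (-1 : ℂ) ^ lm •
        I.vertexMode m b (I.vertexMode l a (chargeMul (fun k => ε l (m + k) * ε m k) x)) := by
    simp_all [twistedMode_twistedMode, one_smul]
  rw [h']
  exact hK _

lemma comm_of_twistedMode_local (hI : I.Integral) {ω : Modes (Fock N d)}
    (hω : I.IsStress ω) {ε : Cocycle d} {l m : Charge d}
    (h : LocalFields (I.twistedMode ε l) (I.twistedMode ε m) 1) (k : Charge d) (lm : ℤ)
    (hlm : I.pair l m = lm) : ε l (m + k) * ε m k = (-1) ^ lm * (ε m (l + k) * ε l k) := by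
  obtain ⟨K, hK⟩ := h
  obtain ⟨lk, hlk⟩ := hI l k
  obtain ⟨mk, hmk⟩ := hI m k
  set K' := K + (-lm).toNat
  obtain ⟨n, hn⟩ := eq_ofNat_of_zero_le (show 0 ≤ (K' : ℤ) + lm by omega)
  have h1 := congrFun (congrFun (zwMul_pow_eq_zero_of_le (hK (ket (bare k)))
    (Nat.le_add_right K (-lm).toNat)) (lk + n)) mk
  obtain ⟨v1, v2⟩ := vertexMode_coeff hI hω l m k (l + (m + k)) lk mk lm hlk hmk hlm K' n hn.symm
  rw [if_pos rfl] at v1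
  have v2 := v2 (lk + n) mk
  rw [v1] at v2
  have h2 := congrFun (congrFun (zwMul_pow_map (lapply (R := ℂ) (bare (l + (m + k)))) K'
    fun a b => I.twistedMode ε l a (I.twistedMode ε m b (ket (bare k))) -
      (1 : ℂ) • I.twistedMode ε m b (I.twistedMode ε l a (ket (bare k)))) (lk + n)) mk
  rw [h1] at h2
  have h3 : (fun a b => lapply (R := ℂ) (bare (l + (m + k)))
      (I.twistedMode ε l a (I.twistedMode ε m b (ket (bare k))) -
      (1 : ℂ) • I.twistedMode ε m b (I.twistedMode ε l a (ket (bare k))))) =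
      (ε l (m + k) * ε m k) • (fun a b =>
        I.vertexMode l a (I.vertexMode m b (ket (bare k))) (bare (l + (m + k)))) -
      (ε m (l + k) * ε l k) • (fun a b =>
        I.vertexMode m b (I.vertexMode l a (ket (bare k))) (bare (l + (m + k)))) := by
    ext1 a
    ext1 b
    rw [twistedMode_twistedMode, twistedMode_twistedMode, chargeMul_ket, chargeMul_ket]
    simp [bare]
  rw [h3, map_sub, map_smul, map_smul] at h2
  simp only [psub, psmul, pzero, map_zero, smul_eq_mul] at h2
  rw [v1] at h2
  have h4 := neg_one_zpow_mul_self lm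
  generalize (zwMul ^ K') (fun a b => I.vertexMode m b (I.vertexMode l a (ket (bare k)))
    (bare (l + (m + k)))) (lk + n) mk = Y at h2 v2
  linear_combination h2 - (ε m (l + k) * ε l k) * (Y * h4 + (-1) ^ lm * v2)

end LatticeInput

namespace LatticeInput

/-! ## The reflected theory is a vertex operator superalgebra -/

variable {N d : ℕ} {I : LatticeInput N d} {κ : Cocycle d}

lemma vertexMode_zero (hI : I.Integral) (t : ℤ) : I.vertexMode 0 t = if t = 0 then lid else 0 := by
  have h0 : ∀ i, I.momentum 0 i = 0 := fun i => by simp [momentum]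
  have := I.family_eq_zero (fun t : ℤ => I.vertexMode 0 t - if t = 0 then lid else 0)
    (fun t i n _ => ?_) (fun t i n => ⟨1, one_ne_zero, ?_⟩) (fun t k k' => ?_) t
  · exact sub_eq_zero.1 this
  · convert szero _
    refine lext fun x => ?_
    simp only [lsub, lcomp, map_sub, bosMode_vertexMode hI, h0,
      Complex.ofReal_zero, zero_smul, add_zero, lzero]
    split_ifs <;> simp
  · convert szero _
    refine lext fun x => ?_
    simp only [lsub, lcomp, one_smul, map_sub, fermMode_vertexMode hI, lzero]
    split_ifs <;> simp
  · rw [lsub, fsub, vertexMode_bare hI, pair_zero_left, zero_add]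
    by_cases ht : t = 0
    · simp [ht, ket_bare_coeff]
    · simp [ht]

lemma refl_vertexOp_zero (hI : I.Integral) (t : ℤ) :
    refl (I.vertexOp 0) t = if t = 0 then lid else 0 := by
  refine lext fun x => ?_
  rw [refl_vertexOp, vertexMode_zero hI]
  have : I.cocycle 0 = fun _ => 1 := funext I.cocycle_zero_left
  rw [this, chargeMul_one]

lemma twistedMode_zero (hI : I.Integral) {ε : Cocycle d} (hε : ∀ k, ε 0 k = 1) (t : ℤ) :
    I.twistedMode ε 0 t = if t = 0 then lid else 0 := by
  refine lext fun x => ?_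
  rw [twistedMode, lcomp, vertexMode_zero hI, show ε 0 = fun _ => 1 from funext hε, chargeMul_one]

lemma _root_.IsNop.eq_of_id {V : Type*} [AddCommGroup V] [Module ℂ V] {A B C : Modes V}
    (h : IsNop A B 1 C) (hB : ∀ t, B t = if t = 0 then lid else 0) : C = A := by
  funext t
  refine lext fun x => ?_
  rw [h t x]
  simp only [hB]
  rcases lt_or_ge t 0 with ht | ht
  · have h1 : ∀ j : ℕ, A j ((if t - j = 0 then lid else 0 : V →ₗ[ℂ] V) x) = 0 :=
      fun j => by rw [if_neg (by omega)]; simp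
    simp only [h1]
    rw [finsum_zero, zero_add, one_smul, finsum_eq_single _ (-1 - t).toNat]
    · rw [if_pos (by omega), show -1 - ((-1 - t).toNat : ℤ) = t by omega]
      rfl
    · intro j hj
      rw [if_neg (by omega)]
      rfl
  · have h1 : ∀ j : ℕ, (if t + 1 + j = 0 then lid else 0 : V →ₗ[ℂ] V)
        (A (-1 - j) x) = 0 := fun j => by rw [if_neg (by omega)]; rfl
    simp only [h1, finsum_zero]
    rw [finsum_eq_single _ t.toNat]
    · simp_all [if_pos]
    · intro j hj
      rw [if_neg (by omega)]
      simp

/-- The reflected fields. -/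
def fieldOf (I : LatticeInput N d) (κ : Cocycle d) : Fock N d →ₗ[ℂ] (Modes (Fock N d)) :=
  Finsupp.linearCombination ℂ (I.stateMode κ)

lemma fieldOf_ket (b : State N d) : I.fieldOf κ (ket b) = I.stateMode κ b := by simp [fieldOf, ket]

lemma fieldOf_eq_sum (v : Fock N d) : I.fieldOf κ v = ∑ b ∈ v.support, v b • I.stateMode κ b := by
  rw [fieldOf, Finsupp.linearCombination_apply, Finsupp.sum]

/-- The data of the reflected theory. -/
def reflData (I : LatticeInput N d) (κ : Cocycle d) : VOSAData where
  V := Fock N d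
  parity := fermParity
  vac := vacuum
  conf := I.stress false + I.stress true
  mode := LinearMap.pi fun n : ℤ => (LinearMap.proj (-n - 1)).comp (I.fieldOf κ)

lemma stateMode_bosPair (hI : I.Integral) (hκ : ∀ k, κ 0 k = 1) (i : Fin N) :
    ∃ P, IsNop (I.bosMode i) (I.bosMode i) 1 P ∧
      I.fieldOf κ (bosCreate i 0 (bosCreate i 0 vacuum)) = P := by
  have e : bosCreate i 0 (bosCreate i 0 (vacuum : Fock N d)) =
      ket { bos := single (toLex (i, 0)) 2, ferm := ∅, charge := 0 } := by
    rw [vacuum, bosCreate_ket, bosCreate_ket]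
    simp only [zero_add, ← Finsupp.single_add]
  have hs : (single (toLex (i, 0) : Osc N) 2).toMultiset.sort (· ≤ ·) =
      [toLex (i, 0), toLex (i, 0)] := by
    rw [Finsupp.toMultiset_single, two_nsmul, Multiset.singleton_add, Multiset.sort_cons,
      Multiset.sort_singleton]
    simp
  rw [e, fieldOf_ket]
  have hB := vertexOp_reflectable hI (0 : Charge d)
  have h1 := isNop_refl (right := I.isRight i) (n := 0) (s := 1) hB (I.bosMode i)
    (fun k => I.bosMode_natCast i k) (fun k => I.bosMode_neg i k) (I.bosAnnihilate_eventually i)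
  have h2 := isNop_refl (right := I.isRight i) (n := 0) (s := 1)
    (hB.normalOrder (right := I.isRight i) (c := bosCreate i) (n := 0) (s := 1)
      (I.bosAnnihilate_eventually i)) (I.bosMode i)
    (fun k => I.bosMode_natCast i k) (fun k => I.bosMode_neg i k) (I.bosAnnihilate_eventually i)
  rw [h1.eq_of_id (refl_vertexOp_zero hI), divDeriv_zero] at h2
  refine ⟨_, h2, ?_⟩
  funext t
  refine lext fun x => ?_
  rw [stateMode, lcomp, show κ 0 = fun _ => 1 from funext hκ, chargeMul_one, stateField, hs]
  simp [bosField, fermField, Osc.idx, Osc.lvl]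

lemma stateMode_fermPair (hI : I.Integral) (hκ : ∀ k, κ 0 k = 1) (i : Fin N) :
    ∃ Q, IsNop (fermMode i) (divDeriv 1 (fermMode i)) (-1) Q ∧
      I.fieldOf κ (fermCreate i 1 (fermCreate i 0 vacuum)) = -Q := by
  have hlt : (toLex (i, 0) : Osc N) < toLex (i, 1) := by
    rw [Prod.Lex.toLex_lt_toLex]
    exact Or.inr ⟨rfl, by norm_num⟩
  have e : fermCreate i 1 (fermCreate i 0 (vacuum : Fock N d)) =
      -ket { bos := 0, ferm := {toLex (i, 0), toLex (i, 1)}, charge := 0 } := by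
    rw [vacuum, fermCreate_ket, if_neg (by simp), map_smul, fermCreate_ket, if_neg (by simp)]
    simp only [fermSign, Finset.filter_empty, Finset.card_empty, pow_zero, one_smul,
      insert_empty_eq, Finset.filter_singleton, if_pos hlt, Finset.card_singleton, pow_one,
      neg_smul]
    rw [Finset.pair_comm]
  have hs : ({toLex (i, 0), toLex (i, 1)} : Finset (Osc N)).sort (· ≤ ·) =
      [toLex (i, 0), toLex (i, 1)] := by
    grind [Finset.sort_insert, Finset.sort_singleton, Finset.mem_singleton]
  rw [e, map_neg, fieldOf_ket]
  have hB := vertexOp_reflectable hI (0 : Charge d)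
  have h1 := isNop_refl (right := I.isRight i) (n := 1) (s := 1) hB (fermMode i)
    (fun k => fermMode_natCast i k) (fun k => fermMode_neg i k) (fermAnnihilate_eventually i)
  have h2 := isNop_refl (right := I.isRight i) (n := 0) (s := -1)
    (hB.normalOrder (right := I.isRight i) (c := fermCreate i) (n := 1) (s := 1)
      (fermAnnihilate_eventually i)) (fermMode i)
    (fun k => fermMode_natCast i k) (fun k => fermMode_neg i k) (fermAnnihilate_eventually i)
  rw [h1.eq_of_id (refl_vertexOp_zero hI), divDeriv_zero] at h2
  refine ⟨_, h2, ?_⟩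
  congr 1
  funext t
  refine lext fun x => ?_
  rw [stateMode, lcomp, show κ 0 = fun _ => 1 from funext hκ, chargeMul_one, stateField, hs]
  simp [bosField, fermField, Osc.idx, Osc.lvl]

lemma stress_add (I : LatticeInput N d) : I.stress false + I.stress true = ∑ i, (1 / 2 : ℂ) •
    (bosCreate i 0 (bosCreate i 0 vacuum) + fermCreate i 1 (fermCreate i 0 vacuum)) := by
  rw [stress, stress, ← sum_add_distrib]
  refine sum_congr rfl fun i _ => ?_
  cases I.isRight i <;> simp

lemma isStress_fieldOf (hI : I.Integral) (hκ : ∀ k, κ 0 k = 1) :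
    I.IsStress (I.fieldOf κ (I.stress false + I.stress true)) := by
  choose P hP hP' using fun i => stateMode_bosPair (κ := κ) hI hκ i
  choose Q hQ hQ' using fun i => stateMode_fermPair (κ := κ) hI hκ i
  refine ⟨P, Q, hP, hQ, fun t x => ?_⟩
  rw [stress_add, map_sum, Finset.sum_apply, lsum]
  refine sum_congr rfl fun i _ => ?_
  rw [map_smul, map_add, hP', hQ']
  simp [sub_eq_add_neg]

lemma fieldOf_truncated (hI : I.Integral) (v : Fock N d) : Truncated (I.fieldOf κ v) := by
  induction v using fock_induction with
  | h0 => exact fun x => ⟨0, fun n _ => by simp⟩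
  | hadd v w hv hw =>
    intro x
    obtain ⟨M, hM⟩ := hv x
    obtain ⟨M', hM'⟩ := hw x
    refine ⟨min M M', fun n hn => ?_⟩
    rw [map_add, padd, ladd, hM n (by omega), hM' n (by omega), add_zero]
  | hket c b =>
    intro x
    obtain ⟨M, hM⟩ := (stateMode_local_free hI κ b).1 x
    refine ⟨M, fun n hn => ?_⟩
    rw [map_smul, fieldOf_ket, psmul, lsmul, hM n hn, smul_zero]

lemma stateMode_local_stateMode (hI : I.Integral) {ω : Modes (Fock N d)}
    (hω : I.IsStress ω) (hε : I.IsLocalCocycle (I.twist κ)) (b b' : State N d) :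
    LocalFields (I.stateMode κ b) (I.stateMode κ b') ((-1) ^ (b.ferm.card * b'.ferm.card)) := by
  obtain ⟨-, hb, hf⟩ := stateMode_local_free hI κ b'
  rw [mul_comm]
  refine stateMode_local hI κ b _ hb hf ?_
  have h := stateMode_local hI κ b' 0
    (fun i => bosMode_twistedMode_local hI _ b.charge i)
    (fun i => by simpa using fermMode_twistedMode_local hI _ b.charge i)
    (twistedMode_local hI hω hε _ _)
  rw [zero_mul, pow_zero] at h
  exact h.symm (one_mul 1)

lemma fermParity_apply (v : Fock N d) (b : State N d) :
    fermParity v b = (-1 : ℂ) ^ b.ferm.card * v b :=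
  diagonal_apply fermParity_ket v b

lemma fermParity_fermParity (v : Fock N d) : fermParity (fermParity v) = v := by
  grind [fermParity_apply, neg_one_pow_mul_self]

lemma fieldOf_local (hI : I.Integral) {ω : Modes (Fock N d)}
    (hω : I.IsStress ω) (hε : I.IsLocalCocycle (I.twist κ)) (p q : ℕ)
    (u v : Fock N d) (hu : fermParity u = (-1 : ℂ) ^ p • u) (hv : fermParity v = (-1 : ℂ) ^ q • v) :
    LocalFields (I.fieldOf κ u) (I.fieldOf κ v) ((-1) ^ (p * q)) := by
  have key : ∀ {p : ℕ} {u : Fock N d}, fermParity u = (-1 : ℂ) ^ p • u → ∀ b ∈ u.support,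
      (-1 : ℂ) ^ b.ferm.card = (-1) ^ p := by
    intro p u hu b hb
    have := DFunLike.congr_fun hu b
    rw [fermParity_apply, fsmul, smul_eq_mul] at this
    exact mul_right_cancel₀ (Finsupp.mem_support_iff.1 hb) this
  have hs : (-1 : ℂ) ^ (p * q) * (-1) ^ (p * q) = 1 := neg_one_pow_mul_self _
  rw [fieldOf_eq_sum u]
  refine LocalFields.sum _ fun b hb => LocalFields.smul _ (LocalFields.symm ?_ hs)
  rw [fieldOf_eq_sum v]
  refine LocalFields.sum _ fun b' hb' => LocalFields.smul _ (LocalFields.symm ?_ hs)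
  have := stateMode_local_stateMode hI hω hε b b'
  rwa [pow_mul, key hu b hb, ← pow_mul, mul_comm p, pow_mul, key hv b' hb', ← pow_mul,
    mul_comm q] at this

lemma pair_self_nonneg (I : LatticeInput N d) (l : Charge d) : 0 ≤ I.pair l l :=
  sum_nonneg fun _ _ => mul_self_nonneg _

lemma weight_nonneg (b : State N d) : 0 ≤ I.weight b := by
  have := I.pair_self_nonneg b.charge
  have h2 : 0 ≤ ∑ m ∈ b.ferm, ((m.lvl : ℝ) + 1 / 2) := sum_nonneg fun _ _ => by positivity
  unfold weight
  positivity

lemma exists_weight (hev : ∀ l, ∃ n : ℤ, I.pair l l = 2 * n) (b : State N d) :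
    ∃ n : ℤ, (I.weight b : ℂ) = n / 2 ∧ (-1 : ℂ) ^ b.ferm.card = (-1) ^ n := by
  obtain ⟨n, hn⟩ := hev b.charge
  refine ⟨2 * oscWt b.bos + 2 * ∑ m ∈ b.ferm, (m.lvl : ℤ) + 2 * n + b.ferm.card, ?_, ?_⟩
  · rw [weight, hn, sum_add_distrib, Finset.sum_const]
    push_cast
    simp only [nsmul_eq_mul]
    ring
  · rw [zpow_add₀ (by norm_num), zpow_natCast, Even.neg_one_zpow ⟨oscWt b.bos +
      ∑ m ∈ b.ferm, (m.lvl : ℤ) + n, by ring⟩, one_mul]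

lemma finite_weight_le (hfin : ∀ C : ℝ, {l | I.pair l l ≤ C}.Finite) (C : ℝ) :
    {b : State N d | I.weight b ≤ C}.Finite := by
  obtain ⟨W, hW⟩ := exists_nat_ge C
  have hosc : {m : Osc N | m.lvl ≤ W}.Finite := by
    refine (((Set.finite_univ (α := Fin N)).prod (Set.finite_Iic W)).image toLex).subset
      fun m hm => ⟨ofLex m, ⟨trivial, hm⟩, rfl⟩
  refine (((finite_oscWt_le W).prod (hosc.finite_subsets.preimage
    Finset.coe_injective.injOn)).prod (hfin (2 * W))).of_injOn
    (f := fun b : State N d => ((b.bos, b.ferm), b.charge)) (fun b hb => ?_) (fun b _ b' _ h => ?_)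
  · simp only [Set.mem_ofPred_eq, weight] at hb
    have h0 := I.pair_self_nonneg b.charge
    have h1 : 0 ≤ ∑ m ∈ b.ferm, ((m.lvl : ℝ) + 1 / 2) := sum_nonneg fun _ _ => by positivity
    have h2 : (0 : ℝ) ≤ oscWt b.bos := by positivity
    refine ⟨⟨?_, fun m hm => ?_⟩, ?_⟩
    · have : (oscWt b.bos : ℝ) ≤ W := by linarith
      exact Nat.cast_le.1 this
    · have := single_le_sum (f := fun m : Osc N => (m.lvl : ℝ) + 1 / 2)
        (fun m _ => by positivity) hm
      simp only at this
      have : (m.lvl : ℝ) ≤ W := by linarith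
      exact Nat.cast_le.1 this
    · show I.pair b.charge b.charge ≤ 2 * W
      linarith
  · simp only [Prod.mk.injEq] at h
    exact State.ext h.1.1 h.1.2 h.2

lemma reflData_L (n : ℤ) : (I.reflData κ).L n =
    I.fieldOf κ (I.stress false + I.stress true) (-n - 2) := by
  show I.fieldOf κ (I.stress false + I.stress true) (-(n + 1) - 1) = _
  rw [show -(n + 1) - 1 = -n - 2 by ring]

lemma isTC_fieldOf (hI : I.Integral) {ω : Modes (Fock N d)}
    (hω : I.IsStress ω) (v : Fock N d) : IsTC (ω (-1)) (I.fieldOf κ v) := by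
  induction v using fock_induction with
  | h0 => intro n x; simp
  | hadd v w hv hw =>
    intro n x
    simp only [map_add, padd, ladd, smul_add, ← hv n x, ← hw n x]
    abel
  | hket c b =>
    intro n x
    rw [map_smul, fieldOf_ket]
    simp only [psmul, lsmul, map_smul]
    rw [← smul_sub, smul_comm]
    congr 1
    exact stateMode_isTC hI κ b hω.isTC_bosMode hω.isTC_fermMode (hω.isTC_twistedMode hI _ _) n x

lemma fieldOf_creates (hI : I.Integral) (hκ : ∀ l, κ l 0 = 1) (v : Fock N d) :
    Creates (I.fieldOf κ v) vacuum v := by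
  induction v using fock_induction with
  | h0 => exact ⟨fun t _ => by simp, by simp⟩
  | hadd v w hv hw =>
    refine ⟨fun t ht => ?_, ?_⟩
    · rw [map_add, padd, ladd, hv.1 t ht, hw.1 t ht, add_zero]
    · rw [map_add, padd, ladd, hv.2, hw.2]
  | hket c b =>
    have h := stateMode_creates hI κ b
    rw [hκ, one_smul] at h
    refine ⟨fun t ht => ?_, ?_⟩
    · rw [map_smul, fieldOf_ket, psmul, lsmul, h.1 t ht, smul_zero]
    · rw [map_smul, fieldOf_ket, psmul, lsmul, h.2]

lemma fieldOf_parity (hI : I.Integral) (v : Fock N d) (n : ℤ) (x : Fock N d) :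
    fermParity (I.fieldOf κ v n x) = I.fieldOf κ (fermParity v) n (fermParity x) := by
  induction v using fock_induction with
  | h0 => simp
  | hadd v w hv hw => simp only [map_add, padd, ladd, hv, hw]
  | hket c b =>
    simp_all [fieldOf_ket, fermParity_ket, stateMode_parity]

lemma stateMode_bare (k : Charge d) : I.stateMode κ (bare k) =
    I.twistedMode (I.twist κ) k := by
  funext t
  refine lext fun x => ?_
  rw [stateMode, twistedMode, lcomp, lcomp, ← chargeMul_chargeMul, ← refl_vertexOp]
  simp [stateField, bare, bosField, fermField]

lemma fieldOf_vacuum (hI : I.Integral) (hκ : ∀ k, I.cocycle 0 k * κ 0 k = 1) (t : ℤ) :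
    I.fieldOf κ vacuum t = if t = 0 then lid else 0 := by
  rw [vacuum_eq_bare, fieldOf_ket, stateMode_bare, twistedMode_zero hI hκ]

lemma fermParity_stress (I : LatticeInput N d) :
    fermParity (I.stress false + I.stress true) = I.stress false + I.stress true := by
  rw [stress_add, map_sum]
  refine sum_congr rfl fun i _ => ?_
  have hv : fermParity (vacuum : Fock N d) = vacuum := by
    rw [vacuum, fermParity_ket]
    simp
  rw [map_smul, map_add, ← I.bosMode_natCast, fermParity_bosMode, fermParity_bosMode,
    ← fermMode_natCast, ← fermMode_natCast, fermParity_fermMode, fermParity_fermMode, hv]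
  simp

lemma IsLocalCocycle.one_left (hε : I.IsLocalCocycle (I.twist κ))
    (k : Charge d) : κ 0 k = 1 := by
  simpa [twist, cocycle_zero_left] using hε.zero_left k

lemma IsLocalCocycle.one_right (hε : I.IsLocalCocycle (I.twist κ))
    (k : Charge d) : κ k 0 = 1 := by
  simpa [twist, cocycle_zero_right] using hε.zero_right k

lemma reflData_isVOSA (hI : I.Integral) (hev : ∀ l, ∃ n : ℤ, I.pair l l = 2 * n)
    (hfin : ∀ C : ℝ, {l | I.pair l l ≤ C}.Finite)
    (hε : I.IsLocalCocycle (I.twist κ)) :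
    (I.reflData κ).IsVOSA (3 * N / 2) := by
  have hκl := hε.one_left
  have hω := isStress_fieldOf hI hκl
  have heig : ∀ (n : ℤ) (v : Fock N d), v ∈ eigenspace
      ((I.fieldOf κ (I.stress false + I.stress true)) (-2)) ((n : ℂ) / 2) ↔
      ∀ b ∈ v.support, (I.weight b : ℂ) = n / 2 := by
    intro n v
    rw [Module.End.mem_eigenspace_iff, Finsupp.ext_iff]
    refine forall_congr' fun b => ?_
    rw [hω.apply, fsmul, smul_eq_mul, Finsupp.mem_support_iff]
    constructor
    · exact fun h h0 => mul_right_cancel₀ h0 h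
    · intro h
      by_cases h0 : v b = 0
      · rw [h0, mul_zero, mul_zero]
      · rw [h h0]
  have hdim : ∀ n : ℤ, FiniteDimensional ℂ (eigenspace (M := Fock N d)
      ((I.fieldOf κ (I.stress false + I.stress true)) (-2)) ((n : ℂ) / 2)) := by
    intro n
    have hS := finite_weight_le (I := I) hfin (n / 2)
    have : Module.Finite ℂ (Finsupp.supported ℂ ℂ {b : State N d | I.weight b ≤ n / 2}) := by
      have := hS.to_subtype
      exact Module.Finite.equiv (Finsupp.supportedEquivFinsupp (R := ℂ) (M := ℂ) _).symm
    refine Submodule.finiteDimensional_of_le (V := Fock N d) (S₂ := Finsupp.supported ℂ ℂ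
      {b : State N d | I.weight b ≤ n / 2}) fun v hv b hb => ?_
    have := (heig n v).1 hv b hb
    have h2 : I.weight b = n / 2 := mod_cast this
    exact h2.le
  have hpar : ∀ (n : ℤ) (v : Fock N d), v ∈ eigenspace
      ((I.fieldOf κ (I.stress false + I.stress true)) (-2)) ((n : ℂ) / 2) →
      fermParity v = (-1 : ℂ) ^ n • v := by
    intro n v hv
    refine Finsupp.ext fun b => ?_
    rw [fermParity_apply, fsmul, smul_eq_mul]
    by_cases h0 : v b = 0
    · rw [h0, mul_zero, mul_zero]
    · obtain ⟨m, hm, hm'⟩ := exists_weight hev b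
      have := (heig n v).1 hv b (Finsupp.mem_support_iff.2 h0)
      rw [hm] at this
      have hmn : m = n := by simp_all []
      rw [hm', hmn]
  have L0 : (I.reflData κ).L 0 = I.fieldOf κ (I.stress false + I.stress true) (-2) := by
    rw [reflData_L, neg_zero, zero_sub]
  refine
    { parity_parity := fun v => ?_
      parity_mode := fun v n w => fieldOf_parity hI v _ w
      parity_vac := ?_
      parity_conf := I.fermParity_stress
      vac_ne_zero := Finsupp.single_ne_zero.2 one_ne_zero
      truncation := fun v w => ?_
      vacuum := fun n w => ?_
      creation := fun v => (fieldOf_creates hI hε.one_right v).2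
      creation_regular := fun v n hn => (fieldOf_creates hI hε.one_right v).1 _ (by omega)
      translation := fun v n w => ?_
      locality := fun p q u v hu hv => ?_
      virasoro := fun m n x => ?_
      grading := ?_
      grading_finite := fun n => ?_
      grading_bounded := ⟨0, fun n hn => ?_⟩
      grading_parity := fun n v hv => ?_ }
  · exact fermParity_fermParity v
  · show fermParity vacuum = vacuum
    rw [vacuum, fermParity_ket]
    simp
  · obtain ⟨M, hM⟩ := fieldOf_truncated (κ := κ) hI v w
    exact ⟨-M, fun n hn => hM _ (by omega)⟩
  · show I.fieldOf κ vacuum (-n - 1) w = _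
    rw [fieldOf_vacuum hI hε.zero_left]
    by_cases hn : n = -1
    · rw [if_pos (by omega), if_pos hn]
      rfl
    · rw [if_neg (by omega), if_neg hn]
      rfl
  · have := isTC_fieldOf (κ := κ) hI hω v (-n - 1) w
    rw [show -n - 1 + 1 = -n by ring] at this
    have e : (I.reflData κ).mode v (n - 1) = I.fieldOf κ v (-n) :=
      congrArg (I.fieldOf κ v) (by ring)
    rw [reflData_L, show (- -1 - 2 : ℤ) = -1 by norm_num, e, ← Int.cast_neg]
    exact this
  · obtain ⟨K, hK⟩ := fieldOf_local hI hω hε p q u v hu hv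
    refine ⟨K, fun m k x => ?_⟩
    have := congrFun (congrFun (hK x) (-m - 1)) (-k - 1)
    rw [zwMul_pow_apply] at this
    refine Eq.trans (sum_congr rfl fun j _ => ?_) this
    rw [show -m - 1 - (K - j : ℤ) = -(m + K - j) - 1 by ring,
      show -k - 1 - (j : ℤ) = -(k + j) - 1 by ring]
    rfl
  · rw [reflData_L, reflData_L, reflData_L]
    exact hω.virasoro m n x
  · rw [L0, eq_top_iff]
    intro v _
    induction v using fock_induction with
    | h0 => exact szero _
    | hadd v w hv hw => exact add_mem (hv trivial) (hw trivial)
    | hket c b =>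
      refine smul_mem _ _ ?_
      obtain ⟨n, hn, -⟩ := exists_weight hev b
      refine Submodule.mem_iSup_of_mem n ((heig n _).2 fun b' hb' => ?_)
      have := Finsupp.support_single_subset hb'
      rw [Finset.mem_singleton] at this
      rw [this, hn]
  · rw [L0]
    exact hdim n
  · rw [L0, eq_bot_iff]
    intro v hv
    rw [Submodule.mem_bot]
    refine Finsupp.support_eq_empty.1 (Finset.eq_empty_of_forall_notMem fun b hb => ?_)
    have := (heig n v).1 hv b hb
    have h2 : I.weight b = n / 2 := mod_cast this
    have h3 := weight_nonneg (I := I) b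
    have h4 : (n : ℝ) < 0 := mod_cast hn
    linarith
  · rw [L0] at hv
    exact hpar n v hv

end LatticeInput

namespace LatticeInput

/-! ## Reflections of lattice theories -/

variable {N d : ℕ} {I : LatticeInput N d}

/-- The fields of the theory. -/
def theoryField (I : LatticeInput N d) : Fock N d →ₗ[ℂ] (ℝ × ℝ → Op N d) :=
  Finsupp.linearCombination ℂ I.stateField

lemma theoryField_ket (b : State N d) : I.theoryField (ket b) = I.stateField b := by
  simp [theoryField, ket]

lemma isReflection_iff {W : VOSAData} : I.theory.IsReflection W ↔
    (∀ (v w : Fock N d) (r s : ℝ), I.theoryField v (r, s) w ≠ 0 → ∃ n : ℤ, r + s = n) ∧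
    ∃ (Φ : Fock N d ≃ₗ[ℂ] W.V) (κ : Charge d → Charge d → ℂˣ),
      Φ vacuum = W.vac ∧ Φ (I.stress false + I.stress true) = W.conf ∧
      (∀ v, Φ (fermParity v) = W.parity (Φ v)) ∧
      ∀ k l, ∀ v ∈ span ℂ (ket '' {b : State N d | b.charge = k}),
        ∀ w ∈ span ℂ (ket '' {b : State N d | b.charge = l}), ∀ n : ℤ,
        W.mode (Φ v) n (Φ w) =
          (κ k l : ℂ) • Φ (∑ᶠ r : ℝ, I.theoryField v (r, -n - 1 - r) w) :=
  Iff.rfl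

lemma isomorphic_iff {κ : Cocycle d} {W : VOSAData} :
    (I.reflData κ).Isomorphic W ↔ ∃ f : Fock N d ≃ₗ[ℂ] W.V,
      f vacuum = W.vac ∧ f (I.stress false + I.stress true) = W.conf ∧
      (∀ v, f (fermParity v) = W.parity (f v)) ∧
      ∀ v (n : ℤ) w, f (I.fieldOf κ v (-n - 1) w) = W.mode (f v) n (f w) :=
  Iff.rfl

lemma stateField_reflectable (hI : I.Integral) (b : State N d) : Reflectable (I.stateField b) :=
  bosField_reflectable I (fermField_reflectable hI b.charge _) _

lemma stateField_bare (l : Charge d) : I.stateField (bare l) = I.vertexOp l := by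
  simp [stateField, bare, bosField, fermField]

lemma stateMode_ket (hI : I.Integral) (κ : Cocycle d) (b b' : State N d)
    (t : ℤ) : I.stateMode κ b t (ket b') =
      κ b.charge b'.charge • ∑ᶠ r : ℝ, I.stateField b (r, t - r) (ket b') := by
  rw [stateMode, lcomp, chargeMul_ket, map_smul, refl_apply (stateField_reflectable hI b)]

lemma integral_of_isReflection {W : VOSAData} (h : I.theory.IsReflection W) : I.Integral := by
  intro l m
  obtain ⟨n, hn⟩ := (isReflection_iff.1 h).1 (ket (bare l)) (ket (bare m))
    (I.leadExponent (I.momentum l) (I.momentum m)).1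
    (I.leadExponent (I.momentum l) (I.momentum m)).2 (fun h0 => by
      have := DFunLike.congr_fun h0 (bare (l + m))
      rw [theoryField_ket, stateField_bare, vertexOp_lead, if_pos ⟨rfl, rfl⟩] at this
      exact I.cocycle_ne_zero l m this)
  exact ⟨n, by rw [← hn, leadExponent_total]⟩

lemma exists_isomorphic_of_isReflection {W : VOSAData} (h : I.theory.IsReflection W) :
    ∃ κ : Cocycle d, (∀ l m, κ l m ≠ 0) ∧ (I.reflData κ).Isomorphic W := by
  have hI := integral_of_isReflection h
  obtain ⟨-, Φ, κ, h1, h2, h3, h4⟩ := isReflection_iff.1 h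
  refine ⟨fun l m => κ l m, fun l m => (κ l m).ne_zero,
    isomorphic_iff.2 ⟨Φ, h1, h2, h3, fun v n w => ?_⟩⟩
  have e : (((-n - 1 : ℤ)) : ℝ) = -n - 1 := by push_cast; ring
  revert w
  refine fock_induction (p := fun v => ∀ w : Fock N d,
    Φ (I.fieldOf (fun l m => (κ l m : ℂ)) v (-n - 1) w) = W.mode (Φ v) n (Φ w)) v
    (fun w => by simp) (fun x y hx hy w => ?_) (fun c b w => ?_)
  · simp only [map_add, padd, ladd, hx, hy]
  · refine fock_induction (p := fun w => Φ (I.fieldOf (fun l m => (κ l m : ℂ)) (c • ket b)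
      (-n - 1) w) = W.mode (Φ (c • ket b)) n (Φ w)) w (by simp) (fun x y hx hy => ?_)
      (fun c' b' => ?_)
    · simp only [map_add, hx, hy]
    · have := h4 b.charge b'.charge (ket b) (subset_span ⟨b, rfl, rfl⟩) (ket b')
        (subset_span ⟨b', rfl, rfl⟩) n
      rw [theoryField_ket] at this
      simp only [map_smul, psmul, lsmul, fieldOf_ket, stateMode_ket hI, e]
      rw [this]

lemma theoryField_reflectable (hI : I.Integral) (v : Fock N d) : Reflectable (I.theoryField v) := by
  induction v using fock_induction with
  | h0 => exact ⟨fun w x h => absurd (by simp) h, fun w t => by simp, fun w => ⟨0, by simp⟩⟩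
  | hadd v w hv hw =>
    have hor : ∀ x y, I.theoryField (v + w) x y ≠ 0 →
        I.theoryField v x y ≠ 0 ∨ I.theoryField w x y ≠ 0 := by
      intro x y h
      by_contra! hc
      rw [map_add, padd, ladd, hc.1, hc.2, add_zero] at h
      exact h rfl
    refine ⟨fun y x h => ?_, fun y t => ?_, fun y => ?_⟩
    · exact (hor _ _ h).elim (hv.int y x) (hw.int y x)
    · exact ((hv.fin y t).union (hw.fin y t)).subset fun r hr => hor _ _ hr
    · obtain ⟨M, hM⟩ := hv.bdd y
      obtain ⟨M', hM'⟩ := hw.bdd y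
      refine ⟨min M M', fun x h => ?_⟩
      rcases hor _ _ h with h | h
      · exact (Int.cast_le.2 (min_le_left M M')).trans (hM x h)
      · exact (Int.cast_le.2 (min_le_right M M')).trans (hM' x h)
  | hket c b =>
    have key : ∀ x y, I.theoryField (c • ket b) x y ≠ 0 → I.stateField b x y ≠ 0 := by
      intro x y h h0
      rw [map_smul, theoryField_ket, psmul, lsmul, h0, smul_zero] at h
      exact h rfl
    have hb := stateField_reflectable hI b
    refine ⟨fun y x h => hb.int y x (key _ _ h), fun y t => (hb.fin y t).subset fun r hr =>
      key _ _ hr, fun y => ?_⟩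
    obtain ⟨M, hM⟩ := hb.bdd y
    exact ⟨M, fun x h => hM x (key _ _ h)⟩

lemma refl_theoryField (hI : I.Integral) (v : Fock N d) (t : ℤ) :
    refl (I.theoryField v) t = I.fieldOf (fun _ _ => 1) v t := by
  induction v using fock_induction with
  | h0 =>
    refine lext fun x => ?_
    rw [refl_apply (theoryField_reflectable hI _)]
    simp
  | hadd v w hv hw =>
    rw [map_add (I.fieldOf _), padd, ← hv, ← hw]
    refine lext fun x => ?_
    rw [ladd]
    rw [refl_apply (theoryField_reflectable hI _), refl_apply (theoryField_reflectable hI _),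
      refl_apply (theoryField_reflectable hI _)]
    rw [← finsum_add_distrib ((theoryField_reflectable hI v).fin x t)
      ((theoryField_reflectable hI w).fin x t)]
    simp
  | hket c b =>
    refine lext fun x => ?_
    rw [refl_apply (theoryField_reflectable hI _), map_smul, map_smul, fieldOf_ket,
      theoryField_ket, psmul, lsmul, stateMode, lcomp,
      chargeMul_one, refl_apply (stateField_reflectable hI b),
      smul_finsum' _ ((stateField_reflectable hI b).fin x t)]
    simp

lemma isReflection_reflData (hI : I.Integral) (κ : Charge d → Charge d → ℂˣ) :
    I.theory.IsReflection (I.reflData fun l m => κ l m) := by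
  refine isReflection_iff.2 ⟨fun v w r s h => (theoryField_reflectable hI v).int w (r, s) h,
    LinearEquiv.refl ℂ (Fock N d), κ, rfl, rfl, fun _ => rfl, fun k l v hv w hw n => ?_⟩
  have hw' : chargeMul (fun m => (κ k m : ℂ)) w = (κ k l : ℂ) • w := by
    refine span_induction (p := fun w _ => chargeMul (fun m => (κ k m : ℂ)) w =
      (κ k l : ℂ) • w) ?_ (by simp) (fun x y _ _ hx hy => by rw [map_add, hx, hy, smul_add])
      (fun c x _ hx => by rw [map_smul, hx, smul_comm]) hw
    rintro _ ⟨b, hb, rfl⟩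
    rw [chargeMul_ket]
    exact congrArg (fun m => (κ k m : ℂ) • ket b) hb
  have key : ∀ t : ℤ, I.fieldOf (fun l m => (κ l m : ℂ)) v t =
      I.fieldOf (fun _ _ => 1) v t ∘ₗ chargeMul (fun m => (κ k m : ℂ)) := by
    intro t
    refine span_induction (p := fun v _ => I.fieldOf (fun l m => (κ l m : ℂ)) v t =
      I.fieldOf (fun _ _ => 1) v t ∘ₗ chargeMul (fun m => (κ k m : ℂ))) ?_
      (by simp) (fun x y _ _ hx hy => by
        rw [map_add, map_add, padd, padd, hx, hy, LinearMap.add_comp])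
      (fun c x _ hx => by
        rw [map_smul, map_smul, psmul, psmul, hx, LinearMap.smul_comp]) hv
    rintro _ ⟨b, hb, rfl⟩
    have hb : b.charge = k := hb
    refine lext fun x => ?_
    rw [fieldOf_ket, fieldOf_ket, lcomp, stateMode, stateMode, lcomp, lcomp, chargeMul_one, hb]
  show I.fieldOf (fun l m => (κ l m : ℂ)) v (-n - 1) w =
    (κ k l : ℂ) • ∑ᶠ r : ℝ, I.theoryField v (r, -n - 1 - r) w
  rw [key, lcomp, hw', map_smul, ← refl_theoryField hI, refl_apply (theoryField_reflectable hI v)]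
  push_cast
  rfl

lemma isLocalCocycle_of_isomorphic (hI : I.Integral) {κ : Cocycle d}
    {W : VOSAData} {c : ℂ} (hW : W.IsVOSA c) (h : (I.reflData κ).Isomorphic W) :
    I.IsLocalCocycle (I.twist κ) := by
  obtain ⟨f, hvac, -, h3, hmode⟩ := isomorphic_iff.1 h
  have hω := isStress_fieldOf (κ := fun _ _ => 1) hI fun _ => rfl
  have hbare : ∀ l, W.HasParity 0 (f (ket (bare l))) := fun l => by
    rw [VOSAData.HasParity, ← h3, fermParity_ket]
    simp [bare]
  refine ⟨fun k => ?_, fun l => ?_, fun l m k n hn => ?_⟩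
  · have := hW.vacuum (-1) (f (ket (bare k)))
    rw [if_pos rfl, ← hvac, ← hmode] at this
    have := DFunLike.congr_fun (f.injective this) (bare k)
    rw [vacuum_eq_bare, fieldOf_ket, stateMode_bare, twistedMode, lcomp,
      chargeMul_ket, map_smul, fsmul, vertexMode_bare hI, ket_bare_coeff,
      if_pos rfl, pair_zero_left] at this
    simpa [bare] using this
  · have := hW.creation (f (ket (bare l)))
    rw [← hvac, ← hmode] at this
    have := DFunLike.congr_fun (f.injective this) (bare l)
    rw [vacuum_eq_bare, fieldOf_ket, stateMode_bare, twistedMode, lcomp,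
      chargeMul_ket, map_smul, fsmul, vertexMode_bare hI, ket_bare_coeff,
      if_pos rfl, pair_zero_right] at this
    simpa [bare] using this
  · refine comm_of_twistedMode_local (ε := I.twist κ) hI hω ?_ k n hn
    obtain ⟨K, hK⟩ := hW.locality 0 0 _ _ (hbare l) (hbare m)
    refine ⟨K, fun x => ?_⟩
    ext1 a
    ext1 b
    rw [zwMul_pow_apply, pzero, pzero]
    refine f.injective (Eq.trans ?_ ((hK (-a - 1) (-b - 1) (f x)).trans (map_zero f).symm))
    rw [map_sum]
    refine sum_congr rfl fun j _ => ?_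
    rw [← hmode, ← hmode, ← hmode, ← hmode, map_smul, map_sub, map_smul,
      show -(-a - 1 + K - j) - 1 = a - (K - j : ℤ) by ring,
      show -(-b - 1 + j) - 1 = b - (j : ℤ) by ring, fieldOf_ket, fieldOf_ket, stateMode_bare,
      stateMode_bare, mul_zero, pow_zero]

/-! ### Chiral theories -/

/-- A chiral field contains no powers of `z̄`. -/
def IsChiral (B : ℝ × ℝ → Op N d) : Prop := ∀ x w, B x w ≠ 0 → x.2 = 0

lemma IsChiral.of_ket {B : ℝ × ℝ → Op N d} (h : ∀ x b, x.2 ≠ 0 → B x (ket b) = 0) : IsChiral B := by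
  intro x w hw
  by_contra hx
  refine hw ?_
  induction w using fock_induction with
  | h0 => simp
  | hadd v w hv hw => simp_all
  | hket c b => rw [map_smul, h x b hx, smul_zero]

lemma IsChiral.normalOrder {B : ℝ × ℝ → Op N d} (hB : IsChiral B)
    (c a : ℕ → Op N d) (n : ℕ) (s : ℂ) : IsChiral (normalOrder false c a n s B) := by
  refine IsChiral.of_ket fun x b hx => ?_
  have h0 : ∀ y : ℝ × ℝ, y.2 = x.2 → ∀ w, B y w = 0 := fun y hy w => by
    by_contra hc
    exact hx (hy ▸ hB y w hc)
  rw [LatticeInput.normalOrder, onBasis_ket]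
  have h1 : ∀ k : ℕ, B (x - expo false (k - n)) (ket b) = 0 := fun k => h0 _ (by simp [expo]) _
  have h2 : ∀ k : ℕ, B (x + expo false (k + 1 + n)) (a k (ket b)) = 0 := fun k =>
    h0 _ (by simp [expo]) _
  simp [h1, h2]

lemma vertexOp_isChiral (h : ∀ i, I.isRight i = false) (l : Charge d) :
    IsChiral (I.vertexOp l) := by
  refine IsChiral.of_ket fun x b hx => ?_
  rw [vertexOp, onBasis_ket]
  have h1 : ∀ p q, (I.leadExponent p q).2 = 0 := fun p q => by simp [leadExponent, snd_sum, expo, h]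
  have h2 : ∀ M, (I.oscExponent M).2 = 0 := fun M => by
    simp [oscExponent, Finsupp.sum, snd_sum, expo, h]
  have h3 : ∀ J M, ¬ (J ≤ b.bos ∧ x = I.leadExponent (I.momentum l) (I.momentum b.charge)
      + I.oscExponent M - I.oscExponent J) := by
    rintro J M ⟨-, rfl⟩
    simp [h1, h2] at hx
  simp only [if_neg (h3 _ _), finsum_zero, smul_zero]

lemma stateField_isChiral (h : ∀ i, I.isRight i = false) (b : State N d) :
    IsChiral (I.stateField b) := by
  have hf : ∀ L, IsChiral (I.fermField b.charge L) := by
    intro L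
    induction L with
    | nil => exact vertexOp_isChiral h _
    | cons m L ih =>
      rw [fermField, h]
      exact ih.normalOrder _ _ _ _
  have hb : ∀ L, IsChiral (I.bosField (I.fermField b.charge (b.ferm.sort (· ≤ ·))) L) := by
    intro L
    induction L with
    | nil => exact hf _
    | cons m L ih =>
      rw [bosField, h]
      exact ih.normalOrder _ _ _ _
  exact hb _

lemma reflData_isomorphic_chiral (h : ∀ i, I.isRight i = false) :
    (I.reflData fun _ _ => 1).Isomorphic I.theory.chiral := by
  refine isomorphic_iff.2 ⟨LinearEquiv.refl ℂ (Fock N d), rfl, ?_, fun _ => rfl, fun v n w => ?_⟩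
  · show I.stress false + I.stress true = I.stress false
    rw [add_eq_left, stress]
    simp [h]
  · show I.fieldOf (fun _ _ => 1) v (-n - 1) w = I.theoryField v (-n - 1, 0) w
    induction v using fock_induction with
    | h0 => simp
    | hadd x y hx hy => simp only [map_add, padd, ladd, hx, hy]
    | hket c b =>
      simp only [map_smul, psmul, lsmul, fieldOf_ket, theoryField_ket]
      congr 1
      rw [stateMode, lcomp, chargeMul_one, refl]
      induction w using fock_induction with
      | h0 => simp
      | hadd x y hx hy => simp only [map_add, hx, hy]
      | hket c b' =>
        rw [map_smul, map_smul, onBasis_ket, finsum_eq_single _ (-n - 1 : ℝ)]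
        · push_cast
          rw [sub_self]
        · intro r hr
          by_contra hc
          have := stateField_isChiral h b _ _ hc
          push_cast at this
          exact hr (by linarith)

/-! ### Existence of cocycles -/

/-- The bilinear form in the exponent of the standard cocycle. -/
def cocycleForm (I : LatticeInput N d) (l m : Charge d) : ℝ :=
  ∑ i, ∑ j, if j < i then (l i : ℝ) * m j * I.form (I.e i) (I.e j) else 0

lemma cocycleForm_add_right (l m k : Charge d) :
    I.cocycleForm l (m + k) = I.cocycleForm l m + I.cocycleForm l k := by
  simp only [cocycleForm, ← sum_add_distrib]
  refine sum_congr rfl fun i _ => sum_congr rfl fun j _ => ?_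
  split_ifs
  · simp only [padd]
    push_cast
    ring
  · simp

lemma form_eq_pair (h : ∀ i, I.isRight i = false) (i j : Fin d) :
    I.form (I.e i) (I.e j) = I.pair (Pi.single i 1) (Pi.single j 1) := by
  simp only [form, pair, h]
  refine sum_congr rfl fun k _ => ?_
  simp [momentum, Pi.single_apply]

lemma pair_eq_sum (h : ∀ i, I.isRight i = false) (l m : Charge d) :
    I.pair l m = ∑ i, ∑ j, (l i : ℝ) * m j * I.form (I.e i) (I.e j) := by
  simp only [pair, momentum, form, h, Bool.false_eq_true, if_false, one_mul, Finset.sum_mul_sum]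
  rw [sum_comm]
  refine sum_congr rfl fun i _ => ?_
  rw [sum_comm]
  refine sum_congr rfl fun j _ => ?_
  rw [mul_sum]
  refine sum_congr rfl fun k _ => ?_
  ring

lemma cocycleForm_add_swap (h : ∀ i, I.isRight i = false) (l m : Charge d) :
    I.cocycleForm l m + I.cocycleForm m l =
      I.pair l m - ∑ i, (l i : ℝ) * m i * I.form (I.e i) (I.e i) := by
  have e : I.cocycleForm m l =
      ∑ i, ∑ j, if i < j then (l i : ℝ) * m j * I.form (I.e i) (I.e j) else 0 := by
    rw [cocycleForm, sum_comm]
    refine sum_congr rfl fun i _ => sum_congr rfl fun j _ => ?_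
    split_ifs
    · rw [form_eq_pair h, form_eq_pair h, pair_comm]
      ring
    · rfl
  rw [e, cocycleForm, pair_eq_sum h, ← sum_add_distrib, ← sum_sub_distrib]
  refine sum_congr rfl fun i _ => ?_
  rw [← sum_add_distrib, eq_sub_iff_add_eq]
  have : (l i : ℝ) * m i * I.form (I.e i) (I.e i) =
      ∑ j, if j = i then (l i : ℝ) * m j * I.form (I.e i) (I.e j) else 0 := by simp
  rw [this, ← sum_add_distrib]
  refine sum_congr rfl fun j _ => ?_
  rcases lt_trichotomy i j with hij | rfl | hij
  · simp [hij, hij.not_gt, hij.ne']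
  · simp
  · simp [hij, hij.not_gt, hij.ne]

lemma isLocalCocycle_cocycle (h : ∀ i, I.isRight i = false) (hI : I.Integral)
    (hev : ∀ l, ∃ n : ℤ, I.pair l l = 2 * n) : I.IsLocalCocycle I.cocycle := by
  refine ⟨I.cocycle_zero_left, I.cocycle_zero_right, fun l m k n hn => ?_⟩
  have hc : ∀ l m, I.cocycle l m = Complex.exp (Real.pi * Complex.I * (I.cocycleForm l m : ℝ)) :=
    fun _ _ => rfl
  have hint : ∀ l m, ∃ a : ℤ, I.cocycleForm l m = a := by
    intro l m
    choose p hp using hI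
    refine ⟨∑ i, ∑ j, if j < i then l i * m j * p (Pi.single i 1) (Pi.single j 1) else 0, ?_⟩
    rw [cocycleForm]
    push_cast
    refine sum_congr rfl fun i _ => sum_congr rfl fun j _ => ?_
    split_ifs
    · rw [form_eq_pair h, hp]
    · rfl
  obtain ⟨a, ha⟩ := hint m l
  choose q hq using hev
  have hs := cocycleForm_add_swap h l m
  have hdiag : ∑ i, (l i : ℝ) * m i * I.form (I.e i) (I.e i) =
      ((2 * ∑ i, l i * m i * q (Pi.single i 1) : ℤ) : ℝ) := by
    push_cast
    rw [mul_sum]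
    refine sum_congr rfl fun i _ => ?_
    rw [form_eq_pair h, hq]
    ring
  rw [hn, hdiag, ha] at hs
  have hlm : I.cocycleForm l m = ((n - a - 2 * ∑ i, l i * m i * q (Pi.single i 1) : ℤ) : ℝ) := by
    push_cast at hs ⊢
    linarith
  have hexp : ∀ b : ℤ, Complex.exp (Real.pi * Complex.I * b) = (-1) ^ b := fun b => by
    rw [mul_comm, Complex.exp_int_mul, Complex.exp_pi_mul_I]
  rw [hc, hc, hc, hc, cocycleForm_add_right, cocycleForm_add_right, hlm, ha]
  push_cast
  rw [mul_add, mul_add, Complex.exp_add, Complex.exp_add]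
  have e1 := hexp (n - a - 2 * ∑ i, l i * m i * q (Pi.single i 1))
  push_cast at e1
  rw [e1, hexp a]
  have e2 : (-1 : ℂ) ^ (n - a - 2 * ∑ i, l i * m i * q (Pi.single i 1)) = (-1) ^ n * (-1) ^ a := by
    rw [show n - a - 2 * ∑ i, l i * m i * q (Pi.single i 1) =
      n + a + (-(a + ∑ i, l i * m i * q (Pi.single i 1)) +
        -(a + ∑ i, l i * m i * q (Pi.single i 1))) by ring,
      zpow_add₀ (by norm_num), zpow_add₀ (by norm_num) n, Even.neg_one_zpow ⟨_, rfl⟩, mul_one]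
  rw [e2]
  ring

end LatticeInput

/-! ## Symmetric cocycles on free abelian groups -/

section Extension

variable {A : Type*} [AddCommGroup A]

/-- A normalized symmetric two-cocycle with values in `ℂˣ`. -/
structure IsSymmCocycle (c : A → A → ℂˣ) : Prop where
  zero_left : ∀ a, c 0 a = 1
  symm : ∀ a b, c a b = c b a
  assoc : ∀ a b k, c a b * c (a + b) k = c a (b + k) * c b k

/-- The extension of `A` by `ℂˣ` defined by a symmetric cocycle. -/
def CocycleExt {c : A → A → ℂˣ} (_ : IsSymmCocycle c) : Type _ := ℂˣ × A

variable {c : A → A → ℂˣ} (hc : IsSymmCocycle c)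

instance : AddCommGroup (CocycleExt hc) :=
  letI : Add (CocycleExt hc) := ⟨fun x y => (x.1 * y.1 * c x.2 y.2, x.2 + y.2)⟩
  letI : Zero (CocycleExt hc) := ⟨(1, 0)⟩
  letI : Neg (CocycleExt hc) := ⟨fun x => (x.1⁻¹ * (c (-x.2) x.2)⁻¹, -x.2)⟩
  { AddGroup.ofLeftAxioms (G := CocycleExt hc) (fun x y z => pext (by
        show x.1 * y.1 * c x.2 y.2 * z.1 * c (x.2 + y.2) z.2 =
          x.1 * (y.1 * z.1 * c y.2 z.2) * c x.2 (y.2 + z.2)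
        calc _ = x.1 * y.1 * z.1 * (c x.2 y.2 * c (x.2 + y.2) z.2) := by
              simp only [mul_comm, mul_left_comm]
          _ = _ := by rw [hc.assoc]; simp only [mul_comm, mul_left_comm])
        (add_assoc x.2 y.2 z.2))
      (fun x => pext (by
        show 1 * x.1 * c 0 x.2 = x.1
        rw [hc.zero_left, one_mul, mul_one]) (zero_add x.2))
      (fun x => pext (by
        show x.1⁻¹ * (c (-x.2) x.2)⁻¹ * x.1 * c (-x.2) x.2 = 1
        rw [mul_right_comm x.1⁻¹, inv_mul_cancel, one_mul, inv_mul_cancel])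
        (neg_add_cancel x.2)) with
    add_comm := fun x y => pext (by
      show x.1 * y.1 * c x.2 y.2 = y.1 * x.1 * c y.2 x.2
      rw [hc.symm, mul_comm x.1]) (add_comm x.2 y.2) }

lemma CocycleExt.add_eq (x y : CocycleExt hc) : x + y = (x.1 * y.1 * c x.2 y.2, x.2 + y.2) := rfl

lemma IsSymmCocycle.exists_coboundary [Module.Free ℤ A] {c : A → A → ℂˣ} (hc : IsSymmCocycle c) :
    ∃ β : A → ℂˣ, ∀ a b, β (a + b) = β a * β b * c a b := by
  let π : CocycleExt hc →ₗ[ℤ] A := (AddMonoidHom.mk' (fun x : CocycleExt hc => x.2)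
    fun _ _ => rfl).toIntLinearMap
  obtain ⟨s, hs⟩ := Module.projective_lifting_property π lid fun a => ⟨(1, a), rfl⟩
  have hs' : ∀ a, (s a).2 = a := fun a => lcongr hs a
  refine ⟨fun a => (s a).1, fun a b => ?_⟩
  show (s (a + b)).1 = _
  rw [map_add, CocycleExt.add_eq, hs', hs']

end Extension

namespace LatticeInput

/-! ## Isomorphisms from isometries of lattices -/

variable {N d : ℕ}

lemma IsLocalCocycle.exists_coboundary {I I' : LatticeInput N d} (hI : I.Integral)
    {ε ε' : Cocycle d} (hε : I.IsLocalCocycle ε) (hε' : I'.IsLocalCocycle ε')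
    (h0 : ∀ l m, ε l m ≠ 0) (h0' : ∀ l m, ε' l m ≠ 0) (g : (Charge d) ≃+ (Charge d))
    (hg : ∀ l m, I'.pair (g l) (g m) = I.pair l m) :
    ∃ β : Charge d → ℂ, (∀ l, β l ≠ 0) ∧ β 0 = 1 ∧
      ∀ l m, β (l + m) * ε l m = β l * β m * ε' (g l) (g m) := by
  set c : Charge d → Charge d → ℂˣ := fun l m =>
    Units.mk0 (ε' (g l) (g m) / ε l m) (div_ne_zero (h0' _ _) (h0 _ _)) with hc
  have hcv : ∀ l m, (c l m : ℂ) * ε l m = ε' (g l) (g m) := fun l m => by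
    rw [hc, Units.val_mk0, div_mul_cancel₀ _ (h0 l m)]
  have h1 : ∀ k, c 0 k = 1 := fun k => by simp [hc, hε.zero_left, hε'.zero_left]
  have h1' : ∀ k, c k 0 = 1 := fun k => by simp [hc, hε.zero_right, hε'.zero_right]
  have h2 : ∀ l m k, c l (m + k) * c m k = c m (l + k) * c l k := by
    intro l m k
    obtain ⟨n, hn⟩ := hI l m
    have e1 := hε.comm l m k n hn
    have e2 := hε'.comm (g l) (g m) (g k) n (by rw [hg, hn])
    have hne : ε l (m + k) * ε m k ≠ 0 := mul_ne_zero (h0 _ _) (h0 _ _)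
    refine Units.ext (mul_right_cancel₀ hne ?_)
    rw [← map_add, ← map_add, ← hcv, ← hcv, ← hcv, ← hcv] at e2
    push_cast
    linear_combination e2 - (c m (l + k) : ℂ) * c l k * e1
  have hsymm : ∀ l m, c l m = c m l := fun l m => by
    have := h2 l m 0
    rwa [add_zero, add_zero, h1', h1', mul_one, mul_one] at this
  have hcoc : IsSymmCocycle c := ⟨h1, hsymm, fun a b k => by
    rw [hsymm (a + b), mul_comm, h2 k a b, add_comm k b, hsymm k b]⟩
  obtain ⟨β, hβ⟩ := hcoc.exists_coboundary
  refine ⟨fun l => β l, fun l => (β l).ne_zero, ?_, fun l m => ?_⟩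
  · have := hβ 0 0
    rw [add_zero, h1, mul_one, left_eq_mul] at this
    show (β 0 : ℂ) = 1
    rw [this, Units.val_one]
  · have : (β (l + m) : ℂ) = β l * β m * c l m := by
      rw [hβ]
      push_cast
      rfl
    show (β (l + m) : ℂ) * ε l m = _
    rw [this, mul_assoc, hcv]

/-- A linear bijection of Fock spaces that intertwines the free fields, up to a rotation `R`. -/
structure Intertwines (I I' : LatticeInput N d) (R : Matrix (Fin N) (Fin N) ℝ)
    (F : Fock N d ≃ₗ[ℂ] Fock N d) : Prop where
  bos : ∀ i n x, F (I.bosMode i n x) = ∑ j, (R j i : ℂ) • I'.bosMode j n (F x)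
  ferm : ∀ i n x, F (fermMode i n x) = ∑ j, (R j i : ℂ) • fermMode j n (F x)
  parity : ∀ x, F (fermParity x) = fermParity (F x)

section Graph

variable (I I' : LatticeInput N d) (R : Matrix (Fin N) (Fin N) ℝ)

/-- The rotated boson modes. -/
def rotBos (i : Fin N) (n : ℤ) : Op N d := ∑ j, (R j i : ℂ) • I.bosMode j n

/-- The rotated fermion modes. -/
def rotFerm (i : Fin N) (n : ℤ) : Op N d := ∑ j, (R j i : ℂ) • fermMode j n

variable {R}

lemma rotBos_apply (i : Fin N) (n : ℤ) (x : Fock N d) :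
    I.rotBos R i n x = ∑ j, (R j i : ℂ) • I.bosMode j n x := by
  simp [rotBos, lsum]

lemma rotFerm_apply (i : Fin N) (n : ℤ) (x : Fock N d) :
    rotFerm R i n x = ∑ j, (R j i : ℂ) • fermMode j n x := by
  simp [rotFerm, lsum]

lemma orthogonal_sum (hR : Rᵀ * R = 1) (i j : Fin N) :
    ∑ k, (R k i : ℂ) * R k j = if i = j then 1 else 0 := by
  have := congrFun (congrFun hR i) j
  rw [Matrix.mul_apply, Matrix.one_apply] at this
  simp only [transpose_apply] at this
  have h := congrArg (fun x : ℝ => (x : ℂ)) this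
  push_cast at h
  rw [h]
  split_ifs <;> simp

lemma rotBos_comm (hR : Rᵀ * R = 1) (i j : Fin N) (m n : ℤ) (x : Fock N d) :
    I.rotBos R i m (I.rotBos R j n x) = I.rotBos R j n (I.rotBos R i m x) +
      (if i = j ∧ m + n + 2 = 0 then (-(m + 1) : ℂ) else 0) • x := by
  simp only [rotBos_apply, map_sum, map_smul, smul_sum]
  rw [sum_comm (f := fun k p => (R k i : ℂ) • (R p j : ℂ) • I.bosMode p n (I.bosMode k m x))]
  have : (if i = j ∧ m + n + 2 = 0 then (-(m + 1) : ℂ) else 0) =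
      ∑ p, (R p j : ℂ) * ∑ k, (R k i : ℂ) *
        (if k = p ∧ m + n + 2 = 0 then (-(m + 1) : ℂ) else 0) := by
    by_cases h : m + n + 2 = 0
    · simp only [h, and_true, mul_ite, mul_zero, Finset.sum_ite_eq', mem_univ, if_true]
      rw [← mul_boole, ← orthogonal_sum hR, mul_sum]
      exact sum_congr rfl fun _ _ => by ring
    · simp [h]
  rw [this, sum_smul, ← sum_add_distrib]
  refine sum_congr rfl fun p _ => ?_
  rw [mul_smul, sum_smul, smul_sum, ← sum_add_distrib]
  refine sum_congr rfl fun k _ => ?_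
  rw [I.bosMode_comm]
  module

lemma rotFerm_anticomm (hR : Rᵀ * R = 1) (i j : Fin N) (m n : ℤ) (x : Fock N d) :
    rotFerm R i m (rotFerm R j n x) = -rotFerm R j n (rotFerm R i m x) +
      (if i = j ∧ m + n + 1 = 0 then (1 : ℂ) else 0) • x := by
  simp only [rotFerm_apply, map_sum, map_smul, smul_sum]
  rw [sum_comm (f := fun k p => (R k i : ℂ) • (R p j : ℂ) • fermMode p n (fermMode k m x))]
  have : (if i = j ∧ m + n + 1 = 0 then (1 : ℂ) else 0) =
      ∑ p, (R p j : ℂ) * ∑ k, (R k i : ℂ) *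
        (if k = p ∧ m + n + 1 = 0 then (1 : ℂ) else 0) := by
    by_cases h : m + n + 1 = 0
    · simp only [h, and_true, mul_ite, mul_zero, Finset.sum_ite_eq', mem_univ, if_true, mul_one]
      rw [← orthogonal_sum hR]
      exact sum_congr rfl fun _ _ => by ring
    · simp [h]
  rw [this, sum_smul, ← sum_neg_distrib, ← sum_add_distrib]
  refine sum_congr rfl fun p _ => ?_
  rw [mul_smul, sum_smul, smul_sum, ← sum_neg_distrib, ← sum_add_distrib]
  refine sum_congr rfl fun k _ => ?_
  rw [fermMode_anticomm]
  module

lemma rotBos_rotFerm_comm (i j : Fin N) (m n : ℤ) (x : Fock N d) :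
    I.rotBos R i m (rotFerm R j n x) = rotFerm R j n (I.rotBos R i m x) := by
  simp only [rotBos_apply, rotFerm_apply, map_sum, map_smul, smul_sum]
  rw [sum_comm]
  refine sum_congr rfl fun p _ => ?_
  refine sum_congr rfl fun k _ => ?_
  rw [bosMode_fermMode_comm, smul_comm]

lemma sum_rotBos (hR : R * Rᵀ = 1) (j : Fin N) (n : ℤ) (x : Fock N d) :
    ∑ i, (R j i : ℂ) • I.rotBos R i n x = I.bosMode j n x := by
  simp only [rotBos_apply, smul_sum, smul_smul]
  rw [sum_comm]
  have h := orthogonal_sum (R := Rᵀ) (by simpa using hR) j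
  simp only [transpose_apply] at h
  simp only [← sum_smul, h, ite_smul, one_smul, zero_smul, Finset.sum_ite_eq, mem_univ, if_true]

lemma sum_rotFerm (hR : R * Rᵀ = 1) (j : Fin N) (n : ℤ) (x : Fock N d) :
    ∑ i, (R j i : ℂ) • rotFerm R i n x = fermMode j n x := by
  simp only [rotFerm_apply, smul_sum, smul_smul]
  rw [sum_comm]
  have h := orthogonal_sum (R := Rᵀ) (by simpa using hR) j
  simp only [transpose_apply] at h
  simp only [← sum_smul, h, ite_smul, one_smul, zero_smul, Finset.sum_ite_eq, mem_univ, if_true]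

variable (R) in
/-- The paired boson modes on the product of two Fock spaces. -/
def bosPair (i : Fin N) (n : ℤ) : Fock N d × Fock N d →ₗ[ℂ] Fock N d × Fock N d :=
  (I.bosMode i n).prodMap (I'.rotBos R i n)

variable (R) in
/-- The paired fermion modes on the product of two Fock spaces. -/
def fermPair (i : Fin N) (n : ℤ) : Fock N d × Fock N d →ₗ[ℂ] Fock N d × Fock N d :=
  (fermMode i n).prodMap (rotFerm R i n)

variable (R) in
/-- The submodules of the product of two Fock spaces that contain given pairs of momentum
states and are stable under the paired creators. -/
def IsGraphLike (g : Charge d → Charge d) (β : Charge d → ℂ)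
    (P : Submodule ℂ (Fock N d × Fock N d)) : Prop :=
  (∀ k, (ket (bare k), β k • ket (bare (g k))) ∈ P) ∧
  (∀ w ∈ P, ∀ i (n : ℕ), bosPair I I' R i n w ∈ P) ∧
  ∀ w ∈ P, ∀ i (n : ℕ), fermPair R i n w ∈ P

variable (R) in
/-- The smallest such submodule. -/
def graph (g : Charge d → Charge d) (β : Charge d → ℂ) :
    Submodule ℂ (Fock N d × Fock N d) := sInf {P | IsGraphLike I I' R g β P}

variable {g : Charge d → Charge d} {β : Charge d → ℂ}

lemma graph_isGraphLike : IsGraphLike I I' R g β (graph I I' R g β) := by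
  refine ⟨fun k => ?_, fun w hw i n => ?_, fun w hw i n => ?_⟩ <;>
    simp only [graph, Submodule.mem_sInf] at *
  · exact fun P hP => hP.1 k
  · exact fun P hP => hP.2.1 w (hw P hP) i n
  · exact fun P hP => hP.2.2 w (hw P hP) i n

lemma graph_le {P : Submodule ℂ (Fock N d × Fock N d)} (hP : IsGraphLike I I' R g β P) :
    graph I I' R g β ≤ P := sInf_le hP

lemma mem_graph_of_inf {P : Submodule ℂ (Fock N d × Fock N d)}
    (hP : IsGraphLike I I' R g β (graph I I' R g β ⊓ P)) {w : Fock N d × Fock N d}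
    (hw : w ∈ graph I I' R g β) : w ∈ P := (graph_le I I' hP hw).2

lemma rotBos_bare (i : Fin N) (n : ℤ) (hn : n < -1) (k : Charge d) :
    I.rotBos R i n (ket (bare k)) = 0 := by
  simp_all [rotBos_apply, bosMode_bare]

lemma rotFerm_bare (i : Fin N) (n : ℤ) (hn : n < 0) (k : Charge d) :
    rotFerm R i n (ket (bare k)) = 0 := by
  simp_all [rotFerm_apply, fermMode_bare]

lemma rotBos_zero_bare (hR : Rᵀ * R = 1) (hg : ∀ k, I'.momentum (g k) = R *ᵥ I.momentum k)
    (i : Fin N) (k : Charge d) :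
    I'.rotBos R i (-1) (ket (bare (g k))) = (I.momentum k i : ℂ) • ket (bare (g k)) := by
  rw [rotBos_apply]
  simp only [bosMode_zero_bare, smul_smul, ← sum_smul]
  congr 1
  have : I.momentum k i = ∑ j, R j i * I'.momentum (g k) j := by
    have h : Rᵀ *ᵥ I'.momentum (g k) = I.momentum k := by rw [hg, mulVec_mulVec, hR, one_mulVec]
    exact (congrFun h i).symm
  rw [this]
  push_cast
  rfl

lemma bosPair_mem_graph (hR : Rᵀ * R = 1) (hg : ∀ k, I'.momentum (g k) = R *ᵥ I.momentum k)
    {w : Fock N d × Fock N d} (hw : w ∈ graph I I' R g β) (i : Fin N) (n : ℤ) :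
    bosPair I I' R i n w ∈ graph I I' R g β := by
  have hG := graph_isGraphLike I I' (R := R) (g := g) (β := β)
  rcases le_or_gt 0 n with hn | hn
  · obtain ⟨n, rfl⟩ := eq_ofNat_of_zero_le hn
    exact hG.2.1 w hw i n
  refine mem_graph_of_inf I I' (P := (graph I I' R g β).comap (bosPair I I' R i n))
    ⟨fun k => ⟨hG.1 k, ?_⟩, fun w hw j m => ⟨hG.2.1 w hw.1 j m, ?_⟩,
      fun w hw j m => ⟨hG.2.2 w hw.1 j m, ?_⟩⟩ hw
  · show (I.bosMode i n (ket (bare k)), I'.rotBos R i n (β k • ket (bare (g k)))) ∈ graph I I' R g β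
    rw [map_smul]
    rcases eq_or_ne n (-1) with rfl | h
    · rw [bosMode_zero_bare, rotBos_zero_bare I I' hR hg, smul_comm]
      exact smul_mem _ (I.momentum k i : ℂ) (hG.1 k)
    · rw [bosMode_bare _ _ _ (by omega), rotBos_bare _ _ _ (by omega), smul_zero]
      exact szero _
  · have h : bosPair I I' R i n (bosPair I I' R j m w) = bosPair I I' R j m (bosPair I I' R i n w) +
        (if i = j ∧ n + m + 2 = 0 then (-(n + 1) : ℂ) else 0) • w :=
      pext (I.bosMode_comm i j n m w.1) (I'.rotBos_comm hR i j n m w.2)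
    show bosPair I I' R i n (bosPair I I' R j m w) ∈ graph I I' R g β
    rw [h]
    exact add_mem (hG.2.1 _ hw.2 j m) (smul_mem _ _ hw.1)
  · have h : bosPair I I' R i n (fermPair R j m w) = fermPair R j m (bosPair I I' R i n w) :=
      pext (I.bosMode_fermMode_comm i j n m w.1) (I'.rotBos_rotFerm_comm i j n m w.2)
    show bosPair I I' R i n (fermPair R j m w) ∈ graph I I' R g β
    rw [h]
    exact hG.2.2 _ hw.2 j m

lemma fermPair_mem_graph (hR : Rᵀ * R = 1)
    {w : Fock N d × Fock N d} (hw : w ∈ graph I I' R g β) (i : Fin N) (n : ℤ) :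
    fermPair R i n w ∈ graph I I' R g β := by
  have hG := graph_isGraphLike I I' (R := R) (g := g) (β := β)
  rcases le_or_gt 0 n with hn | hn
  · obtain ⟨n, rfl⟩ := eq_ofNat_of_zero_le hn
    exact hG.2.2 w hw i n
  refine mem_graph_of_inf I I' (P := (graph I I' R g β).comap (fermPair R i n))
    ⟨fun k => ⟨hG.1 k, ?_⟩, fun w hw j m => ⟨hG.2.1 w hw.1 j m, ?_⟩,
      fun w hw j m => ⟨hG.2.2 w hw.1 j m, ?_⟩⟩ hw
  · show (fermMode i n (ket (bare k)), rotFerm R i n (β k • ket (bare (g k)))) ∈ graph I I' R g β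
    rw [map_smul, fermMode_bare _ _ hn, rotFerm_bare _ _ hn, smul_zero]
    exact szero _
  · have h : fermPair R i n (bosPair I I' R j m w) = bosPair I I' R j m (fermPair R i n w) :=
      pext (I.bosMode_fermMode_comm j i m n w.1).symm (I'.rotBos_rotFerm_comm j i m n w.2).symm
    show fermPair R i n (bosPair I I' R j m w) ∈ graph I I' R g β
    rw [h]
    exact hG.2.1 _ hw.2 j m
  · have h : fermPair R i n (fermPair R j m w) = -fermPair R j m (fermPair R i n w) +
        (if i = j ∧ n + m + 1 = 0 then (1 : ℂ) else 0) • w :=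
      pext (fermMode_anticomm i j n m w.1) (rotFerm_anticomm hR i j n m w.2)
    show fermPair R i n (fermPair R j m w) ∈ graph I I' R g β
    rw [h]
    exact add_mem (Submodule.neg_mem _ (hG.2.2 _ hw.2 j m))
      (smul_mem _ _ hw.1)

lemma parity_mem_graph {w : Fock N d × Fock N d} (hw : w ∈ graph I I' R g β) :
    fermParity.prodMap fermParity w ∈ graph I I' R g β := by
  have hG := graph_isGraphLike I I' (R := R) (g := g) (β := β)
  refine mem_graph_of_inf I I' (P := (graph I I' R g β).comap (fermParity.prodMap fermParity))
    ⟨fun k => ⟨hG.1 k, ?_⟩, fun w hw j m => ⟨hG.2.1 w hw.1 j m, ?_⟩,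
      fun w hw j m => ⟨hG.2.2 w hw.1 j m, ?_⟩⟩ hw
  · have hb : ∀ k : Charge d, fermParity (ket (bare k) : Fock N d) = ket (bare k) := fun k => by
      rw [fermParity_ket]
      simp [bare]
    show (fermParity (ket (bare k)), fermParity (β k • ket (bare (g k)))) ∈ graph I I' R g β
    rw [map_smul, hb, hb]
    exact hG.1 k
  · have h : fermParity.prodMap fermParity (bosPair I I' R j m w) =
        bosPair I I' R j m (fermParity.prodMap fermParity w) := by
      refine pext (I.fermParity_bosMode j m w.1) ?_
      show fermParity (I'.rotBos R j m w.2) = I'.rotBos R j m (fermParity w.2)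
      simp only [rotBos_apply, map_sum, map_smul, fermParity_bosMode]
    show fermParity.prodMap fermParity (bosPair I I' R j m w) ∈ graph I I' R g β
    rw [h]
    exact hG.2.1 _ hw.2 j m
  · have h : fermParity.prodMap fermParity (fermPair R j m w) =
        (-1 : ℂ) • fermPair R j m (fermParity.prodMap fermParity w) := by
      refine pext (fermParity_fermMode j m w.1) ?_
      show fermParity (rotFerm R j m w.2) = (-1 : ℂ) • rotFerm R j m (fermParity w.2)
      simp only [rotFerm_apply, map_sum, map_smul, fermParity_fermMode, smul_sum]
      exact sum_congr rfl fun _ _ => smul_comm _ _ _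
    show fermParity.prodMap fermParity (fermPair R j m w) ∈ graph I I' R g β
    rw [h]
    exact smul_mem _ _ (hG.2.2 _ hw.2 j m)

lemma coeff_bare_graph (hg : Injective g) {w : Fock N d × Fock N d}
    (hw : w ∈ graph I I' R g β) (k : Charge d) : w.2 (bare (g k)) = β k * w.1 (bare k) := by
  have hG := graph_isGraphLike I I' (R := R) (g := g) (β := β)
  set P : Submodule ℂ (Fock N d × Fock N d) := ker
    (lapply (bare (g k)) ∘ₗ LinearMap.snd ℂ (Fock N d) (Fock N d) -
      β k • lapply (bare k) ∘ₗ LinearMap.fst ℂ (Fock N d) (Fock N d)) with hP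
  have hmem : ∀ w, w ∈ P ↔ w.2 (bare (g k)) = β k * w.1 (bare k) := fun w => by
    rw [hP, mem_ker, lsub, sub_eq_zero]
    rfl
  refine (hmem w).1 (graph_le I I' ⟨fun k' => ?_, fun w _ i n => ?_, fun w _ i n => ?_⟩ hw)
  · simp_all [ket_bare_coeff, hg.eq_iff]
  · rw [hmem]
    show I'.rotBos R i n w.2 (bare (g k)) = β k * I.bosMode i n w.1 (bare k)
    rw [bosMode_coeff_bare _ _ _ (by omega), rotBos_apply, mul_zero, finsetSum_apply]
    exact sum_eq_zero fun j _ => by rw [fsmul, bosMode_coeff_bare _ _ _ (by omega), smul_zero]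
  · rw [hmem]
    show rotFerm R i n w.2 (bare (g k)) = β k * fermMode i n w.1 (bare k)
    rw [fermMode_coeff_bare _ _ (by omega), rotFerm_apply, mul_zero, finsetSum_apply]
    exact sum_eq_zero fun j _ => by rw [fsmul, fermMode_coeff_bare _ _ (by omega), smul_zero]

lemma graph_snd_eq_zero (hR : Rᵀ * R = 1) (hR' : R * Rᵀ = 1) (hg' : Bijective g)
    (hg : ∀ k, I'.momentum (g k) = R *ᵥ I.momentum k) {x : Fock N d}
    (hx : (0, x) ∈ graph I I' R g β) : x = 0 := by
  refine eq_zero_of_annihilators I' ((graph I I' R g β).comap (LinearMap.inr ℂ _ _))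
    (fun w hw i k => ?_) (fun w hw i k => ?_) (fun w hw k => ?_) hx
  · show ((0 : Fock N d), I'.bosAnnihilate i (k + 1) w) ∈ graph I I' R g β
    rw [← bosMode_neg, ← sum_rotBos I' hR']
    have : ((0 : Fock N d), ∑ j, (R i j : ℂ) • I'.rotBos R j (-1 - (k + 1 : ℕ)) w) =
        ∑ j, (R i j : ℂ) • bosPair I I' R j (-1 - (k + 1 : ℕ)) (0, w) := by
      refine pext ?_ ?_
      · rw [fst_sum]
        exact (sum_eq_zero fun j _ => by simp [bosPair]).symm
      · rw [snd_sum]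
        rfl
    rw [this]
    exact sum_mem fun j _ => smul_mem _ _
      (bosPair_mem_graph I I' hR hg hw j _)
  · show ((0 : Fock N d), fermAnnihilate i k w) ∈ graph I I' R g β
    rw [← fermMode_neg, ← sum_rotFerm hR']
    have : ((0 : Fock N d), ∑ j, (R i j : ℂ) • rotFerm R j (-1 - (k : ℤ)) w) =
        ∑ j, (R i j : ℂ) • fermPair R j (-1 - (k : ℤ)) (0, w) := by
      refine pext ?_ ?_
      · rw [fst_sum]
        exact (sum_eq_zero fun j _ => by simp [fermPair]).symm
      · rw [snd_sum]
        rfl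
    rw [this]
    exact sum_mem fun j _ => smul_mem _ _ (fermPair_mem_graph I I' hR hw j _)
  · obtain ⟨k, rfl⟩ := hg'.2 k
    have := coeff_bare_graph I I' hg'.1 (w := (0, w)) hw k
    simpa using this

lemma graph_fst_eq_zero (hR : Rᵀ * R = 1) (hg' : Bijective g) (hβ : ∀ k, β k ≠ 0)
    (hg : ∀ k, I'.momentum (g k) = R *ᵥ I.momentum k) {x : Fock N d}
    (hx : (x, 0) ∈ graph I I' R g β) : x = 0 := by
  refine eq_zero_of_annihilators I ((graph I I' R g β).comap (LinearMap.inl ℂ _ _))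
    (fun w hw i k => ?_) (fun w hw i k => ?_) (fun w hw k => ?_) hx
  · have := bosPair_mem_graph I I' hR hg hw i (-1 - (k + 1 : ℕ))
    rw [bosPair, LinearMap.inl_apply, prodMap_apply, map_zero, bosMode_neg] at this
    exact this
  · have := fermPair_mem_graph I I' hR hw i (-1 - (k : ℤ))
    rw [fermPair, LinearMap.inl_apply, prodMap_apply, map_zero, fermMode_neg] at this
    exact this
  · have := coeff_bare_graph I I' hg'.1 (w := (w, 0)) hw k
    rw [Finsupp.zero_apply, eq_comm, mul_eq_zero] at this
    exact this.resolve_left (hβ k)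

lemma exists_mem_graph_left (x : Fock N d) : ∃ y, (x, y) ∈ graph I I' R g β := by
  have hG := graph_isGraphLike I I' (R := R) (g := g) (β := β)
  have := eq_top_of_creators ((graph I I' R g β).map (LinearMap.fst ℂ _ _))
    (fun k => ⟨_, hG.1 k, rfl⟩) ?_ ?_ x
  · simp_all []
  · rintro _ ⟨w, hw, rfl⟩ i k
    exact ⟨_, hG.2.1 w hw i k, rfl⟩
  · rintro _ ⟨w, hw, rfl⟩ i k
    exact ⟨_, hG.2.2 w hw i k, rfl⟩

lemma exists_mem_graph_right (hR' : R * Rᵀ = 1) (hg' : Bijective g) (hβ : ∀ k, β k ≠ 0)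
    (y : Fock N d) : ∃ x, (x, y) ∈ graph I I' R g β := by
  have hG := graph_isGraphLike I I' (R := R) (g := g) (β := β)
  have := eq_top_of_creators ((graph I I' R g β).map (LinearMap.snd ℂ _ _))
    (fun k => ?_) ?_ ?_ y
  · simp_all []
  · obtain ⟨k, rfl⟩ := hg'.2 k
    refine ⟨_, smul_mem _ (β k)⁻¹ (hG.1 k), ?_⟩
    simp [smul_smul, inv_mul_cancel₀ (hβ k)]
  · rintro _ ⟨w, hw, rfl⟩ j k
    refine ⟨_, sum_mem fun i (_ : i ∈ univ) => smul_mem _ (R j i : ℂ) (hG.2.1 w hw i k), ?_⟩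
    rw [map_sum]
    exact sum_rotBos I' hR' j k w.2
  · rintro _ ⟨w, hw, rfl⟩ j k
    refine ⟨_, sum_mem fun i (_ : i ∈ univ) => smul_mem _ (R j i : ℂ) (hG.2.2 w hw i k), ?_⟩
    rw [map_sum]
    exact sum_rotFerm hR' j k w.2

lemma exists_intertwines (hR : Rᵀ * R = 1) (hR' : R * Rᵀ = 1) (hg' : Bijective g)
    (hβ : ∀ k, β k ≠ 0) (hg : ∀ k, I'.momentum (g k) = R *ᵥ I.momentum k) :
    ∃ F : Fock N d ≃ₗ[ℂ] Fock N d, Intertwines I I' R F ∧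
      (∀ k, F (ket (bare k)) = β k • ket (bare (g k))) ∧
      ∀ x k, F x (bare (g k)) = β k * x (bare k) := by
  have hG := graph_isGraphLike I I' (R := R) (g := g) (β := β)
  have huniq : ∀ {x y y'}, (x, y) ∈ graph I I' R g β → (x, y') ∈ graph I I' R g β → y = y' := by
    intro x y y' h h'
    refine sub_eq_zero.1 (graph_snd_eq_zero I I' (β := β) hR hR' hg' hg ?_)
    have := sub_mem h h'
    rwa [Prod.mk_sub_mk, sub_self] at this
  choose f hf using fun x => exists_mem_graph_left I I' (R := R) (g := g) (β := β) x
  have hlin : IsLinearMap ℂ f := ⟨fun x y => huniq (hf _) (add_mem (hf x) (hf y)),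
    fun c x => huniq (hf _) (smul_mem _ c (hf x))⟩
  have hbij : Bijective hlin.mk' := by
    refine ⟨fun x y (hxy : f x = f y) => ?_, fun y => ?_⟩
    · refine sub_eq_zero.1 (graph_fst_eq_zero I I' hR hg' hβ hg (R := R) (g := g) (β := β) ?_)
      have := sub_mem (hf x) (hf y)
      rwa [Prod.mk_sub_mk, hxy, sub_self] at this
    · obtain ⟨x, hx⟩ := exists_mem_graph_right I I' hR' hg' hβ y
      exact ⟨x, huniq (hf x) hx⟩
  obtain ⟨F, hF⟩ : ∃ F : Fock N d ≃ₗ[ℂ] Fock N d, ∀ x, (x, F x) ∈ graph I I' R g β :=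
    ⟨LinearEquiv.ofBijective hlin.mk' hbij, hf⟩
  refine ⟨F, ⟨fun i n x => ?_, fun i n x => ?_, fun x => ?_⟩,
    fun k => huniq (hF _) (hG.1 k), fun x k => coeff_bare_graph I I' hg'.1 (hF x) k⟩
  · rw [← rotBos_apply]
    have h : (I.bosMode i n x, I'.rotBos R i n (F x)) ∈ graph I I' R g β :=
      bosPair_mem_graph I I' hR hg (hF x) i n
    exact huniq (hF _) h
  · rw [← rotFerm_apply]
    have h : (fermMode i n x, rotFerm R i n (F x)) ∈ graph I I' R g β := fermPair_mem_graph I I' hR (hF x) i n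
    exact huniq (hF _) h
  · have h := parity_mem_graph I I' (hF x)
    rw [prodMap_apply] at h
    exact huniq (hF _) h

end Graph

end LatticeInput

section Conj

variable {V : Type*} [AddCommGroup V] [Module ℂ V] (F : V ≃ₗ[ℂ] V)

/-- The field conjugated by a linear bijection. -/
def conjField (A : Modes V) : Modes V := fun t => F.toLinearMap ∘ₗ A t ∘ₗ F.symm.toLinearMap

lemma conjField_apply (A : Modes V) (t : ℤ) (x : V) : conjField F A t x = F (A t (F.symm x)) := rfl

lemma LocalFields.conj {A C : Modes V} {s : ℂ} (h : LocalFields A C s) :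
    LocalFields (conjField F A) (conjField F C) s := by
  obtain ⟨N, hN⟩ := h
  refine ⟨N, fun x => ?_⟩
  have := zwMul_pow_map F.toLinearMap N
    (fun a b => A a (C b (F.symm x)) - s • C b (A a (F.symm x)))
  rw [hN] at this
  simp only [conjField_apply, symm_apply_apply]
  simp only [LinearEquiv.coe_coe, map_sub, map_smul, pzero, map_zero] at this
  exact this

lemma IsTC.conj {T : V →ₗ[ℂ] V} {A : Modes V} (h : IsTC T A) {T' : V →ₗ[ℂ] V}
    (hT : ∀ x, F (T x) = T' (F x)) : IsTC T' (conjField F A) := by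
  intro n x
  have e : F.symm (T' x) = T (F.symm x) := by rw [symm_apply_eq, hT, apply_symm_apply]
  rw [conjField_apply, conjField_apply, conjField_apply, e, ← hT, ← map_sub, h, map_smul]

lemma Creates.conj {A : Modes V} {vac v : V} (h : Creates A vac v) (hF : F vac = vac) :
    Creates (conjField F A) vac (F v) := by
  have e : F.symm vac = vac := by rw [symm_apply_eq, hF]
  refine ⟨fun t ht => ?_, ?_⟩
  · rw [conjField_apply, e, h.1 t ht, map_zero]
  · rw [conjField_apply, e, h.2]

end Conj

namespace LatticeInput

variable {N d : ℕ} {I I' : LatticeInput N d} {R : Matrix (Fin N) (Fin N) ℝ}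
  {F : Fock N d ≃ₗ[ℂ] Fock N d}

lemma Intertwines.sum_bos (h : Intertwines I I' R F) (hR' : R * Rᵀ = 1) (j : Fin N) (n : ℤ)
    (x : Fock N d) : I'.bosMode j n x = ∑ i, (R j i : ℂ) • conjField F (I.bosMode i) n x := by
  rw [← sum_rotBos I' hR' j n x]
  refine sum_congr rfl fun i _ => ?_
  rw [rotBos_apply, conjField_apply, h.bos, apply_symm_apply]

lemma Intertwines.sum_ferm (h : Intertwines I I' R F) (hR' : R * Rᵀ = 1) (j : Fin N) (n : ℤ)
    (x : Fock N d) : fermMode j n x = ∑ i, (R j i : ℂ) • conjField F (fermMode i) n x := by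
  rw [← sum_rotFerm hR' j n x]
  refine sum_congr rfl fun i _ => ?_
  rw [rotFerm_apply, conjField_apply, h.ferm, apply_symm_apply]

lemma Intertwines.bosMode_local (h : Intertwines I I' R F) (hR' : R * Rᵀ = 1) {s : ℂ}
    {A : Modes (Fock N d)} (hA : ∀ i, LocalFields (I.bosMode i) A s) (j : Fin N) :
    LocalFields (I'.bosMode j) (conjField F A) s := by
  have e : I'.bosMode j = ∑ i, (R j i : ℂ) • conjField F (I.bosMode i) := by
    funext n
    refine lext fun x => ?_
    rw [h.sum_bos hR', Finset.sum_apply, lsum]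
    rfl
  rw [e]
  exact LocalFields.sum _ fun i _ => ((hA i).conj F).smul _

lemma Intertwines.fermMode_local (h : Intertwines I I' R F) (hR' : R * Rᵀ = 1) {s : ℂ}
    {A : Modes (Fock N d)} (hA : ∀ i, LocalFields (fermMode i) A s) (j : Fin N) :
    LocalFields (fermMode j) (conjField F A) s := by
  have e : fermMode (d := d) j = ∑ i, (R j i : ℂ) • conjField F (fermMode i) := by
    funext n
    refine lext fun x => ?_
    rw [h.sum_ferm hR', Finset.sum_apply, lsum]
    rfl
  rw [e]
  exact LocalFields.sum _ fun i _ => ((hA i).conj F).smul _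

lemma Intertwines.stress (h : Intertwines I I' R F) (hR' : R * Rᵀ = 1)
    {g : Charge d → Charge d} {β : Charge d → ℂ} (hg : Bijective g)
    (hpair : ∀ k, I'.pair (g k) (g k) = I.pair k k)
    (hβ : ∀ k, β k ≠ 0) (h1 : ∀ k, F (ket (bare k)) = β k • ket (bare (g k)))
    (h2 : ∀ x k, F x (bare (g k)) = β k * x (bare k)) {ω ω' : Modes (Fock N d)}
    (hω : I.IsStress ω) (hω' : I'.IsStress ω') (t : ℤ) (x : Fock N d) :
    F (ω t x) = ω' t (F x) := by
  have := I'.family_eq_zero (fun t => conjField F ω t - ω' t) (fun t j n _ => ?_)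
    (fun t j n => ⟨1, one_ne_zero, ?_⟩) (fun t k k' => ?_) t
  · have := lcongr this (F x)
    rw [lsub, conjField_apply, symm_apply_apply, lzero, sub_eq_zero] at this
    exact this
  · convert szero _
    refine lext fun x => ?_
    have e : conjField F ω t (I'.bosMode j n x) = I'.bosMode j n (conjField F ω t x) +
        ((n + 1 : ℤ) : ℂ) • I'.bosMode j (t + n + 2) x := by
      simp only [h.sum_bos hR', map_sum, map_smul, smul_sum, ← sum_add_distrib]
      refine sum_congr rfl fun i _ => ?_
      simp only [conjField_apply, symm_apply_apply, hω.bos, map_add, map_smul, smul_add]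
      rw [smul_comm]
    simp only [lsub, lcomp, map_sub, e, hω'.bos]
    simp
  · convert szero _
    refine lext fun x => ?_
    have e : conjField F ω t (fermMode j n x) = fermMode j n (conjField F ω t x) +
        ((t + 2 * n + 3 : ℤ) / 2 : ℂ) • fermMode j (t + n + 2) x := by
      simp only [h.sum_ferm hR', map_sum, map_smul, smul_sum, ← sum_add_distrib]
      refine sum_congr rfl fun i _ => ?_
      simp only [conjField_apply, symm_apply_apply, hω.ferm, map_add, map_smul, smul_add]
      rw [smul_comm]
    simp only [lsub, lcomp, one_smul, map_sub, e, hω'.ferm]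
    simp
  · obtain ⟨k, rfl⟩ := hg.2 k
    obtain ⟨k', rfl⟩ := hg.2 k'
    have hs : F.symm (ket (bare (g k))) = (β k)⁻¹ • ket (bare k) := by
      rw [symm_apply_eq, map_smul, h1, smul_smul, inv_mul_cancel₀ (hβ k), one_smul]
    rw [lsub, fsub, conjField_apply, hs, h2, map_smul, fsmul, smul_eq_mul]
    rcases lt_trichotomy t (-2) with ht | rfl | ht
    · rw [hω.bare_eq_zero t ht, hω'.bare_eq_zero t ht]
      simp
    · rw [hω.bare_zero, hω'.bare_zero, hpair, fsmul, fsmul, ket_bare_coeff, ket_bare_coeff]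
      simp only [hg.1.eq_iff]
      by_cases hk : k' = k
      · rw [hk, if_pos rfl]
        field_simp [hβ k]
        ring
      · simp [hk]
    · rw [hω.coeff_bare t (by omega), hω'.coeff_bare t (by omega)]
      simp

lemma Intertwines.twistedMode (h : Intertwines I I' R F) (hR' : R * Rᵀ = 1) (hI : I.Integral)
    (hI' : I'.Integral) {ε ε' : Cocycle d} {g : (Charge d) ≃+ (Charge d)}
    {β : Charge d → ℂ} (hg : ∀ k, I'.momentum (g k) = R *ᵥ I.momentum k)
    (hpair : ∀ l m, I'.pair (g l) (g m) = I.pair l m)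
    (hβ : ∀ k, β k ≠ 0) (hε : ∀ l m, β (l + m) * ε l m = β l * β m * ε' (g l) (g m))
    (h1 : ∀ k, F (ket (bare k)) = β k • ket (bare (g k)))
    (h2 : ∀ x k, F x (bare (g k)) = β k * x (bare k)) (l : Charge d) (t : ℤ) :
    conjField F (I.twistedMode ε l) t = β l • I'.twistedMode ε' (g l) t := by
  have := I'.family_eq_zero (fun t => conjField F (I.twistedMode ε l) t -
      β l • I'.twistedMode ε' (g l) t) (fun t j n _ => ?_)
    (fun t j n => ⟨1, one_ne_zero, ?_⟩) (fun t k k' => ?_) t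
  · exact sub_eq_zero.1 this
  · have e : ∀ x, I'.bosMode j n (conjField F (I.twistedMode ε l) t x) =
        conjField F (I.twistedMode ε l) t (I'.bosMode j n x) +
        (I'.momentum (g l) j : ℂ) • conjField F (I.twistedMode ε l) (t + n + 1) x := by
      intro x
      have hm : (I'.momentum (g l) j : ℂ) = ∑ i, (R j i : ℂ) * I.momentum l i := by
        rw [hg]
        simp only [mulVec, dotProduct]
        push_cast
        rfl
      simp only [h.sum_bos hR', map_sum, map_smul, hm, sum_smul, ← sum_add_distrib]
      refine sum_congr rfl fun i _ => ?_
      simp only [conjField_apply, symm_apply_apply, bosMode_twistedMode hI, map_add,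
        map_smul, smul_add, mul_smul]
    have : I'.bosMode j n ∘ₗ (conjField F (I.twistedMode ε l) t - β l • I'.twistedMode ε' (g l) t) -
        (conjField F (I.twistedMode ε l) t - β l • I'.twistedMode ε' (g l) t) ∘ₗ I'.bosMode j n =
        (I'.momentum (g l) j : ℂ) • (conjField F (I.twistedMode ε l) (t + n + 1) -
          β l • I'.twistedMode ε' (g l) (t + n + 1)) := by
      refine lext fun x => ?_
      simp only [lsub, lcomp, lsmul, map_sub, map_smul, e, bosMode_twistedMode hI']
      module
    rw [this]
    exact smul_mem _ _ (subset_span ⟨t + n + 1, rfl⟩)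
  · convert szero _
    refine lext fun x => ?_
    have e : fermMode j n (conjField F (I.twistedMode ε l) t x) =
        conjField F (I.twistedMode ε l) t (fermMode j n x) := by
      simp only [h.sum_ferm hR', map_sum, map_smul]
      refine sum_congr rfl fun i _ => ?_
      simp only [conjField_apply, symm_apply_apply, fermMode_twistedMode hI]
    simp only [lsub, lcomp, lsmul, one_smul, map_sub, map_smul, e, fermMode_twistedMode hI']
    simp
  · obtain ⟨k, rfl⟩ := g.surjective k
    obtain ⟨k', rfl⟩ := g.surjective k'
    have hs : F.symm (ket (bare (g k))) = (β k)⁻¹ • ket (bare k) := by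
      rw [symm_apply_eq, map_smul, h1, smul_smul, inv_mul_cancel₀ (hβ k), one_smul]
    have hc : ∀ k : Charge d, (bare k : State N d).charge = k := fun _ => rfl
    simp only [lsub, fsub, conjField_apply, hs, h2, map_smul,
      fsmul, smul_eq_mul, LatticeInput.twistedMode, lcomp,
      lsmul, chargeMul_ket, hc, vertexMode_bare hI, vertexMode_bare hI', hpair,
      ← map_add, g.injective.eq_iff]
    by_cases hk : k' = l + k ∧ (t : ℝ) = I.pair l k
    · rw [if_pos hk, hk.1]
      have := hε l k
      field_simp [hβ k]
      linear_combination this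
    · simp [hk]

lemma reflData_isomorphic (hI : I.Integral) (hI' : I'.Integral)
    {κ κ' : Cocycle d} (hκ : ∀ l m, κ l m ≠ 0) (hκ' : ∀ l m, κ' l m ≠ 0)
    (hε : I.IsLocalCocycle (I.twist κ))
    (hε' : I'.IsLocalCocycle (I'.twist κ'))
    (g : (Charge d) ≃+ (Charge d)) (hR' : R * Rᵀ = 1)
    (hg : ∀ k, I'.momentum (g k) = R *ᵥ I.momentum k) :
    (I.reflData κ).Isomorphic (I'.reflData κ') := by
  have hR : Rᵀ * R = 1 := mul_eq_one_comm.1 hR'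
  have hpair : ∀ l m, I'.pair (g l) (g m) = I.pair l m := by
    intro l m
    show I'.momentum (g l) ⬝ᵥ I'.momentum (g m) = I.momentum l ⬝ᵥ I.momentum m
    rw [hg, hg, dotProduct_mulVec, vecMul_mulVec, hR, vecMul_one]
  obtain ⟨β, hβ, hβ0, hββ⟩ := hε.exists_coboundary hI hε'
    (fun l m => mul_ne_zero (I.cocycle_ne_zero l m) (hκ l m))
    (fun l m => mul_ne_zero (I'.cocycle_ne_zero l m) (hκ' l m)) g hpair
  obtain ⟨F, hF, h1, h2⟩ := exists_intertwines I I' hR hR' g.bijective hβ hg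
  have hω := isStress_fieldOf hI hε.one_left
  have hω' := isStress_fieldOf hI' hε'.one_left
  have hst := hF.stress hR' g.bijective (fun k => hpair k k) hβ h1 h2 hω hω'
  have htw := hF.twistedMode (ε := I.twist κ)
    (ε' := I'.twist κ') hR' hI hI' hg hpair hβ hββ h1 h2
  have hvac : F vacuum = vacuum := by rw [vacuum_eq_bare, h1, map_zero, hβ0, one_smul]
  have hvac' : F.symm vacuum = vacuum := by rw [symm_apply_eq, hvac]
  have hconf : F (I.stress false + I.stress true) = I'.stress false + I'.stress true := by
    have e := (fieldOf_creates hI hε.one_right (I.stress false + I.stress true)).2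
    rw [← e, hst, hvac, (fieldOf_creates hI' hε'.one_right _).2]
  have hT : I'.fieldOf κ' (I'.stress false + I'.stress true) (-1) vacuum = 0 :=
    (fieldOf_creates hI' hε'.one_right _).1 _ (by omega)
  have key : ∀ b : State N d, ∀ t, conjField F (I.stateMode κ b) t = I'.fieldOf κ' (F (ket b)) t := by
    intro b t
    have hpar : fermParity (F (ket b)) = (-1 : ℂ) ^ b.ferm.card • F (ket b) := by
      rw [← hF.parity, fermParity_ket, map_smul]
    obtain ⟨-, hb, hf⟩ := stateMode_local_free hI κ b
    have hloc : ∀ b' : State N d, LocalFields (I'.stateMode κ' b')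
        (conjField F (I.stateMode κ b)) ((-1) ^ (b.ferm.card * b'.ferm.card)) := by
      intro b'
      refine stateMode_local hI' κ' b' _ (hF.bosMode_local hR' hb) (hF.fermMode_local hR' hf) ?_
      obtain ⟨l, hl⟩ := g.surjective b'.charge
      have e : I'.twistedMode (I'.twist κ') b'.charge =
          (β l)⁻¹ • conjField F (I.twistedMode (I.twist κ) l) := by
        funext t
        rw [psmul, htw, smul_smul, inv_mul_cancel₀ (hβ l), one_smul, hl]
      rw [e]
      refine LocalFields.smul _ (LocalFields.conj F ?_)
      have h := stateMode_local hI κ b 0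
        (fun i => bosMode_twistedMode_local hI _ l i)
        (fun i => by simpa using fermMode_twistedMode_local hI _ l i)
        (twistedMode_local hI hω hε _ _)
      rw [zero_mul, pow_zero] at h
      exact h.symm (one_mul 1)
    have hD : ∀ b' : State N d, LocalFields (conjField F (I.stateMode κ b) +
        (-1 : ℂ) • I'.fieldOf κ' (F (ket b))) (I'.stateMode κ' b')
        ((-1) ^ (b.ferm.card * b'.ferm.card)) := by
      intro b'
      refine LocalFields.add ((hloc b').symm (neg_one_pow_mul_self _)) (LocalFields.smul _ ?_)
      have := fieldOf_local hI' hω' hε' _ _ (F (ket b)) (ket b') hpar (fermParity_ket b')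
      rwa [fieldOf_ket] at this
    have hC : Creates (conjField F (I.stateMode κ b)) vacuum (F (ket b)) := by
      have := stateMode_creates hI κ b
      rw [hε.one_right, one_smul] at this
      exact this.conj F hvac
    have hC' := fieldOf_creates hI' hε'.one_right (F (ket b))
    have hTC : IsTC (I'.fieldOf κ' (I'.stress false + I'.stress true) (-1))
        (conjField F (I.stateMode κ b) + (-1 : ℂ) • I'.fieldOf κ' (F (ket b))) := by
      have t1 := (stateMode_isTC hI κ b hω.isTC_bosMode hω.isTC_fermMode
        (hω.isTC_twistedMode hI _ _)).conj F (hst (-1))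
      have t2 := isTC_fieldOf (κ := κ') hI' hω' (F (ket b))
      intro n x
      have e1 := t1 n x
      have e2 := t2 n x
      generalize I'.fieldOf κ' (I'.stress false + I'.stress true) (-1) = T' at e1 e2 ⊢
      simp only [padd, psmul, ladd, lsmul, map_add, map_smul]
      rw [smul_add, ← e1, smul_comm, ← e2]
      module
    have hkill := hTC.kills_vac hT (vac := vacuum) ⟨fun t ht => by
        rw [padd, ladd, hC.1 t ht, psmul, lsmul, hC'.1 t ht, smul_zero, add_zero], by
        rw [padd, ladd, hC.2, psmul, lsmul, hC'.2]
        module⟩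
    have hzero : ∀ b', (conjField F (I.stateMode κ b) + (-1 : ℂ) • I'.fieldOf κ' (F (ket b))) t
        (ket b') = 0 := by
      intro b'
      have hc := stateMode_creates hI' κ' b'
      rw [hε'.one_right, one_smul] at hc
      exact (hD b').eq_zero hkill hc t
    refine fock_ext fun b' => ?_
    have := hzero b'
    rw [padd, ladd, psmul, lsmul, neg_one_smul, ← sub_eq_add_neg, sub_eq_zero] at this
    exact this
  refine isomorphic_iff.2 ⟨F, hvac, hconf, hF.parity, fun v n w => ?_⟩
  show F (I.fieldOf κ v (-n - 1) w) = I'.fieldOf κ' (F v) (-n - 1) (F w)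
  induction v using fock_induction with
  | h0 => simp
  | hadd x y hx hy => simp only [map_add, padd, ladd, hx, hy]
  | hket c b =>
    simp only [map_smul, psmul, lsmul]
    rw [fieldOf_ket, ← key, conjField_apply, symm_apply_apply]

end LatticeInput

lemma VOSAData.Isomorphic.symm {W W' : VOSAData} (h : W.Isomorphic W') : W'.Isomorphic W := by
  obtain ⟨f, h1, h2, h3, h4⟩ := h
  refine ⟨f.symm, ?_, ?_, fun v => ?_, fun v n w => ?_⟩ <;> rw [symm_apply_eq]
  · exact h1.symm
  · exact h2.symm
  · rw [h3, apply_symm_apply]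
  · rw [h4, apply_symm_apply, apply_symm_apply]

lemma VOSAData.Isomorphic.trans {W W' W'' : VOSAData} (h : W.Isomorphic W')
    (h' : W'.Isomorphic W'') : W.Isomorphic W'' := by
  obtain ⟨f, h1, h2, h3, h4⟩ := h
  obtain ⟨f', h1', h2', h3', h4'⟩ := h'
  exact ⟨f.trans f', by simp [h1, h1'], by simp [h2, h2'], fun v => by simp [h3, h3'],
    fun v n w => by simp [h4, h4']⟩

namespace LatticeInput

variable {N d : ℕ} {I I' : LatticeInput N d} {R : Matrix (Fin N) (Fin N) ℝ}

lemma reflections_of_isometry (hch : ∀ i, I'.isRight i = false) (hI' : I'.Integral)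
    (hev : ∀ l, ∃ n : ℤ, I'.pair l l = 2 * n) (hfin : ∀ C : ℝ, {l | I'.pair l l ≤ C}.Finite)
    (g : (Charge d) ≃+ (Charge d)) (hR : R * Rᵀ = 1)
    (hg : ∀ k, I'.momentum (g k) = R *ᵥ I.momentum k) :
    (∃ W, I.theory.IsReflection W ∧ W.IsVOSA (3 * N / 2)) ∧
      ∀ (W : VOSAData) (c : ℂ), I.theory.IsReflection W → W.IsVOSA c →
        W.Isomorphic I'.theory.chiral := by
  have hpair : ∀ l m, I.pair l m = I'.pair (g l) (g m) := by
    intro l m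
    show I.momentum l ⬝ᵥ I.momentum m = I'.momentum (g l) ⬝ᵥ I'.momentum (g m)
    rw [hg, hg, dotProduct_mulVec, vecMul_mulVec, mul_eq_one_comm.1 hR, vecMul_one]
  have hI : I.Integral := fun l m => by
    rw [hpair]
    exact hI' _ _
  have hev2 : ∀ l, ∃ n : ℤ, I.pair l l = 2 * n := fun l => by
    rw [hpair]
    exact hev _
  let J : LatticeInput N d := { isRight := fun _ => false, e := I.e }
  have hJ : I.IsLocalCocycle J.cocycle := by
    obtain ⟨h1, h2, h3⟩ := isLocalCocycle_cocycle (I := J) (fun _ => rfl) hI hev2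
    exact ⟨h1, h2, h3⟩
  refine ⟨?_, fun W c hW hc => ?_⟩
  · let κ : Charge d → Charge d → ℂˣ := fun l m =>
      Units.mk0 (J.cocycle l m / I.cocycle l m)
        (div_ne_zero (J.cocycle_ne_zero l m) (I.cocycle_ne_zero l m))
    have e : (I.twist fun l m => κ l m) = J.cocycle := by
      funext l m
      exact mul_div_cancel₀ _ (I.cocycle_ne_zero l m)
    refine ⟨_, isReflection_reflData hI κ, reflData_isVOSA hI hev2 (fun C => ?_) (by rwa [e])⟩
    refine ((hfin C).preimage g.injective.injOn).subset fun l hl => ?_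
    rw [Set.mem_ofPred_eq, hpair] at hl
    exact hl
  · obtain ⟨κ, hκ, hiso⟩ := exists_isomorphic_of_isReflection hW
    refine hiso.symm.trans ((reflData_isomorphic hI hI' hκ (fun _ _ => one_ne_zero)
      (isLocalCocycle_of_isomorphic hI hc hiso) ?_ g hR hg).trans (reflData_isomorphic_chiral hch))
    convert isLocalCocycle_cocycle hch hI' hev using 3
    exact mul_one _

end LatticeInput

/-- Twice the simple roots of `E_8`. -/
def e8Double : Matrix (Fin 8) (Fin 8) ℤ :=
  !![ 1, -1, -1, -1, -1, -1, -1, 1; 2, 2, 0, 0, 0, 0, 0, 0; -2, 2, 0, 0, 0, 0, 0, 0;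
      0, -2, 2, 0, 0, 0, 0, 0;
      0, 0, -2, 2, 0, 0, 0, 0;
      0, 0, 0, -2, 2, 0, 0, 0;
      0, 0, 0, 0, -2, 2, 0, 0;
      0, 0, 0, 0, 0, -2, 2, 0]

/-- Half the Gram matrix of the simple roots of `E_8`, above and on the diagonal. -/
def e8Half : Matrix (Fin 8) (Fin 8) ℤ := Matrix.of fun i j =>
  if i = j then 1 else if (i, j) ∈ [((0 : Fin 8), (2 : Fin 8)), (1, 3), (2, 3), (3, 4), (4, 5),
    (5, 6), (6, 7)] then -1 else 0

/-- Twice the inverse of `e8Double`. -/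
def e8DoubleInv : Matrix (Fin 8) (Fin 8) ℤ :=
  !![ 0, 1, -1, 0, 0, 0, 0, 0; 0, 1, 1, 0, 0, 0, 0, 0; 0, 1, 1, 2, 0, 0, 0, 0;
      0, 1, 1, 2, 2, 0, 0, 0;
      0, 1, 1, 2, 2, 2, 0, 0;
      0, 1, 1, 2, 2, 2, 2, 0;
      0, 1, 1, 2, 2, 2, 2, 2;
      4, 5, 7, 10, 8, 6, 4, 2]

lemma e8Root_eq : e8Root = (1 / 2 : ℝ) • e8Double.map (Int.cast : ℤ → ℝ) := by
  ext i j
  fin_cases i <;> fin_cases j <;> norm_num [e8Root, e8Double]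

lemma e8Root_mul_transpose : e8Root * e8Rootᵀ = (e8Half + e8Halfᵀ).map (Int.cast : ℤ → ℝ) := by
  have h : e8Double * e8Doubleᵀ = (4 : ℤ) • (e8Half + e8Halfᵀ) := by decide +kernel
  have := congrArg (fun M => M.map (Int.castRingHom ℝ)) h
  rw [Matrix.map_mul, Matrix.transpose_map, Int.coe_castRingHom] at this
  rw [e8Root_eq, Matrix.transpose_smul, Matrix.smul_mul, Matrix.mul_smul, this]
  ext i j
  simp only [Matrix.smul_apply, Matrix.map_apply, smul_eq_mul, Int.cast_mul, Int.cast_ofNat]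
  ring

lemma e8Root_mul_inv : e8Root * ((1 / 2 : ℝ) • e8DoubleInv.map (Int.cast : ℤ → ℝ)) = 1 := by
  have h : e8Double * e8DoubleInv = 4 := by decide +kernel
  have := congrArg (fun M => M.map (Int.castRingHom ℝ)) h
  rw [Matrix.map_mul, Int.coe_castRingHom] at this
  rw [e8Root_eq, Matrix.smul_mul, Matrix.mul_smul, this, smul_smul]
  ext i j
  rw [show (4 : Matrix (Fin 8) (Fin 8) ℤ) = (4 : ℤ) • 1 by rw [zsmul_one]; rfl]
  simp only [Matrix.smul_apply, Matrix.map_apply, Matrix.one_apply]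
  split_ifs <;> norm_num

/-- The `E_8` input. -/
def e8Input : LatticeInput 8 8 where
  isRight := fun _ => false
  e := e8Root

lemma e8Input_momentum (l : Fin 8 → ℤ) : e8Input.momentum l = (fun j => (l j : ℝ)) ᵥ* e8Root := by
  ext i
  simp [momentum, e8Input, Matrix.vecMul, dotProduct]

lemma e8Input_pair (l m : Fin 8 → ℤ) :
    e8Input.pair l m = ((l ⬝ᵥ (e8Half + e8Halfᵀ) *ᵥ m : ℤ) : ℝ) := by
  show e8Input.momentum l ⬝ᵥ e8Input.momentum m = _
  rw [e8Input_momentum, e8Input_momentum, ← Matrix.mulVec_transpose e8Root (fun j => (m j : ℝ)),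
    ← dotProduct_mulVec, mulVec_mulVec, e8Root_mul_transpose]
  simp [dotProduct, mulVec]

lemma e8Input_even (l : Fin 8 → ℤ) : ∃ n : ℤ, e8Input.pair l l = 2 * n := by
  refine ⟨l ⬝ᵥ e8Half *ᵥ l, ?_⟩
  rw [e8Input_pair, Matrix.add_mulVec, dotProduct_add, Matrix.mulVec_transpose,
    dotProduct_comm l (l ᵥ* _), ← dotProduct_mulVec]
  push_cast
  ring

lemma e8Input_momentum_vecMul (l : Fin 8 → ℤ) :
    e8Input.momentum l ᵥ* ((1 / 2 : ℝ) • e8DoubleInv.map (Int.cast : ℤ → ℝ)) =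
      fun j => (l j : ℝ) := by
  rw [e8Input_momentum, Matrix.vecMul_vecMul, e8Root_mul_inv, vecMul_one]

lemma e8Input_momentum_injective : Injective e8Input.momentum := by
  intro l m h
  have := e8Input_momentum_vecMul l
  rw [h, e8Input_momentum_vecMul] at this
  ext j
  exact_mod_cast (congrFun this j).symm

lemma e8Input_finite (C : ℝ) : {l | e8Input.pair l l ≤ C}.Finite := by
  set M : Matrix (Fin 8) (Fin 8) ℝ := (1 / 2 : ℝ) • e8DoubleInv.map (Int.cast : ℤ → ℝ)
  obtain ⟨K, hK⟩ : ∃ K : ℝ, ∀ i j, |M i j| ≤ K :=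
    ⟨∑ i, ∑ j, |M i j|, fun i j =>
      (single_le_sum (f := fun j => |M i j|) (fun _ _ => abs_nonneg _)
        (mem_univ j)).trans (single_le_sum (f := fun i => ∑ j, |M i j|)
        (fun _ _ => sum_nonneg fun _ _ => abs_nonneg _) (mem_univ i))⟩
  have hK0 : 0 ≤ K := (abs_nonneg _).trans (hK 0 0)
  refine (Set.Finite.pi' (t := fun _ : Fin 8 => Set.Icc (-⌈8 * ((C + 1) * K)⌉) ⌈8 * ((C + 1) * K)⌉)
    fun _ => Set.finite_Icc _ _).subset fun l hl j => ?_
  have hp : ∀ i, |e8Input.momentum l i| ≤ C + 1 := by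
    intro i
    have h1 : e8Input.momentum l i * e8Input.momentum l i ≤ C :=
      (single_le_sum (f := fun i => e8Input.momentum l i * e8Input.momentum l i)
        (fun _ _ => mul_self_nonneg _) (mem_univ i)).trans hl
    exact abs_le.2 ⟨by nlinarith [sq_nonneg (e8Input.momentum l i + 1)],
      by nlinarith [sq_nonneg (e8Input.momentum l i - 1)]⟩
  have hj : |(l j : ℝ)| ≤ 8 * ((C + 1) * K) := by
    rw [← congrFun (e8Input_momentum_vecMul l) j]
    rw [show (8 : ℝ) * ((C + 1) * K) = (univ : Finset (Fin 8)).card • ((C + 1) * K) by simp]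
    show |∑ i, e8Input.momentum l i * M i j| ≤ _
    refine (Finset.abs_sum_le_sum_abs _ _).trans
      (Finset.sum_le_card_nsmul _ _ _ fun i _ => ?_)
    rw [abs_mul]
    exact mul_le_mul (hp i) (hK i j) (abs_nonneg _) ((abs_nonneg _).trans (hp i))
  have := hj.trans (Int.le_ceil _)
  rw [abs_le] at this
  exact ⟨mod_cast this.1, mod_cast this.2⟩

lemma mem_e8Lattice (y : Fin 8 → ℝ) : y ∈ e8Lattice ↔ ∃ l, e8Input.momentum l = y := by
  refine (Submodule.mem_span_range_iff_exists_fun ℤ).trans (exists_congr fun l => ?_)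
  rw [e8Input_momentum]
  have : ∑ i, l i • e8Root i = (fun j => (l j : ℝ)) ᵥ* e8Root := by
    ext i
    simp [Matrix.vecMul, dotProduct]
  rw [this]

lemma transpose_mul_self_of_isometry {n : Type*} [Fintype n] [DecidableEq n] (R : Matrix n n ℝ)
    (h : ∀ x, R *ᵥ x ⬝ᵥ R *ᵥ x = x ⬝ᵥ x) : Rᵀ * R = 1 := by
  refine Matrix.ext_of_mulVec_single fun i => dotProduct_eq _ _ fun x => ?_
  have := h (Pi.single i 1 + x)
  simp only [mulVec_add, add_dotProduct, dotProduct_add, h, dotProduct_comm x (Pi.single i 1),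
    dotProduct_comm (R *ᵥ x) (R *ᵥ Pi.single i 1)] at this
  rw [← mulVec_mulVec, Matrix.mulVec_transpose, ← dotProduct_mulVec, one_mulVec]
  linarith

lemma sigmaModel_reflections (h : SOPlus44) (f : R44 ≃ₗ[ℝ] (Fin 8 → ℝ))
    (hf : ∀ x, ∑ i, f x i ^ 2 = ∑ i, x i ^ 2) (hfl : ∀ x, f x ∈ e8Lattice ↔ x ∈ windingLattice h) :
    (∃ W : VOSAData, (sigmaModel h).IsReflection W ∧ W.IsVOSA 12) ∧
      ∀ W : VOSAData, (sigmaModel h).IsReflection W → W.IsVOSA 12 → W.Isomorphic VfE8 := by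
  let I : LatticeInput 8 8 :=
    { isRight := fun i => (finSumFinEquiv (m := 4) (n := 4).symm i).isRight
      e := fun j i => windingBasis h (finSumFinEquiv (m := 4) (n := 4).symm j)
        (finSumFinEquiv (m := 4) (n := 4).symm i) }
  let φ : (Fin 8 → ℝ) ≃ₗ[ℝ] (Fin 8 → ℝ) :=
    (funCongrLeft ℝ ℝ (finSumFinEquiv (m := 4) (n := 4))).trans f
  have hφ : ∀ x, φ x ⬝ᵥ φ x = x ⬝ᵥ x := fun x => by
    have := hf (funCongrLeft ℝ ℝ (finSumFinEquiv (m := 4) (n := 4)) x)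
    simp only [sq] at this
    exact this.trans ((finSumFinEquiv (m := 4) (n := 4)).sum_comp fun i => x i * x i)
  let R := LinearMap.toMatrix' φ.toLinearMap
  have hR : ∀ x, R *ᵥ x = φ x := fun x => LinearMap.toMatrix'_mulVec φ.toLinearMap x
  have hRR : Rᵀ * R = 1 := transpose_mul_self_of_isometry R fun x => by rw [hR, hφ]
  have hmem : ∀ l, φ (I.momentum l) ∈ e8Lattice := by
    intro l
    refine (hfl _).2 ((Submodule.mem_span_range_iff_exists_fun ℤ).2
      ⟨fun j => l (finSumFinEquiv (m := 4) (n := 4) j), ?_⟩)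
    ext i
    simp only [Finset.sum_apply, zsmul_eq_mul]
    rw [← (finSumFinEquiv (m := 4) (n := 4)).symm.sum_comp]
    simp [momentum, I, LinearEquiv.funCongrLeft_apply]
  choose g hg using fun l => (mem_e8Lattice _).1 (hmem l)
  have hadd : ∀ l m, g (l + m) = g l + g m := fun l m => e8Input_momentum_injective (by
    rw [hg, momentum_add, momentum_add, map_add, hg, hg])
  let G : (Fin 8 → ℤ) →+ (Fin 8 → ℤ) := AddMonoidHom.mk' g hadd
  have hsurj : Surjective G := by
    intro m
    have h1 : e8Input.momentum m ∈ e8Lattice := (mem_e8Lattice _).2 ⟨m, rfl⟩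
    rw [← f.apply_symm_apply (e8Input.momentum m), hfl] at h1
    obtain ⟨l, hl⟩ := (Submodule.mem_span_range_iff_exists_fun ℤ).1 h1
    refine ⟨fun j => l (finSumFinEquiv (m := 4) (n := 4).symm j), e8Input_momentum_injective ?_⟩
    show e8Input.momentum (g _) = _
    rw [hg]
    show f _ = _
    rw [← LinearEquiv.eq_symm_apply, ← hl]
    ext i
    simp only [Finset.sum_apply, zsmul_eq_mul]
    rw [← (finSumFinEquiv (m := 4) (n := 4)).symm.sum_comp]
    simp [momentum, I, LinearEquiv.funCongrLeft_apply]
  have hinj : Injective G :=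
    OrzechProperty.injective_of_surjective_endomorphism G.toIntLinearMap hsurj
  have key := reflections_of_isometry (I := I) (I' := e8Input) (fun _ => rfl)
    (fun l m => ⟨_, e8Input_pair l m⟩) e8Input_even e8Input_finite
    (AddEquiv.ofBijective G ⟨hinj, hsurj⟩) (mul_eq_one_comm.1 hRR) fun k => (hg k).trans (hR _).symm
  refine ⟨?_, fun W hW hc => key.2 W 12 hW hc⟩
  obtain ⟨W, hW, hc⟩ := key.1
  exact ⟨W, hW, by convert hc using 1; norm_num⟩

/-! ## Quaternions and `SU(2)` -/

/-- The coordinates of a quaternion. -/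
abbrev quatCoord : ℍ[ℝ] ≃ₗ[ℝ] (Fin 4 → ℝ) := QuaternionAlgebra.linearEquivTuple (-1) 0 (-1)

lemma quatCoord_apply (x : ℍ[ℝ]) : quatCoord x = ![x.re, x.imI, x.imJ, x.imK] := rfl

lemma quatCoord_dotProduct (x y : ℍ[ℝ]) : quatCoord x ⬝ᵥ quatCoord y = (x * star y).re := by
  simp [quatCoord_apply, dotProduct, sum_univ_four]

/-- The matrix of a quaternion acting on `ℂ²`. -/
def su2Mat (q : ℍ[ℝ]) : Matrix (Fin 2) (Fin 2) ℂ :=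
  !![⟨q.re, q.imJ⟩, ⟨-q.imI, q.imK⟩; ⟨q.imI, q.imK⟩, ⟨q.re, -q.imJ⟩]

lemma ofC2_su2Mat_mulVec (q x : ℍ[ℝ]) :
    ofC2 (su2Mat q *ᵥ toC2 (quatCoord x)) = quatCoord (q * x) := by
  ext i
  fin_cases i <;>
    simp [ofC2, toC2, su2Mat, quatCoord_apply, mulVec, dotProduct, Fin.sum_univ_two] <;>
    ring

lemma su2Mat_mul (p q : ℍ[ℝ]) : su2Mat (p * q) = su2Mat p * su2Mat q := by
  ext i j
  fin_cases i <;> fin_cases j <;> apply Complex.ext <;>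
    simp [su2Mat, Matrix.mul_apply, Fin.sum_univ_two] <;> ring

lemma su2Mat_one : su2Mat 1 = 1 := by
  ext i j
  fin_cases i <;> fin_cases j <;> apply Complex.ext <;> simp [su2Mat]

lemma su2Mat_star (q : ℍ[ℝ]) : su2Mat (star q) = star (su2Mat q) := by
  ext i j
  fin_cases i <;> fin_cases j <;> apply Complex.ext <;> simp [su2Mat, Matrix.star_apply]

lemma su2Mat_det (q : ℍ[ℝ]) : (su2Mat q).det = (normSq q : ℝ) := by
  rw [normSq_def']
  apply Complex.ext <;> simp [su2Mat, Matrix.det_fin_two, -Complex.ofReal_add, -Complex.ofReal_pow,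
    Complex.ofReal_re, Complex.ofReal_im] <;> ring

lemma normSq_of_mem_unitary (u : unitary ℍ[ℝ]) : normSq (u : ℍ[ℝ]) = 1 := by
  have : (u : ℍ[ℝ]) * star (u : ℍ[ℝ]) = 1 := Unitary.coe_mul_star_self u
  rw [self_mul_star] at this
  exact congrArg QuaternionAlgebra.re this

lemma mem_unitary_of_normSq {q : ℍ[ℝ]} (h : normSq q = 1) : q ∈ unitary ℍ[ℝ] := by
  rw [Unitary.mem_iff, self_mul_star, Quaternion.star_mul_self, h]
  simp

/-- The unit quaternions form the group `SU(2)`. -/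
def su2Hom : unitary ℍ[ℝ] →* SU2 where
  toFun u := ⟨su2Mat u, by
    rw [Matrix.mem_specialUnitaryGroup_iff, Matrix.mem_unitaryGroup_iff, ← su2Mat_star,
      ← su2Mat_mul, su2Mat_det, normSq_of_mem_unitary,
      show (u : ℍ[ℝ]) * star (u : ℍ[ℝ]) = 1 from Unitary.coe_mul_star_self u, su2Mat_one]
    simp⟩
  map_one' := Subtype.ext su2Mat_one
  map_mul' u v := Subtype.ext (su2Mat_mul u v)

lemma su2Hom_bijective : Bijective su2Hom := by
  constructor
  · intro u v h
    have h' : su2Mat u = su2Mat v := congrArg Subtype.val h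
    have h0 := congrFun (congrFun h' 0) 0
    have h1 := congrFun (congrFun h' 1) 0
    simp only [su2Mat, of_apply, cons_val', cons_val_zero, cons_val_one, Complex.mk.injEq] at h0 h1
    exact Subtype.ext (QuaternionAlgebra.ext h0.1 h1.1 h0.2 h1.2)
  · intro g
    have hu := g.2
    rw [Matrix.mem_specialUnitaryGroup_iff, Matrix.mem_unitaryGroup_iff] at hu
    have hadj : star g.1 = g.1.adjugate := by
      calc star g.1 = g.1.adjugate * g.1 * star g.1 := by
            rw [Matrix.adjugate_mul, hu.2, one_smul, one_mul]
        _ = _ := by rw [mul_assoc, hu.1, mul_one]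
    rw [Matrix.adjugate_fin_two] at hadj
    have e1 := congrFun (congrFun hadj 0) 0
    have e2 := congrFun (congrFun hadj 0) 1
    simp only [Matrix.star_apply, of_apply, cons_val', cons_val_zero, cons_val_one,
      cons_val_fin_one, RCLike.star_def] at e1 e2
    have hg : su2Mat ⟨(g.1 0 0).re, (g.1 1 0).re, (g.1 0 0).im, (g.1 1 0).im⟩ = g.1 := by
      ext i j
      fin_cases i <;> fin_cases j
      · rfl
      · rw [Complex.ext_iff] at e2
        apply Complex.ext
        · simpa [su2Mat] using congrArg Neg.neg e2.1
        · simpa [su2Mat] using e2.2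
      · rfl
      · rw [Complex.ext_iff] at e1
        apply Complex.ext
        · simpa [su2Mat] using e1.1
        · simpa [su2Mat] using e1.2
    refine ⟨⟨_, mem_unitary_of_normSq ?_⟩, Subtype.ext hg⟩
    have := su2Mat_det ⟨(g.1 0 0).re, (g.1 1 0).re, (g.1 0 0).im, (g.1 1 0).im⟩
    rw [hg, hu.2] at this
    exact_mod_cast this.symm

/-- The unit quaternions form the group `SU(2)`. -/
def su2Equiv : unitary ℍ[ℝ] ≃* SU2 := MulEquiv.ofBijective su2Hom su2Hom_bijective

/-- `Π_L ⊕ Π_R` as pairs of quaternions. -/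
def quatPair : (ℍ[ℝ] × ℍ[ℝ]) ≃ₗ[ℝ] R44 :=
  (quatCoord.prodCongr quatCoord).trans (LinearEquiv.sumArrowLequivProdArrow _ _ ℝ ℝ).symm

lemma quatPair_apply (x : ℍ[ℝ] × ℍ[ℝ]) :
    quatPair x = Sum.elim (quatCoord x.1) (quatCoord x.2) := rfl

lemma su2Act_quatPair (u v : unitary ℍ[ℝ]) (x : ℍ[ℝ] × ℍ[ℝ]) :
    su2Act (su2Equiv u, su2Equiv v) (quatPair x) = quatPair (((u, v) : ℍ[ℝ] × ℍ[ℝ]) * x) := by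
  rw [quatPair_apply, quatPair_apply, su2Act, Sum.elim_comp_inl, Sum.elim_comp_inr]
  congr 1 <;> exact ofC2_su2Mat_mulVec _ _

/-- The winding-momentum lattice in quaternionic coordinates. -/
def quatLattice (h : SOPlus44) : AddSubgroup (ℍ[ℝ] × ℍ[ℝ]) :=
  (windingLattice h).toAddSubgroup.comap quatPair.toLinearMap.toAddMonoidHom

lemma mem_quatLattice {h : SOPlus44} {x : ℍ[ℝ] × ℍ[ℝ]} :
    x ∈ quatLattice h ↔ quatPair x ∈ windingLattice h := Iff.rfl

lemma mem_G0_iff {h : SOPlus44} {u v : unitary ℍ[ℝ]} : (su2Equiv u, su2Equiv v) ∈ G0 h ↔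
      ∀ x : ℍ[ℝ] × ℍ[ℝ], (((u, v) : ℍ[ℝ] × ℍ[ℝ]) * x) ∈ quatLattice h ↔ x ∈ quatLattice h := by
  rw [← quatPair.surjective.forall (p := fun y => su2Act (su2Equiv u, su2Equiv v) y ∈
    windingLattice h ↔ y ∈ windingLattice h) |>.trans (forall_congr' fun x => ?_)]
  · rfl
  · rw [su2Act_quatPair, mem_quatLattice, mem_quatLattice]

/-! ## Narain lattices -/

/-- The bilinear form of `ℝ^{4,4}`. -/
def form44 (x y : R44) : ℝ := x ⬝ᵥ eta44 *ᵥ y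

lemma form44_eq (x y : R44) :
    form44 x y = ∑ i, x (.inl i) * y (.inl i) - ∑ i, x (.inr i) * y (.inr i) := by
  simp [form44, eta44, LieAlgebra.Orthogonal.indefiniteDiagonal, Matrix.mulVec_diagonal,
    dotProduct, sub_eq_add_neg]

lemma form44_comm (x y : R44) : form44 x y = form44 y x := by simp only [form44_eq, mul_comm]

lemma form44_add_left (x y z : R44) : form44 (x + y) z = form44 x z + form44 y z := by
  simp only [form44, add_dotProduct]

lemma form44_smul_left (c : ℝ) (x y : R44) : form44 (c • x) y = c * form44 x y := by
  simp only [form44, smul_dotProduct, smul_eq_mul]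

lemma form44_sum_left {ι : Type*} (s : Finset ι) (f : ι → R44) (y : R44) :
    form44 (∑ i ∈ s, f i) y = ∑ i ∈ s, form44 (f i) y := by
  simp only [form44, sum_dotProduct]

lemma form44_mulVec (h : SOPlus44) (x y : R44) :
    form44 (h.1.val *ᵥ x) (h.1.val *ᵥ y) = form44 x y := by
  have := h.2.1
  calc _ = x ⬝ᵥ ((h.1.val)ᵀ * eta44 * h.1.val) *ᵥ y := by
        rw [form44, ← Matrix.vecMul_transpose, ← dotProduct_mulVec, mulVec_mulVec, mulVec_mulVec]
    _ = _ := by rw [this]; rfl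

lemma mulVec_inv_mulVec (h : SOPlus44) (x : R44) : h.1.val *ᵥ ((h⁻¹).1.val *ᵥ x) = x := by simp [e]

lemma inv_sqrt_two_sq : (√2)⁻¹ * (√2)⁻¹ = (1 / 2 : ℝ) := by
  rw [← mul_inv, Real.mul_self_sqrt zero_le_two, one_div]

lemma windingBasis_expand (h : SOPlus44) (x : R44) :
    x = ∑ i, (form44 x (windingBasis h (.inr i)) • windingBasis h (.inl i) +
      form44 x (windingBasis h (.inl i)) • windingBasis h (.inr i)) := by
  obtain ⟨z, rfl⟩ : ∃ z, h.1.val *ᵥ z = x := ⟨_, mulVec_inv_mulVec h x⟩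
  simp only [windingBasis, form44_mulVec]
  simp only [← Matrix.mulVec_smul, ← Matrix.mulVec_add, ← Matrix.mulVec_sum]
  congr 1
  have h2 := inv_sqrt_two_sq
  ext (j | j)
  · simp only [form44_eq, narainBasis, Finset.sum_apply, padd, psmul,
      Sum.elim_inl, Sum.elim_inr, smul_eq_mul, Pi.neg_apply, Pi.single_apply, sum_add_distrib]
    simp
    linear_combination (-2 * z (.inl j)) * h2
  · simp only [form44_eq, narainBasis, Finset.sum_apply, padd, psmul,
      Sum.elim_inl, Sum.elim_inr, smul_eq_mul, Pi.neg_apply, Pi.single_apply, sum_add_distrib]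
    simp
    linear_combination (-2 * z (.inr j)) * h2

lemma narainBasis_form (j k : Fin 4 ⊕ Fin 4) : ∃ n : ℤ, form44 (narainBasis j) (narainBasis k) = n := by
  have h2 := inv_sqrt_two_sq
  refine ⟨if j = k.swap then 1 else 0, ?_⟩
  rcases j with j | j <;> rcases k with k | k <;> by_cases hjk : j = k <;>
    simp [form44_eq, narainBasis, Pi.single_apply, hjk, h2, Ne.symm] <;> norm_num

lemma mem_windingLattice_iff (h : SOPlus44) (x : R44) :
    x ∈ windingLattice h ↔ ∀ j, ∃ n : ℤ, form44 x (windingBasis h j) = n := by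
  constructor
  · intro hx j
    induction hx using span_induction with
    | mem x hx =>
      obtain ⟨k, rfl⟩ := hx
      rw [windingBasis, windingBasis, form44_mulVec]
      exact narainBasis_form k j
    | zero => exact ⟨0, by simp [form44]⟩
    | add x y _ _ hx hy =>
      obtain ⟨m, hm⟩ := hx
      obtain ⟨n, hn⟩ := hy
      exact ⟨m + n, by rw [form44_add_left, hm, hn]; push_cast; rfl⟩
    | smul c x _ hx =>
      obtain ⟨n, hn⟩ := hx
      exact ⟨c * n, by rw [← Int.cast_smul_eq_zsmul ℝ, form44_smul_left, hn]; push_cast; rfl⟩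
  · intro hx
    choose n hn using hx
    rw [windingBasis_expand h x]
    refine sum_mem fun i _ => add_mem ?_ ?_ <;>
      rw [hn, Int.cast_smul_eq_zsmul] <;>
      exact smul_mem _ _ (subset_span ⟨_, rfl⟩)

lemma windingLattice_dual (h : SOPlus44) (x : R44) :
    x ∈ windingLattice h ↔ ∀ y ∈ windingLattice h, ∃ n : ℤ, form44 x y = n := by
  refine ⟨fun hx y hy => ?_, fun hx => (mem_windingLattice_iff h x).2 fun j =>
    hx _ (subset_span ⟨j, rfl⟩)⟩
  induction hy using span_induction with
  | mem y hy =>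
    obtain ⟨k, rfl⟩ := hy
    exact (mem_windingLattice_iff h x).1 hx k
  | zero => exact ⟨0, by simp [form44]⟩
  | add y z _ _ hy hz =>
    obtain ⟨m, hm⟩ := hy
    obtain ⟨n, hn⟩ := hz
    exact ⟨m + n, by rw [form44_comm, form44_add_left, form44_comm y, form44_comm z, hm, hn]; push_cast; rfl⟩
  | smul c y _ hy =>
    obtain ⟨n, hn⟩ := hy
    exact ⟨c * n, by
      rw [← Int.cast_smul_eq_zsmul ℝ, form44_comm, form44_smul_left, form44_comm, hn]; push_cast; rfl⟩

lemma windingLattice_even (h : SOPlus44) {x : R44} (hx : x ∈ windingLattice h) :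
    ∃ n : ℤ, form44 x x = 2 * n := by
  choose n hn using (mem_windingLattice_iff h x).1 hx
  refine ⟨∑ i, n (.inr i) * n (.inl i), ?_⟩
  have e := congrArg (fun z => form44 z x) (windingBasis_expand h x)
  rw [e, form44_sum_left]
  push_cast
  rw [mul_sum]
  refine sum_congr rfl fun i _ => ?_
  rw [form44_add_left, form44_smul_left, form44_smul_left, form44_comm (windingBasis _ _),
    form44_comm (windingBasis _ _), hn, hn]
  ring

lemma mulVec_mem_windingLattice (l : SOPlus44) (x : R44) :
    l.1.val *ᵥ x ∈ windingLattice l ↔ x ∈ narainLattice := by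
  have e : windingLattice l = narainLattice.map (l.1.val.mulVecLin.restrictScalars ℤ) := by
    rw [narainLattice, Submodule.map_span, ← Set.range_comp]
    rfl
  rw [e]
  refine ⟨fun ⟨y, hy, hxy⟩ => ?_, fun hx => ⟨x, hx, rfl⟩⟩
  have h1 : (l⁻¹).1.val *ᵥ (l.1.val *ᵥ y) = (l⁻¹).1.val *ᵥ (l.1.val *ᵥ x) := congrArg _ hxy
  have h2 := mulVec_inv_mulVec l⁻¹
  rw [inv_inv] at h2
  rw [h2, h2] at h1
  rwa [← h1]

lemma moduliPoint_eq_of_le {h k : SOPlus44} (p : SOPlus44) (hp : p ∈ SO4xSO4)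
    (hle : ∀ j, p.1.val *ᵥ windingBasis k j ∈ windingLattice h) : moduliPoint h = moduliPoint k := by
  have hsub : ∀ x ∈ windingLattice (p * k), x ∈ windingLattice h := fun x hx => by
    refine Submodule.span_le.2 ?_ hx
    rintro _ ⟨j, rfl⟩
    have := hle j
    rwa [windingBasis, mulVec_mulVec] at this
  have heq : ∀ x, x ∈ windingLattice (p * k) ↔ x ∈ windingLattice h := fun x =>
    ⟨hsub x, fun hx => (windingLattice_dual _ x).2 fun y hy =>
      (windingLattice_dual h x).1 hx y (hsub y hy)⟩
  refine (DoubleCoset.eq _ _ _ _).2 ⟨p⁻¹, SO4xSO4.inv_mem hp, h⁻¹ * (p * k), fun x => ?_, by group⟩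
  rw [← mulVec_mem_windingLattice h, ← mulVec_mem_windingLattice (p * k) x, heq]
  have : h.1.val *ᵥ ((h⁻¹ * (p * k)).1.val *ᵥ x) = (p * k).1.val *ᵥ x := by simp []
  rw [this]

lemma exists_of_moduliPoint_eq {h k : SOPlus44} (hhk : moduliPoint h = moduliPoint k) :
    ∃ p ∈ SO4xSO4, ∀ x, p.1.val *ᵥ x ∈ windingLattice h ↔ x ∈ windingLattice k := by
  obtain ⟨p, hp, n, hn, rfl⟩ := (DoubleCoset.eq _ _ _ _).1 hhk
  refine ⟨p⁻¹, SO4xSO4.inv_mem hp, fun x => ?_⟩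
  have e : x = (p * h * n).1.val *ᵥ ((p * h * n)⁻¹.1.val *ᵥ x) := (mulVec_inv_mulVec _ x).symm
  generalize ((p * h * n)⁻¹).1.val *ᵥ x = y at e
  subst e
  rw [mulVec_mem_windingLattice, ← hn y, ← mulVec_mem_windingLattice h, mulVec_mulVec,
    mulVec_mulVec]
  have : (p⁻¹).1.val * (p * h * n).1.val = h.1.val * n.1.val :=
    congrArg (fun l : SOPlus44 => l.1.val) (show p⁻¹ * (p * h * n) = h * n by group)
  rw [this]

/-! ## Rotations of the quaternions -/

/-- The quaternion `i`. -/
@[simps] def qI : ℍ[ℝ] := ⟨0, 1, 0, 0⟩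

/-- The quaternion `j`. -/
@[simps] def qJ : ℍ[ℝ] := ⟨0, 0, 1, 0⟩

lemma quatAut_star (φ : ℍ[ℝ] ≃ₐ[ℝ] ℍ[ℝ]) (x : ℍ[ℝ]) : φ (star x) = star (φ x) := by
  have key : ∀ y : ℍ[ℝ], y.re = 0 → (φ y).re = 0 := by
    intro y hy
    have h1 : y * y = ((-normSq y : ℝ) : ℍ[ℝ]) := by
      have hs : star y = -y := by ext <;> simp [hy]
      rw [Quaternion.coe_neg, ← self_mul_star, hs]
      simp
    have h2 := congrArg φ h1
    rw [map_mul, ← algebraMap_def, AlgEquiv.commutes] at h2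
    have hn := normSq_nonneg (a := y)
    generalize φ y = z at h2 ⊢
    have e0 := congrArg QuaternionAlgebra.re h2
    have e1 := congrArg imI h2
    have e2 := congrArg imJ h2
    have e3 := congrArg imK h2
    simp [algebraMap_def] at e0 e1 e2 e3
    by_contra hz
    have f1 : z.imI = 0 := by grind
    have f2 : z.imJ = 0 := by grind
    have f3 : z.imK = 0 := by grind
    rw [f1, f2, f3] at e0
    exact hz (by nlinarith [mul_self_nonneg z.re])
  have hx : star x = ((2 * x.re : ℝ) : ℍ[ℝ]) - x := by
    ext
    · simp
      ring
    all_goals simp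
  have hr : (φ x).re = x.re := by
    have := key (x - (x.re : ℝ)) (by simp)
    rw [map_sub, ← algebraMap_def, AlgEquiv.commutes] at this
    simp [algebraMap_def] at this
    linarith
  rw [hx, map_sub, ← algebraMap_def, AlgEquiv.commutes]
  ext
  · simp [algebraMap_def, hr]
    ring
  all_goals simp [algebraMap_def]

lemma quatAut_normSq (φ : ℍ[ℝ] ≃ₐ[ℝ] ℍ[ℝ]) (x : ℍ[ℝ]) : normSq (φ x) = normSq x := by
  have h := self_mul_star (φ x)
  rw [← quatAut_star, ← map_mul, self_mul_star, ← algebraMap_def, AlgEquiv.commutes] at h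
  exact (congrArg QuaternionAlgebra.re h).symm

lemma exists_quatAut {p q : ℍ[ℝ]} (hp : p * p = -1) (hq : q * q = -1) (hpq : q * p = -(p * q)) :
    ∃ φ : ℍ[ℝ] ≃ₐ[ℝ] ℍ[ℝ], φ qI = p ∧ φ qJ = q := by
  let b : QuaternionAlgebra.Basis ℍ[ℝ] (-1 : ℝ) 0 (-1) :=
    { i := p, j := q, k := p * q
      i_mul_i := by rw [hp]; simp
      j_mul_j := by rw [hq]; simp
      i_mul_j := rfl
      j_mul_i := by rw [hpq]; simp }
  let F : ℍ[ℝ] →ₐ[ℝ] ℍ[ℝ] := b.liftHom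
  have hinj : Injective F := F.toRingHom.injective
  refine ⟨AlgEquiv.ofBijective F
    ⟨hinj, (LinearMap.injective_iff_surjective (f := F.toLinearMap)).1 hinj⟩, ?_, ?_⟩ <;>
  · show b.lift _ = _
    simp [QuaternionAlgebra.Basis.lift, b]

lemma quat_eq_sum (x : ℍ[ℝ]) : x = (x.re : ℝ) • 1 + x.imI • qI + x.imJ • qJ +
    x.imK • (qI * qJ) := by
  ext <;> simp

/-- The rotation `x ↦ φ(x) m` of the quaternions. -/
def quatRot (φ : ℍ[ℝ] ≃ₐ[ℝ] ℍ[ℝ]) (m : ℍ[ℝ]) : Matrix (Fin 4) (Fin 4) ℝ :=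
  LinearMap.toMatrix' (quatCoord.toLinearMap ∘ₗ LinearMap.mulRight ℝ m ∘ₗ φ.toLinearMap ∘ₗ
    quatCoord.symm.toLinearMap)

lemma quatRot_mulVec (φ : ℍ[ℝ] ≃ₐ[ℝ] ℍ[ℝ]) (m x : ℍ[ℝ]) :
    quatRot φ m *ᵥ quatCoord x = quatCoord (φ x * m) := by
  rw [quatRot, LinearMap.toMatrix'_mulVec]
  simp

lemma quatRot_orthogonal (φ : ℍ[ℝ] ≃ₐ[ℝ] ℍ[ℝ]) {m : ℍ[ℝ]} (hm : normSq m = 1) :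
    (quatRot φ m)ᵀ * quatRot φ m = 1 := by
  refine transpose_mul_self_of_isometry _ fun x => ?_
  obtain ⟨x, rfl⟩ := quatCoord.surjective x
  rw [quatRot_mulVec, quatCoord_dotProduct, quatCoord_dotProduct, ← normSq_def,
    ← normSq_def, map_mul, quatAut_normSq, hm, mul_one]

lemma quatRot_det_pos (φ : ℍ[ℝ] ≃ₐ[ℝ] ℍ[ℝ]) {m : ℍ[ℝ]} (hm : normSq m = 1) :
    0 < (quatRot φ m).det := by
  have hne : (quatRot φ m).det ≠ 0 := fun h => by
    have := congrArg Matrix.det (quatRot_orthogonal φ hm)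
    rw [det_mul, h, mul_zero, Matrix.det_one] at this
    exact zero_ne_one this
  have hre : ∀ y : ℍ[ℝ], y.re = 0 → (φ y).re = 0 := fun y hy => by
    have h1 : star y = -y := by ext <;> simp [hy]
    have := congrArg QuaternionAlgebra.re (quatAut_star φ y)
    rw [h1, map_neg] at this
    simp at this
    linarith
  set p := φ qI with hp
  set q := φ qJ with hq
  have hp0 : p.re = 0 := hre _ rfl
  have hq0 : q.re = 0 := hre _ rfl
  have hpq : p.imI * q.imI + p.imJ * q.imJ + p.imK * q.imK = 0 := by
    have h : (φ (qI * qJ)).re = 0 := hre _ (by simp)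
    rw [map_mul, ← hp, ← hq] at h
    simp [hp0, hq0] at h
    linarith
  let X : Matrix (Fin 4) (Fin 4) ℝ := !![m.re, -m.imI, -m.imJ, -m.imK; m.imI, m.re, m.imK, -m.imJ;
    m.imJ, -m.imK, m.re, m.imI; m.imK, m.imJ, -m.imI, m.re]
  let Y : Matrix (Fin 4) (Fin 4) ℝ := !![1, 0, 0, 0; 0, p.imI, q.imI, p.imJ * q.imK - p.imK * q.imJ;
    0, p.imJ, q.imJ, p.imK * q.imI - p.imI * q.imK;
    0, p.imK, q.imK, p.imI * q.imJ - p.imJ * q.imI]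
  have hXY : quatRot φ m = X * Y := by
    refine Matrix.ext_of_mulVec_single fun i => ?_
    obtain ⟨x, hx⟩ := quatCoord.surjective (Pi.single i 1)
    rw [← hx, quatRot_mulVec, quat_eq_sum x]
    simp only [map_add, map_smul, map_mul, map_one, ← hp, ← hq]
    rw [← mulVec_mulVec]
    ext j
    fin_cases j <;>
      simp [X, Y, quatCoord_apply, mulVec, dotProduct, sum_univ_four, hp0, hq0]
    · linear_combination (-x.imK * m.re) * hpq
    · linear_combination (-x.imK * m.imI) * hpq
    · linear_combination (-x.imK * m.imJ) * hpq
    · linear_combination (-x.imK * m.imK) * hpq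
  have hX : X.det = normSq m ^ 2 := by
    simp [X, Matrix.det_succ_row_zero, Fin.sum_univ_succ, Fin.succAbove, normSq_def']
    ring
  have hY : Y.det = (p.imJ * q.imK - p.imK * q.imJ) ^ 2 + (p.imK * q.imI - p.imI * q.imK) ^ 2 +
      (p.imI * q.imJ - p.imJ * q.imI) ^ 2 := by
    simp [Y, Matrix.det_succ_row_zero, Fin.sum_univ_succ, Fin.succAbove]
    ring
  rw [hXY, det_mul, hX, hm, hY] at hne ⊢
  exact lt_of_le_of_ne (by positivity) (Ne.symm hne)

lemma exists_quatRot {A : Matrix (Fin 4) (Fin 4) ℝ} (hA : Aᵀ * A = 1) (hd : 0 < A.det) :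
    ∃ φ m, normSq m = 1 ∧ A = quatRot φ m := by
  have hpres : ∀ x y, A *ᵥ x ⬝ᵥ A *ᵥ y = x ⬝ᵥ y := fun x y => by
    rw [dotProduct_mulVec, vecMul_mulVec, hA, vecMul_one]
  let f : ℍ[ℝ] → ℍ[ℝ] := fun x => quatCoord.symm (A *ᵥ quatCoord x)
  have hf : ∀ x, quatCoord (f x) = A *ᵥ quatCoord x := fun x => quatCoord.apply_symm_apply _
  have hin : ∀ x y, (f x * star (f y)).re = (x * star y).re := fun x y => by
    rw [← quatCoord_dotProduct, ← quatCoord_dotProduct, hf, hf, hpres]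
  set m := f 1 with hm
  have hm1 : normSq m = 1 := by
    rw [normSq_def, hin]
    simp
  have hmm : star m * m = 1 := by rw [Quaternion.star_mul_self, hm1, Quaternion.coe_one]
  have himag : ∀ x : ℍ[ℝ], x.re = 0 → (f x * star m).re = 0 := fun x hx => by
    rw [hin]
    simpa using hx
  have hprod : ∀ x y : ℍ[ℝ], x.re = 0 → y.re = 0 →
      (f x * star m) * (f y * star m) + (f y * star m) * (f x * star m) =
        ((-2 * (x * star y).re : ℝ) : ℍ[ℝ]) := fun x y hx hy => by
    have h1 := himag x hx
    have h2 := himag y hy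
    have h3 : ((f x * star m) * star (f y * star m)).re = (x * star y).re := by
      rw [star_mul, star_star, mul_assoc, ← mul_assoc (star m), hmm, one_mul, hin]
    generalize f x * star m = u at h1 h3 ⊢
    generalize f y * star m = v at h2 h3 ⊢
    rw [← h3]
    ext <;> simp [h1, h2] <;> ring
  have hsq : ∀ x : ℍ[ℝ], x.re = 0 → normSq x = 1 →
      (f x * star m) * (f x * star m) = -1 := fun x hx hn => by
    have h := hprod x x hx hx
    rw [← normSq_def, hn, ← two_smul ℝ] at h
    refine smul_right_injective _ (two_ne_zero (α := ℝ)) (h.trans ?_)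
    ext <;> simp
  obtain ⟨φ, hφ1, hφ2⟩ := exists_quatAut (p := f qI * star m)
    (q := f qJ * star m) (hsq _ rfl (by simp [normSq_def']))
    (hsq _ rfl (by simp [normSq_def'])) (by
      have h := hprod qJ qI rfl rfl
      refine eq_neg_of_add_eq_zero_left (h.trans ?_)
      ext <;> simp)
  refine ⟨φ, m, hm1, ?_⟩
  set B := quatRot φ m with hB
  have hBB : Bᵀ * B = 1 := quatRot_orthogonal φ hm1
  have hO : (Bᵀ * A)ᵀ * (Bᵀ * A) = 1 := by
    rw [Matrix.transpose_mul, Matrix.transpose_transpose, Matrix.mul_assoc, ← Matrix.mul_assoc B,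
      mul_eq_one_comm.1 hBB, Matrix.one_mul, hA]
  have hfix : ∀ x : ℍ[ℝ], φ x * m = f x → (Bᵀ * A) *ᵥ quatCoord x = quatCoord x := fun x hx => by
    rw [← mulVec_mulVec, ← hf, ← hx, ← quatRot_mulVec, mulVec_mulVec, hBB, one_mulVec]
  have h0 := hfix 1 (by rw [map_one, one_mul])
  have h1 := hfix qI (by rw [hφ1, mul_assoc, hmm, mul_one])
  have h2 := hfix qJ (by rw [hφ2, mul_assoc, hmm, mul_one])
  have hdet : 0 < (Bᵀ * A).det := by
    rw [det_mul, Matrix.det_transpose]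
    exact mul_pos (quatRot_det_pos φ hm1) hd
  suffices h : Bᵀ * A = 1 by
    rw [← Matrix.one_mul A, ← mul_eq_one_comm.1 hBB, Matrix.mul_assoc, h, Matrix.mul_one]
  generalize Bᵀ * A = O at h0 h1 h2 hO hdet
  have c : ∀ (j : Fin 4) (x : ℍ[ℝ]), quatCoord x = Pi.single j 1 → O *ᵥ quatCoord x = quatCoord x →
      ∀ i, O i j = (1 : Matrix (Fin 4) (Fin 4) ℝ) i j := fun j x hx h i => by
    rw [hx] at h
    have := congrFun h i
    rw [Matrix.mulVec_single_one] at this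
    rw [Matrix.one_apply, ← Pi.single_apply]
    exact this
  have c0 := c 0 1 (by ext i; fin_cases i <;> simp [quatCoord_apply]) h0
  have c1 := c 1 _ (by ext i; fin_cases i <;> simp [quatCoord_apply]) h1
  have c2 := c 2 _ (by ext i; fin_cases i <;> simp [quatCoord_apply]) h2
  have hcol : ∀ i : Fin 4, ∑ l, O l i * O l 3 = (1 : Matrix (Fin 4) (Fin 4) ℝ) i 3 := fun i => by
    rw [← hO]
    rfl
  have d0 := hcol 0
  have d1 := hcol 1
  have d2 := hcol 2
  have d3 := hcol 3
  simp [sum_univ_four, c0, c1, c2] at d0 d1 d2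
  simp [sum_univ_four, d0, d1, d2] at d3
  have hOd : O = Matrix.diagonal ![1, 1, 1, O 3 3] := by
    ext i j
    fin_cases j
    · exact (c0 i).trans (by fin_cases i <;> simp [Matrix.one_apply])
    · exact (c1 i).trans (by fin_cases i <;> simp [Matrix.one_apply])
    · exact (c2 i).trans (by fin_cases i <;> simp [Matrix.one_apply])
    · fin_cases i <;> simp [d0, d1, d2]
  rw [hOd] at hdet ⊢
  rw [Matrix.det_diagonal] at hdet
  simp [Fin.prod_univ_four] at hdet
  have : O 3 3 = 1 := by nlinarith
  rw [this]
  ext i j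
  fin_cases i <;> fin_cases j <;> rfl

lemma exists_mem_SO4xSO4 (φ ψ : ℍ[ℝ] ≃ₐ[ℝ] ℍ[ℝ]) {a b : ℍ[ℝ]} (ha : normSq a = 1)
    (hb : normSq b = 1) : ∃ p ∈ SO4xSO4, ∀ x : ℍ[ℝ] × ℍ[ℝ],
      p.1.val *ᵥ quatPair x = quatPair (φ x.1 * a, ψ x.2 * b) := by
  have h1 := quatRot_orthogonal φ ha
  have h2 := quatRot_orthogonal ψ hb
  have e1 : fromBlocks (quatRot φ a) 0 0 (quatRot ψ b) *
      fromBlocks (quatRot φ a)ᵀ 0 0 (quatRot ψ b)ᵀ = 1 := by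
    simp [fromBlocks_multiply, mul_eq_one_comm.1 h1, mul_eq_one_comm.1 h2]
  refine ⟨⟨⟨fromBlocks (quatRot φ a) 0 0 (quatRot ψ b), _, e1, mul_eq_one_comm.1 e1⟩, ?_, ?_, ?_⟩,
    ⟨rfl, rfl⟩, fun x => ?_⟩
  · show (fromBlocks (quatRot φ a) 0 0 (quatRot ψ b))ᵀ * eta44 *
      fromBlocks (quatRot φ a) 0 0 (quatRot ψ b) = eta44
    simp [eta44_eq, Matrix.fromBlocks_transpose, fromBlocks_multiply, h1, h2]
  · exact quatRot_det_pos φ ha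
  · exact quatRot_det_pos ψ hb
  · show fromBlocks (quatRot φ a) 0 0 (quatRot ψ b) *ᵥ _ = _
    simp [quatPair_apply, Matrix.fromBlocks_mulVec, quatRot_mulVec]

lemma exists_quatRot_of_mem {p : SOPlus44} (hp : p ∈ SO4xSO4) :
    ∃ (φ ψ : ℍ[ℝ] ≃ₐ[ℝ] ℍ[ℝ]) (a b : ℍ[ℝ]), normSq a = 1 ∧ normSq b = 1 ∧
      ∀ x : ℍ[ℝ] × ℍ[ℝ], p.1.val *ᵥ quatPair x = quatPair (φ x.1 * a, ψ x.2 * b) := by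
  obtain ⟨h1, h2, h3⟩ := p.2
  have e : p.1.val = fromBlocks p.1.val.toBlocks₁₁ 0 0 p.1.val.toBlocks₂₂ := by
    conv_lhs => rw [← Matrix.fromBlocks_toBlocks p.1.val, hp.1, hp.2]
  rw [e, eta44_eq, Matrix.fromBlocks_transpose, fromBlocks_multiply, fromBlocks_multiply] at h1
  simp [Matrix.fromBlocks_inj] at h1
  obtain ⟨φ, a, ha, hA⟩ := exists_quatRot h1.1 h2
  obtain ⟨ψ, b, hb, hB⟩ := exists_quatRot h1.2 h3
  refine ⟨φ, ψ, a, b, ha, hb, fun x => ?_⟩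
  rw [e, hA, hB]
  simp [quatPair_apply, Matrix.fromBlocks_mulVec, quatRot_mulVec]

/-- The automorphism of `SU(2)` given by an automorphism of the quaternions. -/
def su2Aut (φ : ℍ[ℝ] ≃ₐ[ℝ] ℍ[ℝ]) : SU2 ≃* SU2 :=
  su2Equiv.symm.trans ((Unitary.mapEquiv
    ({ φ.toMulEquiv with map_star' := quatAut_star φ } : ℍ[ℝ] ≃⋆* ℍ[ℝ])).toMulEquiv.trans su2Equiv)

lemma su2Aut_su2Equiv (φ : ℍ[ℝ] ≃ₐ[ℝ] ℍ[ℝ]) (u : unitary ℍ[ℝ]) :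
    su2Aut φ (su2Equiv u) = su2Equiv ⟨φ u, mem_unitary_of_normSq
      ((quatAut_normSq φ u).trans (normSq_of_mem_unitary u))⟩ := by
  simp only [su2Aut, MulEquiv.trans_apply, MulEquiv.symm_apply_apply]
  rfl

lemma G0_equiv_of_moduliPoint_eq {h k : SOPlus44} (hhk : moduliPoint h = moduliPoint k) :
    Nonempty (G0 k ≃* G0 h) := by
  obtain ⟨p, hp, hmem⟩ := exists_of_moduliPoint_eq hhk
  obtain ⟨φ, ψ, a, b, ha, hb, hx⟩ := exists_quatRot_of_mem hp
  have ha0 : a ≠ 0 := fun h => by simp [h] at ha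
  have hb0 : b ≠ 0 := fun h => by simp [h] at hb
  have hlat : ∀ x : ℍ[ℝ] × ℍ[ℝ], (φ x.1 * a, ψ x.2 * b) ∈ quatLattice h ↔ x ∈ quatLattice k :=
    fun x => by rw [mem_quatLattice, ← hx, hmem, mem_quatLattice]
  have hsurj : Surjective fun x : ℍ[ℝ] × ℍ[ℝ] => (φ x.1 * a, ψ x.2 * b) := fun y =>
    ⟨(φ.symm (y.1 * a⁻¹), ψ.symm (y.2 * b⁻¹)), by simp [ha0, hb0]⟩
  have key : (G0 k).map ((su2Aut φ).prodCongr (su2Aut ψ)).toMonoidHom = G0 h := by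
    ext g
    obtain ⟨⟨u, v⟩, rfl⟩ := ((su2Aut φ).prodCongr (su2Aut ψ)).surjective g
    rw [show ((su2Aut φ).prodCongr (su2Aut ψ)) (u, v) =
      ((su2Aut φ).prodCongr (su2Aut ψ)).toMonoidHom (u, v) from rfl,
      Subgroup.mem_map_iff_mem ((su2Aut φ).prodCongr (su2Aut ψ)).injective]
    obtain ⟨u, rfl⟩ := su2Equiv.surjective u
    obtain ⟨v, rfl⟩ := su2Equiv.surjective v
    rw [mem_G0_iff, show ((su2Aut φ).prodCongr (su2Aut ψ)).toMonoidHom (su2Equiv u, su2Equiv v) =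
      (su2Aut φ (su2Equiv u), su2Aut ψ (su2Equiv v)) from rfl, su2Aut_su2Equiv, su2Aut_su2Equiv,
      mem_G0_iff]
    refine Iff.trans (forall_congr' fun x => ?_) hsurj.forall.symm
    rw [hlat, ← hlat]
    simp only [Prod.fst_mul, Prod.snd_mul, map_mul, mul_assoc]
    rfl
  exact ⟨((((su2Aut φ).prodCongr (su2Aut ψ))).subgroupMap (G0 k)).trans (MulEquiv.subgroupCongr key)⟩

/-! ## Hurwitz units and `SL_2(𝔽_3)` -/

/-- The representative of smallest absolute value. -/
def liftZMod3 (x : ZMod 3) : ℤ := if x = 0 then 0 else if x = 1 then 1 else -1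

/-- The coordinates of a matrix over `𝔽_3` in the basis `1, I, J, IJ`, where `I = (0 -1; 1 0)` and
`J = (1 1; 1 -1)`. -/
def quatMod3 (A : T24) : Fin 4 → ZMod 3 :=
  ![-(A.1 0 0 + A.1 1 1), A.1 0 1 - A.1 1 0, A.1 0 1 + A.1 1 0 - A.1 1 1 + A.1 0 0,
    A.1 0 1 + A.1 1 0 + A.1 1 1 - A.1 0 0]

/-- Twice the Hurwitz unit that reduces to a given matrix modulo `3`. -/
def hurwitzUnit (A : T24) (i : Fin 4) : ℤ :=
  if quatMod3 A 0 * quatMod3 A 1 * quatMod3 A 2 * quatMod3 A 3 = 0 then 2 * liftZMod3 (quatMod3 A i)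
  else -liftZMod3 (quatMod3 A i)

/-- The character of `SL_2(𝔽_3)` of order three. -/
def chi3 (A : T24) : ZMod 3 :=
  (1 - A.1 1 0 ^ 2) * A.1 0 1 * A.1 1 1 + A.1 1 0 * (A.1 0 0 + A.1 1 1)

lemma hurwitzUnit_mul : ∀ A B : T24,
    2 * hurwitzUnit (A * B) 0 = hurwitzUnit A 0 * hurwitzUnit B 0 - hurwitzUnit A 1 * hurwitzUnit B 1
      - hurwitzUnit A 2 * hurwitzUnit B 2 - hurwitzUnit A 3 * hurwitzUnit B 3 ∧
    2 * hurwitzUnit (A * B) 1 = hurwitzUnit A 0 * hurwitzUnit B 1 + hurwitzUnit A 1 * hurwitzUnit B 0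
      + hurwitzUnit A 2 * hurwitzUnit B 3 - hurwitzUnit A 3 * hurwitzUnit B 2 ∧
    2 * hurwitzUnit (A * B) 2 = hurwitzUnit A 0 * hurwitzUnit B 2 - hurwitzUnit A 1 * hurwitzUnit B 3
      + hurwitzUnit A 2 * hurwitzUnit B 0 + hurwitzUnit A 3 * hurwitzUnit B 1 ∧
    2 * hurwitzUnit (A * B) 3 = hurwitzUnit A 0 * hurwitzUnit B 3 + hurwitzUnit A 1 * hurwitzUnit B 2
      - hurwitzUnit A 2 * hurwitzUnit B 1 + hurwitzUnit A 3 * hurwitzUnit B 0 := by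
  decide +kernel

lemma hurwitzUnit_norm : ∀ A : T24, hurwitzUnit A 0 ^ 2 + hurwitzUnit A 1 ^ 2 +
    hurwitzUnit A 2 ^ 2 + hurwitzUnit A 3 ^ 2 = 4 := by
  decide +kernel

lemma hurwitzUnit_injective : ∀ A B : T24, hurwitzUnit A = hurwitzUnit B → A = B := by
  decide +kernel

lemma exists_hurwitzUnit_of_mem : ∀ a ∈ Finset.Icc (-2 : ℤ) 2, ∀ b ∈ Finset.Icc (-2 : ℤ) 2,
    ∀ c ∈ Finset.Icc (-2 : ℤ) 2, ∀ d ∈ Finset.Icc (-2 : ℤ) 2, a ^ 2 + b ^ 2 + c ^ 2 + d ^ 2 = 4 →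
      a % 2 = b % 2 ∧ b % 2 = c % 2 → ∃ A : T24, hurwitzUnit A = ![a, b, c, d] := by
  decide +kernel

lemma chi3_mul : ∀ A B : T24, chi3 (A * B) = chi3 A + chi3 B := by decide +kernel

lemma exists_commutator : ∀ X : T24, chi3 X = 0 → ∃ A B : T24, A * B = X * (B * A) := by
  decide +kernel

lemma abelianization_eq_iff (A B : T24) :
    Abelianization.of A = Abelianization.of B ↔ chi3 A = chi3 B := by
  constructor
  · intro h
    let f : T24 →* Multiplicative (ZMod 3) :=
      MonoidHom.mk' (fun A => Multiplicative.ofAdd (chi3 A)) fun A B => by rw [chi3_mul, ofAdd_add]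
    have := congrArg (Abelianization.lift f) h
    simpa [f] using this
  · intro h
    have h1 : chi3 (A * B⁻¹) = 0 := by
      have := chi3_mul (A * B⁻¹) B
      rw [inv_mul_cancel_right, h] at this
      linear_combination -this
    obtain ⟨P, Q, hPQ⟩ := exists_commutator _ h1
    have h2 := congrArg Abelianization.of hPQ
    simp only [map_mul, map_inv] at h2
    rw [mul_comm (Abelianization.of Q)] at h2
    exact mul_inv_eq_one.1 (right_eq_mul.1 h2)

/-- The Hurwitz unit that reduces to a given matrix modulo `3`. -/
@[simps] def hurwitzQuat (A : T24) : ℍ[ℝ] :=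
  ⟨hurwitzUnit A 0 / 2, hurwitzUnit A 1 / 2, hurwitzUnit A 2 / 2, hurwitzUnit A 3 / 2⟩

lemma hurwitzQuat_normSq (A : T24) : normSq (hurwitzQuat A) = 1 := by
  have : (hurwitzUnit A 0 ^ 2 + hurwitzUnit A 1 ^ 2 + hurwitzUnit A 2 ^ 2 +
    hurwitzUnit A 3 ^ 2 : ℝ) = 4 := mod_cast hurwitzUnit_norm A
  rw [normSq_def']
  simp
  linarith

lemma hurwitzQuat_mul (A B : T24) : hurwitzQuat (A * B) = hurwitzQuat A * hurwitzQuat B := by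
  obtain ⟨h0, h1, h2, h3⟩ := hurwitzUnit_mul A B
  replace h0 := congrArg (Int.cast : ℤ → ℝ) h0
  replace h1 := congrArg (Int.cast : ℤ → ℝ) h1
  replace h2 := congrArg (Int.cast : ℤ → ℝ) h2
  replace h3 := congrArg (Int.cast : ℤ → ℝ) h3
  push_cast at h0 h1 h2 h3
  ext <;> simp <;> linarith

/-- `SL_2(𝔽_3)` as the group of Hurwitz units. -/
def t24Hom : T24 →* unitary ℍ[ℝ] :=
  MonoidHom.mk' (fun A => ⟨hurwitzQuat A, mem_unitary_of_normSq (hurwitzQuat_normSq A)⟩)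
    fun A B => Subtype.ext (hurwitzQuat_mul A B)

lemma t24Hom_injective : Injective t24Hom := by
  intro A B h
  have h' : hurwitzQuat A = hurwitzQuat B := congrArg Subtype.val h
  have h0 := congrArg QuaternionAlgebra.re h'
  have h1 := congrArg imI h'
  have h2 := congrArg imJ h'
  have h3 := congrArg imK h'
  simp at h0 h1 h2 h3
  refine hurwitzUnit_injective A B (funext fun i => ?_)
  fin_cases i <;> assumption

lemma exists_t24Hom {u : unitary ℍ[ℝ]} {p q r s : ℤ} (hp : (u : ℍ[ℝ]).re - (u : ℍ[ℝ]).imI = p)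
    (hq : (u : ℍ[ℝ]).imI - (u : ℍ[ℝ]).imJ = q) (hr : (u : ℍ[ℝ]).imJ - (u : ℍ[ℝ]).imK = r)
    (hs : (u : ℍ[ℝ]).imJ + (u : ℍ[ℝ]).imK = s) : ∃ A, t24Hom A = u := by
  have hn := normSq_of_mem_unitary u
  rw [normSq_def'] at hn
  have e0 : (u : ℍ[ℝ]).re = ((2 * p + 2 * q + r + s : ℤ) : ℝ) / 2 := by push_cast; linarith
  have e1 : (u : ℍ[ℝ]).imI = ((2 * q + r + s : ℤ) : ℝ) / 2 := by push_cast; linarith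
  have e2 : (u : ℍ[ℝ]).imJ = ((r + s : ℤ) : ℝ) / 2 := by push_cast; linarith
  have e3 : (u : ℍ[ℝ]).imK = ((s - r : ℤ) : ℝ) / 2 := by push_cast; linarith
  rw [e0, e1, e2, e3] at hn
  have hn' : (2 * p + 2 * q + r + s) ^ 2 + (2 * q + r + s) ^ 2 + (r + s) ^ 2 + (s - r) ^ 2 = 4 := by
    have : (((2 * p + 2 * q + r + s) ^ 2 + (2 * q + r + s) ^ 2 + (r + s) ^ 2 + (s - r) ^ 2 : ℤ) : ℝ)
      = 4 := by push_cast at hn ⊢; linarith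
    exact_mod_cast this
  have hb : ∀ x : ℤ, x ^ 2 ≤ 4 → x ∈ Finset.Icc (-2 : ℤ) 2 := fun x hx =>
    Finset.mem_Icc.2 ⟨by nlinarith, by nlinarith⟩
  obtain ⟨A, hA⟩ := exists_hurwitzUnit_of_mem _ (hb (2 * p + 2 * q + r + s) (by nlinarith))
    _ (hb (2 * q + r + s) (by nlinarith)) _ (hb (r + s) (by nlinarith)) _
    (hb (s - r) (by nlinarith)) hn' (by omega)
  refine ⟨A, Subtype.ext (show hurwitzQuat A = u from ?_)⟩
  ext
  · rw [e0]; simp [hA]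
  · rw [e1]; simp [hA]
  · rw [e2]; simp [hA]
  · rw [e3]; simp [hA]

/-! ## The distinguished lattice -/

/-- The left-moving parts of a basis of the distinguished lattice, times `√2`. -/
def baseL : Fin 4 ⊕ Fin 4 → Fin 4 → ℤ :=
  Sum.elim ![![1, -1, 0, 0], ![0, 1, -1, 0], ![0, 0, 1, -1], ![0, 0, 1, 1]]
    ![![1, 0, -1, 0], ![1, 1, 0, 0], ![1, 0, 0, -1], ![1, 0, 1, 0]]

/-- The right-moving parts of a basis of the distinguished lattice, times `√2`. -/
def baseR : Fin 4 ⊕ Fin 4 → Fin 4 → ℤ :=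
  Sum.elim ![![1, -1, 0, 0], ![0, 1, -1, 0], ![0, 0, 1, -1], ![0, 0, 1, 1]]
    ![![-1, 0, -1, 0], ![-1, -1, 0, 0], ![0, -1, -1, 0], ![0, -1, 0, -1]]

/-- Twice the matrix of the distinguished point of the moduli space. -/
def baseInt : Matrix (Fin 4 ⊕ Fin 4) (Fin 4 ⊕ Fin 4) ℤ := Matrix.of fun i j =>
  i.elim (fun i => j.elim (fun j => baseL (.inl j) i + baseL (.inr j) i)
    fun j => baseL (.inl j) i - baseL (.inr j) i)
    fun i => j.elim (fun j => baseR (.inl j) i + baseR (.inr j) i)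
    fun j => baseR (.inl j) i - baseR (.inr j) i

lemma base_isSOPlus : IsSOPlus ((1 / 2 : ℝ) • baseInt.map (Int.cast : ℤ → ℝ)) := by
  have hdet : ∀ M : Matrix (Fin 4) (Fin 4) ℤ, 0 < M.det →
      0 < ((1 / 2 : ℝ) • M.map (Int.cast : ℤ → ℝ)).det := fun M hM => by
    have := Int.cast_det (R := ℝ) M
    rw [Matrix.det_smul, ← this]
    have : (0 : ℝ) < (M.det : ℤ) := mod_cast hM
    positivity
  refine ⟨?_, hdet baseInt.toBlocks₁₁ (by decide +kernel),
    hdet baseInt.toBlocks₂₂ (by decide +kernel)⟩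
  have h : baseIntᵀ * fromBlocks 1 0 0 (-1) * baseInt =
      (4 : ℤ) • fromBlocks 1 0 0 (-1) := by decide +kernel
  have := congrArg (fun M => M.map (Int.castRingHom ℝ)) h
  rw [Matrix.map_mul, Matrix.map_mul, Matrix.transpose_map, Int.coe_castRingHom] at this
  have e : (fromBlocks (1 : Matrix (Fin 4) (Fin 4) ℤ) 0 0
      (-1 : Matrix (Fin 4) (Fin 4) ℤ)).map (Int.cast : ℤ → ℝ) = eta44 := by
    rw [Matrix.fromBlocks_map, eta44_eq]
    congr 1 <;> ext i j <;> simp [Matrix.one_apply]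
  rw [Matrix.transpose_smul, Matrix.smul_mul, Matrix.smul_mul, Matrix.mul_smul, ← e, this]
  ext i j
  simp only [Matrix.smul_apply, Matrix.map_apply, smul_eq_mul, Int.cast_mul, Int.cast_ofNat]
  ring

/-- The distinguished point of the moduli space. -/
def basePoint : SOPlus44 :=
  ⟨⟨(1 / 2 : ℝ) • baseInt.map (Int.cast : ℤ → ℝ), _, mul_eq_one_comm.1 (show
    eta44 * ((1 / 2 : ℝ) • baseInt.map (Int.cast : ℤ → ℝ))ᵀ * eta44 * _ = 1 by
      rw [Matrix.mul_assoc, Matrix.mul_assoc, ← Matrix.mul_assoc _ eta44, base_isSOPlus.1,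
        eta44_mul_self]), by
      rw [Matrix.mul_assoc, Matrix.mul_assoc, ← Matrix.mul_assoc _ eta44, base_isSOPlus.1,
        eta44_mul_self]⟩, base_isSOPlus⟩

lemma windingBasis_basePoint (j : Fin 4 ⊕ Fin 4) : windingBasis basePoint j =
    (√2)⁻¹ • Sum.elim (fun i => (baseL j i : ℝ)) (fun i => (baseR j i : ℝ)) := by
  show ((1 / 2 : ℝ) • baseInt.map (Int.cast : ℤ → ℝ)) *ᵥ _ = _
  rcases j with j | j <;> rw [narainBasis, Matrix.mulVec_smul] <;> congr 1 <;> ext (i | i) <;>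
    simp [mulVec, dotProduct, sum_sum_type, Pi.single_apply, baseInt] <;> ring

/-! ## The symmetry group of the distinguished lattice -/

lemma form44_quatPair (x y : ℍ[ℝ] × ℍ[ℝ]) :
    form44 (quatPair x) (quatPair y) = (x.1 * star y.1).re - (x.2 * star y.2).re := by
  rw [← quatCoord_dotProduct, ← quatCoord_dotProduct, form44_eq]
  rfl

lemma re_mul_mul_star (u x y : ℍ[ℝ]) : (u * x * star (u * y)).re = normSq u * (x * star y).re := by
  simp [normSq_def']
  ring

lemma form44_su2Act (g : SU2 × SU2) (x y : R44) :
    form44 (su2Act g x) (su2Act g y) = form44 x y := by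
  obtain ⟨u, hu⟩ := su2Equiv.surjective g.1
  obtain ⟨v, hv⟩ := su2Equiv.surjective g.2
  obtain rfl : (su2Equiv u, su2Equiv v) = g := pext hu hv
  obtain ⟨x, rfl⟩ := quatPair.surjective x
  obtain ⟨y, rfl⟩ := quatPair.surjective y
  rw [su2Act_quatPair, su2Act_quatPair, form44_quatPair, form44_quatPair]
  simp only [Prod.fst_mul, Prod.snd_mul, re_mul_mul_star, normSq_of_mem_unitary, one_mul]

lemma exists_su2Act_eq (g : SU2 × SU2) : ∃ L : R44 →ₗ[ℝ] R44, ∀ x, su2Act g x = L x := by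
  obtain ⟨u, hu⟩ := su2Equiv.surjective g.1
  obtain ⟨v, hv⟩ := su2Equiv.surjective g.2
  obtain rfl : (su2Equiv u, su2Equiv v) = g := pext hu hv
  refine ⟨quatPair.toLinearMap ∘ₗ LinearMap.mulLeft ℝ ((u, v) : ℍ[ℝ] × ℍ[ℝ]) ∘ₗ
    quatPair.symm.toLinearMap, fun x => ?_⟩
  obtain ⟨x, rfl⟩ := quatPair.surjective x
  rw [su2Act_quatPair]
  simp

lemma mem_G0_iff_form (h : SOPlus44) (g : SU2 × SU2) :
    g ∈ G0 h ↔ ∀ j k, ∃ n : ℤ, form44 (su2Act g (windingBasis h j)) (windingBasis h k) = n := by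
  constructor
  · intro hg j k
    exact (mem_windingLattice_iff h _).1 ((hg _).2 (subset_span ⟨j, rfl⟩)) k
  · intro hg
    obtain ⟨L, hL⟩ := exists_su2Act_eq g
    have hsub : windingLattice h ≤ (windingLattice h).comap (L.restrictScalars ℤ) := by
      refine Submodule.span_le.2 ?_
      rintro _ ⟨j, rfl⟩
      refine (mem_windingLattice_iff h _).2 fun k => ?_
      have := hg j k
      rwa [hL] at this
    replace hsub : ∀ x ∈ windingLattice h, su2Act g x ∈ windingLattice h := fun x hx => by
      rw [hL]
      exact hsub hx
    exact fun x => ⟨fun hx => (windingLattice_dual h x).2 fun y hy => by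
      rw [← form44_su2Act g]
      exact (windingLattice_dual h _).1 hx _ (hsub y hy), hsub x⟩

/-- The quaternion with given integral coordinates. -/
@[simps] def intQuat (a : Fin 4 → ℤ) : ℍ[ℝ] := ⟨a 0, a 1, a 2, a 3⟩

lemma windingBasis_basePoint_eq (j : Fin 4 ⊕ Fin 4) : windingBasis basePoint j =
    quatPair ((√2)⁻¹ • (intQuat (baseL j), intQuat (baseR j))) := by
  rw [windingBasis_basePoint, map_smul, quatPair_apply]
  congr 2 <;> ext i <;> fin_cases i <;> rfl

/-- Four times the pairing of a translate of a left- or right-moving part of a basis vector. -/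
def quatDot (s a b : Fin 4 → ℤ) : ℤ :=
  (s 0 * a 0 - s 1 * a 1 - s 2 * a 2 - s 3 * a 3) * b 0 +
  (s 0 * a 1 + s 1 * a 0 + s 2 * a 3 - s 3 * a 2) * b 1 +
  (s 0 * a 2 - s 1 * a 3 + s 2 * a 0 + s 3 * a 1) * b 2 +
  (s 0 * a 3 + s 1 * a 2 - s 2 * a 1 + s 3 * a 0) * b 3

lemma chi3_eq_iff : ∀ A B : T24, chi3 A = chi3 B ↔ ∀ j k : Fin 4 ⊕ Fin 4,
    (4 : ℤ) ∣ quatDot (hurwitzUnit A) (baseL j) (baseL k) -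
      quatDot (hurwitzUnit B) (baseR j) (baseR k) := by
  decide +kernel

lemma form44_su2Act_base (A B : T24) (j k : Fin 4 ⊕ Fin 4) :
    form44 (su2Act (su2Equiv (t24Hom A), su2Equiv (t24Hom B)) (windingBasis basePoint j))
      (windingBasis basePoint k) = ((quatDot (hurwitzUnit A) (baseL j) (baseL k) -
        quatDot (hurwitzUnit B) (baseR j) (baseR k) : ℤ) : ℝ) / 4 := by
  have h2 := inv_sqrt_two_sq
  rw [windingBasis_basePoint_eq, windingBasis_basePoint_eq, su2Act_quatPair, form44_quatPair]
  show ((hurwitzQuat A * _) * _).re - ((hurwitzQuat B * _) * _).re = _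
  generalize (√2)⁻¹ = c at h2 ⊢
  generalize hR : ((_ : ℤ) : ℝ) / 4 = R
  refine Eq.trans (b := c * c * (2 * R)) ?_ (by rw [h2]; ring)
  rw [← hR]
  simp [quatDot]
  ring

lemma nonempty_G0_basePoint : Nonempty (G0 basePoint ≃* T24FibreT24) := by
  have hmem : ∀ A B : T24, (su2Equiv (t24Hom A), su2Equiv (t24Hom B)) ∈ G0 basePoint ↔
      (A, B) ∈ T24FibreT24 := fun A B => by
    rw [mem_G0_iff_form]
    refine Iff.trans ?_ ((chi3_eq_iff A B).symm.trans (abelianization_eq_iff A B).symm)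
    refine forall_congr' fun j => forall_congr' fun k => ?_
    rw [form44_su2Act_base]
    constructor
    · rintro ⟨n, hn⟩
      refine ⟨n, ?_⟩
      rw [div_eq_iff four_ne_zero] at hn
      rw [mul_comm]
      exact_mod_cast hn
    · rintro ⟨n, hn⟩
      exact ⟨n, by rw [hn]; push_cast; ring⟩
  let f : T24 × T24 →* SU2 × SU2 :=
    (su2Equiv.toMonoidHom.comp t24Hom).prodMap (su2Equiv.toMonoidHom.comp t24Hom)
  have hf : ∀ A B, f (A, B) = (su2Equiv (t24Hom A), su2Equiv (t24Hom B)) := fun _ _ => rfl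
  have hinj : Injective f := by
    rintro ⟨A, B⟩ ⟨C, D⟩ h
    rw [hf, hf, Prod.mk.injEq] at h
    exact pext (t24Hom_injective (su2Equiv.injective h.1))
      (t24Hom_injective (su2Equiv.injective h.2))
  have himg : T24FibreT24.map f = G0 basePoint := by
    ext g
    obtain ⟨u, hu⟩ := su2Equiv.surjective g.1
    obtain ⟨v, hv⟩ := su2Equiv.surjective g.2
    obtain rfl : (su2Equiv u, su2Equiv v) = g := pext hu hv
    constructor
    · rintro ⟨⟨A, B⟩, hAB, h⟩
      rw [← h, hf]
      exact (hmem A B).2 hAB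
    · intro h
      have key : ∀ (x : ℍ[ℝ] × ℍ[ℝ]), (∀ j, ∃ n : ℤ, form44 (quatPair x) (windingBasis basePoint j) = n)
          → ∀ j, ∃ n : ℤ, form44 (quatPair (((u, v) : ℍ[ℝ] × ℍ[ℝ]) * x)) (windingBasis basePoint j) = n
          := fun x hx => (mem_windingLattice_iff _ _).1
            ((mem_G0_iff.1 h x).2 ((mem_windingLattice_iff _ _).2 hx))
      have k1 := key (((√2 : ℝ) : ℍ[ℝ]), 0) fun j => ⟨baseL j 0, by
        rw [form44_eq, windingBasis_basePoint]
        simp [quatPair_apply, quatCoord_apply, sum_univ_four, ← mul_assoc]⟩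
      have k2 := key (0, ((√2 : ℝ) : ℍ[ℝ])) fun j => ⟨-baseR j 0, by
        rw [form44_eq, windingBasis_basePoint]
        simp [quatPair_apply, quatCoord_apply, sum_univ_four, ← mul_assoc]⟩
      simp only [form44_eq, windingBasis_basePoint] at k1 k2
      choose m hm using fun i => k1 (.inl i)
      choose n hn using fun i => k2 (.inl i)
      have a0 := hm 0
      have a1 := hm 1
      have a2 := hm 2
      have a3 := hm 3
      have b0 := hn 0
      have b1 := hn 1
      have b2 := hn 2
      have b3 := hn 3
      simp [quatPair_apply, quatCoord_apply, sum_univ_four, baseL, baseR] at a0 a1 a2 a3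
      simp [quatPair_apply, quatCoord_apply, sum_univ_four, baseL, baseR] at b0 b1 b2 b3
      obtain ⟨A, rfl⟩ := exists_t24Hom (u := u) (p := m 0) (q := m 1) (r := m 2) (s := m 3)
        (by linarith) (by linarith) (by linarith) (by linarith)
      obtain ⟨B, rfl⟩ := exists_t24Hom (u := v) (p := -n 0) (q := -n 1) (r := -n 2) (s := -n 3)
        (by push_cast; linarith) (by push_cast; linarith) (by push_cast; linarith)
        (by push_cast; linarith)
      exact ⟨(A, B), (hmem A B).1 h, rfl⟩
  exact ⟨((T24FibreT24.equivMapOfInjective f hinj).trans (MulEquiv.subgroupCongr himg)).symm⟩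

/-! ## The isometry with the `E_8` lattice -/

/-- `(x; y) ↦ ((x + y)/√2; (x - y)/√2)`. -/
def sumDiff : R44 →ₗ[ℝ] R44 where
  toFun x := Sum.elim (fun i => (√2)⁻¹ * (x (.inl i) + x (.inr i)))
    (fun i => (√2)⁻¹ * (x (.inl i) - x (.inr i)))
  map_add' x y := by ext (i | i) <;> simp <;> ring
  map_smul' c x := by ext (i | i) <;> simp <;> ring

lemma sumDiff_sumDiff (x : R44) : sumDiff (sumDiff x) = x := by
  have h2 := inv_sqrt_two_sq
  ext (i | i) <;> simp only [sumDiff, LinearMap.coe_mk, AddHom.coe_mk, Sum.elim_inl, Sum.elim_inr]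
  · linear_combination (2 * x (.inl i)) * h2
  · linear_combination (2 * x (.inr i)) * h2

/-- The isometry of the distinguished lattice with the `E_8` lattice. -/
def e8Isometry : R44 ≃ₗ[ℝ] (Fin 8 → ℝ) :=
  (LinearEquiv.ofInvolutive sumDiff sumDiff_sumDiff).trans
    (funCongrLeft ℝ ℝ (finSumFinEquiv (m := 4) (n := 4)).symm)

lemma e8Isometry_sq (x : R44) : ∑ i, e8Isometry x i ^ 2 = ∑ i, x i ^ 2 := by
  have h2 := inv_sqrt_two_sq
  refine ((finSumFinEquiv (m := 4) (n := 4)).symm.sum_comp fun i => sumDiff x i ^ 2).trans ?_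
  rw [sum_sum_type, sum_sum_type, ← sum_add_distrib, ← sum_add_distrib]
  refine sum_congr rfl fun i _ => ?_
  simp only [sumDiff, LinearMap.coe_mk, AddHom.coe_mk, Sum.elim_inl, Sum.elim_inr]
  linear_combination (2 * (x (.inl i) ^ 2 + x (.inr i) ^ 2)) * h2

lemma base_e8Double_dvd : ∀ (j : Fin 4 ⊕ Fin 4) (i : Fin 8), (4 : ℤ) ∣
    ∑ k, ((finSumFinEquiv (m := 4) (n := 4)).symm k).elim (fun i => baseL j i + baseR j i)
      (fun i => baseL j i - baseR j i) * e8DoubleInv k i := by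
  decide +kernel

lemma e8Double_base_dvd : ∀ (j : Fin 8) (k : Fin 4 ⊕ Fin 4), (4 : ℤ) ∣
    ∑ i : Fin 4, ((e8Double j (castAdd 4 i) + e8Double j (natAdd 4 i)) * baseL k i -
      (e8Double j (castAdd 4 i) - e8Double j (natAdd 4 i)) * baseR k i) := by
  decide +kernel

lemma e8Isometry_mem (x : R44) : e8Isometry x ∈ e8Lattice ↔ x ∈ windingLattice basePoint := by
  have h2 := inv_sqrt_two_sq
  constructor
  · intro hx
    have hle : e8Lattice ≤ (windingLattice basePoint).comap
        (e8Isometry.symm.toLinearMap.restrictScalars ℤ) := by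
      refine Submodule.span_le.2 ?_
      rintro _ ⟨j, rfl⟩
      refine (mem_windingLattice_iff _ _).2 fun k => ?_
      obtain ⟨n, hn⟩ := e8Double_base_dvd j k
      refine ⟨n, ?_⟩
      have e : (n : ℝ) = (∑ i : Fin 4, ((e8Double j (castAdd 4 i) + e8Double j (natAdd 4 i)) *
        baseL k i - (e8Double j (castAdd 4 i) - e8Double j (natAdd 4 i)) * baseR k i) : ℤ) / 4 := by
        rw [hn]
        push_cast
        ring
      rw [e, form44_eq, windingBasis_basePoint, ← sum_sub_distrib]
      push_cast
      rw [sum_div]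
      refine sum_congr rfl fun i _ => ?_
      show ((√2)⁻¹ * (e8Root j (castAdd 4 i) + e8Root j (natAdd 4 i))) * ((√2)⁻¹ * _) -
        ((√2)⁻¹ * (e8Root j (castAdd 4 i) - e8Root j (natAdd 4 i))) * ((√2)⁻¹ * _) = _
      rw [e8Root_eq]
      simp only [Matrix.smul_apply, Matrix.map_apply, smul_eq_mul, Sum.elim_inl, Sum.elim_inr]
      generalize (√2)⁻¹ = c at h2
      linear_combination (1 / 2 * ((e8Double j (castAdd 4 i) + e8Double j (natAdd 4 i)) *
        baseL k i - (e8Double j (castAdd 4 i) - e8Double j (natAdd 4 i)) * baseR k i)) * h2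
    have := hle hx
    simpa using this
  · intro hx
    have hle : windingLattice basePoint ≤ e8Lattice.comap
        (e8Isometry.toLinearMap.restrictScalars ℤ) := by
      refine Submodule.span_le.2 ?_
      rintro _ ⟨j, rfl⟩
      refine (mem_e8Lattice _).2 ?_
      choose n hn using base_e8Double_dvd j
      refine ⟨n, ?_⟩
      rw [e8Input_momentum]
      have e : (fun i => (n i : ℝ)) = e8Isometry (windingBasis basePoint j) ᵥ*
          ((1 / 2 : ℝ) • e8DoubleInv.map (Int.cast : ℤ → ℝ)) := by
        ext i
        have h4 : (n i : ℝ) = (∑ k, ((finSumFinEquiv (m := 4) (n := 4)).symm k).elim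
          (fun i => baseL j i + baseR j i) (fun i => baseL j i - baseR j i) * e8DoubleInv k i : ℤ) / 4 := by
          rw [hn]
          push_cast
          ring
        rw [h4]
        push_cast
        rw [sum_div]
        show _ = ∑ k, e8Isometry (windingBasis basePoint j) k *
          ((1 / 2 : ℝ) • e8DoubleInv.map (Int.cast : ℤ → ℝ)) k i
        refine sum_congr rfl fun k _ => ?_
        simp only [Matrix.smul_apply, Matrix.map_apply, smul_eq_mul]
        have hk : e8Isometry (windingBasis basePoint j) k =
            (((finSumFinEquiv (m := 4) (n := 4)).symm k).elim (fun i => baseL j i + baseR j i)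
              (fun i => baseL j i - baseR j i) : ℤ) / 2 := by
          show sumDiff (windingBasis basePoint j) ((finSumFinEquiv (m := 4) (n := 4)).symm k) = _
          rw [windingBasis_basePoint]
          generalize (finSumFinEquiv (m := 4) (n := 4)).symm k = k'
          rcases k' with i | i <;> simp [sumDiff]
          · linear_combination (baseL j i + baseR j i : ℝ) * h2
          · linear_combination (baseL j i - baseR j i : ℝ) * h2
        rw [hk]
        ring
      rw [e, Matrix.vecMul_vecMul, mul_eq_one_comm.1 e8Root_mul_inv, vecMul_one]
      rfl
    exact hle hx

lemma exists_e8_isometry {h : SOPlus44} (hh : moduliPoint h = moduliPoint basePoint) :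
    ∃ f : R44 ≃ₗ[ℝ] (Fin 8 → ℝ), (∀ x, ∑ i, f x i ^ 2 = ∑ i, x i ^ 2) ∧
      ∀ x, f x ∈ e8Lattice ↔ x ∈ windingLattice h := by
  obtain ⟨p, hp, hmem⟩ := exists_of_moduliPoint_eq hh.symm
  obtain ⟨φ, ψ, a, b, ha, hb, hx⟩ := exists_quatRot_of_mem hp
  let P : R44 ≃ₗ[ℝ] R44 := LinearEquiv.ofLinearMap (mulVecLin p.1.val) (mulVecLin (p⁻¹).1.val)
    (lext fun x => mulVec_inv_mulVec p x) (lext fun x => by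
      simp [])
  have hP : ∀ x, P x = p.1.val *ᵥ x := fun x => rfl
  refine ⟨P.trans e8Isometry, fun x => ?_, fun x => ?_⟩
  · rw [LinearEquiv.trans_apply, e8Isometry_sq, hP]
    obtain ⟨x, rfl⟩ := quatPair.surjective x
    have e : ∀ y : ℍ[ℝ] × ℍ[ℝ], ∑ i, quatPair y i ^ 2 =
        normSq y.1 + normSq y.2 := fun y => by
      rw [sum_sum_type, normSq_def, normSq_def, ← quatCoord_dotProduct, ← quatCoord_dotProduct]
      simp only [sq]
      rfl
    rw [hx, e, e, map_mul, map_mul, quatAut_normSq, quatAut_normSq, ha, hb, mul_one, mul_one]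
  · rw [LinearEquiv.trans_apply, e8Isometry_mem, hP, hmem]

/-! ## Lattices over the Hurwitz order -/

/-- The Hurwitz quaternion `a + b i + c j + d (1 + i + j + k) / 2`. -/
def hurwitz (a b c d : ℤ) : ℍ[ℝ] := ⟨a + d / 2, b + d / 2, c + d / 2, d / 2⟩

section
variable (a b c d : ℤ)
@[simp] lemma hurwitz_re : (hurwitz a b c d).re = a + d / 2 := rfl
@[simp] lemma hurwitz_imI : (hurwitz a b c d).imI = b + d / 2 := rfl
@[simp] lemma hurwitz_imJ : (hurwitz a b c d).imJ = c + d / 2 := rfl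
@[simp] lemma hurwitz_imK : (hurwitz a b c d).imK = d / 2 := rfl
end

lemma exists_hurwitz_near (y : ℍ[ℝ]) : ∃ a b c d, normSq (y - hurwitz a b c d) < 1 := by
  set d := round (2 * y.imK) with hd
  refine ⟨round (y.re - d / 2), round (y.imI - d / 2), round (y.imJ - d / 2), d, ?_⟩
  have h0 := abs_le.1 (abs_sub_round (2 * y.imK))
  have h1 := abs_le.1 (abs_sub_round (y.re - d / 2))
  have h2 := abs_le.1 (abs_sub_round (y.imI - d / 2))
  have h3 := abs_le.1 (abs_sub_round (y.imJ - d / 2))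
  rw [← hd] at h0
  simp only [normSq_def', Quaternion.re_sub, Quaternion.imI_sub, Quaternion.imJ_sub,
    Quaternion.imK_sub, hurwitz_re, hurwitz_imI, hurwitz_imJ, hurwitz_imK]
  nlinarith

lemma hurwitz_mul_mem {Γ : AddSubgroup ℍ[ℝ]} (hi : ∀ x ∈ Γ, qI * x ∈ Γ) (hj : ∀ x ∈ Γ, qJ * x ∈ Γ)
    (ht : ∀ x ∈ Γ, hurwitz 0 0 0 1 * x ∈ Γ) (a b c d : ℤ) {x : ℍ[ℝ]} (hx : x ∈ Γ) :
    hurwitz a b c d * x ∈ Γ := by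
  have e : hurwitz a b c d * x =
      a • x + b • (qI * x) + c • (qJ * x) + d • (hurwitz 0 0 0 1 * x) := by
    ext <;> simp <;> ring
  rw [e]
  exact add_mem (add_mem (add_mem (zsmul_mem hx a) (zsmul_mem (hi x hx) b))
    (zsmul_mem (hj x hx) c)) (zsmul_mem (ht x hx) d)

lemma exists_hurwitz_decomp (a b c d : ℤ) : ∃ a' b' c' d' a'' d'',
    hurwitz a b c d = hurwitz a'' 0 0 d'' + hurwitz 1 1 0 0 * hurwitz a' b' c' d' ∧
      (hurwitz a'' 0 0 d'' = 0 ∨ normSq (hurwitz a'' 0 0 d'') = 1) := by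
  have key : ∀ s ε δ e : ℤ, a + b + c = 2 * s + ε → d = 2 * e + δ → ∃ a' b' c' d',
      hurwitz a b c d = hurwitz ε 0 0 δ + hurwitz 1 1 0 0 * hurwitz a' b' c' d' := by
    intro s ε δ e h1 h2
    refine ⟨s + e, b + c - s, c + e, -c, ?_⟩
    obtain rfl : a = 2 * s + ε - b - c := by omega
    subst h2
    ext <;> simp <;> ring
  obtain ⟨s, hs⟩ := Int.even_or_odd' (a + b + c)
  obtain ⟨e, he⟩ := Int.even_or_odd' d
  rcases hs with hs | hs <;> rcases he with he | he
  · obtain ⟨a', b', c', d', h⟩ := key s 0 0 e (by omega) (by omega)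
    exact ⟨a', b', c', d', 0, 0, h, .inl (by ext <;> simp)⟩
  · obtain ⟨a', b', c', d', h⟩ := key s 0 1 e (by omega) (by omega)
    exact ⟨a', b', c', d', 0, 1, h, .inr (by norm_num [normSq_def'])⟩
  · obtain ⟨a', b', c', d', h⟩ := key s 1 0 e (by omega) (by omega)
    exact ⟨a', b', c', d', 1, 0, h, .inr (by norm_num [normSq_def'])⟩
  · obtain ⟨a', b', c', d', h⟩ := key (s + 1) (-1) 1 e (by omega) (by omega)
    exact ⟨a', b', c', d', -1, 1, h, .inr (by norm_num [normSq_def'])⟩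

/-- An even unimodular lattice in `ℍ ⊕ ℍ` that is stable under the quaternion group on either side
and under the diagonal Hurwitz units. -/
structure IsHurwitzGlue (M : AddSubgroup (ℍ[ℝ] × ℍ[ℝ])) : Prop where
  dual : ∀ p, p ∈ M ↔ ∀ q ∈ M, ∃ n : ℤ, (p.1 * star q.1).re - (p.2 * star q.2).re = n
  even : ∀ p ∈ M, ∃ n : ℤ, normSq p.1 - normSq p.2 = 2 * n
  left : ∀ p ∈ M, (qI * p.1, p.2) ∈ M ∧ (qJ * p.1, p.2) ∈ M
  right : ∀ p ∈ M, (p.1, qI * p.2) ∈ M ∧ (p.1, qJ * p.2) ∈ M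
  diag : ∀ p ∈ M, (hurwitz 0 0 0 1 * p.1, hurwitz 0 0 0 1 * p.2) ∈ M

namespace IsHurwitzGlue

variable {M : AddSubgroup (ℍ[ℝ] × ℍ[ℝ])}

lemma swap (hM : IsHurwitzGlue M) :
    IsHurwitzGlue (M.comap (AddEquiv.prodComm : ℍ[ℝ] × ℍ[ℝ] ≃+ _).toAddMonoidHom) where
  dual p := (hM.dual p.swap).trans ⟨fun h q hq => (h _ hq).imp' (-·) fun n hn => by
      push_cast; rw [← hn]; simp, fun h q hq => (h q.swap hq).imp' (-·) fun n hn => by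
      push_cast; rw [← hn]; simp⟩
  even p hp := (hM.even _ hp).imp' (-·) fun n hn => by push_cast; rw [mul_neg, ← hn]; simp
  left p hp := hM.right _ hp
  right p hp := hM.left _ hp
  diag p hp := hM.diag _ hp

lemma hurwitz_mul_mem_left (hM : IsHurwitzGlue M) (a b c d : ℤ) {x : ℍ[ℝ]} (hx : (x, 0) ∈ M) :
    (hurwitz a b c d * x, 0) ∈ M := by
  refine hurwitz_mul_mem (Γ := M.comap (AddMonoidHom.inl ℍ[ℝ] ℍ[ℝ])) (fun x hx => (hM.left _ hx).1)
    (fun x hx => (hM.left _ hx).2) (fun x hx => ?_) a b c d hx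
  simpa using hM.diag _ hx

lemma exists_left (hM : IsHurwitzGlue M) : ∃ a, normSq a = 2 ∧ (a, 0) ∈ M ∧
    (∀ x, (x, 0) ∈ M → ∃ k l m n, x = hurwitz k l m n * a) ∧
    ∀ p ∈ M, ∃ k l m n, p.1 = hurwitz 1 1 0 0 * ((1 / 2 : ℝ) • (hurwitz k l m n * a)) := by
  classical
  have hI : ∀ p ∈ M, (hurwitz 1 (-1) 0 0 * p.1, 0) ∈ M := fun p hp => by
    convert sub_mem hp (hM.left p hp).1 using 1
    ext <;> simp <;> ring
  have hex : ∃ N : ℕ, ∃ a, (a, 0) ∈ M ∧ a ≠ 0 ∧ normSq a = N := by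
    by_contra! hno
    have h0 : ∀ p ∈ M, p.1 = 0 := fun p hp => by
      by_contra hne
      obtain ⟨n, hn⟩ := hM.even _ (hI p hp)
      rw [map_zero, sub_zero] at hn
      refine hno (2 * n).toNat _ (hI p hp) (fun h => hne ?_) ?_
      · refine (mul_eq_zero.1 h).resolve_left fun h => ?_
        simpa using congrArg QuaternionAlgebra.re h
      · have : (0 : ℤ) ≤ 2 * n := by exact_mod_cast hn ▸ normSq_nonneg
        rw [hn, ← Int.cast_natCast (R := ℝ), Int.toNat_of_nonneg this]
        push_cast
        rfl
    have := h0 (1, 0) ((hM.dual _).2 fun q hq => ⟨0, by simp [h0 q hq]⟩)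
    exact one_ne_zero this
  obtain ⟨a, ha, hane, hN⟩ := Nat.find_spec hex
  have hmin : ∀ x, (x, 0) ∈ M → x ≠ 0 → normSq a ≤ normSq x := by
    intro x hx hne
    obtain ⟨n, hn⟩ := hM.even _ hx
    rw [map_zero, sub_zero] at hn
    simp only at hn
    have h0 : (0 : ℤ) ≤ 2 * n := by exact_mod_cast hn ▸ normSq_nonneg
    have e : normSq x = ((2 * n).toNat : ℕ) := by
      rw [hn, ← Int.cast_natCast (R := ℝ), Int.toNat_of_nonneg h0]
      push_cast
      rfl
    rw [hN, e]
    exact_mod_cast Nat.find_min' hex ⟨x, hx, hne, e⟩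
  have hpos : 0 < normSq a :=
    lt_of_le_of_ne normSq_nonneg fun h => hane (Quaternion.normSq_eq_zero.1 h.symm)
  have hgen : ∀ x, (x, 0) ∈ M → ∃ k l m n, x = hurwitz k l m n * a := by
    intro x hx
    obtain ⟨k, l, m, n, hlt⟩ := exists_hurwitz_near (x * a⁻¹)
    refine ⟨k, l, m, n, ?_⟩
    by_contra hne
    have hmem : (x - hurwitz k l m n * a, 0) ∈ M := by
      simpa using sub_mem hx (hM.hurwitz_mul_mem_left k l m n ha)
    have h1 := hmin _ hmem (sub_ne_zero.2 hne)
    have e : x - hurwitz k l m n * a = (x * a⁻¹ - hurwitz k l m n) * a := by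
      rw [sub_mul, inv_mul_cancel_right₀ hane]
    rw [e, map_mul] at h1
    nlinarith
  have hhalf : ∀ p ∈ M, ∃ k l m n, p.1 = hurwitz 1 1 0 0 * ((1 / 2 : ℝ) • (hurwitz k l m n * a)) := by
    intro p hp
    obtain ⟨k, l, m, n, e⟩ := hgen _ (hI p hp)
    refine ⟨k, l, m, n, ?_⟩
    rw [← e]
    ext <;> simp <;> ring
  refine ⟨a, ?_, ha, hgen, hhalf⟩
  have hmem : ((2 / normSq a) • a, (0 : ℍ[ℝ])) ∈ M := by
    refine (hM.dual _).2 fun q hq => ?_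
    obtain ⟨k, l, m, n, e⟩ := hhalf q hq
    refine ⟨k - l, ?_⟩
    have e2 : a * star q.1 = (normSq a / 2) •
        (star (hurwitz k l m n) * hurwitz 1 (-1) 0 0) := by
      rw [e, star_mul, Quaternion.star_smul, star_mul, smul_mul_assoc, mul_smul_comm,
        ← mul_assoc, ← mul_assoc, self_mul_star, Quaternion.coe_mul_eq_smul,
        smul_mul_assoc, smul_smul]
      congr 1
      · ring
      · congr 1
        ext <;> simp
    rw [smul_mul_assoc, e2, smul_smul, div_mul_div_cancel₀ hpos.ne', div_self two_ne_zero]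
    simp
  have h1 := hmin _ hmem (by simp [hane])
  rw [normSq_smul, div_pow, sq (normSq a), div_mul_eq_mul_div,
    mul_div_mul_right _ _ hpos.ne', le_div_iff₀ hpos] at h1
  obtain ⟨n, hn⟩ := hM.even _ ha
  rw [map_zero, sub_zero] at hn
  simp only at hn
  rw [hn] at h1 hpos ⊢
  norm_cast at h1 hpos ⊢
  obtain hlt | rfl | hlt := lt_trichotomy n 1
  · omega
  · rfl
  · push_cast at h1
    nlinarith

lemma exists_glue_left (hM : IsHurwitzGlue M) {p : ℍ[ℝ] × ℍ[ℝ]} (hp : p ∈ M)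
    (hpn : (p.1, 0) ∉ M) : ∃ a, normSq a = 2 ∧ (a, 0) ∈ M ∧
      (p.1 - hurwitz 1 1 0 0 * ((1 / 2 : ℝ) • a), 0) ∈ M := by
  obtain ⟨a, ha, ham, -, h⟩ := hM.exists_left
  obtain ⟨k, l, m, n, e⟩ := h p hp
  obtain ⟨k', l', m', n', k'', n'', e', hu⟩ := exists_hurwitz_decomp k l m n
  have e2 : p.1 = hurwitz 1 1 0 0 * ((1 / 2 : ℝ) • (hurwitz k'' 0 0 n'' * a)) +
      hurwitz 0 1 0 0 * (hurwitz k' l' m' n' * a) := by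
    have : hurwitz 1 1 0 0 * hurwitz 1 1 0 0 = (2 : ℝ) • hurwitz 0 1 0 0 := by
      ext <;> simp <;> norm_num
    rw [e, e', add_mul, smul_add, mul_add]
    congr 1
    rw [mul_smul_comm, mul_assoc, ← mul_assoc, this, smul_mul_assoc, smul_smul]
    norm_num
  have hm := hM.hurwitz_mul_mem_left 0 1 0 0 (hM.hurwitz_mul_mem_left k' l' m' n' ham)
  rcases hu with hu | hu
  · simp_all []
  · refine ⟨hurwitz k'' 0 0 n'' * a, by rw [map_mul, hu, ha, one_mul],
      hM.hurwitz_mul_mem_left _ _ _ _ ham, ?_⟩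
    rwa [e2, add_sub_cancel_left]

lemma exists_notMem (hM : IsHurwitzGlue M) : ∃ p ∈ M, (p.1, 0) ∉ M := by
  by_contra! hno
  obtain ⟨a, ha, ham, h, -⟩ := hM.exists_left
  have hmem : (hurwitz 1 1 0 0 * ((1 / 2 : ℝ) • a), (0 : ℍ[ℝ])) ∈ M := by
    refine (hM.dual _).2 fun q hq => ?_
    obtain ⟨k, l, m, n, e⟩ := h _ (hno q hq)
    refine ⟨k + l + n, ?_⟩
    have e2 : hurwitz 1 1 0 0 * ((1 / 2 : ℝ) • a) * star q.1 =
        hurwitz 1 1 0 0 * star (hurwitz k l m n) := by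
      rw [e, star_mul, mul_assoc, smul_mul_assoc, ← mul_assoc a, self_mul_star, ha,
        Quaternion.coe_mul_eq_smul, smul_smul, one_div_mul_cancel two_ne_zero, one_smul]
    rw [e2]
    simp
    ring
  obtain ⟨n, hn⟩ := hM.even _ hmem
  simp only [map_mul, normSq_smul, ha, map_zero, sub_zero] at hn
  norm_num [normSq_def'] at hn
  norm_cast at hn
  omega

lemma exists_generators (hM : IsHurwitzGlue M) : ∃ a b, normSq a = 2 ∧
    normSq b = 2 ∧ (a, 0) ∈ M ∧ (0, b) ∈ M ∧
      (hurwitz 1 1 0 0 * ((1 / 2 : ℝ) • a), hurwitz 1 1 0 0 * ((1 / 2 : ℝ) • b)) ∈ M := by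
  obtain ⟨p, hp, hpn⟩ := hM.exists_notMem
  obtain ⟨a, ha, ham, h1⟩ := hM.exists_glue_left hp hpn
  obtain ⟨b, hb, hbm, h2⟩ := hM.swap.exists_glue_left (p := p.swap) hp fun h => hpn (by
    convert sub_mem hp (show ((0 : ℍ[ℝ]), p.2) ∈ M from h) using 1
    simp [Prod.ext_iff])
  refine ⟨a, b, ha, hb, ham, hbm, ?_⟩
  convert sub_mem (sub_mem hp h1) (show ((0 : ℍ[ℝ]), _) ∈ M from h2) using 1
  simp [Prod.ext_iff]

lemma hurwitz_mul_mem_diag (hM : IsHurwitzGlue M) (a b c d : ℤ) {p : ℍ[ℝ] × ℍ[ℝ]} (hp : p ∈ M) :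
    (hurwitz a b c d * p.1, hurwitz a b c d * p.2) ∈ M := by
  have e : (hurwitz a b c d * p.1, hurwitz a b c d * p.2) =
      a • p + b • (qI * p.1, qI * p.2) + c • (qJ * p.1, qJ * p.2) +
        d • (hurwitz 0 0 0 1 * p.1, hurwitz 0 0 0 1 * p.2) := by
    ext <;> simp <;> ring
  rw [e]
  exact add_mem (add_mem (add_mem (zsmul_mem hp a)
    (zsmul_mem (hM.right _ (hM.left p hp).1).1 b)) (zsmul_mem (hM.right _ (hM.left p hp).2).2 c))
    (zsmul_mem (hM.diag p hp) d)

end IsHurwitzGlue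

/-! ## Uniqueness of the symmetric point -/

lemma quatAut_re (φ : ℍ[ℝ] ≃ₐ[ℝ] ℍ[ℝ]) (x : ℍ[ℝ]) : (φ x).re = x.re := by
  have h := congrArg φ (Quaternion.self_add_star' x)
  rw [map_add, quatAut_star, Quaternion.self_add_star', ← algebraMap_def, AlgEquiv.commutes] at h
  have := congrArg QuaternionAlgebra.re h
  simp [algebraMap_def] at this
  exact this

lemma eq_one_or_of_commute {p q x : ℍ[ℝ]} (hp : p * p = -1) (hq : q * q = -1)
    (hpq : q * p = -(p * q)) (h1 : x * p = p * x) (h2 : x * q = q * x)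
    (hx : normSq x = 1) : x = 1 ∨ x = -1 := by
  obtain ⟨φ, rfl, rfl⟩ := exists_quatAut hp hq hpq
  obtain ⟨x, rfl⟩ := φ.surjective x
  rw [← map_mul, ← map_mul] at h1 h2
  rw [quatAut_normSq] at hx
  replace h1 := φ.injective h1
  replace h2 := φ.injective h2
  have e1 := congrArg imJ h1
  have e2 := congrArg imK h1
  have e3 := congrArg imK h2
  simp at e1 e2 e3
  have f1 : x.imI = 0 := by linarith
  have f2 : x.imJ = 0 := by linarith
  have f3 : x.imK = 0 := by linarith
  rw [normSq_def', f1, f2, f3] at hx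
  rcases mul_self_eq_one_iff.1 (by linarith : x.re * x.re = 1) with h | h
  · left
    rw [show x = 1 by ext <;> simp [h, f1, f2, f3], map_one]
  · right
    rw [show x = -1 by ext <;> simp [h, f1, f2, f3], map_neg, map_one]

lemma eq_hurwitz_or_of_cycle {x : ℍ[ℝ]} (h1 : x * qI = qJ * x) (h2 : x * qJ = qI * qJ * x)
    (hx : normSq x = 1) : x = hurwitz 0 0 0 1 ∨ x = -hurwitz 0 0 0 1 := by
  have e1 := congrArg QuaternionAlgebra.re h1
  have e2 := congrArg imI h1
  have e3 := congrArg QuaternionAlgebra.re h2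
  simp at e1 e2 e3
  have f1 : x.imI = x.re := by linarith
  have f2 : x.imJ = x.re := by linarith
  have f3 : x.imK = x.re := by linarith
  rw [normSq_def', f1, f2, f3] at hx
  have : (x.re - 1 / 2) * (x.re + 1 / 2) = 0 := by linarith
  rcases mul_eq_zero.1 this with h | h
  · left
    ext <;> simp <;> linarith
  · right
    ext <;> simp <;> linarith

/-- Generators of two commuting quaternion groups that are permuted cyclically by a further
element. -/
structure QuatGens (G : Type*) [Group G] (e₁ e₂ z f₁ f₂ w t : G) : Prop where
  e₁_sq : e₁ * e₁ = z
  e₂_sq : e₂ * e₂ = z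
  e_comm : e₂ * e₁ = z * (e₁ * e₂)
  z_sq : z * z = 1
  z_ne : z ≠ 1
  f₁_sq : f₁ * f₁ = w
  f₂_sq : f₂ * f₂ = w
  f_comm : f₂ * f₁ = w * (f₁ * f₂)
  w_sq : w * w = 1
  w_ne : w ≠ 1
  comm₁₁ : e₁ * f₁ = f₁ * e₁
  comm₁₂ : e₁ * f₂ = f₂ * e₁
  comm₂₁ : e₂ * f₁ = f₁ * e₂
  comm₂₂ : e₂ * f₂ = f₂ * e₂
  t_e₁ : t * e₁ = e₂ * t
  t_e₂ : t * e₂ = e₁ * e₂ * t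
  t_f₁ : t * f₁ = f₂ * t
  t_f₂ : t * f₂ = f₁ * f₂ * t

lemma exists_quatGens : ∃ e₁ e₂ z f₁ f₂ w t : T24FibreT24, QuatGens T24FibreT24 e₁ e₂ z f₁ f₂ w t := by
  obtain ⟨I, J, Z, t, hI, hJ, hc, h1, h2, hZ, hZ1, cI, cJ, cZ⟩ : ∃ I J Z t : T24, I * I = Z ∧ J * J = Z ∧ J * I = Z * (I * J) ∧
      t * I = J * t ∧ t * J = I * J * t ∧ Z * Z = 1 ∧ Z ≠ 1 ∧ chi3 I = 0 ∧ chi3 J = 0 ∧ chi3 Z = 0 :=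
    ⟨⟨!![0, -1; 1, 0], by decide⟩, ⟨!![1, 1; 1, -1], by decide⟩, -1, ⟨!![1, 1; 0, 1], by decide⟩, by
      decide +kernel⟩
  have h1' : chi3 1 = 0 := by decide
  have mem : ∀ {A B : T24}, chi3 A = chi3 B → (A, B) ∈ T24FibreT24 := fun h =>
    (abelianization_eq_iff _ _).2 h
  refine ⟨⟨(I, 1), mem (by rw [cI, h1'])⟩, ⟨(J, 1), mem (by rw [cJ, h1'])⟩,
    ⟨(Z, 1), mem (by rw [cZ, h1'])⟩, ⟨(1, I), mem (by rw [cI, h1'])⟩,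
    ⟨(1, J), mem (by rw [cJ, h1'])⟩, ⟨(1, Z), mem (by rw [cZ, h1'])⟩, ⟨(t, t), mem rfl⟩, ?_⟩
  constructor <;> simp [Subtype.ext_iff, Prod.ext_iff, *]

namespace QuatGens

variable {G : Type*} [Group G] {e₁ e₂ z f₁ f₂ w t : G}

lemma swap (hg : QuatGens G e₁ e₂ z f₁ f₂ w t) : QuatGens G f₁ f₂ w e₁ e₂ z t :=
  ⟨hg.f₁_sq, hg.f₂_sq, hg.f_comm, hg.w_sq, hg.w_ne, hg.e₁_sq, hg.e₂_sq, hg.e_comm, hg.z_sq, hg.z_ne,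
    hg.comm₁₁.symm, hg.comm₂₁.symm, hg.comm₁₂.symm, hg.comm₂₂.symm, hg.t_f₁, hg.t_f₂, hg.t_e₁,
    hg.t_e₂⟩

lemma map_comm (hg : QuatGens G e₁ e₂ z f₁ f₂ w t) {α : G →* ℍ[ℝ]} (hz : α z = -1) :
    α e₁ * α e₁ = -1 ∧ α e₂ * α e₂ = -1 ∧ α e₂ * α e₁ = -(α e₁ * α e₂) := by
  simp only [← map_mul, hg.e₁_sq, hg.e₂_sq, hz, true_and]
  rw [hg.e_comm, map_mul, hz, neg_one_mul]

lemma map_f (hg : QuatGens G e₁ e₂ z f₁ f₂ w t) {α : G →* ℍ[ℝ]}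
    (hα : ∀ g, normSq (α g) = 1) (hz : α z = -1) :
    (α f₁ = 1 ∨ α f₁ = -1) ∧ (α f₂ = 1 ∨ α f₂ = -1) ∧ α w = 1 := by
  obtain ⟨h1, h2, h3⟩ := hg.map_comm hz
  have hf : α f₁ = 1 ∨ α f₁ = -1 := eq_one_or_of_commute h1 h2 h3
    (by rw [← map_mul, ← map_mul, hg.comm₁₁]) (by rw [← map_mul, ← map_mul, hg.comm₂₁]) (hα _)
  refine ⟨hf, eq_one_or_of_commute h1 h2 h3
    (by rw [← map_mul, ← map_mul, hg.comm₁₂]) (by rw [← map_mul, ← map_mul, hg.comm₂₂]) (hα _), ?_⟩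
  rw [← hg.f₁_sq, map_mul]
  rcases hf with h | h <;> simp [h]

lemma map_z (hg : QuatGens G e₁ e₂ z f₁ f₂ w t) (α : G →* ℍ[ℝ]) : α z = 1 ∨ α z = -1 :=
  mul_self_eq_one_iff.1 (by rw [← map_mul, hg.z_sq, map_one])

lemma exists_glue_of_map (hg : QuatGens G e₁ e₂ z f₁ f₂ w t) {α β : G →* ℍ[ℝ]}
    (hα : ∀ g, normSq (α g) = 1) (hβ : ∀ g, normSq (β g) = 1)
    (hz : α z = -1) (hw : β w = -1) {h : SOPlus44}
    (hL : ∀ g, ∀ x ∈ quatLattice h, (α g * x.1, β g * x.2) ∈ quatLattice h) :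
    ∃ φ ψ : ℍ[ℝ] ≃ₐ[ℝ] ℍ[ℝ], IsHurwitzGlue ((quatLattice h).comap
      (prodMap (φ : ℍ[ℝ] →+ ℍ[ℝ]) (ψ : ℍ[ℝ] →+ ℍ[ℝ]))) := by
  obtain ⟨a1, a2, a3⟩ := hg.map_comm hz
  obtain ⟨b1, b2, b3⟩ := hg.swap.map_comm hw
  obtain ⟨hf₁, hf₂, hw'⟩ := hg.map_f hα hz
  obtain ⟨he₁, he₂, -⟩ := hg.swap.map_f hβ hw
  obtain ⟨φ, p1, p2⟩ := exists_quatAut a1 a2 a3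
  obtain ⟨ψ, q1, q2⟩ := exists_quatAut b1 b2 b3
  have hr : ∀ x y, (x, y) ∈ quatLattice h → (x, -y) ∈ quatLattice h := fun x y hx => by
    simpa [hw', hw] using hL w _ hx
  have hl : ∀ x y, (x, y) ∈ quatLattice h → (-x, y) ∈ quatLattice h := fun x y hx => by
    simpa using neg_mem (hr x y hx)
  have tL : φ.symm (α t) = hurwitz 0 0 0 1 ∨ φ.symm (α t) = -hurwitz 0 0 0 1 := by
    refine eq_hurwitz_or_of_cycle ?_ ?_ (by rw [quatAut_normSq, hα]) <;> apply φ.injective <;>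
      simp only [map_mul, AlgEquiv.apply_symm_apply, p1, p2] <;> simp only [← map_mul]
    exacts [congrArg α hg.t_e₁, congrArg α hg.t_e₂]
  have tR : ψ.symm (β t) = hurwitz 0 0 0 1 ∨ ψ.symm (β t) = -hurwitz 0 0 0 1 := by
    refine eq_hurwitz_or_of_cycle ?_ ?_ (by rw [quatAut_normSq, hβ]) <;> apply ψ.injective <;>
      simp only [map_mul, AlgEquiv.apply_symm_apply, q1, q2] <;> simp only [← map_mul]
    exacts [congrArg β hg.t_f₁, congrArg β hg.t_f₂]
  rw [AlgEquiv.symm_apply_eq, AlgEquiv.symm_apply_eq, map_neg] at tL tR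
  have hmem : ∀ p : ℍ[ℝ] × ℍ[ℝ], p ∈ (quatLattice h).comap
      (prodMap (φ : ℍ[ℝ] →+ ℍ[ℝ]) (ψ : ℍ[ℝ] →+ ℍ[ℝ])) ↔
      (φ p.1, ψ p.2) ∈ quatLattice h := fun p => Iff.rfl
  have hform : ∀ p q : ℍ[ℝ] × ℍ[ℝ], form44 (quatPair (φ p.1, ψ p.2)) (quatPair (φ q.1, ψ q.2)) =
      (p.1 * star q.1).re - (p.2 * star q.2).re := fun p q => by
    simp only [form44_quatPair, ← quatAut_star, ← map_mul, quatAut_re]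
  refine ⟨φ, ψ, fun p => ?_, fun p hp => ?_, fun p hp => ⟨?_, ?_⟩, fun p hp => ⟨?_, ?_⟩,
    fun p hp => ?_⟩
  · rw [hmem, mem_quatLattice, windingLattice_dual]
    refine ⟨fun H q hq => hform p q ▸ H _ hq, fun H y hy => ?_⟩
    obtain ⟨q, rfl⟩ := quatPair.surjective y
    have e := hform p (φ.symm q.1, ψ.symm q.2)
    simp only [AlgEquiv.apply_symm_apply] at e
    rw [e]
    refine H (φ.symm q.1, ψ.symm q.2) ((hmem _).2 ?_)
    rwa [AlgEquiv.apply_symm_apply, AlgEquiv.apply_symm_apply]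
  · obtain ⟨n, hn⟩ := windingLattice_even h hp
    exact ⟨n, by rw [normSq_def, normSq_def, ← hform, ← hn]; rfl⟩
  all_goals rw [hmem] at hp ⊢; simp only [map_mul, p1, p2, q1, q2]
  · have := hL e₁ _ hp
    rcases he₁ with h | h <;> rw [h] at this
    · simpa using this
    · simpa using hr _ _ this
  · have := hL e₂ _ hp
    rcases he₂ with h | h <;> rw [h] at this
    · simpa using this
    · simpa using hr _ _ this
  · have := hL f₁ _ hp
    rcases hf₁ with h | h <;> rw [h] at this
    · simpa using this
    · simpa using hl _ _ this
  · have := hL f₂ _ hp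
    rcases hf₂ with h | h <;> rw [h] at this
    · simpa using this
    · simpa using hl _ _ this
  · have := hL t _ hp
    rcases tL with h | h <;> rcases tR with h' | h' <;> rw [h, h'] at this
    · exact this
    · simpa using hr _ _ this
    · simpa using hl _ _ this
    · simpa using neg_mem this

end QuatGens

lemma exists_hurwitz_base (j : Fin 4 ⊕ Fin 4) : ∃ a b c d a' b' c' d',
    intQuat (baseL j) = hurwitz a b c d * hurwitz 1 1 0 0 ∧
      intQuat (baseR j) = intQuat (baseL j) + (2 : ℝ) • hurwitz a' b' c' d' := by
  rcases j with j | j <;> fin_cases j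
  · refine ⟨0, -1, 0, 0, 0, 0, 0, 0, ?_, ?_⟩ <;> ext <;> simp [baseL, baseR]
  · refine ⟨1, 1, 0, -1, 0, 0, 0, 0, ?_, ?_⟩ <;> ext <;> simp [baseL, baseR] <;> norm_num
  · refine ⟨0, 0, 1, 0, 0, 0, 0, 0, ?_, ?_⟩ <;> ext <;> simp [baseL, baseR]
  · refine ⟨-1, -1, -1, 2, 0, 0, 0, 0, ?_, ?_⟩ <;> ext <;> simp [baseL, baseR] <;> norm_num
  · refine ⟨1, 0, 0, -1, -1, 0, 0, 0, ?_, ?_⟩ <;> ext <;> simp [baseL, baseR] <;> norm_num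
  · refine ⟨1, 0, 0, 0, -1, -1, 0, 0, ?_, ?_⟩ <;> ext <;> norm_num [baseL, baseR] <;> simp
  · refine ⟨1, 0, 1, -1, -1, -1, -1, 1, ?_, ?_⟩ <;> ext <;> simp [baseL, baseR] <;> norm_num
  · refine ⟨0, -1, 0, 1, 0, 0, 0, -1, ?_, ?_⟩ <;> ext <;> simp [baseL, baseR] <;> norm_num

lemma moduliPoint_eq_of_glue {h : SOPlus44} {φ ψ : ℍ[ℝ] ≃ₐ[ℝ] ℍ[ℝ]}
    (hM : IsHurwitzGlue ((quatLattice h).comap (prodMap (φ : ℍ[ℝ] →+ ℍ[ℝ]) (ψ : ℍ[ℝ] →+ ℍ[ℝ])))) :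
    moduliPoint h = moduliPoint basePoint := by
  obtain ⟨a, b, ha, hb, -, hbm, hab⟩ := hM.exists_generators
  have hn : ∀ (χ : ℍ[ℝ] ≃ₐ[ℝ] ℍ[ℝ]) (c : ℍ[ℝ]), normSq c = 2 →
      normSq ((√2)⁻¹ • χ c) = 1 := fun χ c hc => by
    rw [normSq_smul, quatAut_normSq, hc, sq, inv_sqrt_two_sq, one_div_mul_cancel two_ne_zero]
  obtain ⟨p, hp, hx⟩ := exists_mem_SO4xSO4 φ ψ (hn φ a ha) (hn ψ b hb)
  refine moduliPoint_eq_of_le p hp fun j => ?_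
  obtain ⟨k, l, m, n, k', l', m', n', e1, e2⟩ := exists_hurwitz_base j
  have h1 := hM.hurwitz_mul_mem_diag k l m n hab
  have h2 := hM.swap.hurwitz_mul_mem_left k' l' m' n' hbm
  have h3 : _ ∈ quatLattice h := add_mem h1 h2
  have e : ∀ (χ : ℍ[ℝ] ≃ₐ[ℝ] ℍ[ℝ]) (x c : ℍ[ℝ]), χ ((√2)⁻¹ • x) * (√2)⁻¹ • χ c =
      χ (x * (1 / 2 : ℝ) • c) := fun χ x c => by
    rw [← map_smul χ, ← map_mul, smul_mul_smul_comm, inv_sqrt_two_sq, mul_smul_comm]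
  rw [windingBasis_basePoint_eq, hx, ← mem_quatLattice]
  convert h3 using 1
  simp only [Prod.smul_mk, e, e2]
  ext1
  · simp [e1, mul_assoc]
  · simp only [e1, add_mul, smul_mul_assoc, mul_smul_comm, mul_assoc]
    simp

lemma moduliPoint_eq_basePoint {h : SOPlus44} (hG : Nonempty (G0 h ≃* T24FibreT24)) :
    moduliPoint h = moduliPoint basePoint := by
  obtain ⟨Φ⟩ := hG
  let γ : T24FibreT24 →* unitary ℍ[ℝ] × unitary ℍ[ℝ] :=
    ((su2Equiv.prodCongr su2Equiv).symm.toMonoidHom.comp (G0 h).subtype).comp Φ.symm.toMonoidHom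
  have hγ : Injective γ := (su2Equiv.prodCongr su2Equiv).symm.injective.comp
    (Subtype.val_injective.comp Φ.symm.injective)
  let α : T24FibreT24 →* ℍ[ℝ] := ((unitary ℍ[ℝ]).subtype.comp (MonoidHom.fst _ _)).comp γ
  let β : T24FibreT24 →* ℍ[ℝ] := ((unitary ℍ[ℝ]).subtype.comp (MonoidHom.snd _ _)).comp γ
  have hα : ∀ g, normSq (α g) = 1 := fun g => normSq_of_mem_unitary (γ g).1
  have hβ : ∀ g, normSq (β g) = 1 := fun g => normSq_of_mem_unitary (γ g).2
  have hinj : ∀ g, g ≠ 1 → α g = 1 → β g ≠ 1 := fun g hg h1 h2 =>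
    hg (hγ ((pext (Subtype.ext h1) (Subtype.ext h2) : γ g = 1).trans (map_one γ).symm))
  have hL : ∀ g, ∀ x ∈ quatLattice h, (α g * x.1, β g * x.2) ∈ quatLattice h := fun g x hx => by
    have : (su2Equiv (γ g).1, su2Equiv (γ g).2) ∈ G0 h := by
      have e : (su2Equiv (γ g).1, su2Equiv (γ g).2) = (Φ.symm g).1 :=
        (su2Equiv.prodCongr su2Equiv).apply_symm_apply _
      rw [e]
      exact (Φ.symm g).2
    exact (mem_G0_iff.1 this x).2 hx
  obtain ⟨e₁, e₂, z, f₁, f₂, w, t, hg⟩ := exists_quatGens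
  rcases hg.map_z α with hz | hz
  · have hz' := (hg.map_z β).resolve_left (hinj z hg.z_ne hz)
    have hw := (hg.map_f hβ hz').2.2
    have hw' := (hg.swap.map_z α).resolve_left fun h => hinj w hg.w_ne h hw
    obtain ⟨φ, ψ, hM⟩ := hg.swap.exists_glue_of_map hα hβ hw' hz' hL
    exact moduliPoint_eq_of_glue hM
  · have hw' := (hg.swap.map_z β).resolve_left (hinj w hg.w_ne (hg.map_f hα hz).2.2)
    obtain ⟨φ, ψ, hM⟩ := hg.exists_glue_of_map hα hβ hz hw' hL
    exact moduliPoint_eq_of_glue hM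

end

theorem theorem6p1 :
    ∃ μ : ModuliT4,
      -- `μ` is the unique point of the moduli space with `G_0 ≅ T_24 ×_{C_3} T_24`
      (∀ h : SOPlus44, moduliPoint h = μ ↔ Nonempty (G0 h ≃* T24FibreT24)) ∧
      ∀ h : SOPlus44, moduliPoint h = μ →
        -- the reflected winding-momentum lattice is isometric to the `E_8` lattice
        (∃ f : R44 ≃ₗ[ℝ] (Fin 8 → ℝ),
          (∀ x, ∑ i, f x i ^ 2 = ∑ i, x i ^ 2) ∧
          ∀ x, f x ∈ e8Lattice ↔ x ∈ windingLattice h) ∧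
        -- the sigma model has a reflection that is a vertex operator superalgebra
        (∃ W : VOSAData, (sigmaModel h).IsReflection W ∧ W.IsVOSA 12) ∧
        -- and every such reflection is isomorphic to `V^f_{E_8}`
        ∀ W : VOSAData, (sigmaModel h).IsReflection W → W.IsVOSA 12 → W.Isomorphic VfE8 := by
  refine ⟨moduliPoint basePoint, fun h => ⟨fun hh => ?_, moduliPoint_eq_basePoint⟩, fun h hh => ?_⟩
  · obtain ⟨e⟩ := G0_equiv_of_moduliPoint_eq hh
    obtain ⟨e'⟩ := nonempty_G0_basePoint
    exact ⟨e.symm.trans e'⟩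
  · obtain ⟨f, hf, hfl⟩ := exists_e8_isometry hh
    obtain ⟨h1, h2⟩ := sigmaModel_reflections h f hf hfl
    exact ⟨⟨f, hf, hfl⟩, h1, h2⟩
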